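/- **Setting.** A query is a pair $q=(c,r)\in[0,1]^2$; it matches the points of $[c,c+r]$. For a dataset $D=(D_1,\dots,D_m)\in[0,1]^m$ let $c_D(q)$ be the number of indices $i$ with $D_i\in[c,c+r]$. For probability measures $\chi=(\chi_1,\dots,\chi_m)$ write $D\sim\chi$ if the $D_i$ are independent with $D_i\sim\chi_i$, and let $c_\chi(q)=\mathbb E_{D\sim\chi}[c_D(q)]$. For a class $\mathfrak X$ of probability measures on $[0,1]$ the closure under conditioning $\bar{\mathfrak X}$ is the set of all laws of $\frac{Z-a}{b-a}$ conditioned on $Z\in(a,b)$, where $Z\sim\mu\in\mathfrak X$, $0\le a<b\le 1$ and $\mu((a,b))>0$; $\bar\chi$ denotes the closure of $\{\chi_1,\dots,\chi_n\}$. The total variation $TV(\mathfrak Y)$ of a set of probability measures is the supremum of the total variation distances of two of its members. A class $\mathfrak Y$ is *distribution learnable* (for cardinality estimation) with parameters $\mathcal T_m,\mathcal S_m,\mathcal B_m$ and constants $\varkappa_1,\varkappa_2>0$ if there is an algorithm that turns every dataset $D$ of $m\ge1$ points of $[0,1]$ into a model $\hat f$, depending measurably on $D$ and the query, such that (i) for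 all $\chi_1,\dots,\chi_m\in\mathfrak Y$ and $e\ge\sqrt m$, $\ \mathbb P_{D\sim\chi}[\|c_\chi-\hat f\|_\infty\ge e]\le\varkappa_1e^{-\varkappa_2(e/\sqrt m-1)^2}$; (ii) $\hat f$ is evaluated in at most $\mathcal T_m$ operations and stored in at most $\mathcal S_m$ bits; (iii) training takes at most $m\mathcal B_m$ operations. A *learned cardinality estimator* is a pair of programs (insertion, query) for a random access machine with unit-cost addition, subtraction and comparison of natural numbers, unit-cost copying and comparison of data points and query endpoints, and calls to the learning algorithm, which are charged the cost of that algorithm (a call may rescale an interval $(a,b)$ of data to $(0,1)$). The points are inserted one by one into an initially empty memory. Queries read only the estimator's own memory (natural numbers, a data point counting as one word of $\lfloor\log_2 n\rfloor+1$ bits, and models), not the storage of the dataset; the space is the number of bits of that memory, excluding the storage of the dataset. **Theorem.** For all $\varkappa_1,\varkappa_2>0$ there is a constant $C>0$ such that the following holds. Let $\mathfrak X$ be a class of probability measures on $[0,1]$ such that $\bar{\mathfrak X}$ is distribution learnable with constants $\varkappa_1,\varkappa_2$ and parameters $\mathcal T,\mathcal S,\mathcal B$, where $\mathcal T_m$,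 $\mathcal S_m$ and the total training time $m\mathcal B_m$ are nondecreasing in $m$. Let $\varepsilon>0$, $\delta\ge0$ and $N=\lceil\varepsilon^2\rceil$. Then there is a learned cardinality estimator such that: 1. (Accuracy.) For every $n$, all $\chi_1,\dots,\chi_n\in\mathfrak X$ with $TV(\bar\chi)\le\delta$ and every query $q$, if the $n$ points of $D\sim\chi$ have been inserted, then the answer $\hat c(q)$ satisfies $\mathbb E_{D\sim\chi}|\hat c(q)-c_D(q)|\le\varepsilon$. 2. (Complexity.) For every $n\ge2$ and every dataset $D\in[0,1]^n$ (hence also in expectation over $D\sim\chi$): - the amortized insertion time over the $n$ insertions is at most $C(\max\{\delta\varepsilon,\varepsilon^2\}\,\mathcal B_N+\log n)$; if $\mathcal B$ itself is nondecreasing, it is also at most $C(\max\{\delta\varepsilon,1\}\,\mathcal B_N+\log n)$; - every query takes at most $C(\log n+\mathcal T_N)$ operations; - the space is at most $C\max\{1,\frac n{\varepsilon^2}\}(\mathcal S_N+\log n)$. -/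

import Mathlib

open MeasureTheory ProbabilityTheory Set

namespace LearnedCE

/-! ### Queries and the cardinality function -/

/-- A one-dimensional range query is a pair `q = (c, r)` with `c, r ∈ [0, 1]`. -/
def IsQuery (q : ℝ × ℝ) : Prop :=
  q.1 ∈ Icc (0 : ℝ) 1 ∧ q.2 ∈ Icc (0 : ℝ) 1

/-- The query `(c, r)` matches the points of `[c, c + r]`. -/
def queryRange (q : ℝ × ℝ) : Set ℝ := Icc q.1 (q.1 + q.2)

/-- The cardinality function: the number of points of the dataset `D` that match `q`. -/
noncomputable def cardinality {n : ℕ} (D : Fin n → ℝ) (q : ℝ × ℝ) : ℝ :=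
  ∑ i, (queryRange q).indicator (fun _ => (1 : ℝ)) (D i)

/-- The distribution cardinality function: the expectation of the cardinality of `q` when the
points of `D` are independent, the `i`-th one with law `χ i`. -/
noncomputable def distCardinality {n : ℕ} (χ : Fin n → Measure ℝ) (q : ℝ × ℝ) : ℝ :=
  ∫ D, cardinality D q ∂(Measure.pi χ)

/-! ### Closure under conditioning and distribution shift -/

/-- The affine map that carries the interval `(a, b)` to `(0, 1)`. -/
noncomputable def rescale (a b x : ℝ) : ℝ := (x - a) / (b - a)

/-- The normalized conditional distribution: condition `μ` on `(a, b)`, then rescale to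
`(0, 1)`. -/
noncomputable def normalizedCond (μ : Measure ℝ) (a b : ℝ) : Measure ℝ :=
  (ProbabilityTheory.cond μ (Ioo a b)).map (rescale a b)

/-- The closure of a distribution class under conditioning: all normalized conditional
distributions on subintervals of `[0, 1]` of positive probability. -/
def condClosure (X : Set (Measure ℝ)) : Set (Measure ℝ) :=
  {ν | ∃ μ ∈ X, ∃ a b : ℝ, 0 ≤ a ∧ a < b ∧ b ≤ 1 ∧ μ (Ioo a b) ≠ 0 ∧ ν = normalizedCond μ a b}

/-- The total variation distance of two probability measures. -/
noncomputable def tvDist (μ ν : Measure ℝ) : ℝ :=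
  sSup {t | ∃ s : Set ℝ, MeasurableSet s ∧ t = |μ.real s - ν.real s|}

/-- The total variation of a set of probability measures: the supremum of the distances of two
of its members. -/
noncomputable def tvSet (Y : Set (Measure ℝ)) : ℝ :=
  sSup {t | ∃ μ ∈ Y, ∃ ν ∈ Y, t = tvDist μ ν}

/-! ### Distribution learnability -/

/-- A learning algorithm for the cardinality operation. It turns a dataset into a model and
evaluates models on queries; the last three fields count the operations of a training call,
the operations of an evaluation, and the space (in bits) that a model occupies. -/
structure Learner where
  Model : Type
  train : List ℝ → Model
  eval : Model → ℝ × ℝ → ℝ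
  trainCost : List ℝ → ℕ
  evalCost : Model → ℝ × ℝ → ℕ
  space : Model → ℕ

/-- The class `Y` is distribution learnable for cardinality estimation, by the algorithm `A`,
with parameters `T` (inference time), `S` (model size), `B` (training time, amortized over the
observations) and constants `κ₁`, `κ₂` in the accuracy requirement. -/
structure Learner.Learns (A : Learner) (κ₁ κ₂ : ℝ) (Y : Set (Measure ℝ)) (T S B : ℕ → ℝ) :
    Prop where
  measurable : ∀ m : ℕ, Measurable fun p : (Fin m → ℝ) × (ℝ × ℝ) =>
    A.eval (A.train (List.ofFn p.1)) p.2
  accuracy : ∀ m : ℕ, 1 ≤ m → ∀ χ : Fin m → Measure ℝ, (∀ i, χ i ∈ Y) →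
    ∀ e : ℝ, √(m : ℝ) ≤ e →
      Measure.pi χ {D : Fin m → ℝ | ENNReal.ofReal e ≤ ⨆ (q : ℝ × ℝ) (_ : IsQuery q),
          ENNReal.ofReal |distCardinality χ q - A.eval (A.train (List.ofFn D)) q|}
        ≤ ENNReal.ofReal (κ₁ * Real.exp (-κ₂ * (e / √(m : ℝ) - 1) ^ 2))
  inference_time : ∀ m : ℕ, 1 ≤ m → ∀ D : Fin m → ℝ, (∀ i, D i ∈ Icc (0 : ℝ) 1) →
    ∀ q, IsQuery q → (A.evalCost (A.train (List.ofFn D)) q : ℝ) ≤ T m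
  model_space : ∀ m : ℕ, 1 ≤ m → ∀ D : Fin m → ℝ, (∀ i, D i ∈ Icc (0 : ℝ) 1) →
    (A.space (A.train (List.ofFn D)) : ℝ) ≤ S m
  training_time : ∀ m : ℕ, 1 ≤ m → ∀ D : Fin m → ℝ, (∀ i, D i ∈ Icc (0 : ℝ) 1) →
    (A.trainCost (List.ofFn D) : ℝ) ≤ m * B m

/-! ### The machine

A random access machine with unit-cost addition, truncated subtraction and comparison of natural
numbers. Data points and query endpoints ("keys") are opaque: they can be copied and compared.
The learning algorithm is available as a subroutine, which is charged its own cost.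

The memory has four parts. Three of them form the summary: numbers, keys and models. The fourth
holds data points only; it is the storage of the dataset itself, it is not charged as space, and
queries cannot see it. -/

/-- The contents of the memory between two operations. -/
structure Memory (M : Type) where
  num : ℕ → ℕ
  key : ℕ → Option ℝ
  model : ℕ → Option M
  data : ℕ → ℝ

/-- The empty memory. -/
def Memory.blank (M : Type) : Memory M where
  num := fun _ => 0
  key := fun _ => none
  model := fun _ => none
  data := fun _ => 0

/-- The summary: the memory with the storage of the dataset erased. -/
def Memory.summary {M : Type} (μ : Memory M) : Memory M := { μ with data := fun _ => 0 }

/-- A state of the machine: the memory, registers for numbers, registers for keys, and a real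
output to which the machine can add but which it cannot read. -/
structure State (M : Type) where
  mem : Memory M
  reg : ℕ → ℕ
  kreg : ℕ → ℝ
  out : ℝ

/-- Instructions. Arguments of type `ℕ` are names of registers, except the constant `c`.
* `const r c`, `add r s t`, `sub r s t`: set `r` to `c`, to `s + t`, to `s - t`.
* `loadNum r s`, `saveNum s r`: read / write the number cell with address `s`.
* `moveKey k l`: copy the key `l` to `k`.
* `loadKey k s`, `saveKey s k`: read / write the key cell with address `s`.
* `loadData k s`, `saveData s k`: read / write the data cell with address `s`.
* `train s base len a b`: train a model on the `len` data cells from address `base` on, rescaled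
  from `(a, b)` to `(0, 1)`, and put it into the model cell with address `s`.
* `output r`: add the number `r` to the output.
* `estimate s p t a b l u`: add `p / t` times the answer of the model in cell `s` to the query
  `[l, u]`, rescaled from `(a, b)` to `(0, 1)`, to the output. -/
inductive Instr where
  | const (r c : ℕ)
  | add (r s t : ℕ)
  | sub (r s t : ℕ)
  | loadNum (r s : ℕ)
  | saveNum (s r : ℕ)
  | moveKey (k l : ℕ)
  | loadKey (k s : ℕ)
  | saveKey (s k : ℕ)
  | loadData (k s : ℕ)
  | saveData (s k : ℕ)
  | train (s base len a b : ℕ)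
  | output (r : ℕ)
  | estimate (s p t a b l u : ℕ)

/-- The dataset on which `Instr.train` calls the learning algorithm, in storage order. -/
noncomputable def trainingSet {M : Type} (σ : State M) (base len a b : ℕ) : List ℝ :=
  (List.range (σ.reg len)).map fun i =>
    rescale (σ.kreg a) (σ.kreg b) (σ.mem.data (σ.reg base + i))

/-- The query on which `Instr.estimate` evaluates a model. -/
noncomputable def rescaledQuery {M : Type} (σ : State M) (a b l u : ℕ) : ℝ × ℝ :=
  (rescale (σ.kreg a) (σ.kreg b) (σ.kreg l),
    rescale (σ.kreg a) (σ.kreg b) (σ.kreg u) - rescale (σ.kreg a) (σ.kreg b) (σ.kreg l))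

/-- The effect of an instruction. -/
noncomputable def Instr.apply (A : Learner) : Instr → State A.Model → State A.Model
  | .const r c, σ => { σ with reg := Function.update σ.reg r c }
  | .add r s t, σ => { σ with reg := Function.update σ.reg r (σ.reg s + σ.reg t) }
  | .sub r s t, σ => { σ with reg := Function.update σ.reg r (σ.reg s - σ.reg t) }
  | .loadNum r s, σ => { σ with reg := Function.update σ.reg r (σ.mem.num (σ.reg s)) }
  | .saveNum s r, σ =>
      { σ with mem := { σ.mem with num := Function.update σ.mem.num (σ.reg s) (σ.reg r) } }
  | .moveKey k l, σ => { σ with kreg := Function.update σ.kreg k (σ.kreg l) }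
  | .loadKey k s, σ =>
      { σ with kreg := Function.update σ.kreg k ((σ.mem.key (σ.reg s)).getD 0) }
  | .saveKey s k, σ =>
      { σ with mem :=
          { σ.mem with key := Function.update σ.mem.key (σ.reg s) (some (σ.kreg k)) } }
  | .loadData k s, σ => { σ with kreg := Function.update σ.kreg k (σ.mem.data (σ.reg s)) }
  | .saveData s k, σ =>
      { σ with mem := { σ.mem with data := Function.update σ.mem.data (σ.reg s) (σ.kreg k) } }
  | .train s base len a b, σ =>
      { σ with mem :=
          { σ.mem with
            model := Function.update σ.mem.model (σ.reg s)
              (some (A.train (trainingSet σ base len a b))) } }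
  | .output r, σ => { σ with out := σ.out + σ.reg r }
  | .estimate s p t a b l u, σ =>
      { σ with out := σ.out + match σ.mem.model (σ.reg s) with
          | none => 0
          | some f => (σ.reg p : ℝ) / σ.reg t * A.eval f (rescaledQuery σ a b l u) }

/-- The number of operations of an instruction. -/
noncomputable def Instr.cost (A : Learner) : Instr → State A.Model → ℕ
  | .train _ base len a b, σ => 1 + A.trainCost (trainingSet σ base len a b)
  | .estimate s _ _ a b l u, σ => 1 + match σ.mem.model (σ.reg s) with
      | none => 0
      | some f => A.evalCost f (rescaledQuery σ a b l u)
  | _, _ => 1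

/-- Programs. The tests compare two number registers or two key registers. -/
inductive Prog where
  | instr (i : Instr)
  | seq (P Q : Prog)
  | ifLt (r s : ℕ) (P Q : Prog)
  | ifKeyLt (k l : ℕ) (P Q : Prog)
  | whileLt (r s : ℕ) (P : Prog)

/-- `Exec A P σ t τ`: started in the state `σ`, the program `P` halts in the state `τ` after `t`
operations. -/
inductive Exec (A : Learner) : Prog → State A.Model → ℕ → State A.Model → Prop where
  | instr (i : Instr) (σ : State A.Model) : Exec A (.instr i) σ (i.cost A σ) (i.apply A σ)
  | seq {P Q : Prog} {σ τ ρ : State A.Model} {t u : ℕ} :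
      Exec A P σ t τ → Exec A Q τ u ρ → Exec A (.seq P Q) σ (t + u) ρ
  | ifLt_true {r s : ℕ} {P Q : Prog} {σ τ : State A.Model} {t : ℕ} :
      σ.reg r < σ.reg s → Exec A P σ t τ → Exec A (.ifLt r s P Q) σ (1 + t) τ
  | ifLt_false {r s : ℕ} {P Q : Prog} {σ τ : State A.Model} {t : ℕ} :
      ¬ σ.reg r < σ.reg s → Exec A Q σ t τ → Exec A (.ifLt r s P Q) σ (1 + t) τ
  | ifKeyLt_true {k l : ℕ} {P Q : Prog} {σ τ : State A.Model} {t : ℕ} :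
      σ.kreg k < σ.kreg l → Exec A P σ t τ → Exec A (.ifKeyLt k l P Q) σ (1 + t) τ
  | ifKeyLt_false {k l : ℕ} {P Q : Prog} {σ τ : State A.Model} {t : ℕ} :
      ¬ σ.kreg k < σ.kreg l → Exec A Q σ t τ → Exec A (.ifKeyLt k l P Q) σ (1 + t) τ
  | while_true {r s : ℕ} {P : Prog} {σ τ ρ : State A.Model} {t u : ℕ} :
      σ.reg r < σ.reg s → Exec A P σ t τ → Exec A (.whileLt r s P) τ u ρ →
        Exec A (.whileLt r s P) σ (1 + t + u) ρ
  | while_false {r s : ℕ} {P : Prog} {σ : State A.Model} :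
      ¬ σ.reg r < σ.reg s → Exec A (.whileLt r s P) σ 1 σ

/-- The final state and the number of operations are determined by program and initial state. -/
theorem Exec.det {A : Learner} {P : Prog} {σ τ τ₂ : State A.Model} {t t₂ : ℕ}
    (h : Exec A P σ t τ) (h₂ : Exec A P σ t₂ τ₂) : t = t₂ ∧ τ = τ₂ := by
  induction h generalizing t₂ τ₂ with
  | instr i σ => cases h₂; exact ⟨rfl, rfl⟩
  | seq _ _ ih ih' =>
    cases h₂ with
    | seq a b =>
      obtain ⟨rfl, rfl⟩ := ih a
      obtain ⟨rfl, rfl⟩ := ih' b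
      exact ⟨rfl, rfl⟩
  | ifLt_true hc _ ih =>
    cases h₂ with
    | ifLt_true _ a => obtain ⟨rfl, rfl⟩ := ih a; exact ⟨rfl, rfl⟩
    | ifLt_false hn _ => exact absurd hc hn
  | ifLt_false hc _ ih =>
    cases h₂ with
    | ifLt_true hn _ => exact absurd hn hc
    | ifLt_false _ a => obtain ⟨rfl, rfl⟩ := ih a; exact ⟨rfl, rfl⟩
  | ifKeyLt_true hc _ ih =>
    cases h₂ with
    | ifKeyLt_true _ a => obtain ⟨rfl, rfl⟩ := ih a; exact ⟨rfl, rfl⟩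
    | ifKeyLt_false hn _ => exact absurd hc hn
  | ifKeyLt_false hc _ ih =>
    cases h₂ with
    | ifKeyLt_true hn _ => exact absurd hn hc
    | ifKeyLt_false _ a => obtain ⟨rfl, rfl⟩ := ih a; exact ⟨rfl, rfl⟩
  | while_true hc _ _ ih ih' =>
    cases h₂ with
    | while_true _ a b =>
      obtain ⟨rfl, rfl⟩ := ih a
      obtain ⟨rfl, rfl⟩ := ih' b
      exact ⟨rfl, rfl⟩
    | while_false hn => exact absurd hc hn
  | while_false hc =>
    cases h₂ with
    | while_true hn _ _ => exact absurd hn hc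
    | while_false _ => exact ⟨rfl, rfl⟩

/-- The state in which an operation starts: all number registers and the output are zero; key
registers 0 and 1 hold the arguments `x` and `y`, register 3 holds the key 1, and all the others
hold the key 0. Nothing but the memory survives from earlier operations. -/
noncomputable def State.start {M : Type} (μ : Memory M) (x y : ℝ) : State M where
  mem := μ
  reg := fun _ => 0
  kreg := fun k => if k = 0 then x else if k = 1 then y else if k = 3 then 1 else 0
  out := 0

/-- The memory `μ` takes at most `s` bits of space, when a key takes `w` bits: up to some address
beyond which the summary is blank, each cell is charged one bit plus its contents. The storage of
the dataset is not charged. -/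
def SpaceAtMost (A : Learner) (w : ℕ) (μ : Memory A.Model) (s : ℝ) : Prop :=
  ∃ N : ℕ, (∀ i, N ≤ i → μ.num i = 0 ∧ μ.key i = none ∧ μ.model i = none) ∧
    ((∑ i ∈ Finset.range N,
        ((1 + (μ.num i).size) + (1 + (μ.key i).elim 0 fun _ => w) +
          (1 + (μ.model i).elim 0 A.space)) : ℕ) : ℝ) ≤ s

/-- A cardinality estimator that may call the learning algorithm `A`: a program for insertions and
a program for queries, which halt on all data and queries from the unit interval. The remaining
fields record, for the dataset `D` inserted point by point into an empty memory: the memory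
afterwards, the total number of operations of the insertions, and, for each query, the answer and
the number of operations. They are determined by the two programs. Queries see the summary only. -/
structure Estimator (A : Learner) where
  insertProg : Prog
  queryProg : Prog
  memory : List ℝ → Memory A.Model
  insertCost : List ℝ → ℕ
  answer : List ℝ → ℝ × ℝ → ℝ
  queryCost : List ℝ → ℝ × ℝ → ℕ
  memory_nil : memory [] = Memory.blank A.Model
  insertCost_nil : insertCost [] = 0
  insert_run : ∀ (D : List ℝ) (x : ℝ), (∀ y ∈ D, y ∈ Icc (0 : ℝ) 1) → x ∈ Icc (0 : ℝ) 1 →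
    ∃ (t : ℕ) (τ : State A.Model), Exec A insertProg (State.start (memory D) x x) t τ ∧
      memory (D ++ [x]) = τ.mem ∧ insertCost (D ++ [x]) = insertCost D + t
  query_run : ∀ (D : List ℝ) (q : ℝ × ℝ), (∀ y ∈ D, y ∈ Icc (0 : ℝ) 1) → IsQuery q →
    ∃ τ : State A.Model,
      Exec A queryProg (State.start (memory D).summary q.1 (q.1 + q.2)) (queryCost D q) τ ∧
        answer D q = τ.out

end LearnedCE

namespace LearnedCE

/-! ### Order statistics -/

/-! The estimator partitions the line into leaves `[a, b)`. Each leaf counts the points equal to `a`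
exactly and keeps at most `M` inner points, together with a model trained on the first `m` of them
in insertion order. The estimate for a leaf with `c` inner points is `c / m` times the answer of the
model. An overflowing leaf is split at its median, and a leaf is retrained on all its inner points
once `c` exceeds `m + min m R`. All points between the leaf of the left end of a query and the leaf
of its right end are counted exactly by the counters of a search tree, so the error of an answer is
at most the sum of two leaf errors (`abs_rangeEstimate_sub_le`), and it suffices that each has mean
at most `ε / 2`.

Accuracy. The difficulty is that the leaves depend on the data. The leaf around a fixed point `v` is
described as a function `leafState` of the dataset alone, without reference to the search tree. This
function is local: moving points within the leaf does not change the leaf (`leafState_congr`), and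
the indices of the points in the leaf together with the values of all the other points determine it
(`leafState_eq_of_index`). Hence, once an index set `I` and the points outside `I` are fixed, the
event that exactly the points with index in `I` lie in the leaf is empty or a box, with the fixed
interval `(a, b)` as each of its factors (`leafIndices_glue`). Conditioned on it, the inner points
are independent, the `i`-th one with law `χ i` conditioned on `(a, b)`, and after rescaling these
laws belong to the closure under conditioning, for which the learner is accurate.

The mean error of a model on `m` points is `O(√m)`, by integration of the Gaussian tail
(`lintegral_abs_model_sub_le`). Using it for `m + k` points, with `k ≤ min m R`, multiplies this by
at most `2` and adds at most `R * δ` for the shift of the distribution, and the deviation of the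
true count from its mean adds `√(m + k)` (`lintegral_abs_scaled_model_sub_le`). With `M` of order `ε
^ 2` and `R` of order `ε / δ` the sum is at most `ε / 2`. Summation over `I` gives
`lintegral_leafError_le`.

Complexity. The bounds hold for every dataset. The leaves form the bottom level of a tree whose
inner nodes have two to four children, except that the root may have only one; a node with four
children is split before the search enters it, so an insertion passes through the tree once, and the
height is logarithmic. Two potentials pay for the work in the leaves (`Ledger`, `Run`). The excess,
the number of points by which the leaves exceed half of their capacity, grows by at most one per
insertion and drops by about `M / 2` at a split, so there are at most `2 * n / (M + 1)` splits; this
bounds the space, and it amortizes the sorting that finds the median. The stale points, on which no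
model is trained, pay for retraining: if `M ≤ ρ * (R + 1)` with `ρ ≥ 2`, then all training sets
together have at most `(ρ + 2) * n` points, and `ρ` can be chosen of order `max (δ * ε) 1`. If `B`
is not known to be monotone, the bound used instead is that an insertion trains at most two models.

The programs are related to `leafState` by the invariants `TreeInv`, `Leaves` and `Store.Exact`,
which every insertion preserves. The answer of the query program is then `rangeEstimate`, a function
of the dataset to which the probabilistic part applies. -/

/-- The points of `D` in the open interval `(a, b)`, in order. -/
noncomputable def inside (a b : ℝ) (D : List ℝ) : List ℝ := D.filter fun x => a < x ∧ x < b

/-- `s` is the element with index `j` of `l` in increasing order. -/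
def IsKth (j : ℕ) (l : List ℝ) (s : ℝ) : Prop :=
  s ∈ l ∧ l.countP (fun x => x < s) ≤ j ∧ j < l.countP (fun x => x ≤ s)

/-- If `s < t`, the entries that are at most `s` are less than `t`; but there are more than `j` of
the former and at most `j` of the latter. Repeated entries do no harm, because only the value is
specified. -/
theorem IsKth.unique {j : ℕ} {l : List ℝ} {s t : ℝ} (h : IsKth j l s) (h' : IsKth j l t) :
    s = t := by
  have key : ∀ {s t : ℝ}, IsKth j l s → IsKth j l t → ¬ s < t := by
    intro s t h h' hst
    have : l.countP (fun x => x ≤ s) ≤ l.countP (fun x => x < t) :=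
      List.countP_mono_left fun x _ hx => by
        simp only [decide_eq_true_eq] at hx ⊢; exact hx.trans_lt hst
    exact absurd (h.2.2.trans_le (this.trans h'.2.1)) (lt_irrefl _)
  exact le_antisymm (not_lt.1 (key h' h)) (not_lt.1 (key h h'))

theorem IsKth.of_pairwise {j : ℕ} {l : List ℝ} (hl : l.Pairwise (· ≤ ·)) (hj : j < l.length) :
    IsKth j l l[j] := by
  have hsplit : l = l.take j ++ l[j] :: l.drop (j + 1) := by
    rw [← List.drop_eq_getElem_cons hj, List.take_append_drop]
  refine ⟨List.getElem_mem hj, ?_, ?_⟩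
  · have h0 : (l[j] :: l.drop (j + 1)).countP (fun x => x < l[j]) = 0 := by
      rw [List.countP_eq_zero]
      intro x hx
      rw [← List.drop_eq_getElem_cons hj] at hx
      obtain ⟨i, hi, rfl⟩ := List.getElem_of_mem hx
      simp only [List.getElem_drop, decide_eq_true_eq, not_lt]
      rcases Nat.eq_zero_or_pos i with rfl | hi0
      · simp
      · exact List.pairwise_iff_getElem.1 hl _ _ _ _ (by omega)
    calc l.countP (fun x => x < l[j])
        = (l.take j ++ l[j] :: l.drop (j + 1)).countP (fun x => x < l[j]) := by rw [← hsplit]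
      _ ≤ j := by
        rw [List.countP_append, h0]
        exact (List.countP_le_length).trans (by simp)
  · have h1 : (l.take j).countP (fun x => x ≤ l[j]) = j := by
      have : (l.take j).countP (fun x => x ≤ l[j]) = (l.take j).length := by
        rw [List.countP_eq_length]
        intro x hx
        obtain ⟨i, hi, rfl⟩ := List.getElem_of_mem hx
        simp only [List.length_take, lt_inf_iff] at hi
        simp only [List.getElem_take, decide_eq_true_eq]
        exact List.pairwise_iff_getElem.1 hl _ _ _ _ hi.1
      rw [this]; simp; omega
    calc j < (l.take j).countP (fun x => x ≤ l[j])
          + (l[j] :: l.drop (j + 1)).countP (fun x => x ≤ l[j]) := by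
            rw [h1, List.countP_cons_of_pos (by simp)]; omega
      _ = l.countP (fun x => x ≤ l[j]) := by rw [← List.countP_append, ← hsplit]

theorem IsKth.perm {j : ℕ} {l l' : List ℝ} {s : ℝ} (h : IsKth j l s) (p : l.Perm l') :
    IsKth j l' s :=
  ⟨p.mem_iff.1 h.1, by rw [← p.countP_eq]; exact h.2.1, by rw [← p.countP_eq]; exact h.2.2⟩

theorem exists_isKth {j : ℕ} {l : List ℝ} (hj : j < l.length) : ∃ s, IsKth j l s := by
  have hp : (l.mergeSort (fun a b => decide (a ≤ b))).Perm l := List.mergeSort_perm _ _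
  have hs : (l.mergeSort (fun a b => decide (a ≤ b))).Pairwise (· ≤ ·) := by
    have := List.pairwise_mergeSort (le := fun a b : ℝ => decide (a ≤ b))
      (fun a b c h h' => by simp only [decide_eq_true_eq] at *; exact h.trans h')
      (fun a b => by simpa using le_total a b) l
    exact this.imp fun h => by simpa using h
  exact ⟨_, (IsKth.of_pairwise hs (by rw [hp.length_eq]; exact hj)).perm hp⟩

open Classical in
/-- The element with index `j` of `l` in increasing order. -/
noncomputable def kth (j : ℕ) (l : List ℝ) : ℝ :=
  if h : ∃ s, IsKth j l s then h.choose else 0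

theorem IsKth.kth_eq {j : ℕ} {l : List ℝ} {s : ℝ} (h : IsKth j l s) : kth j l = s := by
  have hex : ∃ s, IsKth j l s := ⟨s, h⟩
  rw [kth, dif_pos hex]
  exact hex.choose_spec.unique h

theorem isKth_kth {j : ℕ} {l : List ℝ} (hj : j < l.length) : IsKth j l (kth j l) := by
  obtain ⟨s, hs⟩ := exists_isKth hj
  rwa [hs.kth_eq]

theorem mem_inside {a b x : ℝ} {D : List ℝ} : x ∈ inside a b D ↔ x ∈ D ∧ a < x ∧ x < b := by
  simp [inside]

theorem inside_append (a b : ℝ) (D D' : List ℝ) :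
    inside a b (D ++ D') = inside a b D ++ inside a b D' := List.filter_append ..

theorem inside_singleton_of_mem {a b x : ℝ} (h : a < x ∧ x < b) : inside a b [x] = [x] := by
  simp [inside, h.1, h.2]

theorem inside_singleton_of_not_mem {a b x : ℝ} (h : ¬ (a < x ∧ x < b)) : inside a b [x] = [] := by
  simpa [inside] using h

theorem length_inside (a b : ℝ) (D : List ℝ) :
    (inside a b D).length = D.countP fun x => a < x ∧ x < b := by
  rw [inside, List.countP_eq_length_filter]

theorem inside_left {a b s : ℝ} (h : s ≤ b) (D : List ℝ) :
    inside a s D = (inside a b D).filter fun x => x < s := by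
  rw [inside, inside, List.filter_filter]
  congr 1; ext x; simp only [← Bool.decide_and, decide_eq_decide]
  constructor
  · rintro ⟨h1, h2⟩; exact ⟨h2, h1, h2.trans_le h⟩
  · rintro ⟨h1, h2, _⟩; exact ⟨h2, h1⟩

theorem inside_right {a b s : ℝ} (h : a ≤ s) (D : List ℝ) :
    inside s b D = (inside a b D).filter fun x => s < x := by
  rw [inside, inside, List.filter_filter]
  congr 1; ext x; simp only [← Bool.decide_and, decide_eq_decide]
  constructor
  · rintro ⟨h1, h2⟩; exact ⟨h1, h.trans_lt h1, h2⟩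
  · rintro ⟨h1, h2, h3⟩; exact ⟨h1, h3⟩

/-- The points equal to `s` belong to neither open half. With `M + 1` points and `j = M / 2`, the
halves have at most `M / 2` and `M - M / 2` points, neither of which exceeds half of the capacity,
rounded up. -/
theorem IsKth.length_inside_le {a b s : ℝ} {j : ℕ} {D : List ℝ}
    (h : IsKth j (inside a b D) s) :
    (inside a s D).length ≤ j ∧ (inside s b D).length + j + 1 ≤ (inside a b D).length ∧
      a < s ∧ s < b := by
  have hs := (mem_inside.1 h.1).2
  refine ⟨?_, ?_, hs⟩
  · rw [inside_left hs.2.le, ← List.countP_eq_length_filter]; exact h.2.1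
  · rw [inside_right hs.1.le, ← List.countP_eq_length_filter]
    have := List.length_eq_countP_add_countP (fun x : ℝ => decide (x ≤ s)) (l := inside a b D)
    have h2 : (inside a b D).countP (fun x => decide ¬ (decide (x ≤ s)) = true)
        = (inside a b D).countP (fun x => s < x) := by
      congr 1; ext x; simp
    rw [h2] at this
    have := h.2.2
    omega

/-! ### The leaf that contains a given point -/

/-- The change of the leaf around `v`, given by its end points and the number of points its model
is trained on, when the dataset has become `D`: leaves with more than `M` points are split
at the median, and other leaves are retrained if they have too many new points. -/
noncomputable def refresh (M R : ℕ) (v : ℝ) (D : List ℝ) (t : ℝ × ℝ × ℕ) : ℝ × ℝ × ℕ :=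
  let c := (inside t.1 t.2.1 D).length
  let s := kth (M / 2) (inside t.1 t.2.1 D)
  if M < c then
    if v < s then (t.1, s, (inside t.1 s D).length) else (s, t.2.1, (inside s t.2.1 D).length)
  -- The first argument of the minimum keeps the scaling factor `c / m` at most `2`; the second one
  -- limits the number of untrained points, whose distribution may have shifted.
  else if t.2.2 + min t.2.2 R < c then (t.1, t.2.1, c) else t

/-- The leaf around `v` for the dataset with reverse `L`. -/
noncomputable def leafRev (M R : ℕ) (v : ℝ) : List ℝ → ℝ × ℝ × ℕ
  -- The right end of a query may be any point up to `2`, so there is a second initial leaf, which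
  -- never has inner points; any end point beyond `2` would do in place of `3`.
  | [] => if v < 1 then (0, 1, 0) else (1, 3, 0)
  | x :: L => refresh M R v (x :: L).reverse (leafRev M R v L)

/-- The leaf around `v` after the points of `D` have been inserted. -/
noncomputable def leafState (M R : ℕ) (v : ℝ) (D : List ℝ) : ℝ × ℝ × ℕ :=
  leafRev M R v D.reverse

theorem leafState_nil (M R : ℕ) (v : ℝ) :
    leafState M R v [] = if v < 1 then (0, 1, 0) else (1, 3, 0) := rfl

theorem leafState_concat (M R : ℕ) (v : ℝ) (D : List ℝ) (x : ℝ) :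
    leafState M R v (D ++ [x]) = refresh M R v (D ++ [x]) (leafState M R v D) := by
  simp [leafState, leafRev]

/-- The properties of a leaf. -/
structure GoodLeaf (M R : ℕ) (v : ℝ) (D : List ℝ) (t : ℝ × ℝ × ℕ) : Prop where
  le : t.1 ≤ v
  lt : v < t.2.1
  card_le : (inside t.1 t.2.1 D).length ≤ M
  trained_le : t.2.2 ≤ (inside t.1 t.2.1 D).length
  card_le_trained : (inside t.1 t.2.1 D).length ≤ t.2.2 + min t.2.2 R
  nonneg : 0 ≤ t.1
  -- The closure under conditioning only admits subintervals of `[0, 1]`.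
  le_one : t.1 < 1 → t.2.1 ≤ 1

/-- One insertion makes a leaf overflow by at most one point, whence the bound `M + 1` in the
hypothesis. In the cases of a split and of a retraining the model is fresh, so the bound on
untrained points is trivial. -/
theorem goodLeaf_refresh {M R : ℕ} {v : ℝ} {D : List ℝ} {t : ℝ × ℝ × ℕ}
    (h1 : t.1 ≤ v) (h2 : v < t.2.1) (hc : (inside t.1 t.2.1 D).length ≤ M + 1)
    (hm : t.2.2 ≤ (inside t.1 t.2.1 D).length) (h0 : 0 ≤ t.1) (h01 : t.1 < 1 → t.2.1 ≤ 1) :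
    GoodLeaf M R v D (refresh M R v D t) := by
  obtain ⟨a, b, m⟩ := t
  simp only at h1 h2 hc hm h0 h01
  unfold refresh
  simp only
  split_ifs with hM hv hr
  · obtain ⟨k1, k2, k3, k4⟩ := (isKth_kth (j := M / 2) (l := inside a b D)
      (by omega)).length_inside_le
    exact ⟨h1, hv, by simp only; omega, le_rfl, by simp, h0, fun h => k4.le.trans (h01 h)⟩
  · obtain ⟨k1, k2, k3, k4⟩ := (isKth_kth (j := M / 2) (l := inside a b D)
      (by omega)).length_inside_le
    exact ⟨not_lt.1 hv, h2, by simp only; omega, le_rfl, by simp, h0.trans k3.le,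
      fun h => h01 (k3.trans h)⟩
  · exact ⟨h1, h2, not_lt.1 hM, le_rfl, by simp, h0, h01⟩
  · exact ⟨h1, h2, not_lt.1 hM, hm, not_lt.1 hr, h0, h01⟩

theorem goodLeaf_leafState (M R : ℕ) {v : ℝ} (h0 : 0 ≤ v) (h3 : v < 3) (D : List ℝ) :
    GoodLeaf M R v D (leafState M R v D) := by
  induction D using List.reverseRecOn with
  | nil =>
    rw [leafState_nil]
    split_ifs with h
    · constructor <;> simp [inside, h0, h]
    · constructor <;> simp [inside, h3, not_lt.1 h]
  | append_singleton D x ih =>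
    rw [leafState_concat]
    have hl : ∀ a b : ℝ, (inside a b D).length ≤ (inside a b (D ++ [x])).length ∧
        (inside a b (D ++ [x])).length ≤ (inside a b D).length + 1 := by
      intro a b
      rw [inside_append, List.length_append]
      have : (inside a b [x]).length ≤ 1 := List.length_filter_le _ _
      omega
    have := hl (leafState M R v D).1 (leafState M R v D).2.1
    exact goodLeaf_refresh ih.le ih.lt (by have := ih.card_le; omega)
      (by have := ih.trained_le; omega) ih.nonneg ih.le_one

theorem refresh_subset {M R : ℕ} {v : ℝ} {D : List ℝ} {t : ℝ × ℝ × ℕ} :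
    t.1 ≤ (refresh M R v D t).1 ∧ (refresh M R v D t).2.1 ≤ t.2.1 := by
  unfold refresh
  simp only
  split_ifs with hM hv hr
  · have := (isKth_kth (j := M / 2) (l := inside t.1 t.2.1 D) (by omega)).length_inside_le
    exact ⟨le_rfl, this.2.2.2.le⟩
  · have := (isKth_kth (j := M / 2) (l := inside t.1 t.2.1 D) (by omega)).length_inside_le
    exact ⟨this.2.2.1.le, le_rfl⟩
  · exact ⟨le_rfl, le_rfl⟩
  · exact ⟨le_rfl, le_rfl⟩

/-! ### Locality of the leaf -/

theorem countP_ofFn_congr {n : ℕ} {D D' : Fin n → ℝ} {p p' : ℝ → Bool}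
    (h : ∀ i, p (D i) = p' (D' i)) :
    (List.ofFn D).countP p = (List.ofFn D').countP p' := by
  induction n with
  | zero => simp
  | succ n ih =>
    rw [List.ofFn_succ, List.ofFn_succ, List.countP_cons, List.countP_cons, h 0,
      ih fun i => h i.succ]

theorem length_inside_congr {n : ℕ} {D D' : Fin n → ℝ} {a b : ℝ}
    (h : ∀ i, (a < D i ∧ D i < b) ↔ (a < D' i ∧ D' i < b)) :
    (inside a b (List.ofFn D)).length = (inside a b (List.ofFn D')).length := by
  rw [length_inside, length_inside]
  exact countP_ofFn_congr fun i => by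
    simpa only [← Bool.decide_and, decide_eq_decide] using h i

/-- All decisions depend on numbers of points and, at a split, on the median `s`. A point that is
moved lies in the new leaf before and after, hence strictly on the same side of `s`; so `s` keeps
its rank. -/
theorem refresh_congr {n M R : ℕ} {v : ℝ} {D D' : Fin n → ℝ} {t : ℝ × ℝ × ℕ}
    (h1 : t.1 ≤ v) (h2 : v < t.2.1)
    (h : ∀ i, D i = D' i ∨
      (D i ∈ Ioo (refresh M R v (List.ofFn D) t).1 (refresh M R v (List.ofFn D) t).2.1 ∧
       D' i ∈ Ioo (refresh M R v (List.ofFn D) t).1 (refresh M R v (List.ofFn D) t).2.1)) :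
    refresh M R v (List.ofFn D') t = refresh M R v (List.ofFn D) t := by
  obtain ⟨a, b, m⟩ := t
  simp only at h1 h2
  have hsub := refresh_subset (M := M) (R := R) (v := v) (D := List.ofFn D) (t := (a, b, m))
  simp only at hsub
  have hc : (inside a b (List.ofFn D)).length = (inside a b (List.ofFn D')).length := by
    refine length_inside_congr fun i => ?_
    rcases h i with h | ⟨⟨p, q⟩, ⟨p', q'⟩⟩
    · rw [h]
    · exact ⟨fun _ => ⟨hsub.1.trans_lt p', q'.trans_le hsub.2⟩,
        fun _ => ⟨hsub.1.trans_lt p, q.trans_le hsub.2⟩⟩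
  by_cases hM : M < (inside a b (List.ofFn D)).length
  · have hk := isKth_kth (j := M / 2) (l := inside a b (List.ofFn D)) (by omega)
    obtain ⟨-, -, k3, k4⟩ := hk.length_inside_le
    set s := kth (M / 2) (inside a b (List.ofFn D)) with hs
    have hne : ∀ i, D i = D' i ∨ (a < D i ∧ D i < s ∧ a < D' i ∧ D' i < s) ∨
        (s < D i ∧ D i < b ∧ s < D' i ∧ D' i < b) := by
      intro i
      rcases h i with h | ⟨⟨p, q⟩, ⟨p', q'⟩⟩
      · exact Or.inl h
      · right
        simp only [refresh, if_pos hM, ← hs] at p q p' q'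
        split_ifs at p q p' q' with hv
        · exact Or.inl ⟨p, q, p', q'⟩
        · exact Or.inr ⟨p, q, p', q'⟩
    -- The median is an end point of the new open leaf, so the data point with this value is not
    -- among those that are moved.
    have hk' : IsKth (M / 2) (inside a b (List.ofFn D')) s := by
      refine ⟨?_, ?_, ?_⟩
      · have := mem_inside.1 hk.1
        obtain ⟨i, hi⟩ := (List.mem_ofFn' _ _).1 this.1
        refine mem_inside.2 ⟨(List.mem_ofFn' _ _).2 ⟨i, ?_⟩, this.2⟩
        rcases hne i with e | e | e
        · rw [← e, hi]
        · rw [hi] at e; exact absurd e.2.1 (lt_irrefl _)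
        · rw [hi] at e; exact absurd e.1 (lt_irrefl _)
      · refine le_of_eq_of_le ?_ hk.2.1
        unfold inside
        rw [List.countP_filter, List.countP_filter]
        refine countP_ofFn_congr fun i => ?_
        simp only [← Bool.decide_and, decide_eq_decide]
        rcases hne i with e | e | e
        · rw [e]
        · constructor <;> intro _ <;> refine ⟨?_, ?_, ?_⟩ <;> linarith
        · constructor <;> intro hh <;> exfalso <;> linarith [hh.1]
      · refine lt_of_lt_of_eq hk.2.2 ?_
        unfold inside
        rw [List.countP_filter, List.countP_filter]
        refine countP_ofFn_congr fun i => ?_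
        simp only [← Bool.decide_and, decide_eq_decide]
        rcases hne i with e | e | e
        · rw [e]
        · constructor <;> intro _ <;> refine ⟨?_, ?_, ?_⟩ <;> linarith
        · constructor <;> intro hh <;> exfalso <;> linarith [hh.1]
    have hL : (inside a s (List.ofFn D)).length = (inside a s (List.ofFn D')).length := by
      refine length_inside_congr fun i => ?_
      rcases hne i with e | e | e
      · rw [e]
      · constructor <;> intro _ <;> refine ⟨?_, ?_⟩ <;> linarith
      · constructor <;> intro hh <;> exfalso <;> linarith [hh.1, hh.2]
    have hR : (inside s b (List.ofFn D)).length = (inside s b (List.ofFn D')).length := by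
      refine length_inside_congr fun i => ?_
      rcases hne i with e | e | e
      · rw [e]
      · constructor <;> intro hh <;> exfalso <;> linarith [hh.1, hh.2]
      · constructor <;> intro _ <;> refine ⟨?_, ?_⟩ <;> linarith
    simp only [refresh, ← hc, hk'.kth_eq, ← hs, hL, hR]
  · simp only [refresh, ← hc, if_neg hM]

theorem ofFn_concat {n : ℕ} (D : Fin (n + 1) → ℝ) :
    List.ofFn D = List.ofFn (fun i : Fin n => D i.castSucc) ++ [D (Fin.last n)] := by
  rw [List.ofFn_succ_last]

/-- Leaves only shrink in the course of time, so points that are moved within the final leaf are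
moved within every earlier leaf around `v`, and `refresh_congr` applies at each insertion. -/
theorem leafState_congr {M R : ℕ} {v : ℝ} (h0 : 0 ≤ v) (h3 : v < 3) {n : ℕ} {D D' : Fin n → ℝ}
    (h : ∀ i, D i = D' i ∨
      (D i ∈ Ioo (leafState M R v (List.ofFn D)).1 (leafState M R v (List.ofFn D)).2.1 ∧
       D' i ∈ Ioo (leafState M R v (List.ofFn D)).1 (leafState M R v (List.ofFn D)).2.1)) :
    leafState M R v (List.ofFn D') = leafState M R v (List.ofFn D) := by
  induction n with
  | zero => simp
  | succ n ih =>
    have e : ∀ D : Fin (n + 1) → ℝ, leafState M R v (List.ofFn D) = refresh M R v (List.ofFn D)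
        (leafState M R v (List.ofFn fun i : Fin n => D i.castSucc)) := by
      intro D
      conv_lhs => rw [ofFn_concat]
      rw [leafState_concat, ← ofFn_concat]
    have hsub := refresh_subset (M := M) (R := R) (v := v) (D := List.ofFn D)
      (t := leafState M R v (List.ofFn fun i : Fin n => D i.castSucc))
    rw [← e] at hsub
    have ih' := ih (D := fun i => D i.castSucc) (D' := fun i => D' i.castSucc) fun i => by
      rcases h i.castSucc with h | ⟨p, p'⟩
      · exact Or.inl h
      · exact Or.inr ⟨Ioo_subset_Ioo hsub.1 hsub.2 p, Ioo_subset_Ioo hsub.1 hsub.2 p'⟩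
    have hg := goodLeaf_leafState M R h0 h3 (List.ofFn fun i : Fin n => D i.castSucc)
    rw [e D', ih']
    rw [e D]
    refine refresh_congr hg.le hg.lt ?_
    rw [← e D]
    exact h

/-- The end points of a leaf are data points or end points of an initial leaf. -/
theorem leafState_endpoints (M R : ℕ) {v : ℝ} (D : List ℝ) :
    ((leafState M R v D).1 ∈ D ∨ (leafState M R v D).1 = (leafState M R v []).1) ∧
    ((leafState M R v D).2.1 ∈ D ∨ (leafState M R v D).2.1 = (leafState M R v []).2.1) := by
  induction D using List.reverseRecOn with
  | nil => exact ⟨Or.inr rfl, Or.inr rfl⟩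
  | append_singleton D x ih =>
    rw [leafState_concat]
    set t := leafState M R v D
    have ih1 : t.1 ∈ D ++ [x] ∨ t.1 = (leafState M R v []).1 :=
      ih.1.imp_left fun h => List.mem_append_left _ h
    have ih2 : t.2.1 ∈ D ++ [x] ∨ t.2.1 = (leafState M R v []).2.1 :=
      ih.2.imp_left fun h => List.mem_append_left _ h
    unfold refresh
    simp only
    split_ifs with hM hv hr
    · have := (isKth_kth (j := M / 2) (l := inside t.1 t.2.1 (D ++ [x])) (by omega)).1
      exact ⟨ih1, Or.inl (mem_inside.1 this).1⟩
    · have := (isKth_kth (j := M / 2) (l := inside t.1 t.2.1 (D ++ [x])) (by omega)).1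
      exact ⟨Or.inl (mem_inside.1 this).1, ih2⟩
    · exact ⟨ih1, ih2⟩
    · exact ⟨ih1, ih2⟩

theorem leafState_initial_le (M R : ℕ) {v : ℝ} (D : List ℝ) :
    (leafState M R v []).1 ≤ (leafState M R v D).1 ∧
      (leafState M R v D).2.1 ≤ (leafState M R v []).2.1 := by
  induction D using List.reverseRecOn with
  | nil => exact ⟨le_rfl, le_rfl⟩
  | append_singleton D x ih =>
    rw [leafState_concat]
    exact ⟨ih.1.trans refresh_subset.1, refresh_subset.2.trans ih.2⟩

/-- Datasets that agree outside of the points in the leaf around `v` have the same leaf there. -/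
theorem leafState_eq_of_index {M R : ℕ} {v : ℝ} (h0 : 0 ≤ v) (h3 : v < 3) {n : ℕ}
    {D D' : Fin n → ℝ} {I : Finset (Fin n)}
    (hI : ∀ i, i ∈ I ↔
      D i ∈ Ioo (leafState M R v (List.ofFn D)).1 (leafState M R v (List.ofFn D)).2.1)
    (hI' : ∀ i, i ∈ I ↔
      D' i ∈ Ioo (leafState M R v (List.ofFn D')).1 (leafState M R v (List.ofFn D')).2.1)
    (h : ∀ i, i ∉ I → D i = D' i) :
    leafState M R v (List.ofFn D') = leafState M R v (List.ofFn D) := by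
  -- The leaf of `D'` contains that of `D`: an end point of the former that is a data point has an
  -- index outside `I`, so it is also a point of `D`, and as such it is not inside the leaf of `D`.
  -- The argument is symmetric, so the two leaves coincide, and `leafState_congr` becomes
  -- applicable.
  have key : ∀ {D D' : Fin n → ℝ}, (∀ i, i ∈ I ↔
      D i ∈ Ioo (leafState M R v (List.ofFn D)).1 (leafState M R v (List.ofFn D)).2.1) →
      (∀ i, i ∈ I ↔
      D' i ∈ Ioo (leafState M R v (List.ofFn D')).1 (leafState M R v (List.ofFn D')).2.1) →
      (∀ i, i ∉ I → D i = D' i) →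
      (leafState M R v (List.ofFn D')).1 ≤ (leafState M R v (List.ofFn D)).1 ∧
      (leafState M R v (List.ofFn D)).2.1 ≤ (leafState M R v (List.ofFn D')).2.1 := by
    intro D D' hI hI' h
    have g := goodLeaf_leafState M R h0 h3 (List.ofFn D)
    have g' := goodLeaf_leafState M R h0 h3 (List.ofFn D')
    obtain ⟨e1, e2⟩ := leafState_endpoints M R (v := v) (List.ofFn D')
    obtain ⟨m1, m2⟩ := leafState_initial_le M R (v := v) (List.ofFn D)
    have nin : ∀ i, i ∉ I → ¬ (D' i ∈
        Ioo (leafState M R v (List.ofFn D)).1 (leafState M R v (List.ofFn D)).2.1) := by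
      intro i hi
      rw [← h i hi, ← hI i]; exact hi
    constructor
    · rcases e1 with e1 | e1
      · obtain ⟨i, hi⟩ := (List.mem_ofFn' _ _).1 e1
        have hiI : i ∉ I := by rw [hI' i, hi]; simp
        by_contra hlt
        exact nin i hiI ⟨by rw [hi]; exact not_le.1 hlt, by rw [hi]; exact g'.le.trans_lt g.lt⟩
      · rw [e1]; exact m1
    · rcases e2 with e2 | e2
      · obtain ⟨i, hi⟩ := (List.mem_ofFn' _ _).1 e2
        have hiI : i ∉ I := by rw [hI' i, hi]; simp
        by_contra hlt
        exact nin i hiI ⟨by rw [hi]; exact g.le.trans_lt g'.lt, by rw [hi]; exact not_le.1 hlt⟩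
      · rw [e2]; exact m2
  have a1 := key hI hI' h
  have a2 := key hI' hI fun i hi => (h i hi).symm
  have e1 := le_antisymm a1.1 a2.1
  have e2 := le_antisymm a2.2 a1.2
  refine leafState_congr h0 h3 fun i => ?_
  by_cases hi : i ∈ I
  · right
    refine ⟨(hI i).1 hi, ?_⟩
    rw [← e1, ← e2]; exact (hI' i).1 hi
  · exact Or.inl (h i hi)

/-! ### Probabilistic estimates -/

theorem measurableSet_queryRange (q : ℝ × ℝ) : MeasurableSet (queryRange q) := measurableSet_Icc

theorem measurable_cardinality {n : ℕ} (q : ℝ × ℝ) :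
    Measurable fun D : Fin n → ℝ => cardinality D q :=
  Finset.measurable_sum _ fun i _ =>
    (measurable_const.indicator (measurableSet_queryRange q)).comp (measurable_pi_apply i)

theorem indicator_queryRange_mem (q : ℝ × ℝ) (x : ℝ) :
    (queryRange q).indicator (fun _ => (1 : ℝ)) x ∈ Icc (0 : ℝ) 1 := by
  by_cases h : x ∈ queryRange q <;> simp [h]

theorem memLp_indicator_queryRange (μ : Measure ℝ) [IsFiniteMeasure μ] (q : ℝ × ℝ) :
    MemLp ((queryRange q).indicator fun _ => (1 : ℝ)) 2 μ :=
  (memLp_const (1 : ℝ)).indicator (measurableSet_queryRange q)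

theorem distCardinality_eq {n : ℕ} (χ : Fin n → Measure ℝ) [∀ i, IsProbabilityMeasure (χ i)]
    (q : ℝ × ℝ) : distCardinality χ q = ∑ i, (χ i).real (queryRange q) := by
  have hm : Measurable ((queryRange q).indicator fun _ => (1 : ℝ)) :=
    measurable_const.indicator (measurableSet_queryRange q)
  have hi : ∀ i, Integrable (fun D : Fin n → ℝ =>
      (queryRange q).indicator (fun _ => (1 : ℝ)) (D i)) (Measure.pi χ) := fun i =>
    (measurePreserving_eval χ i).integrable_comp_of_integrable
      ((memLp_indicator_queryRange (χ i) q).integrable one_le_two)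
  unfold distCardinality cardinality
  rw [integral_finsetSum _ fun i _ => hi i]
  refine Finset.sum_congr rfl fun i _ => ?_
  have := integral_map (μ := Measure.pi χ) (measurePreserving_eval χ i).measurable.aemeasurable
    (f := (queryRange q).indicator fun _ => (1 : ℝ)) hm.aestronglyMeasurable
  rw [(measurePreserving_eval χ i).map_eq] at this
  rw [← integral_indicator_one (measurableSet_queryRange q)]
  exact this.symm

/-- The mean absolute deviation of the cardinality from its expectation. -/
theorem lintegral_abs_cardinality_sub_le {n : ℕ} (χ : Fin n → Measure ℝ)
    [∀ i, IsProbabilityMeasure (χ i)] (q : ℝ × ℝ) :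
    ∫⁻ D, ENNReal.ofReal |distCardinality χ q - cardinality D q| ∂(Measure.pi χ)
      ≤ ENNReal.ofReal √(n : ℝ) := by
  set f : Fin n → ℝ → ℝ := fun _ => (queryRange q).indicator fun _ => (1 : ℝ)
  set P := Measure.pi χ
  have hL : ∀ i, MemLp (f i) 2 (χ i) := fun i => memLp_indicator_queryRange (χ i) q
  have hcard : (∑ i, fun D : Fin n → ℝ => f i (D i)) = fun D => cardinality D q := by
    ext D; simp [f, cardinality]
  have hcL : MemLp (fun D : Fin n → ℝ => cardinality D q) 2 P := by
    rw [← hcard]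
    exact memLp_finsetSum' _ fun i _ => (hL i).comp_measurePreserving (measurePreserving_eval χ i)
  have hvar : Var[fun D : Fin n → ℝ => cardinality D q; P] ≤ n := by
    rw [← hcard, variance_sum_pi hL]
    calc ∑ i, Var[f i; χ i] ≤ ∑ _i : Fin n, (1 : ℝ) := by
          refine Finset.sum_le_sum fun i _ => ?_
          have := variance_le_sq_of_bounded (μ := χ i) (X := f i) (a := 0) (b := 1)
            (Filter.Eventually.of_forall fun x => indicator_queryRange_mem q x)
            (hL i).aestronglyMeasurable.aemeasurable
          refine this.trans (by norm_num)
      _ = n := by simp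
  set Y : (Fin n → ℝ) → ℝ := fun D => |distCardinality χ q - cardinality D q|
  have hYL : MemLp Y 2 P := by
    exact ((memLp_const (distCardinality χ q)).sub hcL).abs
  have hY2 : ∫ D, Y D ^ 2 ∂P = Var[fun D : Fin n → ℝ => cardinality D q; P] := by
    rw [variance_eq_integral hcL.aestronglyMeasurable.aemeasurable]
    refine integral_congr_ae (Filter.Eventually.of_forall fun D => ?_)
    simp only [Y, sq_abs, distCardinality, P]
    ring
  -- The square of the mean is at most the mean of the square, since the variance of `Y` is
  -- nonnegative.
  have h1 : (∫ D, Y D ∂P) ^ 2 ≤ n := by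
    have h := variance_nonneg Y P
    rw [variance_eq_sub hYL] at h
    have e : ∫ D, (Y ^ 2) D ∂P = ∫ D, Y D ^ 2 ∂P := rfl
    rw [e, hY2] at h
    linarith
  rw [← ofReal_integral_eq_lintegral_ofReal (hYL.integrable one_le_two)
    (Filter.Eventually.of_forall fun D => abs_nonneg _)]
  exact ENNReal.ofReal_le_ofReal (Real.le_sqrt_of_sq_le h1)

/-- The factor by which the mean error of a model on `m` points may exceed `√m`. -/
noncomputable def errorFactor (κ₁ κ₂ : ℝ) : ℝ := 1 + κ₁ * √(Real.pi / κ₂)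

theorem one_le_errorFactor {κ₁ : ℝ} (κ₂ : ℝ) (h : 0 < κ₁) : 1 ≤ errorFactor κ₁ κ₂ := by
  unfold errorFactor; have : 0 ≤ κ₁ * √(Real.pi / κ₂) := by positivity
  linarith

theorem measurable_eval_train {A : Learner} {κ₁ κ₂ : ℝ} {Y : Set (Measure ℝ)} {T S B : ℕ → ℝ}
    (hA : A.Learns κ₁ κ₂ Y T S B) {m : ℕ} {α : Type*} [MeasurableSpace α] {f : α → Fin m → ℝ}
    {g : α → ℝ × ℝ} (hf : Measurable f) (hg : Measurable g) :
    Measurable fun x => A.eval (A.train (List.ofFn (f x))) (g x) :=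
  (hA.measurable m).comp (hf.prodMk hg)

/-- The mean error of a model. -/
theorem lintegral_abs_model_sub_le {A : Learner} {κ₁ κ₂ : ℝ} {Y : Set (Measure ℝ)}
    {T S B : ℕ → ℝ} (hκ₁ : 0 < κ₁) (hκ₂ : 0 < κ₂) (hA : A.Learns κ₁ κ₂ Y T S B) {m : ℕ}
    (hm : 1 ≤ m) (χ : Fin m → Measure ℝ) [∀ i, IsProbabilityMeasure (χ i)] (hχ : ∀ i, χ i ∈ Y)
    {q : ℝ × ℝ} (hq : IsQuery q) :
    ∫⁻ D, ENNReal.ofReal |distCardinality χ q - A.eval (A.train (List.ofFn D)) q|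
      ∂(Measure.pi χ) ≤ ENNReal.ofReal (√(m : ℝ) * errorFactor κ₁ κ₂) := by
  have hs : 0 < √(m : ℝ) := Real.sqrt_pos.2 (by exact_mod_cast hm)
  set s := √(m : ℝ)
  have hmeas : Measurable fun D : Fin m → ℝ =>
      |distCardinality χ q - A.eval (A.train (List.ofFn D)) q| :=
    (measurable_const.sub (measurable_eval_train hA measurable_id measurable_const)).abs
  -- Layer cake formula: the tail probability is at most `1` up to `√m` and is bounded by the
  -- accuracy requirement beyond. Integrating the Gaussian bound over the whole line gives the
  -- second summand of `errorFactor`.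
  rw [lintegral_eq_lintegral_meas_le _ (Filter.Eventually.of_forall fun D => abs_nonneg _)
    hmeas.aemeasurable]
  set g : ℝ → ℝ := fun t => κ₁ * Real.exp (-κ₂ * (t / s - 1) ^ 2)
  have hg0 : ∀ t, 0 ≤ g t := fun t => by positivity
  have hgauss : Integrable fun x : ℝ => Real.exp (-κ₂ * x ^ 2) := integrable_exp_neg_mul_sq hκ₂
  have hgi : Integrable g := by
    have h1 : Integrable fun x : ℝ => Real.exp (-κ₂ * (x - 1) ^ 2) := hgauss.comp_sub_right 1
    exact (h1.comp_div hs.ne').const_mul κ₁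
  have hgint : ∫ t, g t = κ₁ * (s * √(Real.pi / κ₂)) := by
    simp only [g]
    rw [integral_const_mul,
      Measure.integral_comp_div (fun x : ℝ => Real.exp (-κ₂ * (x - 1) ^ 2)) s,
      integral_sub_right_eq_self (fun x : ℝ => Real.exp (-κ₂ * x ^ 2)) 1, integral_gaussian,
      abs_of_pos hs, smul_eq_mul]
  have hsplit : Ioi (0 : ℝ) = Ioc 0 s ∪ Ioi s := (Ioc_union_Ioi_eq_Ioi hs.le).symm
  have hle : ∀ t, s < t → Measure.pi χ {D : Fin m → ℝ |
      t ≤ |distCardinality χ q - A.eval (A.train (List.ofFn D)) q|} ≤ ENNReal.ofReal (g t) := by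
    intro t ht
    refine (measure_mono ?_).trans (hA.accuracy m hm χ hχ t ht.le)
    intro D hD
    refine (ENNReal.ofReal_le_ofReal hD).trans ?_
    exact le_iSup₂_of_le q hq le_rfl
  calc ∫⁻ t in Ioi 0, Measure.pi χ {D : Fin m → ℝ |
        t ≤ |distCardinality χ q - A.eval (A.train (List.ofFn D)) q|}
      ≤ (∫⁻ t in Ioc 0 s, Measure.pi χ {D : Fin m → ℝ |
          t ≤ |distCardinality χ q - A.eval (A.train (List.ofFn D)) q|})
        + ∫⁻ t in Ioi s, Measure.pi χ {D : Fin m → ℝ |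
          t ≤ |distCardinality χ q - A.eval (A.train (List.ofFn D)) q|} := by
        rw [hsplit]; exact lintegral_union_le _ _ _
    _ ≤ (∫⁻ _t in Ioc 0 s, 1) + ∫⁻ t in Ioi s, ENNReal.ofReal (g t) := by
        refine add_le_add (lintegral_mono fun t => prob_le_one) ?_
        exact setLIntegral_mono' measurableSet_Ioi fun t ht => hle t ht
    _ ≤ ENNReal.ofReal s + ∫⁻ t, ENNReal.ofReal (g t) := by
        refine add_le_add ?_ (setLIntegral_le_lintegral _ _)
        simp
    _ = ENNReal.ofReal s + ENNReal.ofReal (κ₁ * (s * √(Real.pi / κ₂))) := by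
        rw [← ofReal_integral_eq_lintegral_ofReal hgi (Filter.Eventually.of_forall hg0), hgint]
    _ = ENNReal.ofReal (s * errorFactor κ₁ κ₂) := by
        rw [← ENNReal.ofReal_add hs.le (by positivity)]
        congr 1; unfold errorFactor; ring

theorem abs_measureReal_sub_le_one (μ ν : Measure ℝ) [IsProbabilityMeasure μ]
    [IsProbabilityMeasure ν] (s : Set ℝ) : |μ.real s - ν.real s| ≤ 1 := by
  have h1 : μ.real s ≤ 1 := measureReal_le_one
  have h2 : ν.real s ≤ 1 := measureReal_le_one
  have h3 : 0 ≤ μ.real s := measureReal_nonneg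
  have h4 : 0 ≤ ν.real s := measureReal_nonneg
  rw [abs_le]; constructor <;> linarith

theorem tvDist_le_one (μ ν : Measure ℝ) [IsProbabilityMeasure μ] [IsProbabilityMeasure ν] :
    tvDist μ ν ≤ 1 := by
  refine csSup_le ⟨_, ∅, MeasurableSet.empty, rfl⟩ ?_
  rintro t ⟨s, _, rfl⟩
  exact abs_measureReal_sub_le_one μ ν s

/-- A real supremum is an upper bound only if the set is bounded; for probability measures both
suprema involved are over subsets of `[0, 1]`. -/
theorem abs_measureReal_sub_le_tvSet {Y : Set (Measure ℝ)} (hY : ∀ μ ∈ Y, IsProbabilityMeasure μ)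
    {μ ν : Measure ℝ} (hμ : μ ∈ Y) (hν : ν ∈ Y) {s : Set ℝ} (hs : MeasurableSet s) :
    |μ.real s - ν.real s| ≤ tvSet Y := by
  have := hY μ hμ
  have := hY ν hν
  have h1 : |μ.real s - ν.real s| ≤ tvDist μ ν := by
    refine le_csSup ⟨1, ?_⟩ ⟨s, hs, rfl⟩
    rintro t ⟨s, _, rfl⟩
    exact abs_measureReal_sub_le_one μ ν s
  refine h1.trans (le_csSup ⟨1, ?_⟩ ⟨μ, hμ, ν, hν, rfl⟩)
  rintro t ⟨μ, hμ, ν, hν, rfl⟩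
  have := hY μ hμ
  have := hY ν hν
  exact tvDist_le_one μ ν

theorem measurable_rescale (a b : ℝ) : Measurable (rescale a b) :=
  (measurable_id.sub_const a).div_const _

theorem isProbabilityMeasure_of_mem_condClosure {X : Set (Measure ℝ)}
    (hX : ∀ μ ∈ X, IsProbabilityMeasure μ) {ν : Measure ℝ} (hν : ν ∈ condClosure X) :
    IsProbabilityMeasure ν := by
  obtain ⟨μ, hμ, a, b, _, _, _, h0, rfl⟩ := hν
  have := hX μ hμ
  have := cond_isProbabilityMeasure h0
  exact Measure.isProbabilityMeasure_map (measurable_rescale a b).aemeasurable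

/-- A subfamily of independent coordinates is independent. This serves to single out the training
points of a leaf, and to list the points with index in a set in their order. -/
theorem map_pi_comp {ι κ : Type*} [Fintype ι] [Fintype κ] (μ : ι → Measure ℝ)
    [∀ i, IsProbabilityMeasure (μ i)] {e : κ → ι} (he : Function.Injective e) :
    (Measure.pi μ).map (fun D k => D (e k)) = Measure.pi fun k => μ (e k) := by
  have h : iIndepFun (fun i (D : ι → ℝ) => D i) (Measure.pi μ) :=
    iIndepFun_pi (X := fun _ => id) fun _ => aemeasurable_id
  have h2 := (h.precomp he).map_fun_eq_pi_map fun k => (measurable_pi_apply (e k)).aemeasurable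
  refine (Eq.trans ?_ h2).trans ?_
  · rfl
  congr 1; ext1 k
  exact (measurePreserving_eval μ (e k)).map_eq

/-- Scaling up replaces each of the last `k` terms by the mean of the first `m`, from which it
differs by at most `δ`. -/
theorem abs_sum_sub_le {m k : ℕ} (hm : 1 ≤ m) (p : Fin (m + k) → ℝ) {δ : ℝ}
    (h : ∀ i j, |p i - p j| ≤ δ) :
    |((m + k : ℕ) : ℝ) / m * ∑ i : Fin m, p (Fin.castAdd k i) - ∑ i, p i| ≤ k * δ := by
  have hm0 : (0 : ℝ) < m := by exact_mod_cast hm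
  set s := ∑ i : Fin m, p (Fin.castAdd k i)
  have e : ((m + k : ℕ) : ℝ) / m * s - ∑ i, p i = ∑ j : Fin k, (s / m - p (Fin.natAdd m j)) := by
    rw [Fin.sum_univ_add, Finset.sum_sub_distrib]
    simp only [Finset.sum_const, Finset.card_univ, Fintype.card_fin, nsmul_eq_mul]
    push_cast
    have : ((m : ℝ) + k) / m * s = s + k * (s / m) := by field_simp
    rw [this]; ring
  rw [e]
  refine (Finset.abs_sum_le_sum_abs _ _).trans ?_
  have : ∀ j : Fin k, |s / m - p (Fin.natAdd m j)| ≤ δ := by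
    intro j
    have e2 : s / m - p (Fin.natAdd m j)
        = (∑ i : Fin m, (p (Fin.castAdd k i) - p (Fin.natAdd m j))) / m := by
      rw [Finset.sum_sub_distrib]; simp only [Finset.sum_const, Finset.card_univ,
        Fintype.card_fin, nsmul_eq_mul]; field_simp; rfl
    rw [e2, abs_div, abs_of_pos hm0, div_le_iff₀ hm0]
    refine (Finset.abs_sum_le_sum_abs _ _).trans ?_
    calc ∑ i : Fin m, |p (Fin.castAdd k i) - p (Fin.natAdd m j)| ≤ ∑ _i : Fin m, δ :=
          Finset.sum_le_sum fun i _ => h _ _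
      _ = δ * m := by simp [mul_comm]
  calc ∑ j : Fin k, |s / m - p (Fin.natAdd m j)| ≤ ∑ _j : Fin k, δ :=
        Finset.sum_le_sum fun j _ => this j
    _ = k * δ := by simp

/-- The mean error when a model on the first `m` of `m + k` points is scaled up. -/
theorem lintegral_abs_scaled_model_sub_le {A : Learner} {κ₁ κ₂ : ℝ} {Y : Set (Measure ℝ)}
    {T S B : ℕ → ℝ} (hκ₁ : 0 < κ₁) (hκ₂ : 0 < κ₂) (hA : A.Learns κ₁ κ₂ Y T S B) {m k : ℕ}
    (hm : 1 ≤ m) (χ : Fin (m + k) → Measure ℝ) [∀ i, IsProbabilityMeasure (χ i)]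
    (hχ : ∀ i, χ i ∈ Y) {q : ℝ × ℝ} (hq : IsQuery q) {δ : ℝ} (hδ : 0 ≤ δ)
    (htv : ∀ i j, |(χ i).real (queryRange q) - (χ j).real (queryRange q)| ≤ δ) :
    ∫⁻ D, ENNReal.ofReal |((m + k : ℕ) : ℝ) / m *
        A.eval (A.train (List.ofFn fun i : Fin m => D (Fin.castAdd k i))) q - cardinality D q|
      ∂(Measure.pi χ) ≤ ENNReal.ofReal (((m + k : ℕ) : ℝ) / m * (√(m : ℝ) * errorFactor κ₁ κ₂)
        + k * δ + √((m + k : ℕ) : ℝ)) := by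
  set r : ℝ := ((m + k : ℕ) : ℝ) / m with hr
  have hr0 : 0 ≤ r := by positivity
  set χ' : Fin m → Measure ℝ := fun i => χ (Fin.castAdd k i) with hχ'
  have hef := one_le_errorFactor κ₂ hκ₁
  set G : (Fin m → ℝ) → ENNReal := fun D =>
    ENNReal.ofReal |distCardinality χ' q - A.eval (A.train (List.ofFn D)) q| with hG
  have hGm : Measurable G := ENNReal.measurable_ofReal.comp
    (measurable_const.sub (measurable_eval_train hA measurable_id measurable_const)).abs
  have hproj : Measurable fun (D : Fin (m + k) → ℝ) (i : Fin m) => D (Fin.castAdd k i) :=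
    measurable_pi_lambda _ fun i => measurable_pi_apply _
  have h1 : ∫⁻ D : Fin (m + k) → ℝ, G (fun i : Fin m => D (Fin.castAdd k i)) ∂(Measure.pi χ)
      ≤ ENNReal.ofReal (√(m : ℝ) * errorFactor κ₁ κ₂) := by
    rw [← lintegral_map hGm hproj,
      map_pi_comp χ (Fin.castAdd_injective m k)]
    exact lintegral_abs_model_sub_le hκ₁ hκ₂ hA hm χ' (fun i => hχ _) hq
  have h2 : |r * distCardinality χ' q - distCardinality χ q| ≤ k * δ := by
    rw [distCardinality_eq, distCardinality_eq]
    exact abs_sum_sub_le hm (fun i => (χ i).real (queryRange q)) htv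
  have hpt : ∀ D : Fin (m + k) → ℝ, ENNReal.ofReal |r *
      A.eval (A.train (List.ofFn fun i : Fin m => D (Fin.castAdd k i))) q - cardinality D q|
      ≤ ENNReal.ofReal r * G (fun i : Fin m => D (Fin.castAdd k i)) + ENNReal.ofReal (k * δ) +
        ENNReal.ofReal |distCardinality χ q - cardinality D q| := by
    intro D
    rw [hG, ← ENNReal.ofReal_mul hr0, ← ENNReal.ofReal_add (by positivity) (by positivity),
      ← ENNReal.ofReal_add (by positivity) (by positivity)]
    refine ENNReal.ofReal_le_ofReal ?_
    set f := A.eval (A.train (List.ofFn fun i : Fin m => D (Fin.castAdd k i))) q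
    -- The three sources of error: the model for its own training set, the extrapolation from `m` to
    -- `m + k` distributions, and the deviation of the count from its mean.
    have e : r * f - cardinality D q = -(r * (distCardinality χ' q - f))
        + (r * distCardinality χ' q - distCardinality χ q)
        + (distCardinality χ q - cardinality D q) := by ring
    rw [e]
    refine (abs_add_le _ _).trans (add_le_add ((abs_add_le _ _).trans (add_le_add ?_ h2)) le_rfl)
    rw [abs_neg, abs_mul, abs_of_nonneg hr0]
  refine (lintegral_mono hpt).trans ?_
  have hGp : Measurable fun D : Fin (m + k) → ℝ => G fun i : Fin m => D (Fin.castAdd k i) :=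
    hGm.comp hproj
  rw [lintegral_add_left (by fun_prop), lintegral_add_right _ measurable_const,
    lintegral_const_mul _ hGp, lintegral_const, measure_univ, mul_one]
  calc _ ≤ ENNReal.ofReal r * ENNReal.ofReal (√(m : ℝ) * errorFactor κ₁ κ₂)
        + ENNReal.ofReal (k * δ) + ENNReal.ofReal √((m + k : ℕ) : ℝ) := by
        gcongr
        exact lintegral_abs_cardinality_sub_le χ q
    _ = _ := by
        rw [← ENNReal.ofReal_mul hr0, ← ENNReal.ofReal_add (by positivity) (by positivity),
          ← ENNReal.ofReal_add (by positivity) (by positivity)]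

/-! ### Measurability of the leaf -/

/-- The order statistics and the estimates are given by different formulas, depending on which
indices lie in a leaf. Since the formulas agree with the function on their pieces, the pieces need
not be disjoint. -/
theorem measurable_of_countable_cover {α β ι : Type*} [MeasurableSpace α] [MeasurableSpace β]
    [Countable ι] {f : α → β} (E : ι → Set α) (g : ι → α → β) (hE : ∀ i, MeasurableSet (E i))
    (hg : ∀ i, Measurable (g i)) (hcov : ∀ x, ∃ i, x ∈ E i) (h : ∀ i, ∀ x ∈ E i, f x = g i x) :
    Measurable f := by
  intro t ht
  have : f ⁻¹' t = ⋃ i, E i ∩ g i ⁻¹' t := by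
    ext x
    simp only [mem_preimage, mem_iUnion, mem_inter_iff]
    constructor
    · intro hx
      obtain ⟨i, hi⟩ := hcov x
      exact ⟨i, hi, by rwa [← h i x hi]⟩
    · rintro ⟨i, hi, hx⟩
      rwa [h i x hi]
  rw [this]
  exact MeasurableSet.iUnion fun i => (hE i).inter (hg i ht)

theorem countP_ofFn_eq_sum {n : ℕ} (D : Fin n → ℝ) (p : ℝ → Prop) [DecidablePred p] :
    (List.ofFn D).countP (fun x => decide (p x)) = ∑ i, if p (D i) then 1 else 0 := by
  induction n with
  | zero => simp
  | succ n ih =>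
    rw [List.ofFn_succ, List.countP_cons, ih, Fin.sum_univ_succ, add_comm]
    simp

theorem measurable_countP_ofFn {α : Type*} [MeasurableSpace α] {n : ℕ} {D : α → Fin n → ℝ}
    {p : α → ℝ → Prop} [∀ x, DecidablePred (p x)]
    (hp : ∀ i, MeasurableSet {x | p x (D x i)}) :
    Measurable fun x => (List.ofFn (D x)).countP fun y => decide (p x y) := by
  simp only [countP_ofFn_eq_sum]
  exact Finset.measurable_sum _ fun i _ =>
    Measurable.ite (hp i) measurable_const measurable_const

theorem measurable_length_inside {α : Type*} [MeasurableSpace α] {n : ℕ} {D : α → Fin n → ℝ}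
    {a b : α → ℝ} (hD : Measurable D) (ha : Measurable a) (hb : Measurable b) :
    Measurable fun x => (inside (a x) (b x) (List.ofFn (D x))).length := by
  simp only [length_inside]
  refine measurable_countP_ofFn fun i => ?_
  have hDi : Measurable fun x => D x i := (measurable_pi_apply i).comp hD
  exact (measurableSet_lt ha hDi).inter (measurableSet_lt hDi hb)

/-- The order statistic is one of the finitely many coordinates, and that it is the `i`-th one is a
measurable condition on numbers of points. The remaining piece, on which no coordinate qualifies,
carries the default value `0`. -/
theorem measurable_kth_inside {α : Type*} [MeasurableSpace α] {n : ℕ} {D : α → Fin n → ℝ}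
    {a b : α → ℝ} (hD : Measurable D) (ha : Measurable a) (hb : Measurable b) (j : ℕ) :
    Measurable fun x => kth j (inside (a x) (b x) (List.ofFn (D x))) := by
  have hDi : ∀ i, Measurable fun x => D x i := fun i => (measurable_pi_apply i).comp hD
  have hE : ∀ i, MeasurableSet {x | IsKth j (inside (a x) (b x) (List.ofFn (D x))) (D x i)} := by
    intro i
    have h1 : Measurable fun x => (List.ofFn (D x)).countP fun y =>
        decide (y < D x i ∧ a x < y ∧ y < b x) :=
      measurable_countP_ofFn (p := fun x y => y < D x i ∧ a x < y ∧ y < b x) fun k =>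
        (measurableSet_lt (hDi k) (hDi i)).inter
          ((measurableSet_lt ha (hDi k)).inter (measurableSet_lt (hDi k) hb))
    have h2 : Measurable fun x => (List.ofFn (D x)).countP fun y =>
        decide (y ≤ D x i ∧ a x < y ∧ y < b x) :=
      measurable_countP_ofFn (p := fun x y => y ≤ D x i ∧ a x < y ∧ y < b x) fun k =>
        (measurableSet_le (hDi k) (hDi i)).inter
          ((measurableSet_lt ha (hDi k)).inter (measurableSet_lt (hDi k) hb))
    have e : {x | IsKth j (inside (a x) (b x) (List.ofFn (D x))) (D x i)} =
        ({x | a x < D x i} ∩ {x | D x i < b x}) ∩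
        ((fun x => (List.ofFn (D x)).countP fun y =>
          decide (y < D x i ∧ a x < y ∧ y < b x)) ⁻¹' Iic j ∩
        (fun x => (List.ofFn (D x)).countP fun y =>
          decide (y ≤ D x i ∧ a x < y ∧ y < b x)) ⁻¹' Ioi j) := by
      ext x
      simp only [IsKth, mem_inside, mem_ofPred_eq, mem_inter_iff, mem_preimage, mem_Iic, mem_Ioi]
      unfold inside
      rw [List.countP_filter, List.countP_filter]
      simp only [← Bool.decide_and]
      have : D x i ∈ List.ofFn (D x) := (List.mem_ofFn' _ _).2 ⟨i, rfl⟩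
      tauto
    rw [e]
    exact ((measurableSet_lt ha (hDi i)).inter (measurableSet_lt (hDi i) hb)).inter
      ((h1 measurableSet_Iic).inter (h2 measurableSet_Ioi))
  refine measurable_of_countable_cover (ι := Option (Fin n))
    (fun o => o.elim (⋂ i, {x | IsKth j (inside (a x) (b x) (List.ofFn (D x))) (D x i)}ᶜ)
      fun i => {x | IsKth j (inside (a x) (b x) (List.ofFn (D x))) (D x i)})
    (fun o => o.elim (fun _ => 0) fun i x => D x i) ?_ ?_ ?_ ?_
  · rintro (_ | i)
    · exact MeasurableSet.iInter fun i => (hE i).compl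
    · exact hE i
  · rintro (_ | i)
    · exact measurable_const
    · exact hDi i
  · intro x
    by_cases h : ∃ i, IsKth j (inside (a x) (b x) (List.ofFn (D x))) (D x i)
    · obtain ⟨i, hi⟩ := h
      exact ⟨some i, hi⟩
    · refine ⟨none, ?_⟩
      simp only [Option.elim_none, mem_iInter, mem_compl_iff, mem_ofPred_eq]
      exact fun i hi => h ⟨i, hi⟩
  · rintro (_ | i) x hx
    · simp only [Option.elim_none, mem_iInter, mem_compl_iff, mem_ofPred_eq] at hx ⊢
      unfold kth
      rw [dif_neg]
      rintro ⟨s, hs⟩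
      obtain ⟨i, rfl⟩ := (List.mem_ofFn' _ _).1 (mem_inside.1 hs.1).1
      exact hx i hs
    · exact IsKth.kth_eq hx

theorem measurable_refresh {α : Type*} [MeasurableSpace α] (M R : ℕ) (v : ℝ) {n : ℕ}
    {D : α → Fin n → ℝ} {t : α → ℝ × ℝ × ℕ} (hD : Measurable D) (ht : Measurable t) :
    Measurable fun x => refresh M R v (List.ofFn (D x)) (t x) := by
  have ha : Measurable fun x => (t x).1 := ht.fst
  have hb : Measurable fun x => (t x).2.1 := ht.snd.fst
  have hm : Measurable fun x => (t x).2.2 := ht.snd.snd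
  have hc := measurable_length_inside hD ha hb
  have hs := measurable_kth_inside hD ha hb (M / 2)
  unfold refresh
  refine Measurable.ite (measurableSet_lt measurable_const hc) ?_ ?_
  · exact Measurable.ite (measurableSet_lt measurable_const hs)
      (ha.prodMk (hs.prodMk (measurable_length_inside hD ha hs)))
      (hs.prodMk (hb.prodMk (measurable_length_inside hD hs hb)))
  · exact Measurable.ite (measurableSet_lt (hm.add (hm.min measurable_const)) hc)
      (ha.prodMk (hb.prodMk hc)) ht

theorem measurable_leafState (M R : ℕ) (v : ℝ) (n : ℕ) :
    Measurable fun D : Fin n → ℝ => leafState M R v (List.ofFn D) := by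
  induction n with
  | zero => simp only [List.ofFn_zero]; exact measurable_const
  | succ n ih =>
    have e : ∀ D : Fin (n + 1) → ℝ, leafState M R v (List.ofFn D) = refresh M R v (List.ofFn D)
        (leafState M R v (List.ofFn fun i : Fin n => D i.castSucc)) := by
      intro D
      conv_lhs => rw [ofFn_concat]
      rw [leafState_concat, ← ofFn_concat]
    simp only [e]
    have hp : Measurable fun (D : Fin (n + 1) → ℝ) (i : Fin n) => D i.castSucc :=
      measurable_pi_lambda _ fun i => measurable_pi_apply _
    exact measurable_refresh M R v measurable_id (ih.comp hp)

/-! ### The error in a leaf -/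

/-- The query `[l, u]`, restricted to `[a, b]` and rescaled. -/
noncomputable def leafQuery (a b l u : ℝ) : ℝ × ℝ :=
  (rescale a b (max l a), rescale a b (min u b) - rescale a b (max l a))

/-- The estimate for the number of points of `z` in `[l, u]` in a leaf with inner points `z`. -/
noncomputable def leafEstimate (A : Learner) (l u : ℝ) (t : ℝ × ℝ × ℕ) (z : List ℝ) : ℝ :=
  (z.length : ℝ) / t.2.2 * A.eval (A.train ((z.take t.2.2).map (rescale t.1 t.2.1)))
    (leafQuery t.1 t.2.1 l u)

/-- The error of the estimate in the leaf around `v`. -/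
noncomputable def leafError (A : Learner) (M R : ℕ) (v l u : ℝ) (D : List ℝ) : ℝ :=
  let t := leafState M R v D
  |leafEstimate A l u t (inside t.1 t.2.1 D) -
    (inside t.1 t.2.1 D).countP fun x => max l t.1 ≤ x ∧ x ≤ min u t.2.1|

/-- The indices of the points in the leaf around `v`. -/
noncomputable def leafIndices (M R : ℕ) (v : ℝ) {n : ℕ} (D : Fin n → ℝ) : Finset (Fin n) :=
  Finset.univ.filter fun i =>
    (leafState M R v (List.ofFn D)).1 < D i ∧ D i < (leafState M R v (List.ofFn D)).2.1

theorem mem_leafIndices {M R : ℕ} {v : ℝ} {n : ℕ} {D : Fin n → ℝ} {i : Fin n} :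
    i ∈ leafIndices M R v D ↔
      D i ∈ Ioo (leafState M R v (List.ofFn D)).1 (leafState M R v (List.ofFn D)).2.1 := by
  simp [leafIndices]

/-- The elements of `I` in increasing order. -/
def sortedList {n : ℕ} (I : Finset (Fin n)) : List (Fin n) := (List.finRange n).filter (· ∈ I)

theorem inside_ofFn {n : ℕ} {D : Fin n → ℝ} {a b : ℝ} {I : Finset (Fin n)}
    (h : ∀ i, i ∈ I ↔ a < D i ∧ D i < b) : inside a b (List.ofFn D) = (sortedList I).map D := by
  rw [inside, sortedList, List.ofFn_eq_map, List.filter_map]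
  congr 1
  refine List.filter_congr fun i _ => ?_
  simp [h i]

theorem measurableSet_leafIndices_eq (M R : ℕ) (v : ℝ) {n : ℕ} (I : Finset (Fin n)) :
    MeasurableSet {D : Fin n → ℝ | leafIndices M R v D = I} := by
  have : {D : Fin n → ℝ | leafIndices M R v D = I} = ⋂ i, {D | (i ∈ I) ↔
      (leafState M R v (List.ofFn D)).1 < D i ∧ D i < (leafState M R v (List.ofFn D)).2.1} := by
    ext D
    simp only [mem_ofPred_eq, mem_iInter, Finset.ext_iff, mem_leafIndices, mem_Ioo]
    exact forall_congr' fun i => iff_comm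
  rw [this]
  refine MeasurableSet.iInter fun i => ?_
  have h := measurable_leafState M R v n
  have hS : MeasurableSet {D : Fin n → ℝ |
      (leafState M R v (List.ofFn D)).1 < D i ∧ D i < (leafState M R v (List.ofFn D)).2.1} :=
    (measurableSet_lt h.fst (measurable_pi_apply i)).inter
      (measurableSet_lt (measurable_pi_apply i) h.snd.fst)
  by_cases hi : i ∈ I
  · simpa [hi] using hS
  · simp only [hi, false_iff]; exact hS.compl

/-- The measurability of the learner concerns datasets of a fixed size. Where the index set and the
size of the training set are constant, the estimate is an evaluation on a tuple of fixed length. -/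
theorem measurable_leafEstimate {A : Learner} {κ₁ κ₂ : ℝ} {Y : Set (Measure ℝ)} {T S B : ℕ → ℝ}
    (hA : A.Learns κ₁ κ₂ Y T S B) (M R : ℕ) (v l u : ℝ) (n : ℕ) :
    Measurable fun D : Fin n → ℝ => leafEstimate A l u (leafState M R v (List.ofFn D))
      (inside (leafState M R v (List.ofFn D)).1 (leafState M R v (List.ofFn D)).2.1
        (List.ofFn D)) := by
  have h := measurable_leafState M R v n
  refine measurable_of_countable_cover (ι := Finset (Fin n) × ℕ)
    (fun p => {D | leafIndices M R v D = p.1} ∩ {D | (leafState M R v (List.ofFn D)).2.2 = p.2})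
    (fun p D => ((sortedList p.1).length : ℝ) / p.2 * A.eval (A.train
      (List.ofFn fun j : Fin ((sortedList p.1).take p.2).length =>
        rescale (leafState M R v (List.ofFn D)).1 (leafState M R v (List.ofFn D)).2.1
          (D (((sortedList p.1).take p.2).get j))))
      (leafQuery (leafState M R v (List.ofFn D)).1 (leafState M R v (List.ofFn D)).2.1 l u))
    ?_ ?_ ?_ ?_
  · rintro ⟨I, m⟩
    exact (measurableSet_leafIndices_eq M R v I).inter (h.snd.snd (measurableSet_singleton m))
  · rintro ⟨I, m⟩
    refine (measurable_eval_train hA ?_ ?_).const_mul _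
    · refine measurable_pi_lambda _ fun j => ?_
      exact ((measurable_pi_apply _).sub h.fst).div (h.snd.fst.sub h.fst)
    · unfold leafQuery rescale
      have ha := h.fst
      have hb := h.snd.fst
      have h1 : Measurable fun D : Fin n → ℝ =>
          (max l (leafState M R v (List.ofFn D)).1 - (leafState M R v (List.ofFn D)).1) /
          ((leafState M R v (List.ofFn D)).2.1 - (leafState M R v (List.ofFn D)).1) :=
        ((measurable_const.max ha).sub ha).div (hb.sub ha)
      exact h1.prodMk ((((measurable_const.min hb).sub ha).div (hb.sub ha)).sub h1)
  · exact fun D => ⟨(_, _), rfl, rfl⟩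
  · rintro ⟨I, m⟩ D ⟨hI, hm⟩
    simp only [mem_ofPred_eq] at hI hm
    have e : inside (leafState M R v (List.ofFn D)).1 (leafState M R v (List.ofFn D)).2.1
        (List.ofFn D) = (sortedList I).map D :=
      inside_ofFn fun i => by rw [← hI, mem_leafIndices, mem_Ioo]
    simp only [leafEstimate, e, hm, List.length_map]
    congr 3
    apply List.ext_getElem
    · simp
    · intro i h1 h2
      simp

theorem measurable_leafError {A : Learner} {κ₁ κ₂ : ℝ} {Y : Set (Measure ℝ)} {T S B : ℕ → ℝ}
    (hA : A.Learns κ₁ κ₂ Y T S B) (M R : ℕ) (v l u : ℝ) (n : ℕ) :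
    Measurable fun D : Fin n → ℝ => leafError A M R v l u (List.ofFn D) := by
  have h := measurable_leafState M R v n
  have h2 : Measurable fun D : Fin n → ℝ => (List.ofFn D).countP fun x => decide
      ((max l (leafState M R v (List.ofFn D)).1 ≤ x ∧
        x ≤ min u (leafState M R v (List.ofFn D)).2.1) ∧
       (leafState M R v (List.ofFn D)).1 < x ∧ x < (leafState M R v (List.ofFn D)).2.1) :=
    measurable_countP_ofFn (D := fun D : Fin n → ℝ => D) (p := fun D x =>
      (max l (leafState M R v (List.ofFn D)).1 ≤ x ∧
        x ≤ min u (leafState M R v (List.ofFn D)).2.1) ∧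
       (leafState M R v (List.ofFn D)).1 < x ∧ x < (leafState M R v (List.ofFn D)).2.1)
      fun i => ((measurableSet_le (measurable_const.max h.fst) (measurable_pi_apply i)).inter
        (measurableSet_le (measurable_pi_apply i) (measurable_const.min h.snd.fst))).inter
        ((measurableSet_lt h.fst (measurable_pi_apply i)).inter
          (measurableSet_lt (measurable_pi_apply i) h.snd.fst))
  have h3 : Measurable fun D : Fin n → ℝ =>
      ((inside (leafState M R v (List.ofFn D)).1 (leafState M R v (List.ofFn D)).2.1
        (List.ofFn D)).countP fun x => max l (leafState M R v (List.ofFn D)).1 ≤ x ∧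
          x ≤ min u (leafState M R v (List.ofFn D)).2.1 : ℝ) := by
    refine (measurable_from_nat (f := fun k : ℕ => (k : ℝ))).comp ?_
    simp only [inside, List.countP_filter, ← Bool.decide_and]
    exact h2
  exact ((measurable_leafEstimate hA M R v l u n).sub h3).abs

/-! ### Conditioning on a box -/

/-- Conditioning independent coordinates on a box leaves them independent and conditions each of
them separately; both sides agree on boxes. -/
theorem restrict_pi_eq_smul {ι : Type*} [Fintype ι] (μ : ι → Measure ℝ)
    [∀ i, IsProbabilityMeasure (μ i)] {s : Set ℝ} (h0 : ∀ i, μ i s ≠ 0) :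
    (Measure.pi μ).restrict (univ.pi fun _ => s) =
      (Measure.pi μ (univ.pi fun _ => s)) • Measure.pi fun i => ProbabilityTheory.cond (μ i) s := by
  have hp : ∀ i, IsProbabilityMeasure (ProbabilityTheory.cond (μ i) s) :=
    fun i => cond_isProbabilityMeasure (h0 i)
  rw [Measure.restrict_pi_pi]
  refine Measure.pi_eq fun t ht => ?_
  rw [Measure.smul_apply, Measure.pi_pi, Measure.pi_pi, smul_eq_mul, ← Finset.prod_mul_distrib]
  refine Finset.prod_congr rfl fun i _ => ?_
  rw [cond_apply' (ht i), ← mul_assoc, ENNReal.mul_inv_cancel (h0 i) (measure_ne_top _ _), one_mul,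
    Measure.restrict_apply (ht i), inter_comm]

theorem rescale_le_rescale {a b x y : ℝ} (h : a < b) : rescale a b x ≤ rescale a b y ↔ x ≤ y := by
  unfold rescale
  rw [div_le_div_iff_of_pos_right (sub_pos.2 h)]
  constructor <;> intro h <;> linarith

theorem rescale_mem_Icc {a b x : ℝ} (h : a < b) (h1 : a ≤ x) (h2 : x ≤ b) :
    rescale a b x ∈ Icc (0 : ℝ) 1 := by
  unfold rescale
  have : 0 < b - a := sub_pos.2 h
  constructor
  · exact div_nonneg (by linarith) this.le
  · rw [div_le_one this]; linarith

theorem isQuery_rescale {a b l u : ℝ} (h : a < b) (h1 : a ≤ l) (h2 : l ≤ u) (h3 : u ≤ b) :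
    IsQuery (rescale a b l, rescale a b u - rescale a b l) := by
  have hl := rescale_mem_Icc h h1 (h2.trans h3)
  have hu := rescale_mem_Icc h (h1.trans h2) h3
  have := (rescale_le_rescale h).2 h2
  exact ⟨hl, by constructor <;> simp only [mem_Icc] at * <;> linarith⟩

/-- The mean error in a fixed leaf, given which points it contains. -/
theorem lintegral_box_leafEstimate_le {A : Learner} {κ₁ κ₂ : ℝ} {X : Set (Measure ℝ)}
    {T S B : ℕ → ℝ} (hκ₁ : 0 < κ₁) (hκ₂ : 0 < κ₂)
    (hX : ∀ μ ∈ X, IsProbabilityMeasure μ ∧ μ (Icc 0 1)ᶜ = 0)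
    (hA : A.Learns κ₁ κ₂ (condClosure X) T S B) {M R n : ℕ} {δ e : ℝ} (hδ : 0 ≤ δ)
    (he : √(M : ℝ) * (2 * errorFactor κ₁ κ₂ + 1) + R * δ ≤ e)
    {χ : Fin n → Measure ℝ} (hχ : ∀ i, χ i ∈ X)
    (htv : tvSet (condClosure (range χ)) ≤ δ) {a b l u : ℝ} {m : ℕ} (ha : 0 ≤ a) (hab : a < b)
    (h01 : a < 1 → b ≤ 1) (hlu : max l a ≤ min u b)
    {I : Finset (Fin n)} (hm : m ≤ (sortedList I).length)
    (hmR : (sortedList I).length ≤ m + min m R) (hM : (sortedList I).length ≤ M) :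
    ∫⁻ x in univ.pi fun _ : {i // i ∈ I} => Ioo a b,
      ENNReal.ofReal |leafEstimate A l u (a, b, m)
          ((sortedList I).map fun i => if h : i ∈ I then x ⟨i, h⟩ else 0) -
        ((sortedList I).map fun i => if h : i ∈ I then x ⟨i, h⟩ else 0).countP
          fun x => max l a ≤ x ∧ x ≤ min u b| ∂(Measure.pi fun i : {i // i ∈ I} => χ i)
      ≤ ENNReal.ofReal e *
        Measure.pi (fun i : {i // i ∈ I} => χ i) (univ.pi fun _ => Ioo a b) := by
  have hprob : ∀ i, IsProbabilityMeasure (χ i) := fun i => (hX _ (hχ i)).1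
  have hef := one_le_errorFactor κ₂ hκ₁
  have he0 : 0 ≤ e := by
    refine le_trans ?_ he; positivity
  -- For an empty leaf, the factor `c` makes the estimate zero, and so is the count.
  rcases Finset.eq_empty_or_nonempty I with rfl | hne
  · have : sortedList (∅ : Finset (Fin n)) = [] := by simp [sortedList]
    simp [this, leafEstimate]
  by_cases h0 : ∀ i : {i // i ∈ I}, χ i (Ioo a b) ≠ 0
  swap
  · push Not at h0
    obtain ⟨i, hi⟩ := h0
    have hbox : Measure.pi (fun i : {i // i ∈ I} => χ i) (univ.pi fun _ => Ioo a b) = 0 := by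
      rw [Measure.pi_pi]; exact Finset.prod_eq_zero (Finset.mem_univ i) hi
    rw [Measure.restrict_eq_zero.2 hbox]
    simp
  -- Otherwise `a ≥ 1`, and the interval would be a null set for a distribution on `[0, 1]`. This
  -- excludes the leaf beyond `1`.
  have hb1 : b ≤ 1 := by
    obtain ⟨i, hi⟩ := hne
    refine h01 (not_le.1 fun h => h0 ⟨i, hi⟩ ?_)
    refine measure_mono_null ?_ (hX _ (hχ i)).2
    rintro x ⟨hx, -⟩ ⟨-, hx'⟩
    linarith
  obtain ⟨k, hk⟩ := Nat.exists_eq_add_of_le hm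
  have hlen : 0 < (sortedList I).length := by
    obtain ⟨i, hi⟩ := hne
    exact List.length_pos_of_mem (a := i) (by simp [sortedList, hi])
  have hm1 : 1 ≤ m := by omega
  have hkm : k ≤ min m R := by omega
  have hk1 : k ≤ m := hkm.trans (min_le_left _ _)
  have hk2 : k ≤ R := hkm.trans (min_le_right _ _)
  have hmem : ∀ j : Fin (m + k), (sortedList I)[(j : ℕ)]'(by omega) ∈ I := by
    intro j
    have h : (sortedList I)[(j : ℕ)]'(by omega) ∈ sortedList I := List.getElem_mem _
    simp only [sortedList, List.mem_filter, decide_eq_true_eq] at h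
    exact h.2
  -- The enumeration is increasing, so the first `m` points are those on which the model was
  -- trained.
  set f : Fin (m + k) → {i // i ∈ I} := fun j => ⟨(sortedList I)[(j : ℕ)]'(by omega), hmem j⟩
    with hf
  have hfinj : Function.Injective f := by
    intro j j' h
    have hnd : (sortedList I).Nodup := (List.nodup_finRange n).filter _
    simp only [hf, Subtype.mk.injEq] at h
    exact Fin.ext ((hnd.getElem_inj_iff).1 h)
  set q := leafQuery a b l u with hq
  have hquery : IsQuery q :=
    isQuery_rescale hab (le_max_right _ _) hlu (min_le_right _ _)
  set w : ({i // i ∈ I} → ℝ) → Fin (m + k) → ℝ := fun x j => rescale a b (x (f j)) with hw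
  have hwm : Measurable w :=
    measurable_pi_lambda _ fun j => (measurable_rescale a b).comp (measurable_pi_apply _)
  set H : (Fin (m + k) → ℝ) → ENNReal := fun y => ENNReal.ofReal |((m + k : ℕ) : ℝ) / m *
        A.eval (A.train (List.ofFn fun i : Fin m => y (Fin.castAdd k i))) q - cardinality y q|
    with hH
  have hproj : Measurable fun (D : Fin (m + k) → ℝ) (i : Fin m) => D (Fin.castAdd k i) :=
    measurable_pi_lambda _ fun i => measurable_pi_apply _
  have hHm : Measurable H := ENNReal.measurable_ofReal.comp
    (((measurable_eval_train hA hproj measurable_const).const_mul _).sub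
      (measurable_cardinality q)).abs
  have hlist : ∀ x : {i // i ∈ I} → ℝ,
      ((sortedList I).map fun i => if h : i ∈ I then x ⟨i, h⟩ else 0)
        = List.ofFn fun j => x (f j) := by
    intro x
    apply List.ext_getElem
    · simp [hk]
    · intro i h1 h2
      have := hmem ⟨i, by simpa using h2⟩
      simp only [List.getElem_map, List.getElem_ofFn, hf]
      rw [dif_pos this]
  have hGH : ∀ x ∈ univ.pi fun _ : {i // i ∈ I} => Ioo a b,
      ENNReal.ofReal |leafEstimate A l u (a, b, m)
          ((sortedList I).map fun i => if h : i ∈ I then x ⟨i, h⟩ else 0) -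
        ((sortedList I).map fun i => if h : i ∈ I then x ⟨i, h⟩ else 0).countP
          fun x => max l a ≤ x ∧ x ≤ min u b| = H (w x) := by
    intro x hx
    rw [hlist x, hH]
    simp only [leafEstimate, List.length_ofFn]
    congr 3
    · congr 3
      apply List.ext_getElem
      · simp
      · intro i h1 h2
        simp [hw]
    · rw [countP_ofFn_eq_sum, cardinality]
      push_cast
      refine Finset.sum_congr rfl fun j _ => ?_
      have hiff : (max l a ≤ x (f j) ∧ x (f j) ≤ min u b) ↔ w x j ∈ queryRange q := by
        simp only [queryRange, hq, leafQuery, hw, mem_Icc, add_sub_cancel,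
          rescale_le_rescale hab]
      by_cases h : w x j ∈ queryRange q
      · rw [indicator_of_mem h, if_pos (hiff.2 h)]
      · rw [indicator_of_notMem h, if_neg fun h' => h (hiff.1 h')]
  -- The mass of the box factors out. What remains is the mean of the error under the product of the
  -- conditional laws, which `w` carries to normalized conditional laws. They lie in the closure of
  -- `X`, which gives learnability, and in that of the `χ i`, which gives the bound `δ` on their
  -- differences.
  rw [setLIntegral_congr_fun (MeasurableSet.univ_pi fun _ => measurableSet_Ioo) hGH,
    restrict_pi_eq_smul _ h0, lintegral_smul_measure, smul_eq_mul, mul_comm]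
  gcongr
  have hcp : ∀ i : {i // i ∈ I},
      IsProbabilityMeasure (ProbabilityTheory.cond (χ i) (Ioo a b)) :=
    fun i => cond_isProbabilityMeasure (h0 i)
  have hmap : (Measure.pi fun i : {i // i ∈ I} => ProbabilityTheory.cond (χ i) (Ioo a b)).map w
      = Measure.pi fun j => normalizedCond (χ (f j)) a b := by
    have hp' : ∀ j, IsProbabilityMeasure
        ((ProbabilityTheory.cond (χ (f j)) (Ioo a b)).map (rescale a b)) := fun j =>
      Measure.isProbabilityMeasure_map (measurable_rescale a b).aemeasurable
    have h1 : w = (fun (y : Fin (m + k) → ℝ) j => rescale a b (y j)) ∘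
        fun (x : {i // i ∈ I} → ℝ) j => x (f j) := rfl
    have h2 : Measurable fun (y : Fin (m + k) → ℝ) j => rescale a b (y j) :=
      measurable_pi_lambda _ fun j => (measurable_rescale a b).comp (measurable_pi_apply j)
    have h3 : Measurable fun (x : {i // i ∈ I} → ℝ) j => x (f j) :=
      measurable_pi_lambda _ fun j => measurable_pi_apply _
    rw [h1, ← Measure.map_map h2 h3,
      map_pi_comp (fun i : {i // i ∈ I} => ProbabilityTheory.cond (χ i) (Ioo a b)) hfinj,
      Measure.pi_map_pi fun j => (measurable_rescale a b).aemeasurable]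
    rfl
  rw [← lintegral_map hHm hwm, hmap]
  have hmemX : ∀ j, normalizedCond (χ (f j)) a b ∈ condClosure X := fun j =>
    ⟨χ (f j), hχ _, a, b, ha, hab, hb1, h0 (f j), rfl⟩
  have hmemR : ∀ j, normalizedCond (χ (f j)) a b ∈ condClosure (range χ) := fun j =>
    ⟨χ (f j), mem_range_self _, a, b, ha, hab, hb1, h0 (f j), rfl⟩
  have hnp : ∀ j, IsProbabilityMeasure (normalizedCond (χ (f j)) a b) := fun j =>
    isProbabilityMeasure_of_mem_condClosure (fun μ hμ => (hX μ hμ).1) (hmemX j)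
  refine (lintegral_abs_scaled_model_sub_le hκ₁ hκ₂ hA hm1 _ hmemX hquery hδ ?_).trans ?_
  · intro i j
    refine le_trans (abs_measureReal_sub_le_tvSet (Y := condClosure (range χ)) ?_
      (hmemR i) (hmemR j) (measurableSet_queryRange q)) htv
    intro μ hμ
    refine isProbabilityMeasure_of_mem_condClosure (X := range χ) ?_ hμ
    rintro _ ⟨i, rfl⟩
    exact hprob i
  · refine ENNReal.ofReal_le_ofReal (le_trans ?_ he)
    have hm0 : (0 : ℝ) < m := by exact_mod_cast hm1
    -- Both parts of the retraining threshold enter: `k ≤ m` here, and `k ≤ R` in the shift term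
    -- below.
    have h1 : ((m + k : ℕ) : ℝ) / m ≤ 2 := by
      rw [div_le_iff₀ hm0]; push_cast
      have : (k : ℝ) ≤ m := by exact_mod_cast hk1
      linarith
    have h2 : √(m : ℝ) ≤ √(M : ℝ) := Real.sqrt_le_sqrt (by exact_mod_cast (by omega : m ≤ M))
    have h3 : √((m + k : ℕ) : ℝ) ≤ √(M : ℝ) :=
      Real.sqrt_le_sqrt (by exact_mod_cast (by omega : m + k ≤ M))
    have h4 : (k : ℝ) * δ ≤ R * δ := by
      gcongr
    have h5 : ((m + k : ℕ) : ℝ) / m * (√(m : ℝ) * errorFactor κ₁ κ₂)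
        ≤ 2 * (√(M : ℝ) * errorFactor κ₁ κ₂) := by gcongr
    linarith

/-! ### Accuracy -/

/-- The dataset with the points `x` at the indices in `I` and `y` at the others. -/
noncomputable def glue {n : ℕ} (I : Finset (Fin n)) (x : {i // i ∈ I} → ℝ)
    (y : {i // i ∉ I} → ℝ) : Fin n → ℝ :=
  fun i => if h : i ∈ I then x ⟨i, h⟩ else y ⟨i, h⟩

theorem glue_of_mem {n : ℕ} {I : Finset (Fin n)} {x : {i // i ∈ I} → ℝ}
    {y : {i // i ∉ I} → ℝ} {i : Fin n} (h : i ∈ I) : glue I x y i = x ⟨i, h⟩ := dif_pos h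

theorem glue_of_not_mem {n : ℕ} {I : Finset (Fin n)} {x : {i // i ∈ I} → ℝ}
    {y : {i // i ∉ I} → ℝ} {i : Fin n} (h : i ∉ I) : glue I x y i = y ⟨i, h⟩ := dif_neg h

theorem mem_sortedList {n : ℕ} {I : Finset (Fin n)} {i : Fin n} : i ∈ sortedList I ↔ i ∈ I := by
  simp [sortedList]

/-- Whether the leaf around `v` contains exactly the points with index in `I` depends, apart from
the other points, only on these points being in the leaf. -/
theorem leafIndices_glue {M R : ℕ} {v : ℝ} (h0 : 0 ≤ v) (h3 : v < 3) {n : ℕ}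
    {I : Finset (Fin n)} {x₀ : {i // i ∈ I} → ℝ} {y : {i // i ∉ I} → ℝ}
    (h : leafIndices M R v (glue I x₀ y) = I) (x : {i // i ∈ I} → ℝ) :
    (leafIndices M R v (glue I x y) = I ↔ x ∈ univ.pi fun _ : {i // i ∈ I} =>
      Ioo (leafState M R v (List.ofFn (glue I x₀ y))).1
        (leafState M R v (List.ofFn (glue I x₀ y))).2.1) ∧
    (leafIndices M R v (glue I x y) = I →
      leafState M R v (List.ofFn (glue I x y)) = leafState M R v (List.ofFn (glue I x₀ y))) := by
  have hI₀ : ∀ i, i ∈ I ↔ glue I x₀ y i ∈ Ioo (leafState M R v (List.ofFn (glue I x₀ y))).1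
      (leafState M R v (List.ofFn (glue I x₀ y))).2.1 := fun i => by
    conv_lhs => rw [← h]
    exact mem_leafIndices
  have hst : leafIndices M R v (glue I x y) = I →
      leafState M R v (List.ofFn (glue I x y)) = leafState M R v (List.ofFn (glue I x₀ y)) := by
    intro hx
    refine leafState_eq_of_index h0 h3 hI₀ (fun i => ?_) fun i hi => ?_
    · conv_lhs => rw [← hx]
      exact mem_leafIndices
    · rw [glue_of_not_mem hi, glue_of_not_mem hi]
  refine ⟨⟨fun hx => ?_, fun hx => ?_⟩, hst⟩
  · rintro ⟨i, hi⟩ -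
    have h1 : i ∈ leafIndices M R v (glue I x y) := by rw [hx]; exact hi
    rw [mem_leafIndices, hst hx, glue_of_mem hi] at h1
    exact h1
  · have e : leafState M R v (List.ofFn (glue I x y))
        = leafState M R v (List.ofFn (glue I x₀ y)) := by
      refine leafState_congr h0 h3 fun i => ?_
      by_cases hi : i ∈ I
      · right
        refine ⟨(hI₀ i).1 hi, ?_⟩
        rw [glue_of_mem hi]
        exact hx ⟨i, hi⟩ (mem_univ _)
      · left; rw [glue_of_not_mem hi, glue_of_not_mem hi]
    ext i
    rw [mem_leafIndices, e]
    by_cases hi : i ∈ I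
    · simp only [hi, iff_true]
      rw [glue_of_mem hi]
      exact hx ⟨i, hi⟩ (mem_univ _)
    · have := hI₀ i
      rw [glue_of_not_mem hi] at this ⊢
      exact this.symm

/-- The space is decomposed according to the set `I` of indices of the points in the leaf. On each
piece the integral over the points in `I`, with the other points fixed, is over a box with a fixed
leaf, where `lintegral_box_leafEstimate_le` bounds the error by `e` times the mass. The masses add
up to `1`. -/
theorem lintegral_leafError_le {A : Learner} {κ₁ κ₂ : ℝ} {X : Set (Measure ℝ)}
    {T S B : ℕ → ℝ} (hκ₁ : 0 < κ₁) (hκ₂ : 0 < κ₂)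
    (hX : ∀ μ ∈ X, IsProbabilityMeasure μ ∧ μ (Icc 0 1)ᶜ = 0)
    (hA : A.Learns κ₁ κ₂ (condClosure X) T S B) {M R n : ℕ} {δ e : ℝ} (hδ : 0 ≤ δ)
    (he : √(M : ℝ) * (2 * errorFactor κ₁ κ₂ + 1) + R * δ ≤ e)
    {χ : Fin n → Measure ℝ} (hχ : ∀ i, χ i ∈ X)
    (htv : tvSet (condClosure (range χ)) ≤ δ) {v l u : ℝ} (h0 : 0 ≤ v) (h3 : v < 3)
    (hl : l ≤ v) (hu : v ≤ u) :
    ∫⁻ D, ENNReal.ofReal (leafError A M R v l u (List.ofFn D)) ∂(Measure.pi χ)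
      ≤ ENNReal.ofReal e := by
  have hprob : ∀ i, IsProbabilityMeasure (χ i) := fun i => (hX _ (hχ i)).1
  set F : (Fin n → ℝ) → ENNReal := fun D => ENNReal.ofReal (leafError A M R v l u (List.ofFn D))
  have hF : Measurable F := ENNReal.measurable_ofReal.comp (measurable_leafError hA M R v l u n)
  set E : Finset (Fin n) → Set (Fin n → ℝ) := fun I => {D | leafIndices M R v D = I}
  have hE : ∀ I, MeasurableSet (E I) := fun I => measurableSet_leafIndices_eq M R v I
  have hdecomp : ∀ G : (Fin n → ℝ) → ENNReal, ∀ D, G D = ∑ I, (E I).indicator G D := by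
    intro G D
    rw [Finset.sum_eq_single (leafIndices M R v D)]
    · rw [indicator_of_mem]; rfl
    · intro I _ hI
      rw [indicator_of_notMem]
      exact fun h => hI h.symm
    · intro h; exact absurd (Finset.mem_univ _) h
  have key : ∀ I, ∫⁻ D, (E I).indicator F D ∂(Measure.pi χ)
      ≤ ENNReal.ofReal e * ∫⁻ D, (E I).indicator (fun _ => 1) D ∂(Measure.pi χ) := by
    intro I
    have hmp : MeasurePreserving
        (MeasurableEquiv.piEquivPiSubtypeProd (fun _ : Fin n => ℝ) (fun i => i ∈ I))
        (Measure.pi χ) ((Measure.pi fun i : {i // i ∈ I} => χ i).prod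
          (Measure.pi fun i : {i // i ∉ I} => χ i)) := by
      convert measurePreserving_piEquivPiSubtypeProd χ (fun i => i ∈ I)
    set eq := MeasurableEquiv.piEquivPiSubtypeProd (fun _ : Fin n => ℝ) (fun i => i ∈ I)
    have hglue : ∀ p, eq.symm p = glue I p.1 p.2 := fun p => rfl
    have htr : ∀ G : (Fin n → ℝ) → ENNReal, Measurable G → ∫⁻ D, G D ∂(Measure.pi χ) =
        ∫⁻ y, ∫⁻ x, G (glue I x y) ∂(Measure.pi fun i : {i // i ∈ I} => χ i)
          ∂(Measure.pi fun i : {i // i ∉ I} => χ i) := by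
      intro G hG
      rw [← (hmp.symm eq).lintegral_comp hG]
      exact (lintegral_prod_symm' (fun p => G (eq.symm p)) (hG.comp eq.symm.measurable)).trans
        (by simp only [hglue])
    rw [htr _ (hF.indicator (hE I)), htr _ (measurable_const.indicator (hE I)),
      ← lintegral_const_mul' _ _ ENNReal.ofReal_ne_top]
    refine lintegral_mono fun y => ?_
    -- Given the outer points `y`, either no choice of the inner points produces the index set `I`,
    -- or a single such choice `x₀` determines the leaf for all the others.
    by_cases hex : ∃ x₀, leafIndices M R v (glue I x₀ y) = I
    swap
    · push Not at hex
      have : ∀ x, (E I).indicator F (glue I x y) = 0 := fun x =>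
        indicator_of_notMem (show glue I x y ∉ E I from hex x) _
      simp [this]
    obtain ⟨x₀, hx₀⟩ := hex
    have hloc := leafIndices_glue h0 h3 hx₀
    have hgood := goodLeaf_leafState M R h0 h3 (List.ofFn (glue I x₀ y))
    have hlen : inside (leafState M R v (List.ofFn (glue I x₀ y))).1
        (leafState M R v (List.ofFn (glue I x₀ y))).2.1 (List.ofFn (glue I x₀ y)) =
        (sortedList I).map (glue I x₀ y) :=
      inside_ofFn fun i => by
        conv_lhs => rw [← hx₀]
        exact mem_leafIndices
    have hins : ∀ x, leafIndices M R v (glue I x y) = I →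
        inside (leafState M R v (List.ofFn (glue I x y))).1
          (leafState M R v (List.ofFn (glue I x y))).2.1 (List.ofFn (glue I x y)) =
        (sortedList I).map fun i => if h : i ∈ I then x ⟨i, h⟩ else 0 := by
      intro x hx
      rw [inside_ofFn (I := I) fun i => by
        conv_lhs => rw [← hx]
        exact mem_leafIndices]
      refine List.map_congr_left fun i hi => ?_
      rw [mem_sortedList] at hi
      rw [glue_of_mem hi, dif_pos hi]
    set t := leafState M R v (List.ofFn (glue I x₀ y)) with ht
    obtain ⟨a, b, m⟩ := t
    simp only at hgood hloc hlen
    have hlenI : (inside a b (List.ofFn (glue I x₀ y))).length = (sortedList I).length := by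
      rw [hlen, List.length_map]
    have hbox : MeasurableSet (univ.pi fun _ : {i // i ∈ I} => Ioo a b) :=
      MeasurableSet.univ_pi fun _ => measurableSet_Ioo
    have h1 : ∀ x, (E I).indicator F (glue I x y) =
        (univ.pi fun _ : {i // i ∈ I} => Ioo a b).indicator (fun x =>
          ENNReal.ofReal |leafEstimate A l u (a, b, m)
            ((sortedList I).map fun i => if h : i ∈ I then x ⟨i, h⟩ else 0) -
          ((sortedList I).map fun i => if h : i ∈ I then x ⟨i, h⟩ else 0).countP
            fun x => max l a ≤ x ∧ x ≤ min u b|) x := by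
      intro x
      by_cases hx : leafIndices M R v (glue I x y) = I
      · rw [indicator_of_mem (show glue I x y ∈ E I from hx),
          indicator_of_mem ((hloc x).1.1 hx)]
        simp only [F, leafError, hins x hx]
        rw [(hloc x).2 hx]
      · rw [indicator_of_notMem (show glue I x y ∉ E I from hx),
          indicator_of_notMem fun h => hx ((hloc x).1.2 h)]
    have h2 : ∀ x, (E I).indicator (fun _ => (1 : ENNReal)) (glue I x y) =
        (univ.pi fun _ : {i // i ∈ I} => Ioo a b).indicator (fun _ => (1 : ENNReal)) x := by
      intro x
      by_cases hx : leafIndices M R v (glue I x y) = I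
      · rw [indicator_of_mem (show glue I x y ∈ E I from hx),
          indicator_of_mem ((hloc x).1.1 hx)]
      · rw [indicator_of_notMem (show glue I x y ∉ E I from hx),
          indicator_of_notMem fun h => hx ((hloc x).1.2 h)]
    simp only [h1, h2]
    rw [lintegral_indicator hbox, lintegral_indicator hbox, setLIntegral_one]
    have g1 := hgood.le
    have g2 := hgood.lt
    have g3 := hgood.card_le
    have g4 := hgood.trained_le
    have g5 := hgood.card_le_trained
    simp only [hlenI] at g1 g2 g3 g4 g5
    exact lintegral_box_leafEstimate_le hκ₁ hκ₂ hX hA hδ he hχ htv hgood.nonneg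
      (g1.trans_lt g2) hgood.le_one
      ((max_le hl g1).trans (le_min hu g2.le)) g4 g5 g3
  calc ∫⁻ D, F D ∂(Measure.pi χ) = ∑ I, ∫⁻ D, (E I).indicator F D ∂(Measure.pi χ) := by
        rw [← lintegral_finsetSum _ fun I _ => hF.indicator (hE I)]
        exact lintegral_congr fun D => hdecomp F D
    _ ≤ ∑ I, ENNReal.ofReal e * ∫⁻ D, (E I).indicator (fun _ => 1) D ∂(Measure.pi χ) :=
        Finset.sum_le_sum fun I _ => key I
    _ = ENNReal.ofReal e * ∫⁻ _D, 1 ∂(Measure.pi χ) := by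
        rw [← Finset.mul_sum, ← lintegral_finsetSum _ fun I _ => measurable_const.indicator (hE I)]
        congr 1
        exact lintegral_congr fun D => (hdecomp (fun _ => 1) D).symm
    _ = ENNReal.ofReal e := by simp

/-! ### The answer of the estimator -/

/-- Two points are in the same leaf, or the leaf of the first one precedes that of the second. -/
theorem leafState_eq_or_le (M R : ℕ) {v w : ℝ} (h : v ≤ w)
    (D : List ℝ) : leafState M R v D = leafState M R w D ∨
      (leafState M R v D).2.1 ≤ (leafState M R w D).1 := by
  induction D using List.reverseRecOn with
  | nil =>
    rw [leafState_nil, leafState_nil]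
    by_cases h1 : w < 1
    · left; rw [if_pos h1, if_pos (h.trans_lt h1)]
    · by_cases h2 : v < 1
      · right; simp [h1, h2]
      · left; rw [if_neg h1, if_neg h2]
  | append_singleton D x ih =>
    rw [leafState_concat, leafState_concat]
    rcases ih with ih | ih
    · rw [ih]
      unfold refresh
      simp only
      split_ifs
      all_goals first
        | exact Or.inl rfl
        | exact Or.inr le_rfl
        | (exfalso; linarith)
    · exact Or.inr (refresh_subset.2.trans (ih.trans refresh_subset.1))

/-- The estimate for the number of points of `D` in `[l, u]`. -/
noncomputable def rangeEstimate (A : Learner) (M R : ℕ) (D : List ℝ) (l u : ℝ) : ℝ :=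
  let s := leafState M R l D
  let t := leafState M R u D
  -- The open leaf does not contain its left end point. As the leaf begins at or before `l`, these
  -- points match only if it begins exactly at `l`; those at the left end of the second leaf belong
  -- to the exactly counted middle part.
  (if s.1 < l then 0 else (D.countP fun x => x = s.1 : ℝ)) +
    leafEstimate A l u s (inside s.1 s.2.1 D) +
    if s.1 < t.1 then (D.countP fun x => s.2.1 ≤ x ∧ x ≤ t.1) +
      leafEstimate A l u t (inside t.1 t.2.1 D) else 0

theorem countP_eq_add {D : List ℝ} {p p₁ p₂ : ℝ → Prop} [DecidablePred p] [DecidablePred p₁]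
    [DecidablePred p₂] (h : ∀ x, p x ↔ p₁ x ∨ p₂ x) (h' : ∀ x, p₁ x → ¬ p₂ x) :
    D.countP (fun x => p x) = D.countP (fun x => p₁ x) + D.countP fun x => p₂ x := by
  induction D with
  | nil => rfl
  | cons x D ih =>
    simp only [List.countP_cons, ih]
    have a := h x
    have b := h' x
    by_cases h1 : p₁ x <;> by_cases h2 : p₂ x <;> simp_all <;> omega

theorem countP_inside {a b : ℝ} {D : List ℝ} {p : ℝ → Prop} [DecidablePred p] :
    (inside a b D).countP (fun x => p x) = D.countP fun x => p x ∧ a < x ∧ x < b := by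
  simp only [inside, List.countP_filter, Bool.decide_and]

/-- The points in the range consist of those at the left end of the first leaf, the inner points of
the two outer leaves, and the points in between. Only the inner points are estimated. If both ends
are in the same leaf, a single error occurs and the other one is just nonnegative. -/
theorem abs_rangeEstimate_sub_le (A : Learner) (M R : ℕ) (D : List ℝ) {l u : ℝ} (h0 : 0 ≤ l)
    (hlu : l ≤ u) (h3 : u < 3) :
    |rangeEstimate A M R D l u - D.countP fun x => l ≤ x ∧ x ≤ u| ≤
      leafError A M R l l u D + leafError A M R u l u D := by
  have hs := goodLeaf_leafState M R h0 (hlu.trans_lt h3) D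
  have ht := goodLeaf_leafState M R (h0.trans hlu) h3 D
  have hor := leafState_eq_or_le M R hlu D
  unfold rangeEstimate leafError
  set s := leafState M R l D
  set t := leafState M R u D
  obtain ⟨a, b, m⟩ := s
  obtain ⟨a', b', m'⟩ := t
  have hs1 := hs.le
  have hs2 := hs.lt
  have ht1 := ht.le
  have ht2 := ht.lt
  simp only at hs1 hs2 ht1 ht2 hor ⊢
  have hatom : (if a < l then (0 : ℝ) else (D.countP fun x => x = a : ℝ)) =
      ((D.countP fun x => ¬ a < l ∧ x = a : ℕ) : ℝ) := by
    split_ifs with h <;> simp [h]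
  rw [hatom]
  by_cases hlt : a < a'
  · have hba : b ≤ a' := by
      rcases hor with h | h
      · simp only [Prod.mk.injEq] at h; exact absurd h.1 hlt.ne
      · exact h
    have hc : D.countP (fun x => l ≤ x ∧ x ≤ u) = D.countP (fun x => ¬ a < l ∧ x = a) +
        (inside a b D).countP (fun x => max l a ≤ x ∧ x ≤ min u b) +
        D.countP (fun x => b ≤ x ∧ x ≤ a') +
        (inside a' b' D).countP (fun x => max l a' ≤ x ∧ x ≤ min u b') := by
      rw [countP_inside, countP_inside,
        countP_eq_add (p := fun x => l ≤ x ∧ x ≤ u) (p₁ := fun x => l ≤ x ∧ x < b)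
          (p₂ := fun x => b ≤ x ∧ x ≤ u),
        countP_eq_add (p := fun x => l ≤ x ∧ x < b) (p₁ := fun x => ¬ a < l ∧ x = a)
          (p₂ := fun x => (max l a ≤ x ∧ x ≤ min u b) ∧ a < x ∧ x < b),
        countP_eq_add (p := fun x => b ≤ x ∧ x ≤ u) (p₁ := fun x => b ≤ x ∧ x ≤ a')
          (p₂ := fun x => (max l a' ≤ x ∧ x ≤ min u b') ∧ a' < x ∧ x < b')]
      · ring
      all_goals intro x; try simp only [max_le_iff, le_min_iff, not_lt]
      · constructor
        · rintro ⟨h1, h2⟩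
          by_cases h : x ≤ a'
          · exact Or.inl ⟨h1, h⟩
          · rw [not_le] at h
            exact Or.inr ⟨⟨⟨by linarith, by linarith⟩, h2, by linarith⟩, h, by linarith⟩
        · rintro (⟨h1, h2⟩ | ⟨⟨⟨h1, h2⟩, h3, h4⟩, h5, h6⟩) <;> constructor <;> linarith
      · rintro ⟨h1, h2⟩ ⟨-, h3, h4⟩; linarith
      · constructor
        · rintro ⟨h1, h2⟩
          by_cases h : a < x
          · exact Or.inr ⟨⟨⟨h1, h.le⟩, by linarith, h2.le⟩, h, h2⟩
          · rw [not_lt] at h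
            exact Or.inl ⟨by linarith, by linarith⟩
        · rintro (⟨h1, h2⟩ | ⟨⟨⟨h1, h2⟩, h3, h4⟩, h5, h6⟩) <;> constructor <;> linarith
      · rintro ⟨h1, h2⟩ ⟨-, h3, h4⟩; linarith
      · constructor
        · rintro ⟨h1, h2⟩
          rcases lt_or_ge x b with h | h
          · exact Or.inl ⟨h1, h⟩
          · exact Or.inr ⟨h, h2⟩
        · rintro (⟨h1, h2⟩ | ⟨h1, h2⟩) <;> constructor <;> linarith
      · rintro ⟨h1, h2⟩ ⟨h3, h4⟩; linarith
    rw [hc, if_pos hlt]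
    push_cast
    refine le_of_eq_of_le ?_ (abs_add_le _ _)
    congr 1
    ring
  · have he : (a, b, m) = (a', b', m') := by
      rcases hor with h | h
      · exact h
      · exact absurd (hs1.trans_lt (hs2.trans_le h)) hlt
    simp only [Prod.mk.injEq] at he
    obtain ⟨rfl, rfl, rfl⟩ := he
    have hc : D.countP (fun x => l ≤ x ∧ x ≤ u) = D.countP (fun x => ¬ a < l ∧ x = a) +
        (inside a b D).countP (fun x => max l a ≤ x ∧ x ≤ min u b) := by
      rw [countP_inside, countP_eq_add (p := fun x => l ≤ x ∧ x ≤ u)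
        (p₁ := fun x => ¬ a < l ∧ x = a)
        (p₂ := fun x => (max l a ≤ x ∧ x ≤ min u b) ∧ a < x ∧ x < b)]
      all_goals intro x; try simp only [max_le_iff, le_min_iff, not_lt]
      · constructor
        · rintro ⟨h1, h2⟩
          by_cases h : a < x
          · exact Or.inr ⟨⟨⟨h1, h.le⟩, h2, by linarith⟩, h, by linarith⟩
          · rw [not_lt] at h
            exact Or.inl ⟨by linarith, by linarith⟩
        · rintro (⟨h1, h2⟩ | ⟨⟨⟨h1, h2⟩, h3, h4⟩, h5, h6⟩) <;> constructor <;> linarith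
      · rintro ⟨h1, h2⟩ ⟨-, h3, h4⟩; linarith
    rw [hc, if_neg hlt, add_zero]
    push_cast
    rw [add_sub_add_left_eq_sub]
    exact le_add_of_nonneg_right (abs_nonneg _)

theorem cardinality_ofFn {n : ℕ} (D : Fin n → ℝ) (q : ℝ × ℝ) :
    cardinality D q = (List.ofFn D).countP fun x => q.1 ≤ x ∧ x ≤ q.1 + q.2 := by
  rw [countP_ofFn_eq_sum, cardinality]
  push_cast
  refine Finset.sum_congr rfl fun j _ => ?_
  by_cases h : q.1 ≤ D j ∧ D j ≤ q.1 + q.2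
  · rw [indicator_of_mem (show D j ∈ queryRange q from h), if_pos h]
  · rw [indicator_of_notMem (show D j ∉ queryRange q from h), if_neg h]

theorem measurable_rangeEstimate {A : Learner} {κ₁ κ₂ : ℝ} {Y : Set (Measure ℝ)}
    {T S B : ℕ → ℝ} (hA : A.Learns κ₁ κ₂ Y T S B) (M R : ℕ) (l u : ℝ) (n : ℕ) :
    Measurable fun D : Fin n → ℝ => rangeEstimate A M R (List.ofFn D) l u := by
  have hs := measurable_leafState M R l n
  have ht := measurable_leafState M R u n
  have hcast : Measurable fun k : ℕ => (k : ℝ) := measurable_from_nat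
  unfold rangeEstimate
  refine ((Measurable.ite (measurableSet_lt hs.fst measurable_const) measurable_const ?_).add
    (measurable_leafEstimate hA M R l l u n)).add
    (Measurable.ite (measurableSet_lt hs.fst ht.fst) (Measurable.add ?_
      (measurable_leafEstimate hA M R u l u n)) measurable_const)
  · exact hcast.comp (measurable_countP_ofFn (D := fun D : Fin n → ℝ => D)
      (p := fun D x => x = (leafState M R l (List.ofFn D)).1)
      fun i => measurableSet_eq_fun (measurable_pi_apply i) hs.fst)
  · exact hcast.comp (measurable_countP_ofFn (D := fun D : Fin n → ℝ => D)
      (p := fun D x => (leafState M R l (List.ofFn D)).2.1 ≤ x ∧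
        x ≤ (leafState M R u (List.ofFn D)).1)
      fun i => (measurableSet_le hs.snd.fst (measurable_pi_apply i)).inter
        (measurableSet_le (measurable_pi_apply i) ht.fst))

/-- The accuracy of the estimate. -/
theorem rangeEstimate_accuracy {A : Learner} {κ₁ κ₂ : ℝ} {X : Set (Measure ℝ)}
    {T S B : ℕ → ℝ} (hκ₁ : 0 < κ₁) (hκ₂ : 0 < κ₂)
    (hX : ∀ μ ∈ X, IsProbabilityMeasure μ ∧ μ (Icc 0 1)ᶜ = 0)
    (hA : A.Learns κ₁ κ₂ (condClosure X) T S B) {M R n : ℕ} {δ ε : ℝ} (hδ : 0 ≤ δ) (hε : 0 < ε)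
    (he : √(M : ℝ) * (2 * errorFactor κ₁ κ₂ + 1) + R * δ ≤ ε / 2)
    {χ : Fin n → Measure ℝ} (hχ : ∀ i, χ i ∈ X)
    (htv : tvSet (condClosure (range χ)) ≤ δ) {q : ℝ × ℝ} (hq : IsQuery q) :
    Integrable (fun D : Fin n → ℝ =>
      |rangeEstimate A M R (List.ofFn D) q.1 (q.1 + q.2) - cardinality D q|) (Measure.pi χ) ∧
    ∫ D : Fin n → ℝ, |rangeEstimate A M R (List.ofFn D) q.1 (q.1 + q.2) - cardinality D q|
      ∂(Measure.pi χ) ≤ ε := by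
  have hprob : ∀ i, IsProbabilityMeasure (χ i) := fun i => (hX _ (hχ i)).1
  obtain ⟨⟨a1, a2⟩, a3, a4⟩ := hq
  set F : (Fin n → ℝ) → ℝ := fun D =>
    |rangeEstimate A M R (List.ofFn D) q.1 (q.1 + q.2) - cardinality D q|
  have hFm : Measurable F :=
    ((measurable_rangeEstimate hA M R _ _ n).sub (measurable_cardinality q)).abs
  have hnn : ∀ v D, 0 ≤ leafError A M R v q.1 (q.1 + q.2) D := fun v D => abs_nonneg _
  have hm1 : Measurable fun D : Fin n → ℝ =>
      ENNReal.ofReal (leafError A M R q.1 q.1 (q.1 + q.2) (List.ofFn D)) :=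
    ENNReal.measurable_ofReal.comp (measurable_leafError hA M R _ _ _ n)
  have hF : ∫⁻ D, ENNReal.ofReal (F D) ∂(Measure.pi χ) ≤ ENNReal.ofReal ε := by
    calc ∫⁻ D, ENNReal.ofReal (F D) ∂(Measure.pi χ)
        ≤ ∫⁻ D, (ENNReal.ofReal (leafError A M R q.1 q.1 (q.1 + q.2) (List.ofFn D)) +
          ENNReal.ofReal (leafError A M R (q.1 + q.2) q.1 (q.1 + q.2) (List.ofFn D)))
            ∂(Measure.pi χ) := by
          refine lintegral_mono fun D => ?_
          rw [← ENNReal.ofReal_add (hnn _ _) (hnn _ _)]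
          refine ENNReal.ofReal_le_ofReal ?_
          simp only [F, cardinality_ofFn]
          exact abs_rangeEstimate_sub_le A M R _ a1 (by linarith) (by linarith)
      _ ≤ ENNReal.ofReal (ε / 2) + ENNReal.ofReal (ε / 2) := by
          rw [lintegral_add_left hm1]
          exact add_le_add
            (lintegral_leafError_le hκ₁ hκ₂ hX hA hδ he hχ htv a1 (by linarith) le_rfl
              (by linarith))
            (lintegral_leafError_le hκ₁ hκ₂ hX hA hδ he hχ htv (by linarith) (by linarith)
              (by linarith) le_rfl)
      _ = ENNReal.ofReal ε := by
          rw [← ENNReal.ofReal_add (by positivity) (by positivity), add_halves]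
  have hint : Integrable F (Measure.pi χ) := by
    refine ⟨hFm.aestronglyMeasurable, ?_⟩
    rw [hasFiniteIntegral_iff_ofReal (Filter.Eventually.of_forall fun D => abs_nonneg _)]
    exact hF.trans_lt ENNReal.ofReal_lt_top
  refine ⟨hint, ?_⟩
  rw [← ofReal_integral_eq_lintegral_ofReal hint
    (Filter.Eventually.of_forall fun D => abs_nonneg _)] at hF
  exact (ENNReal.ofReal_le_ofReal_iff hε.le).1 hF

/-! ### Search trees with linked levels -/

/-- A search tree whose nodes are the numbers from `1` to `next - 1`. The node `i` at height
`ht i` represents an interval with left end point `lo i`; `right i` is the next node at the same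
height (`0` if there is none), `down i` the first one of its `nk i` children. -/
structure Shape where
  next : ℕ
  root : ℕ
  height : ℕ
  right : ℕ → ℕ
  down : ℕ → ℕ
  nk : ℕ → ℕ
  ht : ℕ → ℕ
  lo : ℕ → ℝ

namespace Shape

/-- `i` is a node. -/
def Node (S : Shape) (i : ℕ) : Prop := 0 < i ∧ i < S.next

/-- The right end point of the interval of a node. -/
noncomputable def hi (S : Shape) (i : ℕ) : ℝ := if S.right i = 0 then 3 else S.lo (S.right i)

/-- The children of a node. -/
noncomputable def kids (S : Shape) (i : ℕ) : Finset ℕ :=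
  (Finset.range S.next).filter fun j => 0 < j ∧ S.ht j + 1 = S.ht i ∧ S.lo i ≤ S.lo j ∧
    S.lo j < S.hi i

/-- The nodes at height `h`. -/
def level (S : Shape) (h : ℕ) : Finset ℕ :=
  (Finset.range S.next).filter fun j => 0 < j ∧ S.ht j = h

/-- The invariant of the search tree. -/
structure Valid (S : Shape) : Prop where
  root_node : S.Node S.root
  ht_root : S.ht S.root = S.height
  height_pos : 1 ≤ S.height
  ht_le : ∀ i, S.Node i → S.ht i ≤ S.height
  eq_root : ∀ i, S.Node i → S.ht i = S.height → i = S.root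
  lo_root : S.lo S.root = 0
  lo_nonneg : ∀ i, S.Node i → 0 ≤ S.lo i
  lo_le : ∀ i, S.Node i → S.lo i ≤ 1
  inj : ∀ i j, S.Node i → S.Node j → S.ht i = S.ht j → S.lo i = S.lo j → i = j
  right_node : ∀ i, S.Node i → S.right i ≠ 0 → S.Node (S.right i)
  ht_right : ∀ i, S.Node i → S.right i ≠ 0 → S.ht (S.right i) = S.ht i
  lo_lt_hi : ∀ i, S.Node i → S.lo i < S.hi i
  sep : ∀ i j, S.Node i → S.Node j → S.ht i = S.ht j → S.lo i < S.lo j → S.hi i ≤ S.lo j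
  down_node : ∀ i, S.Node i → 0 < S.ht i → S.Node (S.down i)
  ht_down : ∀ i, S.Node i → 0 < S.ht i → S.ht (S.down i) + 1 = S.ht i
  lo_down : ∀ i, S.Node i → 0 < S.ht i → S.lo (S.down i) = S.lo i
  nk_eq : ∀ i, S.Node i → 0 < S.ht i → S.nk i = (S.kids i).card
  nk_le : ∀ i, S.Node i → 0 < S.ht i → S.nk i ≤ 4
  -- The root is exempt because a new root starts with a single child.
  nk_ge : ∀ i, S.Node i → 0 < S.ht i → i ≠ S.root → 2 ≤ S.nk i

variable {S : Shape}

theorem mem_kids {i j : ℕ} : j ∈ S.kids i ↔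
    S.Node j ∧ S.ht j + 1 = S.ht i ∧ S.lo i ≤ S.lo j ∧ S.lo j < S.hi i := by
  simp only [kids, Finset.mem_filter, Finset.mem_range, Node]; tauto

theorem mem_level {h j : ℕ} : j ∈ S.level h ↔ S.Node j ∧ S.ht j = h := by
  simp only [level, Finset.mem_filter, Finset.mem_range, Node]; tauto

theorem hi_of_right_eq_zero {i : ℕ} (h : S.right i = 0) : S.hi i = 3 := by simp [hi, h]

theorem hi_of_right_ne_zero {i : ℕ} (h : S.right i ≠ 0) : S.hi i = S.lo (S.right i) := by
  simp [hi, h]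

namespace Valid

theorem hi_le (hS : S.Valid) {i : ℕ} (hi : S.Node i) : S.hi i ≤ 3 := by
  by_cases h : S.right i = 0
  · rw [hi_of_right_eq_zero h]
  · rw [hi_of_right_ne_zero h]; have := hS.lo_le _ (hS.right_node i hi h); linarith

theorem hi_root (hS : S.Valid) : S.hi S.root = 3 := by
  by_cases h : S.right S.root = 0
  · exact hi_of_right_eq_zero h
  · exfalso
    have h1 := hS.eq_root _ (hS.right_node _ hS.root_node h)
      ((hS.ht_right _ hS.root_node h).trans hS.ht_root)
    have h2 := hS.lo_lt_hi _ hS.root_node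
    rw [hi_of_right_ne_zero h, h1] at h2
    exact lt_irrefl _ h2

/-- The interval of `x` ends where that of its right neighbour begins, which is also where the first
child of that neighbour begins. Separation on the level of the children gives the claim. -/
theorem hi_le_hi (hS : S.Valid) {c x : ℕ} (hc : S.Node c) (hx : S.Node x)
    (ht : S.ht c + 1 = S.ht x) (h : S.lo c < S.hi x) : S.hi c ≤ S.hi x := by
  by_cases h0 : S.right x = 0
  · rw [hi_of_right_eq_zero h0]; exact hS.hi_le hc
  · have hy := hS.right_node x hx h0
    have hty := hS.ht_right x hx h0
    rw [hi_of_right_ne_zero h0] at h ⊢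
    have hpos : 0 < S.ht (S.right x) := by omega
    rw [← hS.lo_down _ hy hpos] at h ⊢
    refine hS.sep c _ hc (hS.down_node _ hy hpos) ?_ h
    have := hS.ht_down _ hy hpos
    omega

theorem eq_of_mem (hS : S.Valid) {i j : ℕ} (hi : S.Node i) (hj : S.Node j)
    (ht : S.ht i = S.ht j) {v : ℝ} (h1 : S.lo i ≤ v) (h2 : v < S.hi i) (h3 : S.lo j ≤ v)
    (h4 : v < S.hi j) : i = j := by
  rcases lt_trichotomy (S.lo i) (S.lo j) with h | h | h
  · have := hS.sep i j hi hj ht h; linarith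
  · exact hS.inj i j hi hj ht h
  · have := hS.sep j i hj hi ht.symm h; linarith

theorem down_mem_kids (hS : S.Valid) {i : ℕ} (hi : S.Node i) (h : 0 < S.ht i) :
    S.down i ∈ S.kids i := by
  rw [mem_kids]
  exact ⟨hS.down_node i hi h, hS.ht_down i hi h, (hS.lo_down i hi h).ge,
    by rw [hS.lo_down i hi h]; exact hS.lo_lt_hi i hi⟩

/-! #### Searching -/

/-- One step to the right, if this does not pass `v`. -/
noncomputable def _root_.LearnedCE.Shape.stepRight (S : Shape) (v : ℝ) (i : ℕ) : ℕ :=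
  if S.right i ≠ 0 ∧ S.lo (S.right i) ≤ v then S.right i else i

/-- The child of `x` that contains `v`. -/
noncomputable def _root_.LearnedCE.Shape.child (S : Shape) (v : ℝ) (x : ℕ) : ℕ :=
  S.stepRight v (S.stepRight v (S.stepRight v (S.down x)))

/-- The nodes among the children of `x` that a search for `v` passes after `i`. -/
noncomputable def _root_.LearnedCE.Shape.ahead (S : Shape) (v : ℝ) (x i : ℕ) : Finset ℕ :=
  (S.kids x).filter fun j => S.lo i < S.lo j ∧ S.lo j ≤ v

/-- A step that moves leaves at least one sibling fewer between the current node and `v`; a step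
that stays has arrived. Here `k` is the number of steps done so far. -/
theorem stepRight_spec (hS : S.Valid) {v : ℝ} {x i k : ℕ} (hvx : v < S.hi x)
    (hv3 : v < 3) (hi : i ∈ S.kids x) (hv : S.lo i ≤ v)
    (h : v < S.hi i ∨ (S.ahead v x i).card + k ≤ 3) :
    S.stepRight v i ∈ S.kids x ∧ S.lo (S.stepRight v i) ≤ v ∧
      (v < S.hi (S.stepRight v i) ∨ (S.ahead v x (S.stepRight v i)).card + (k + 1) ≤ 3) := by
  unfold stepRight
  obtain ⟨hn, hht, hlo, hhi⟩ := mem_kids.1 hi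
  split_ifs with hr
  · obtain ⟨h0, hrv⟩ := hr
    have hlt := hS.lo_lt_hi i hn
    rw [hi_of_right_ne_zero h0] at hlt
    have hmem : S.right i ∈ S.kids x := mem_kids.2 ⟨hS.right_node i hn h0,
      by rw [hS.ht_right i hn h0, hht], hlo.trans hlt.le, hrv.trans_lt hvx⟩
    refine ⟨hmem, hrv, Or.inr ?_⟩
    have h' : (S.ahead v x i).card + k ≤ 3 := by
      rcases h with h | h
      · rw [hi_of_right_ne_zero h0] at h; linarith
      · exact h
    have : (S.ahead v x (S.right i)).card < (S.ahead v x i).card := by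
      refine Finset.card_lt_card ⟨?_, fun hsub => ?_⟩
      · intro j hj
        simp only [ahead, Finset.mem_filter] at hj ⊢
        exact ⟨hj.1, hlt.trans hj.2.1, hj.2.2⟩
      · have : S.right i ∈ S.ahead v x (S.right i) := hsub (by
          simp only [ahead, Finset.mem_filter]; exact ⟨hmem, hlt, hrv⟩)
        simp only [ahead, Finset.mem_filter] at this
        exact lt_irrefl _ this.2.1
    omega
  · refine ⟨hi, hv, Or.inl ?_⟩
    by_cases h0 : S.right i = 0
    · rw [hi_of_right_eq_zero h0]
      exact hv3
    · rw [hi_of_right_ne_zero h0]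
      push Not at hr
      exact hr h0

/-- At most four children leave at most three of them ahead of the first one, so three steps
suffice. If `v` were still to the right, the next sibling would be ahead. -/
theorem child_spec (hS : S.Valid) {v : ℝ} {x : ℕ} (hx : S.Node x) (h : 0 < S.ht x)
    (hv : S.lo x ≤ v) (hvx : v < S.hi x) (hv3 : v < 3) :
    S.child v x ∈ S.kids x ∧ S.lo (S.child v x) ≤ v ∧ v < S.hi (S.child v x) := by
  have h0 : (S.ahead v x (S.down x)).card + 0 ≤ 3 := by
    have hd := hS.down_mem_kids hx h
    have : S.ahead v x (S.down x) ⊆ (S.kids x).erase (S.down x) := by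
      intro j hj
      simp only [ahead, Finset.mem_filter] at hj
      refine Finset.mem_erase.2 ⟨?_, hj.1⟩
      rintro rfl
      exact lt_irrefl _ hj.2.1
    have := Finset.card_le_card this
    rw [Finset.card_erase_of_mem hd, ← hS.nk_eq x hx h] at this
    have := hS.nk_le x hx h
    omega
  obtain ⟨a1, a2, a3⟩ := hS.stepRight_spec hvx hv3 (hS.down_mem_kids hx h)
    (by rw [hS.lo_down x hx h]; exact hv) (Or.inr h0)
  obtain ⟨b1, b2, b3⟩ := hS.stepRight_spec hvx hv3 a1 a2 a3
  obtain ⟨c1, c2, c3⟩ := hS.stepRight_spec hvx hv3 b1 b2 b3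
  refine ⟨c1, c2, ?_⟩
  rcases c3 with c3 | c3
  · exact c3
  · have hc : S.ahead v x (S.child v x) = ∅ := Finset.card_eq_zero.1 (by
      change (S.ahead v x (S.child v x)).card + 3 ≤ 3 at c3; omega)
    obtain ⟨hn, hht, hlo, hhi⟩ := mem_kids.1 c1
    change S.Node (S.child v x) at hn
    by_cases h0 : S.right (S.child v x) = 0
    · change v < S.hi (S.child v x)
      rw [hi_of_right_eq_zero h0]; exact hv3
    · by_contra hcon
      change ¬ v < S.hi (S.child v x) at hcon
      have hlt := hS.lo_lt_hi _ hn
      rw [hi_of_right_ne_zero h0] at hcon hlt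
      have : S.right (S.child v x) ∈ S.ahead v x (S.child v x) := by
        simp only [ahead, Finset.mem_filter]
        exact ⟨mem_kids.2 ⟨hS.right_node _ hn h0, by rw [hS.ht_right _ hn h0]; exact hht,
          hlo.trans hlt.le, (not_lt.1 hcon).trans_lt hvx⟩, hlt, not_lt.1 hcon⟩
      rw [hc] at this
      simp at this

/-! #### Insertion of a node -/

/-- The tree after a node with left end point `s` has been inserted to the right of `c`. -/
noncomputable def _root_.LearnedCE.Shape.insert (S : Shape) (c : ℕ) (s : ℝ) (down nk : ℕ → ℕ) :
    Shape :=
  { S with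
    next := S.next + 1
    right := Function.update (Function.update S.right S.next (S.right c)) c S.next
    down := down
    nk := nk
    ht := Function.update S.ht S.next (S.ht c)
    lo := Function.update S.lo S.next s }

section insert
variable {c : ℕ} {s : ℝ} {down nk : ℕ → ℕ}

theorem node_insert {i : ℕ} (h0 : 0 < S.next) :
    (S.insert c s down nk).Node i ↔ S.Node i ∨ i = S.next := by
  simp only [Node, Shape.insert]; omega

theorem insert_lo {i : ℕ} (h : S.Node i) : (S.insert c s down nk).lo i = S.lo i :=
  Function.update_of_ne h.2.ne _ _

theorem insert_lo_next : (S.insert c s down nk).lo S.next = s := Function.update_self ..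

theorem insert_ht {i : ℕ} (h : S.Node i) : (S.insert c s down nk).ht i = S.ht i :=
  Function.update_of_ne h.2.ne _ _

theorem insert_ht_next : (S.insert c s down nk).ht S.next = S.ht c := Function.update_self ..

theorem insert_right {i : ℕ} (h : S.Node i) (hc : i ≠ c) :
    (S.insert c s down nk).right i = S.right i := by
  simp only [Shape.insert]
  rw [Function.update_of_ne hc, Function.update_of_ne h.2.ne]

theorem insert_right_self : (S.insert c s down nk).right c = S.next := Function.update_self ..

theorem insert_right_next (hc : S.Node c) :
    (S.insert c s down nk).right S.next = S.right c := by
  simp only [Shape.insert]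
  rw [Function.update_of_ne hc.2.ne', Function.update_self]

theorem insert_hi (hS : S.Valid) {i : ℕ} (h : S.Node i) (hc : i ≠ c) :
    (S.insert c s down nk).hi i = S.hi i := by
  unfold Shape.hi
  rw [insert_right h hc]
  split_ifs with h0
  · rfl
  · exact insert_lo (hS.right_node i h h0)

theorem insert_hi_self (hc : S.Node c) : (S.insert c s down nk).hi c = s := by
  rw [hi_of_right_ne_zero (by rw [insert_right_self]; have := hc.1; have := hc.2; omega),
    insert_right_self, insert_lo_next]

theorem insert_hi_next (hS : S.Valid) (hc : S.Node c) :
    (S.insert c s down nk).hi S.next = S.hi c := by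
  unfold Shape.hi
  rw [insert_right_next hc]
  split_ifs with h0
  · rfl
  · exact insert_lo (hS.right_node c hc h0)

theorem insert_kids_of_ne (hS : S.Valid) (hc : S.Node c) {x : ℕ} (hx : S.Node x)
    (hxt : S.ht c + 1 = S.ht x) (hxc : S.lo x ≤ S.lo c) (hcx : S.lo c < S.hi x)
    (hs : S.lo c < s) (hs' : s < S.hi c) {i : ℕ} (hi : S.Node i) (hic : i ≠ c) (hix : i ≠ x) :
    (S.insert c s down nk).kids i = S.kids i := by
  have h0 : 0 < S.next := hc.1.trans hc.2
  ext j
  rw [mem_kids, mem_kids, node_insert h0, insert_ht hi, insert_lo hi, insert_hi hS hi hic]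
  constructor
  · rintro ⟨hj | rfl, h1, h2, h3⟩
    · rw [insert_ht hj, insert_lo hj] at *; exact ⟨hj, h1, h2, h3⟩
    · exfalso
      rw [insert_ht_next] at h1
      rw [insert_lo_next] at h2 h3
      exact hix (hS.eq_of_mem hi hx (h1.symm.trans hxt) h2 h3 (hxc.trans hs.le)
        (hs'.trans_le (hS.hi_le_hi hc hx hxt hcx)))
  · rintro ⟨hj, h1, h2, h3⟩
    rw [insert_ht hj, insert_lo hj]; exact ⟨Or.inl hj, h1, h2, h3⟩

theorem insert_kids_parent (hS : S.Valid) (hc : S.Node c) {x : ℕ} (hx : S.Node x)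
    (hxt : S.ht c + 1 = S.ht x) (hxc : S.lo x ≤ S.lo c) (hcx : S.lo c < S.hi x)
    (hs : S.lo c < s) (hs' : s < S.hi c) :
    (S.insert c s down nk).kids x = Insert.insert S.next (S.kids x) := by
  have h0 : 0 < S.next := hc.1.trans hc.2
  have hne : x ≠ c := by rintro rfl; omega
  ext j
  rw [Finset.mem_insert, mem_kids, mem_kids, node_insert h0, insert_ht hx, insert_lo hx,
    insert_hi hS hx hne]
  constructor
  · rintro ⟨hj | rfl, h1, h2, h3⟩
    · rw [insert_ht hj, insert_lo hj] at *; exact Or.inr ⟨hj, h1, h2, h3⟩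
    · exact Or.inl rfl
  · rintro (rfl | ⟨hj, h1, h2, h3⟩)
    · rw [insert_ht_next, insert_lo_next]
      exact ⟨Or.inr rfl, hxt, hxc.trans hs.le, hs'.trans_le (hS.hi_le_hi hc hx hxt hcx)⟩
    · rw [insert_ht hj, insert_lo hj]; exact ⟨Or.inl hj, h1, h2, h3⟩

theorem insert_kids_self (hc : S.Node c) (hs' : s < S.hi c) :
    (S.insert c s down nk).kids c = (S.kids c).filter fun j => S.lo j < s := by
  have h0 : 0 < S.next := hc.1.trans hc.2
  ext j
  rw [Finset.mem_filter, mem_kids, mem_kids, node_insert h0, insert_ht hc, insert_lo hc,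
    insert_hi_self hc]
  constructor
  · rintro ⟨hj | rfl, h1, h2, h3⟩
    · rw [insert_ht hj, insert_lo hj] at *
      exact ⟨⟨hj, h1, h2, h3.trans hs'⟩, h3⟩
    · rw [insert_ht_next] at h1; omega
  · rintro ⟨⟨hj, h1, h2, h3⟩, h4⟩
    rw [insert_ht hj, insert_lo hj]; exact ⟨Or.inl hj, h1, h2, h4⟩

theorem insert_kids_next (hS : S.Valid) (hc : S.Node c) (hs : S.lo c < s) :
    (S.insert c s down nk).kids S.next = (S.kids c).filter fun j => s ≤ S.lo j := by
  have h0 : 0 < S.next := hc.1.trans hc.2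
  ext j
  rw [Finset.mem_filter, mem_kids, mem_kids, node_insert h0, insert_ht_next, insert_lo_next,
    insert_hi_next hS hc]
  constructor
  · rintro ⟨hj | rfl, h1, h2, h3⟩
    · rw [insert_ht hj, insert_lo hj] at *
      exact ⟨⟨hj, h1, hs.le.trans h2, h3⟩, h2⟩
    · rw [insert_ht_next] at h1; omega
  · rintro ⟨⟨hj, h1, h2, h3⟩, h4⟩
    rw [insert_ht hj, insert_lo hj]; exact ⟨Or.inl hj, h1, h4, h3⟩

/-- The new node cuts the interval of `c` at `s`. Children are defined through intervals and
heights, so only three nodes have new sets of children: the parent `x` gains one, and those of `c`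
are divided between `c` and the new node. For a leaf `c` the hypotheses about children are void, so
splits of leaves and of inner nodes are both covered. -/
theorem insert (hS : S.Valid) (hc : S.Node c) {x : ℕ} (hx : S.Node x)
    (hxt : S.ht c + 1 = S.ht x) (hxc : S.lo x ≤ S.lo c) (hcx : S.lo c < S.hi x)
    (hxn : S.nk x ≤ 3) (hs : S.lo c < s) (hs' : s < S.hi c) (hs1 : s ≤ 1)
    (hdown : ∀ i, i ≠ S.next → down i = S.down i)
    (hdown' : 0 < S.ht c → S.Node (down S.next) ∧ S.ht (down S.next) + 1 = S.ht c ∧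
      S.lo (down S.next) = s)
    (hnk : ∀ i, i ≠ S.next → i ≠ c → i ≠ x → nk i = S.nk i) (hnkx : nk x = S.nk x + 1)
    (hnkc : 0 < S.ht c → nk c = 2 ∧ nk S.next = 2 ∧
      ((S.kids c).filter fun j => S.lo j < s).card = 2 ∧
      ((S.kids c).filter fun j => s ≤ S.lo j).card = 2) :
    (S.insert c s down nk).Valid := by
  have h0 : 0 < S.next := hc.1.trans hc.2
  have hxc' : x ≠ c := by rintro rfl; omega
  have hnode : ∀ {i}, (S.insert c s down nk).Node i ↔ S.Node i ∨ i = S.next := node_insert h0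
  have hcroot : c ≠ S.root := by
    rintro rfl
    have := hS.ht_le x hx
    rw [hS.ht_root] at hxt
    omega
  have hnext : ¬ S.Node S.next := fun h => lt_irrefl _ h.2
  have hdn : ∀ i, S.Node i → (S.insert c s down nk).down i = S.down i :=
    fun i hi => hdown i hi.2.ne
  refine ⟨hnode.2 (Or.inl hS.root_node), ?_, hS.height_pos, ?_, ?_, ?_, ?_, ?_, ?_, ?_, ?_, ?_, ?_,
    ?_, ?_, ?_, ?_, ?_, ?_⟩
  · exact (insert_ht hS.root_node).trans hS.ht_root
  · intro i hi
    replace hi := hnode.1 hi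
    rcases hi with hi | rfl
    · rw [insert_ht hi]; exact hS.ht_le i hi
    · rw [insert_ht_next]; exact hS.ht_le c hc
  · intro i hi h
    replace hi := hnode.1 hi
    rcases hi with hi | rfl
    · rw [insert_ht hi] at h; exact hS.eq_root i hi h
    · rw [insert_ht_next] at h; exact absurd (hS.eq_root c hc h) hcroot
  · exact (insert_lo hS.root_node).trans hS.lo_root
  · intro i hi
    replace hi := hnode.1 hi
    rcases hi with hi | rfl
    · rw [insert_lo hi]; exact hS.lo_nonneg i hi
    · rw [insert_lo_next]; exact (hS.lo_nonneg c hc).trans hs.le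
  · intro i hi
    replace hi := hnode.1 hi
    rcases hi with hi | rfl
    · rw [insert_lo hi]; exact hS.lo_le i hi
    · rw [insert_lo_next]; exact hs1
  · have key : ∀ i, S.Node i → S.ht i = S.ht c → S.lo i ≠ s := by
      intro i hi hh hl
      have h1 : S.lo c < S.lo i := by rw [hl]; exact hs
      have := hS.sep c i hc hi hh.symm h1
      rw [hl] at this; linarith
    intro i j hi hj ht hl
    replace hi := hnode.1 hi
    replace hj := hnode.1 hj
    rcases hi with hi | rfl <;> rcases hj with hj | rfl
    · rw [insert_ht hi, insert_ht hj] at ht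
      rw [insert_lo hi, insert_lo hj] at hl
      exact hS.inj i j hi hj ht hl
    · rw [insert_ht hi, insert_ht_next] at ht
      rw [insert_lo hi, insert_lo_next] at hl
      exact absurd hl (key i hi ht)
    · rw [insert_ht hj, insert_ht_next] at ht
      rw [insert_lo hj, insert_lo_next] at hl
      exact absurd hl.symm (key j hj ht.symm)
    · rfl
  · intro i hi h
    replace hi := hnode.1 hi
    rcases hi with hi | rfl
    · by_cases hic : i = c
      · subst hic; rw [insert_right_self]; exact hnode.2 (Or.inr rfl)
      · rw [insert_right hi hic] at h ⊢; exact hnode.2 (Or.inl (hS.right_node i hi h))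
    · rw [insert_right_next hc] at h ⊢; exact hnode.2 (Or.inl (hS.right_node c hc h))
  · intro i hi h
    replace hi := hnode.1 hi
    rcases hi with hi | rfl
    · by_cases hic : i = c
      · subst hic; rw [insert_right_self, insert_ht_next, insert_ht hi]
      · rw [insert_right hi hic] at h ⊢
        rw [insert_ht (hS.right_node i hi h), insert_ht hi]; exact hS.ht_right i hi h
    · rw [insert_right_next hc] at h ⊢
      rw [insert_ht (hS.right_node c hc h), insert_ht_next]; exact hS.ht_right c hc h
  · intro i hi
    replace hi := hnode.1 hi
    rcases hi with hi | rfl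
    · by_cases hic : i = c
      · subst hic; rw [insert_hi_self hi, insert_lo hi]; exact hs
      · rw [insert_hi hS hi hic, insert_lo hi]; exact hS.lo_lt_hi i hi
    · rw [insert_hi_next hS hc, insert_lo_next]; exact hs'
  · intro i j hi hj ht hl
    replace hi := hnode.1 hi
    replace hj := hnode.1 hj
    rcases hi with hi | rfl <;> rcases hj with hj | rfl
    · rw [insert_ht hi, insert_ht hj] at ht
      rw [insert_lo hi, insert_lo hj] at hl
      rw [insert_lo hj]
      by_cases hic : i = c
      · subst hic; rw [insert_hi_self hi]; exact hs'.le.trans (hS.sep _ _ hi hj ht hl)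
      · rw [insert_hi hS hi hic]; exact hS.sep _ _ hi hj ht hl
    · rw [insert_ht hi, insert_ht_next] at ht
      rw [insert_lo hi, insert_lo_next] at hl
      rw [insert_lo_next]
      by_cases hic : i = c
      · subst hic; rw [insert_hi_self hi]
      · rw [insert_hi hS hi hic]
        have : S.lo i < S.lo c := by
          rcases lt_trichotomy (S.lo i) (S.lo c) with h | h | h
          · exact h
          · exact absurd (hS.inj i c hi hc ht h) hic
          · have := hS.sep c i hc hi ht.symm h; linarith
        exact (hS.sep i c hi hc ht this).trans hs.le
    · rw [insert_ht hj, insert_ht_next] at ht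
      rw [insert_lo hj, insert_lo_next] at hl
      rw [insert_lo hj, insert_hi_next hS hc]
      exact hS.sep c j hc hj ht (hs.trans hl)
    · exact absurd hl (lt_irrefl _)
  · intro i hi h
    replace hi := hnode.1 hi
    rcases hi with hi | rfl
    · rw [insert_ht hi] at h
      rw [hdn i hi]; exact hnode.2 (Or.inl (hS.down_node i hi h))
    · rw [insert_ht_next] at h
      exact hnode.2 (Or.inl (hdown' h).1)
  · intro i hi h
    replace hi := hnode.1 hi
    rcases hi with hi | rfl
    · rw [insert_ht hi] at h ⊢
      rw [hdn i hi, insert_ht (hS.down_node i hi h)]; exact hS.ht_down i hi h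
    · rw [insert_ht_next] at h ⊢
      exact (congrArg (· + 1) (insert_ht (hdown' h).1)).trans (hdown' h).2.1
  · intro i hi h
    replace hi := hnode.1 hi
    rcases hi with hi | rfl
    · rw [insert_ht hi] at h
      rw [insert_lo hi, hdn i hi, insert_lo (hS.down_node i hi h)]; exact hS.lo_down i hi h
    · rw [insert_ht_next] at h
      rw [insert_lo_next]
      exact (insert_lo (hdown' h).1).trans (hdown' h).2.2
  · intro i hi h
    change nk i = _
    replace hi := hnode.1 hi
    rcases hi with hi | rfl
    · rw [insert_ht hi] at h
      by_cases hic : i = c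
      · subst hic
        rw [insert_kids_self hi hs', (hnkc h).1, (hnkc h).2.2.1]
      · by_cases hix : i = x
        · subst hix
          rw [hnkx, insert_kids_parent hS hc hi hxt hxc hcx hs hs', Finset.card_insert_of_notMem,
            hS.nk_eq i hi h]
          intro hmem; exact hnext (mem_kids.1 hmem).1
        · rw [hnk i hi.2.ne hic hix, hS.nk_eq i hi h,
            insert_kids_of_ne hS hc hx hxt hxc hcx hs hs' hi hic hix]
    · rw [insert_ht_next] at h
      rw [insert_kids_next hS hc hs, (hnkc h).2.1, (hnkc h).2.2.2]
  · intro i hi h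
    change nk i ≤ 4
    replace hi := hnode.1 hi
    rcases hi with hi | rfl
    · rw [insert_ht hi] at h
      by_cases hic : i = c
      · subst hic; rw [(hnkc h).1]; norm_num
      · by_cases hix : i = x
        · subst hix; omega
        · rw [hnk i hi.2.ne hic hix]; exact hS.nk_le i hi h
    · rw [insert_ht_next] at h; rw [(hnkc h).2.1]; norm_num
  · intro i hi h hir
    change 2 ≤ nk i
    change i ≠ S.root at hir
    replace hi := hnode.1 hi
    rcases hi with hi | rfl
    · rw [insert_ht hi] at h
      by_cases hic : i = c
      · subst hic; rw [(hnkc h).1]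
      · by_cases hix : i = x
        · subst hix; have := hS.nk_ge i hi h hir; omega
        · rw [hnk i hi.2.ne hic hix]; exact hS.nk_ge i hi h hir
    · rw [insert_ht_next] at h; rw [(hnkc h).2.1]

end insert

/-- The third child of a node with four children separates its children into two pairs. -/
theorem third_child (hS : S.Valid) {c : ℕ} (hc : S.Node c) (h : 0 < S.ht c) (h4 : S.nk c = 4) :
    S.right (S.down c) ∈ S.kids c ∧ S.right (S.right (S.down c)) ∈ S.kids c ∧
    S.hi (S.down c) = S.lo (S.right (S.down c)) ∧
    S.hi (S.right (S.down c)) = S.lo (S.right (S.right (S.down c))) ∧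
    ((S.kids c).filter fun j => S.lo j < S.lo (S.right (S.right (S.down c)))).card = 2 ∧
    ((S.kids c).filter fun j => S.lo (S.right (S.right (S.down c))) ≤ S.lo j).card = 2 := by
  have hcard : (S.kids c).card = 4 := by rw [← hS.nk_eq c hc h, h4]
  -- Passing from a child to its right neighbour removes exactly one child from those at or after
  -- it, so these numbers are `4`, `3`, `2` for the first three children.
  have step : ∀ i ∈ S.kids c, 1 < ((S.kids c).filter fun j => S.lo i ≤ S.lo j).card →
      S.right i ≠ 0 ∧ S.right i ∈ S.kids c ∧
      (S.kids c).filter (fun j => S.lo i ≤ S.lo j) =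
        Insert.insert i ((S.kids c).filter fun j => S.lo (S.right i) ≤ S.lo j) ∧
      i ∉ ((S.kids c).filter fun j => S.lo (S.right i) ≤ S.lo j) := by
    intro i hi h1
    obtain ⟨hn, hht, hlo, hhi⟩ := mem_kids.1 hi
    obtain ⟨j, hj, hji⟩ := Finset.exists_mem_ne h1 i
    simp only [Finset.mem_filter] at hj
    obtain ⟨jn, jht, jlo, jhi⟩ := mem_kids.1 hj.1
    have hlt : S.lo i < S.lo j := lt_of_le_of_ne hj.2 fun e =>
      hji (hS.inj j i jn hn (by omega) e.symm)
    have hsep := hS.sep i j hn jn (by omega) hlt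
    have hr0 : S.right i ≠ 0 := by
      intro h0
      rw [hi_of_right_eq_zero h0] at hsep
      have := hS.lo_le j jn
      linarith
    have hlr := hS.lo_lt_hi i hn
    rw [hi_of_right_ne_zero hr0] at hsep hlr
    refine ⟨hr0, mem_kids.2 ⟨hS.right_node i hn hr0, by rw [hS.ht_right i hn hr0, hht],
      hlo.trans hlr.le, hsep.trans_lt jhi⟩, ?_, ?_⟩
    · ext k
      simp only [Finset.mem_insert, Finset.mem_filter]
      constructor
      · rintro ⟨hk, hik⟩
        obtain ⟨kn, kht, klo, khi⟩ := mem_kids.1 hk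
        rcases hik.eq_or_lt with e | e
        · exact Or.inl (hS.inj k i kn hn (by omega) e.symm)
        · right
          have := hS.sep i k hn kn (by omega) e
          rw [hi_of_right_ne_zero hr0] at this
          exact ⟨hk, this⟩
      · rintro (rfl | ⟨hk, hik⟩)
        · exact ⟨hi, le_rfl⟩
        · exact ⟨hk, hlr.le.trans hik⟩
    · simp only [Finset.mem_filter, not_and, not_le]
      exact fun _ => hlr
  have hall : (S.kids c).filter (fun j => S.lo (S.down c) ≤ S.lo j) = S.kids c := by
    refine Finset.filter_true_of_mem fun j hj => ?_
    rw [hS.lo_down c hc h]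
    exact (mem_kids.1 hj).2.2.1
  obtain ⟨a1, a2, a3, a4⟩ := step _ (hS.down_mem_kids hc h) (by rw [hall, hcard]; norm_num)
  have hcard2 : ((S.kids c).filter fun j => S.lo (S.right (S.down c)) ≤ S.lo j).card = 3 := by
    have := Finset.card_insert_of_notMem a4
    rw [← a3, hall, hcard] at this
    omega
  obtain ⟨b1, b2, b3, b4⟩ := step _ a2 (by rw [hcard2]; norm_num)
  have hcard3 : ((S.kids c).filter fun j =>
      S.lo (S.right (S.right (S.down c))) ≤ S.lo j).card = 2 := by
    have := Finset.card_insert_of_notMem b4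
    rw [← b3, hcard2] at this
    omega
  refine ⟨a2, b2, hi_of_right_ne_zero a1, hi_of_right_ne_zero b1, ?_, hcard3⟩
  have := Finset.card_filter_add_card_filter_not (s := S.kids c)
    (fun j => S.lo j < S.lo (S.right (S.right (S.down c))))
  simp only [not_lt] at this
  omega

/-- The tree with a new root on top. -/
noncomputable def _root_.LearnedCE.Shape.grow (S : Shape) : Shape :=
  { next := S.next + 1
    root := S.next
    height := S.height + 1
    right := Function.update S.right S.next 0
    down := Function.update S.down S.next S.root
    nk := Function.update S.nk S.next 1
    ht := Function.update S.ht S.next (S.height + 1)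
    lo := Function.update S.lo S.next 0 }

theorem grow_hi {S : Shape} (hS : S.Valid) {i : ℕ} (h : S.Node i) : S.grow.hi i = S.hi i := by
  have hr : S.grow.right i = S.right i := Function.update_of_ne h.2.ne _ _
  unfold Shape.hi
  rw [hr]
  split_ifs with h0
  · rfl
  · exact Function.update_of_ne (hS.right_node i h h0).2.ne _ _

/-- The old root loses its exemption from having two children, so a full root is required; any root
with at least two would do. -/
theorem grow {S : Shape} (hS : S.Valid) (h4 : S.nk S.root = 4) : S.grow.Valid := by
  have h0 : 0 < S.next := hS.root_node.1.trans hS.root_node.2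
  have hnode : ∀ {i}, S.grow.Node i ↔ S.Node i ∨ i = S.next := by
    intro i; simp only [Node, Shape.grow]; omega
  have hlo : ∀ {i}, S.Node i → S.grow.lo i = S.lo i := fun h => Function.update_of_ne h.2.ne _ _
  have hlo' : S.grow.lo S.next = 0 := Function.update_self ..
  have hht : ∀ {i}, S.Node i → S.grow.ht i = S.ht i := fun h => Function.update_of_ne h.2.ne _ _
  have hht' : S.grow.ht S.next = S.height + 1 := Function.update_self ..
  have hr : ∀ {i}, S.Node i → S.grow.right i = S.right i :=
    fun h => Function.update_of_ne h.2.ne _ _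
  have hr' : S.grow.right S.next = 0 := Function.update_self ..
  have hd : ∀ {i}, S.Node i → S.grow.down i = S.down i := fun h => Function.update_of_ne h.2.ne _ _
  have hd' : S.grow.down S.next = S.root := Function.update_self ..
  have hn : ∀ {i}, S.Node i → S.grow.nk i = S.nk i := fun h => Function.update_of_ne h.2.ne _ _
  have hn' : S.grow.nk S.next = 1 := Function.update_self ..
  have hhi : ∀ {i}, S.Node i → S.grow.hi i = S.hi i := fun h => grow_hi hS h
  have hhi' : S.grow.hi S.next = 3 := hi_of_right_eq_zero hr'
  have hkids : ∀ {i}, S.Node i → S.grow.kids i = S.kids i := by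
    intro i hi
    ext j
    rw [mem_kids, mem_kids, hnode, hht hi, hlo hi, hhi hi]
    constructor
    · rintro ⟨hj | rfl, h1, h2, h3⟩
      · rw [hht hj, hlo hj] at *; exact ⟨hj, h1, h2, h3⟩
      · rw [hht'] at h1; have := hS.ht_le i hi; omega
    · rintro ⟨hj, h1, h2, h3⟩
      rw [hht hj, hlo hj]; exact ⟨Or.inl hj, h1, h2, h3⟩
  have hkids' : S.grow.kids S.next = {S.root} := by
    ext j
    rw [mem_kids, hnode, hht', hlo', hhi', Finset.mem_singleton]
    constructor
    · rintro ⟨hj | rfl, h1, h2, h3⟩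
      · rw [hht hj] at h1; exact hS.eq_root j hj (by omega)
      · rw [hht'] at h1; omega
    · rintro rfl
      have := hS.root_node
      rw [hht this, hlo this, hS.lo_root, hS.ht_root]
      exact ⟨Or.inl this, rfl, le_rfl, by norm_num⟩
  have hne : ∀ {i}, S.Node i → S.ht i ≠ S.height + 1 := fun h => by
    have := hS.ht_le _ h; omega
  refine ⟨hnode.2 (Or.inr rfl), hht', by simp [Shape.grow], ?_, ?_, hlo', ?_, ?_, ?_, ?_, ?_, ?_,
    ?_, ?_, ?_, ?_, ?_, ?_, ?_⟩
  · intro i hi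
    replace hi := hnode.1 hi
    rcases hi with hi | rfl
    · rw [hht hi]; exact (hS.ht_le i hi).trans (Nat.le_succ _)
    · exact hht'.le
  · intro i hi h
    replace hi := hnode.1 hi
    rcases hi with hi | rfl
    · rw [hht hi] at h; exact absurd h (hne hi)
    · rfl
  · intro i hi
    replace hi := hnode.1 hi
    rcases hi with hi | rfl
    · rw [hlo hi]; exact hS.lo_nonneg i hi
    · exact hlo'.ge
  · intro i hi
    replace hi := hnode.1 hi
    rcases hi with hi | rfl
    · rw [hlo hi]; exact hS.lo_le i hi
    · rw [hlo']; exact zero_le_one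
  · intro i j hi hj ht hl
    replace hi := hnode.1 hi
    replace hj := hnode.1 hj
    rcases hi with hi | rfl <;> rcases hj with hj | rfl
    · rw [hht hi, hht hj] at ht; rw [hlo hi, hlo hj] at hl; exact hS.inj i j hi hj ht hl
    · rw [hht hi, hht'] at ht; exact absurd ht (hne hi)
    · rw [hht hj, hht'] at ht; exact absurd ht.symm (hne hj)
    · rfl
  · intro i hi h
    replace hi := hnode.1 hi
    rcases hi with hi | rfl
    · rw [hr hi] at h ⊢; exact hnode.2 (Or.inl (hS.right_node i hi h))
    · exact absurd hr' h
  · intro i hi h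
    replace hi := hnode.1 hi
    rcases hi with hi | rfl
    · rw [hr hi] at h ⊢; rw [hht hi, hht (hS.right_node i hi h)]; exact hS.ht_right i hi h
    · exact absurd hr' h
  · intro i hi
    replace hi := hnode.1 hi
    rcases hi with hi | rfl
    · rw [hlo hi, hhi hi]; exact hS.lo_lt_hi i hi
    · rw [hlo', hhi']; norm_num
  · intro i j hi hj ht hl
    replace hi := hnode.1 hi
    replace hj := hnode.1 hj
    rcases hi with hi | rfl <;> rcases hj with hj | rfl
    · rw [hht hi, hht hj] at ht; rw [hlo hi, hlo hj] at hl; rw [hhi hi, hlo hj]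
      exact hS.sep i j hi hj ht hl
    · rw [hht hi, hht'] at ht; exact absurd ht (hne hi)
    · rw [hht hj, hht'] at ht; exact absurd ht.symm (hne hj)
    · exact absurd hl (lt_irrefl _)
  · intro i hi h
    replace hi := hnode.1 hi
    rcases hi with hi | rfl
    · rw [hht hi] at h; rw [hd hi]; exact hnode.2 (Or.inl (hS.down_node i hi h))
    · rw [hd']; exact hnode.2 (Or.inl hS.root_node)
  · intro i hi h
    replace hi := hnode.1 hi
    rcases hi with hi | rfl
    · rw [hht hi] at h ⊢; rw [hd hi, hht (hS.down_node i hi h)]; exact hS.ht_down i hi h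
    · rw [hd', hht', hht hS.root_node, hS.ht_root]
  · intro i hi h
    replace hi := hnode.1 hi
    rcases hi with hi | rfl
    · rw [hht hi] at h; rw [hd hi, hlo hi, hlo (hS.down_node i hi h)]; exact hS.lo_down i hi h
    · rw [hd', hlo', hlo hS.root_node, hS.lo_root]
  · intro i hi h
    replace hi := hnode.1 hi
    rcases hi with hi | rfl
    · rw [hht hi] at h; rw [hn hi, hkids hi]; exact hS.nk_eq i hi h
    · rw [hn', hkids', Finset.card_singleton]
  · intro i hi h
    replace hi := hnode.1 hi
    rcases hi with hi | rfl
    · rw [hht hi] at h; rw [hn hi]; exact hS.nk_le i hi h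
    · rw [hn']; norm_num
  · intro i hi h hir
    replace hi := hnode.1 hi
    rcases hi with hi | rfl
    · rw [hht hi] at h; rw [hn hi]
      by_cases hir' : i = S.root
      · rw [hir', h4]; norm_num
      · exact hS.nk_ge i hi h hir'
    · exact absurd rfl hir

/-! #### The size of the tree -/

/-- Below the root each inner node has at least two children, and nodes of the same height have
disjoint sets of children because their intervals are disjoint. -/
theorem two_mul_card_level (hS : S.Valid) {h : ℕ} (hh : h + 1 < S.height) :
    2 * (S.level (h + 1)).card ≤ (S.level h).card := by
  have hsub : (S.level (h + 1)).biUnion S.kids ⊆ S.level h := by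
    intro j hj
    obtain ⟨i, hi, hji⟩ := Finset.mem_biUnion.1 hj
    have h1 := mem_level.1 hi
    have h2 := mem_kids.1 hji
    exact mem_level.2 ⟨h2.1, by omega⟩
  have hdisj : ∀ i ∈ S.level (h + 1), ∀ j ∈ S.level (h + 1), i ≠ j →
      Disjoint (S.kids i) (S.kids j) := by
    intro i hi j hj hij
    rw [Finset.disjoint_left]
    intro k hk hk'
    have h1 := mem_level.1 hi
    have h2 := mem_level.1 hj
    obtain ⟨-, -, a1, a2⟩ := mem_kids.1 hk
    obtain ⟨-, -, b1, b2⟩ := mem_kids.1 hk'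
    exact hij (hS.eq_of_mem h1.1 h2.1 (by omega) a1 a2 b1 b2)
  calc 2 * (S.level (h + 1)).card = ∑ _i ∈ S.level (h + 1), 2 := by simp [mul_comm]
    _ ≤ ∑ i ∈ S.level (h + 1), (S.kids i).card := by
        refine Finset.sum_le_sum fun i hi => ?_
        have h1 := mem_level.1 hi
        rw [← hS.nk_eq i h1.1 (by omega)]
        refine hS.nk_ge i h1.1 (by omega) ?_
        rintro rfl
        rw [hS.ht_root] at h1
        omega
    _ = ((S.level (h + 1)).biUnion S.kids).card := (Finset.card_biUnion hdisj).symm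
    _ ≤ (S.level h).card := Finset.card_le_card hsub

theorem level_height (hS : S.Valid) : S.level S.height = {S.root} := by
  ext i
  rw [mem_level, Finset.mem_singleton]
  constructor
  · exact fun h => hS.eq_root i h.1 h.2
  · rintro rfl; exact ⟨hS.root_node, hS.ht_root⟩

theorem level_nonempty (hS : S.Valid) : ∀ k, k ≤ S.height → 1 ≤ (S.level (S.height - k)).card := by
  intro k
  induction k with
  | zero => intro _; rw [Nat.sub_zero, hS.level_height]; simp
  | succ k ih =>
    intro hk
    obtain ⟨i, hi⟩ := Finset.card_pos.1 (ih (by omega))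
    have h1 := mem_level.1 hi
    refine Finset.card_pos.2 ⟨S.down i, mem_level.2 ⟨hS.down_node i h1.1 (by omega), ?_⟩⟩
    have := hS.ht_down i h1.1 (by omega)
    omega

/-- The levels double in size downwards, starting one level below the root; the root itself may have
a single child. -/
theorem two_pow_le (hS : S.Valid) : 2 ^ (S.height - 1) ≤ (S.level 0).card := by
  have key : ∀ k, k < S.height → 2 ^ k ≤ (S.level (S.height - 1 - k)).card := by
    intro k
    induction k with
    | zero => intro h; simpa using hS.level_nonempty 1 hS.height_pos
    | succ k ih =>
      intro hk
      have h1 := ih (by omega)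
      have h2 := hS.two_mul_card_level (h := S.height - 1 - (k + 1)) (by omega)
      rw [show S.height - 1 - (k + 1) + 1 = S.height - 1 - k by omega] at h2
      rw [pow_succ]; omega
  have := key (S.height - 1) (by have := hS.height_pos; omega)
  simpa using this

/-- A geometric sum: all the levels below the root together have at most twice as many nodes as
there are leaves. The root and the number `0`, which is not a node, account for the `2`. -/
theorem next_le (hS : S.Valid) : S.next ≤ 2 * (S.level 0).card + 2 := by
  have hsum : ((Finset.range S.next).filter fun j => 0 < j).card
      = ∑ h ∈ Finset.range (S.height + 1), (S.level h).card := by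
    rw [Finset.card_eq_sum_card_fiberwise (f := S.ht) (t := Finset.range (S.height + 1))]
    · refine Finset.sum_congr rfl fun h _ => ?_
      rw [Finset.filter_filter]; rfl
    · intro i hi
      simp only [Finset.coe_filter, Finset.mem_range, mem_ofPred_eq] at hi
      simp only [Finset.coe_range, mem_Iio]
      have := hS.ht_le i ⟨hi.2, hi.1⟩
      omega
  have hcard : ((Finset.range S.next).filter fun j => 0 < j).card = S.next - 1 := by
    have : (Finset.range S.next).filter (fun j => 0 < j) = (Finset.range S.next).erase 0 := by
      ext j; simp; omega
    rw [this, Finset.card_erase_of_mem]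
    · simp
    · simpa using hS.root_node.1.trans hS.root_node.2
  have key : ∀ k, k < S.height →
      ∑ h ∈ Finset.range (k + 1), (S.level h).card + (S.level k).card ≤ 2 * (S.level 0).card := by
    intro k
    induction k with
    | zero => intro _; simp; omega
    | succ k ih =>
      intro hk
      have h1 := ih (by omega)
      have h2 := hS.two_mul_card_level hk
      rw [Finset.sum_range_succ]
      omega
  have h1 := key (S.height - 1) (by have := hS.height_pos; omega)
  rw [show S.height - 1 + 1 = S.height by have := hS.height_pos; omega] at h1
  rw [Finset.sum_range_succ, hS.level_height, Finset.card_singleton, hcard] at hsum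
  omega

end Valid

end Shape

/-! ### A record store on top of the memory -/

/-- The number fields of the records of which the summary consists. -/
inductive Field where
  | right
  | down
  | nk
  | cnt
  | atom
  | trained
  | base
  | glob

namespace Field

/-- The offset of a field in a record. -/
def code : Field → ℕ
  | right => 0
  | down => 1
  | nk => 2
  | cnt => 3
  | atom => 4
  | trained => 5
  | base => 6
  | glob => 7

/-- The field with a given offset. -/
def decode : ℕ → Field
  | 0 => right
  | 1 => down
  | 2 => nk
  | 3 => cnt
  | 4 => atom
  | 5 => trained
  | 6 => base
  | _ => glob

theorem decode_code (f : Field) : decode f.code = f := by cases f <;> rfl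

theorem code_lt (f : Field) : f.code < 8 := by cases f <;> decide

theorem code_injective : Function.Injective code :=
  Function.LeftInverse.injective decode_code

theorem code_decode {k : ℕ} (h : k < 8) : (decode k).code = k := by
  interval_cases k <;> rfl

instance : DecidableEq Field := code_injective.decidableEq

end Field

/-- The memory, with its number cells arranged in records. -/
structure Store (α : Type) where
  fld : Field → ℕ → ℕ
  key : ℕ → Option ℝ
  model : ℕ → Option α
  data : ℕ → ℝ

namespace Store

variable {α : Type}

/-- The memory that a store describes. -/
def toMemory (G : Store α) : Memory α where
  num a := G.fld (Field.decode (a % 8)) (a / 8)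
  key := G.key
  model := G.model
  data := G.data

/-- The store of an empty memory. -/
def blank (α : Type) : Store α where
  fld _ _ := 0
  key _ := none
  model _ := none
  data _ := 0

/-- The key in a record. -/
noncomputable def lo (G : Store α) (i : ℕ) : ℝ := (G.key i).getD 0

/-- Assignment to a number field. -/
def set (G : Store α) (f : Field) (i v : ℕ) : Store α :=
  { G with fld := Function.update G.fld f (Function.update (G.fld f) i v) }

/-- Assignment to a key. -/
def setKey (G : Store α) (i : ℕ) (v : ℝ) : Store α :=
  { G with key := Function.update G.key i (some v) }

/-- Assignment to a model cell. -/
def setModel (G : Store α) (i : ℕ) (f : α) : Store α :=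
  { G with model := Function.update G.model i (some f) }

/-- Assignment to a data cell. -/
noncomputable def setData (G : Store α) (i : ℕ) (v : ℝ) : Store α :=
  { G with data := Function.update G.data i v }

variable (G : Store α) (f g : Field) (i j v : ℕ) (x : ℝ) (m : α)

@[simp] theorem set_fld_self : (G.set f i v).fld f = Function.update (G.fld f) i v :=
  Function.update_self ..

theorem set_fld_of_ne {f g : Field} (h : g ≠ f) : (G.set f i v).fld g = G.fld g :=
  Function.update_of_ne h ..

@[simp] theorem set_key : (G.set f i v).key = G.key := rfl
@[simp] theorem set_model : (G.set f i v).model = G.model := rfl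
@[simp] theorem set_data : (G.set f i v).data = G.data := rfl
@[simp] theorem set_lo : (G.set f i v).lo = G.lo := rfl
@[simp] theorem setKey_fld : (G.setKey i x).fld = G.fld := rfl
@[simp] theorem setKey_model : (G.setKey i x).model = G.model := rfl
@[simp] theorem setKey_data : (G.setKey i x).data = G.data := rfl
@[simp] theorem setKey_key : (G.setKey i x).key = Function.update G.key i (some x) := rfl
@[simp] theorem setModel_fld : (G.setModel i m).fld = G.fld := rfl
@[simp] theorem setModel_key : (G.setModel i m).key = G.key := rfl
@[simp] theorem setModel_lo : (G.setModel i m).lo = G.lo := rfl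
@[simp] theorem setModel_data : (G.setModel i m).data = G.data := rfl
@[simp] theorem setModel_model :
    (G.setModel i m).model = Function.update G.model i (some m) := rfl
@[simp] theorem setData_fld : (G.setData i x).fld = G.fld := rfl
@[simp] theorem setData_key : (G.setData i x).key = G.key := rfl
@[simp] theorem setData_lo : (G.setData i x).lo = G.lo := rfl
@[simp] theorem setData_model : (G.setData i x).model = G.model := rfl
@[simp] theorem setData_data : (G.setData i x).data = Function.update G.data i x := rfl

@[simp] theorem setKey_lo : (G.setKey i x).lo = Function.update G.lo i x := by
  funext k
  by_cases h : k = i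
  · subst h; simp [lo]
  · simp [lo, h]

theorem toMemory_set : (G.set f i v).toMemory =
    { G.toMemory with num := Function.update G.toMemory.num (8 * i + f.code) v } := by
  have key : (G.set f i v).toMemory.num =
      Function.update G.toMemory.num (8 * i + f.code) v := by
    funext a
    have hf := f.code_lt
    by_cases h : a = 8 * i + f.code
    · subst h
      have h1 : (8 * i + f.code) % 8 = f.code := by omega
      have h2 : (8 * i + f.code) / 8 = i := by omega
      simp [toMemory, h1, h2, Field.decode_code]
    · rw [Function.update_of_ne h]
      simp only [toMemory]
      by_cases h1 : Field.decode (a % 8) = f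
      · have h2 : a % 8 = f.code := by
          rw [← h1, Field.code_decode (Nat.mod_lt _ (by norm_num))]
        rw [h1, set_fld_self, Function.update_of_ne]
        omega
      · rw [set_fld_of_ne _ _ _ h1]
  simp only [toMemory] at key ⊢
  rw [key]
  rfl

end Store

/-! ### Compound operations on records and their cost on the machine. -/

/-- A state of the machine between two compound operations. The number registers 0 and 1 of the
machine serve for address computations. -/
structure Cfg (α : Type) where
  G : Store α
  reg : ℕ → ℕ
  kreg : ℕ → ℝ
  out : ℝ

namespace Cfg

variable {α : Type}

/-- The state of the machine that a configuration describes. -/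
def toState (c : Cfg α) : State α where
  mem := c.G.toMemory
  reg k := if k < 2 then 0 else c.reg (k - 2)
  kreg := c.kreg
  out := c.out

/-- Assignment to a number register. -/
def setReg (c : Cfg α) (r v : ℕ) : Cfg α := { c with reg := Function.update c.reg r v }

/-- Assignment to a key register. -/
noncomputable def setKreg (c : Cfg α) (k : ℕ) (v : ℝ) : Cfg α :=
  { c with kreg := Function.update c.kreg k v }

/-- Replacement of the store. -/
def setG (c : Cfg α) (G : Store α) : Cfg α := { c with G := G }

/-- Addition to the output. -/
noncomputable def addOut (c : Cfg α) (x : ℝ) : Cfg α := { c with out := c.out + x }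

variable (c : Cfg α) (r s v : ℕ) (x : ℝ) (G : Store α)

theorem setReg_reg : (c.setReg r v).reg s = if s = r then v else c.reg s :=
  Function.update_apply ..
@[simp] theorem setReg_kreg : (c.setReg r v).kreg = c.kreg := rfl
@[simp] theorem setReg_G : (c.setReg r v).G = c.G := rfl
@[simp] theorem setReg_out : (c.setReg r v).out = c.out := rfl
theorem setKreg_kreg : (c.setKreg r x).kreg s = if s = r then x else c.kreg s :=
  Function.update_apply ..
@[simp] theorem setKreg_reg : (c.setKreg r x).reg = c.reg := rfl
@[simp] theorem setKreg_G : (c.setKreg r x).G = c.G := rfl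
@[simp] theorem setKreg_out : (c.setKreg r x).out = c.out := rfl
@[simp] theorem setG_reg : (c.setG G).reg = c.reg := rfl
@[simp] theorem setG_kreg : (c.setG G).kreg = c.kreg := rfl
@[simp] theorem setG_G : (c.setG G).G = G := rfl
@[simp] theorem setG_out : (c.setG G).out = c.out := rfl
@[simp] theorem addOut_reg : (c.addOut x).reg = c.reg := rfl
@[simp] theorem addOut_kreg : (c.addOut x).kreg = c.kreg := rfl
@[simp] theorem addOut_G : (c.addOut x).G = c.G := rfl
@[simp] theorem addOut_out : (c.addOut x).out = c.out + x := rfl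

theorem toState_reg : c.toState.reg (r + 2) = c.reg r := by simp [toState]

theorem toState_setReg : (c.setReg r v).toState =
    { c.toState with reg := Function.update c.toState.reg (r + 2) v } := by
  have : (c.setReg r v).toState.reg = Function.update c.toState.reg (r + 2) v := by
    funext k
    rw [Function.update_apply]
    simp only [toState, setReg_reg]
    split_ifs <;> first | rfl | omega
  simp only [toState] at this ⊢
  rw [this]; rfl

end Cfg

/-- Compound operations. -/
inductive Op where
  | const (r c : ℕ)
  | add (r s t : ℕ)
  | sub (r s t : ℕ)
  | get (r : ℕ) (f : Field) (x : ℕ)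
  | put (f : Field) (x r : ℕ)
  | moveKey (k l : ℕ)
  | getKey (k x : ℕ)
  | putKey (x k : ℕ)
  | loadData (k s : ℕ)
  | saveData (s k : ℕ)
  | output (r : ℕ)

namespace Op

variable {α : Type}

/-- The effect of a compound operation. -/
noncomputable def eff : Op → Cfg α → Cfg α
  | const r k, c => c.setReg r k
  | add r s t, c => c.setReg r (c.reg s + c.reg t)
  | sub r s t, c => c.setReg r (c.reg s - c.reg t)
  | get r f x, c => c.setReg r (c.G.fld f (c.reg x))
  | put f x r, c => c.setG (c.G.set f (c.reg x) (c.reg r))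
  | moveKey k l, c => c.setKreg k (c.kreg l)
  | getKey k x, c => c.setKreg k (c.G.lo (c.reg x))
  | putKey x k, c => c.setG (c.G.setKey (c.reg x) (c.kreg k))
  | loadData k s, c => c.setKreg k (c.G.data (c.reg s))
  | saveData s k, c => c.setG (c.G.setData (c.reg s) (c.kreg k))
  | output r, c => c.addOut (c.reg r)

/-- A program that runs instructions one after the other. -/
def chain : List Instr → Prog
  | [] => .instr (.const 0 0)
  | i :: l => .seq (.instr i) (chain l)

/-- The instructions that put the address of a field into register 0. -/
def address (f : Field) (x : ℕ) : List Instr :=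
  [.add 0 (x + 2) (x + 2), .add 0 0 0, .add 0 0 0, .const 1 f.code, .add 0 0 1]

/-- The instructions that carry out a compound operation. -/
def instrs : Op → List Instr
  | const r k => [.const (r + 2) k]
  | add r s t => [.add (r + 2) (s + 2) (t + 2)]
  | sub r s t => [.sub (r + 2) (s + 2) (t + 2)]
  | get r f x => address f x ++ [.loadNum (r + 2) 0, .const 1 0]
  | put f x r => address f x ++ [.saveNum 0 (r + 2), .const 1 0]
  | moveKey k l => [.moveKey k l]
  | getKey k x => [.loadKey k (x + 2)]
  | putKey x k => [.saveKey (x + 2) k]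
  | loadData k s => [.loadData k (s + 2)]
  | saveData s k => [.saveData (s + 2) k]
  | output r => [.output (r + 2)]

end Op

/-- A program that carries out compound operations one after the other. -/
def block : List Op → Prog
  | [] => .instr (.const 0 0)
  | op :: l => .seq (Op.chain op.instrs) (block l)

/-- The effect of a list of compound operations. -/
noncomputable def effs {α : Type} (l : List Op) (c : Cfg α) : Cfg α :=
  l.foldl (fun c op => op.eff c) c

@[simp] theorem effs_nil {α : Type} (c : Cfg α) : effs [] c = c := rfl

@[simp] theorem effs_cons {α : Type} (op : Op) (l : List Op) (c : Cfg α) :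
    effs (op :: l) c = effs l (op.eff c) := rfl

variable {A : Learner}

theorem Op.exec_chain (l : List Instr) (hl : ∀ i ∈ l, ∀ σ : State A.Model, i.cost A σ = 1)
    (σ : State A.Model) : Exec A (Op.chain l) σ (l.length + 1)
      ((Instr.const 0 0).apply A (l.foldl (fun σ i => Instr.apply A i σ) σ)) := by
  induction l generalizing σ with
  | nil => exact Exec.instr (.const 0 0) σ
  | cons i l ih =>
    have h1 := Exec.instr (A := A) i σ
    rw [hl i (by simp)] at h1
    have h2 := h1.seq (ih (fun j hj => hl j (by simp [hj])) (i.apply A σ))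
    rw [show (i :: l).length + 1 = 1 + (l.length + 1) by simp [add_comm]]
    exact h2

/-- Register 0 is zero in every state that comes from a configuration. So the instruction that ends
each chain has no further effect there, while after an address computation it restores this
condition. -/
theorem Cfg.toState_const (c : Cfg A.Model) : (Instr.const 0 0).apply A c.toState = c.toState := by
  simp only [Instr.apply]
  have : Function.update c.toState.reg 0 0 = c.toState.reg := by
    rw [Function.update_eq_self_iff]; simp [Cfg.toState]
  rw [this]

/-- The worst case is an access to a field: five instructions for the address, one for the access,
and two that clear the auxiliary registers. -/
theorem Op.exec (op : Op) (c : Cfg A.Model) :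
    ∃ t, Exec A (Op.chain op.instrs) c.toState t (op.eff c).toState ∧ t ≤ 8 := by
  have hl : ∀ i ∈ op.instrs, ∀ σ : State A.Model, i.cost A σ = 1 := by
    cases op <;> simp [instrs, address, Instr.cost]
  refine ⟨_, (?_ : (Instr.const 0 0).apply A
      (op.instrs.foldl (fun σ i => Instr.apply A i σ) c.toState) = (op.eff c).toState) ▸
      Op.exec_chain op.instrs hl c.toState, by cases op <;> simp [instrs, address]⟩
  have h0 : ∀ r, r + 2 ≠ 0 := fun r => by omega
  have h1 : ∀ r, r + 2 ≠ 1 := fun r => by omega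
  have e0 : c.toState.reg 0 = 0 := by simp [Cfg.toState]
  have e1 : c.toState.reg 1 = 0 := by simp [Cfg.toState]
  have hfin : ∀ (f : Field) (x : ℕ), (address f x).foldl (fun σ i => Instr.apply A i σ) c.toState
      = { c.toState with reg := Function.update (Function.update c.toState.reg 0
          (8 * c.reg x + f.code)) 1 f.code } := by
    intro f x
    simp only [address, List.foldl_cons, List.foldl_nil, Instr.apply, Cfg.toState_reg]
    congr 1
    funext k
    simp only [Function.update_apply]
    split_ifs <;> simp_all <;> omega
  cases op with
  | const r k =>
    simp only [instrs, List.foldl_cons, List.foldl_nil, eff]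
    rw [← Cfg.toState_const (c.setReg r k), Cfg.toState_setReg]; rfl
  | add r s t =>
    simp only [instrs, List.foldl_cons, List.foldl_nil, eff]
    rw [← Cfg.toState_const (c.setReg r _), Cfg.toState_setReg]
    simp only [Instr.apply, Cfg.toState_reg]
  | sub r s t =>
    simp only [instrs, List.foldl_cons, List.foldl_nil, eff]
    rw [← Cfg.toState_const (c.setReg r _), Cfg.toState_setReg]
    simp only [Instr.apply, Cfg.toState_reg]
  | get r f x =>
    simp only [instrs, List.foldl_append, hfin, List.foldl_cons, List.foldl_nil, eff]
    rw [Cfg.toState_setReg]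
    simp only [Instr.apply]
    congr 1
    have hm : c.toState.mem.num (8 * c.reg x + f.code) = c.G.fld f (c.reg x) := by
      have := f.code_lt
      simp only [Cfg.toState, Store.toMemory]
      rw [show (8 * c.reg x + f.code) % 8 = f.code by omega,
        show (8 * c.reg x + f.code) / 8 = c.reg x by omega, Field.decode_code]
    funext k
    simp only [Function.update_apply]
    split_ifs <;> simp_all
  | put f x r =>
    simp only [instrs, List.foldl_append, hfin, List.foldl_cons, List.foldl_nil, eff]
    simp only [Instr.apply]
    have : Function.update (Function.update (Function.update (Function.update c.toState.reg 0
          (8 * c.reg x + f.code)) 1 f.code) 1 0) 0 0 = c.toState.reg := by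
      funext k
      simp only [Function.update_apply]
      split_ifs <;> simp_all
    rw [this]
    have hr : Function.update (Function.update c.toState.reg 0 (8 * c.reg x + f.code)) 1 f.code
        (r + 2) = c.reg r := by
      simp [Cfg.toState_reg]
    rw [hr]
    simp only [Cfg.toState, Cfg.setG, Store.toMemory_set]
    simp
  | moveKey k l => exact Cfg.toState_const (c.setKreg k (c.kreg l))
  | getKey k x =>
    rw [← Cfg.toState_const ((getKey k x).eff c)]
    simp only [instrs, List.foldl_cons, List.foldl_nil, eff]
    simp only [Instr.apply, Cfg.toState_reg]
    rfl
  | putKey x k =>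
    rw [← Cfg.toState_const ((putKey x k).eff c)]
    simp only [instrs, List.foldl_cons, List.foldl_nil, eff]
    simp only [Instr.apply, Cfg.toState_reg]
    rfl
  | loadData k s =>
    rw [← Cfg.toState_const ((loadData k s).eff c)]
    simp only [instrs, List.foldl_cons, List.foldl_nil, eff]
    simp only [Instr.apply, Cfg.toState_reg]
    rfl
  | saveData s k =>
    rw [← Cfg.toState_const ((saveData s k).eff c)]
    simp only [instrs, List.foldl_cons, List.foldl_nil, eff]
    simp only [Instr.apply, Cfg.toState_reg]
    rfl
  | output r =>
    rw [← Cfg.toState_const ((output r).eff c)]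
    simp only [instrs, List.foldl_cons, List.foldl_nil, eff]
    simp only [Instr.apply, Cfg.toState_reg]
    rfl

theorem exec_block (l : List Op) (c : Cfg A.Model) :
    ∃ t, Exec A (block l) c.toState t (effs l c).toState ∧ t ≤ 8 * l.length + 1 := by
  induction l generalizing c with
  | nil =>
    refine ⟨1, ?_, by simp⟩
    have := Exec.instr (A := A) (.const 0 0) c.toState
    rw [Cfg.toState_const] at this
    exact this
  | cons op l ih =>
    obtain ⟨t, h, ht⟩ := op.exec c
    obtain ⟨u, h', hu⟩ := ih (op.eff c)
    exact ⟨t + u, h.seq h', by simp; omega⟩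

/-- Comparison of two number registers. -/
def branch (r s : ℕ) (P Q : Prog) : Prog := .ifLt (r + 2) (s + 2) P Q

/-- A loop. -/
def loop (r s : ℕ) (P : Prog) : Prog := .whileLt (r + 2) (s + 2) P

theorem exec_branch_true {r s : ℕ} {P Q : Prog} {c c' : Cfg A.Model} {t : ℕ}
    (h : c.reg r < c.reg s) (hP : Exec A P c.toState t c'.toState) :
    Exec A (branch r s P Q) c.toState (1 + t) c'.toState :=
  .ifLt_true (by rwa [Cfg.toState_reg, Cfg.toState_reg]) hP

theorem exec_branch_false {r s : ℕ} {P Q : Prog} {c c' : Cfg A.Model} {t : ℕ}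
    (h : ¬ c.reg r < c.reg s) (hQ : Exec A Q c.toState t c'.toState) :
    Exec A (branch r s P Q) c.toState (1 + t) c'.toState :=
  .ifLt_false (by rwa [Cfg.toState_reg, Cfg.toState_reg]) hQ

theorem exec_key_true {k l : ℕ} {P Q : Prog} {c c' : Cfg A.Model} {t : ℕ}
    (h : c.kreg k < c.kreg l) (hP : Exec A P c.toState t c'.toState) :
    Exec A (.ifKeyLt k l P Q) c.toState (1 + t) c'.toState := .ifKeyLt_true h hP

theorem exec_key_false {k l : ℕ} {P Q : Prog} {c c' : Cfg A.Model} {t : ℕ}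
    (h : ¬ c.kreg k < c.kreg l) (hQ : Exec A Q c.toState t c'.toState) :
    Exec A (.ifKeyLt k l P Q) c.toState (1 + t) c'.toState := .ifKeyLt_false h hQ

theorem exec_loop_true {r s : ℕ} {P : Prog} {c c' c'' : Cfg A.Model} {t u : ℕ}
    (h : c.reg r < c.reg s) (hP : Exec A P c.toState t c'.toState)
    (hQ : Exec A (loop r s P) c'.toState u c''.toState) :
    Exec A (loop r s P) c.toState (1 + t + u) c''.toState :=
  .while_true (by rwa [Cfg.toState_reg, Cfg.toState_reg]) hP hQ

theorem exec_loop_false {r s : ℕ} {P : Prog} {c : Cfg A.Model}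
    (h : ¬ c.reg r < c.reg s) : Exec A (loop r s P) c.toState 1 c.toState :=
  .while_false (by rwa [Cfg.toState_reg, Cfg.toState_reg])

/-- The instruction that trains a model. -/
def trainProg (s base len a b : ℕ) : Prog := .instr (.train (s + 2) (base + 2) (len + 2) a b)

/-- The instruction that evaluates a model. -/
def estimateProg (s p t a b l u : ℕ) : Prog :=
  .instr (.estimate (s + 2) (p + 2) (t + 2) a b l u)

theorem exec_train (s base len a b : ℕ) (c : Cfg A.Model) {l : List ℝ}
    (hl : (List.range (c.reg len)).map (fun i => rescale (c.kreg a) (c.kreg b)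
      (c.G.data (c.reg base + i))) = l) :
    Exec A (trainProg s base len a b) c.toState (1 + A.trainCost l)
      (c.setG (c.G.setModel (c.reg s) (A.train l))).toState := by
  have h1 : trainingSet c.toState (base + 2) (len + 2) a b = l := by
    simp only [trainingSet, Cfg.toState_reg]
    exact hl
  have := Exec.instr (A := A) (.train (s + 2) (base + 2) (len + 2) a b) c.toState
  simp only [Instr.cost, Instr.apply, h1, Cfg.toState_reg] at this
  exact this

theorem exec_estimate (s p t a b l u : ℕ) (c : Cfg A.Model) {f : A.Model}
    (hf : c.G.model (c.reg s) = some f) {q : ℝ × ℝ}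
    (hq : q = (rescale (c.kreg a) (c.kreg b) (c.kreg l),
      rescale (c.kreg a) (c.kreg b) (c.kreg u) - rescale (c.kreg a) (c.kreg b) (c.kreg l))) :
    Exec A (estimateProg s p t a b l u) c.toState (1 + A.evalCost f q)
      (c.addOut ((c.reg p : ℝ) / c.reg t * A.eval f q)).toState := by
  have h1 : rescaledQuery c.toState a b l u = q := hq.symm
  have hf' : c.toState.mem.model (c.reg s) = some f := hf
  have := Exec.instr (A := A) (.estimate (s + 2) (p + 2) (t + 2) a b l u) c.toState
  simp only [Instr.cost, Instr.apply, h1, Cfg.toState_reg, hf'] at this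
  exact this

end LearnedCE

namespace LearnedCE

/-! ### The invariants of the store -/

namespace Store

variable {α : Type}

theorem set_fld (G : Store α) (f g : Field) (i v : ℕ) :
    (G.set f i v).fld g = if g = f then Function.update (G.fld g) i v else G.fld g := by
  split_ifs with h
  · subst h; exact set_fld_self ..
  · exact set_fld_of_ne _ _ _ h

/-- The search tree in the store. The heights of the nodes are not stored. -/
noncomputable def shape (G : Store α) (ht : ℕ → ℕ) : Shape where
  next := G.fld .glob 0
  root := G.fld .glob 1
  height := G.fld .glob 2
  right := G.fld .right
  down := G.fld .down
  nk := G.fld .nk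
  ht := ht
  lo := G.lo

/-- The number of points of `D` in the interval of the node `i`. -/
noncomputable def count (G : Store α) (ht : ℕ → ℕ) (D : List ℝ) (i : ℕ) : ℕ :=
  D.countP fun y => (G.shape ht).lo i ≤ y ∧ y < (G.shape ht).hi i

open Classical in
/-- The counters in the nodes are correct for `D`, except that the nodes at height `k` and above
count `v` too. -/
def Counts (G : Store α) (ht : ℕ → ℕ) (D : List ℝ) (v : ℝ) (k : ℕ) : Prop :=
  ∀ i, (G.shape ht).Node i → G.fld .cnt i = G.count ht D i +
    if k ≤ ht i ∧ (G.shape ht).lo i ≤ v ∧ v < (G.shape ht).hi i then 1 else 0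

end Store

variable {A : Learner}

/-- The record `i` describes the leaf with end points `a` and `b`. -/
structure LeafInv (M R : ℕ) (G : Store A.Model) (D : List ℝ) (a b : ℝ) (i : ℕ) : Prop where
  atom : G.fld .atom i = D.countP fun x => x = a
  data : ∀ j (h : j < (inside a b D).length), G.data (G.fld .base i + j) = (inside a b D)[j]
  -- This field connects the machine with the probabilistic part: the record agrees with the
  -- abstract leaf around each of its points.
  state : ∀ w, a ≤ w → w < b → leafState M R w D = (a, b, G.fld .trained i)
  model : 0 < G.fld .trained i → G.model i =
    some (A.train (((inside a b D).take (G.fld .trained i)).map (rescale a b)))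

/-- The parts of the invariant that do not depend on the dataset, except for its size `n`. -/
structure TreeInv (M n : ℕ) (G : Store A.Model) (ht : ℕ → ℕ) : Prop where
  valid : (G.shape ht).Valid
  four_le : 4 ≤ G.fld .glob 0
  -- Node 2 remains the leaf that begins at `1`. The cells `0` to `3` of the field `glob` hold the
  -- next free node number, the root, the height, and the base of the last block of data cells that
  -- was assigned.
  ht_two : ht 2 = 0
  lo_two : G.lo 2 = 1
  base_le : ∀ i, G.fld .base i ≤ G.fld .glob 3
  -- Each leaf owns `M + 1` data cells. The leaf that begins at `1` is exempt: its base stays `0`,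
  -- the base of the first leaf, but it never stores anything.
  sep : ∀ i j, (G.shape ht).Node i → (G.shape ht).Node j → ht i = 0 → ht j = 0 → i ≠ j →
    G.lo i < 1 → G.lo j < 1 → G.fld .base i + (M + 1) ≤ G.fld .base j ∨
      G.fld .base j + (M + 1) ≤ G.fld .base i
  last : G.fld .glob 3 + 2 * (M + 1) = (M + 1) * ((G.shape ht).level 0).card
  -- This includes models out of use, which stay in their cells when the training counter of a leaf
  -- is reset; they are charged as space too.
  models : ∀ i f, G.model i = some f → ∃ l : List ℝ, l ≠ [] ∧ l.length ≤ M ∧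
    (∀ y ∈ l, y ∈ Icc (0 : ℝ) 1) ∧ f = A.train l
  blank : ∀ i, G.fld .glob 0 ≤ i → (∀ f, G.fld f i = 0) ∧ G.key i = none ∧ G.model i = none
  -- Used only to bound the space. The three exceptional fields are controlled by the height and the
  -- assigned blocks, by the correctness of the counters, and by `base_le`.
  bound : ∀ f i, f ≠ .glob → f ≠ .cnt → f ≠ .base → G.fld f i ≤ n + G.fld .glob 0
  cnt_zero : G.fld .cnt 0 = 0
  glob_eq_zero : ∀ i, 4 ≤ i → G.fld .glob i = 0

/-- The record of each leaf is correct. -/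
def Leaves (M R : ℕ) (G : Store A.Model) (ht : ℕ → ℕ) (D : List ℝ) : Prop :=
  ∀ i, (G.shape ht).Node i → ht i = 0 →
    LeafInv M R G D ((G.shape ht).lo i) ((G.shape ht).hi i) i

namespace LeafInv

variable {M R : ℕ} {G G' : Store A.Model} {D : List ℝ} {a b : ℝ} {i : ℕ}

theorem good (h : LeafInv M R G D a b i) (h0 : 0 ≤ a) (hab : a < b) (hb : b ≤ 3) :
    GoodLeaf M R a D (a, b, G.fld .trained i) := by
  rw [← h.state a le_rfl hab]
  exact goodLeaf_leafState M R h0 (hab.trans_le hb) D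

theorem congr (h : LeafInv M R G D a b i) (h1 : G'.fld .atom i = G.fld .atom i)
    (h2 : G'.fld .trained i = G.fld .trained i) (h3 : G'.fld .base i = G.fld .base i)
    (h4 : G'.model i = G.model i)
    (h5 : ∀ j < (inside a b D).length, G'.data (G.fld .base i + j) = G.data (G.fld .base i + j)) :
    LeafInv M R G' D a b i := by
  refine ⟨h1.trans h.atom, fun j hj => ?_, fun w hw hw' => ?_, fun hm => ?_⟩
  · rw [h3, h5 j hj]; exact h.data j hj
  · rw [h2]; exact h.state w hw hw'
  · rw [h2] at hm ⊢; rw [h4]; exact h.model hm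

theorem refresh_eq (h : LeafInv M R G D a b i) (h0 : 0 ≤ a) (hab : a < b) (hb : b ≤ 3)
    {D' : List ℝ} (hD : inside a b D' = inside a b D) (w : ℝ) :
    refresh M R w D' (a, b, G.fld .trained i) = (a, b, G.fld .trained i) := by
  have hg := h.good h0 hab hb
  have h1 := hg.card_le
  have h2 := hg.card_le_trained
  simp only at h1 h2
  unfold refresh
  simp only
  rw [hD, if_neg (by omega), if_neg (by omega)]

theorem concat_of_not_mem (h : LeafInv M R G D a b i) (h0 : 0 ≤ a) (hab : a < b) (hb : b ≤ 3)
    {v : ℝ} (hv : ¬ (a ≤ v ∧ v < b)) : LeafInv M R G (D ++ [v]) a b i := by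
  have hD : inside a b (D ++ [v]) = inside a b D := by
    rw [inside_append, inside_singleton_of_not_mem, List.append_nil]
    exact fun h' => hv ⟨h'.1.le, h'.2⟩
  refine ⟨?_, ?_, fun w hw hw' => ?_, ?_⟩
  · rw [List.countP_append, List.countP_singleton, if_neg, h.atom, add_zero]
    simp only [decide_eq_true_eq]
    rintro rfl
    exact hv ⟨le_rfl, hab⟩
  · rw [hD]; exact h.data
  · rw [leafState_concat, h.state w hw hw', h.refresh_eq h0 hab hb hD]
  · rw [hD]; exact h.model

theorem concat_atom (h : LeafInv M R G D a b i) (h0 : 0 ≤ a) (hab : a < b) (hb : b ≤ 3) :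
    LeafInv M R (G.set .atom i (G.fld .atom i + 1)) (D ++ [a]) a b i := by
  have hD : inside a b (D ++ [a]) = inside a b D := by
    rw [inside_append, inside_singleton_of_not_mem, List.append_nil]
    exact fun h' => lt_irrefl _ h'.1
  have e1 : (G.set .atom i (G.fld .atom i + 1)).fld .trained = G.fld .trained := by
    simp [Store.set_fld]
  have e2 : (G.set .atom i (G.fld .atom i + 1)).fld .base = G.fld .base := by
    simp [Store.set_fld]
  refine ⟨?_, ?_, fun w hw hw' => ?_, ?_⟩
  · rw [Store.set_fld_self, Function.update_self, List.countP_append, List.countP_singleton,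
      if_pos (by simp), h.atom]
  · rw [hD, e2]; exact h.data
  · rw [leafState_concat, h.state w hw hw', h.refresh_eq h0 hab hb hD, e1]
  · rw [hD, e1]; exact h.model

end LeafInv

/-! ### Counters -/

namespace Store

variable {α : Type} {G G' : Store α} {ht ht' : ℕ → ℕ} {D : List ℝ} {v : ℝ} {k : ℕ}

/-- The effect of counting a new point at a node. -/
def bump (G : Store α) (i : ℕ) : Store α := G.set .cnt i (G.fld .cnt i + 1)

@[simp] theorem bump_shape (i : ℕ) : (G.bump i).shape ht = G.shape ht := by
  simp [shape, bump, set_fld]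

open Classical in
theorem count_concat (i : ℕ) : G.count ht (D ++ [v]) i = G.count ht D i +
    if (G.shape ht).lo i ≤ v ∧ v < (G.shape ht).hi i then 1 else 0 := by
  simp only [count, List.countP_append, List.countP_singleton, decide_eq_true_eq]

/-- On each level exactly one interval contains the new point, so a single increment on the way down
corrects the whole level. -/
theorem Counts.bump {c : ℕ} (hS : (G.shape ht).Valid) (h : G.Counts ht D v (k + 1))
    (hc : (G.shape ht).Node c) (htc : ht c = k) (h1 : (G.shape ht).lo c ≤ v)
    (h2 : v < (G.shape ht).hi c) : (G.bump c).Counts ht D v k := by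
  classical
  intro i hi
  rw [bump_shape] at hi ⊢
  have hcount : (G.bump c).count ht D i = G.count ht D i := by simp [count]
  rw [hcount]
  have hi' := h i hi
  simp only [Store.bump, set_fld_self, Function.update_apply]
  split_ifs with hic hcond hcond
  · subst hic
    rw [if_neg (by omega)] at hi'
    omega
  · subst hic
    exact absurd ⟨htc.ge, h1, h2⟩ hcond
  · rw [hi', if_pos]
    refine ⟨?_, hcond.2⟩
    rcases hcond.1.eq_or_lt with e | e
    · exact absurd (hS.eq_of_mem hi hc (by simp [shape, ← e, htc]) hcond.2.1 hcond.2.2 h1 h2) hic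
    · exact e
  · rw [hi', if_neg]
    exact fun hh => hcond ⟨by omega, hh.2⟩

/-! ### Splitting an inner node -/

/-- The effect of splitting the child `c` of `x`, which has four children. -/
noncomputable def splitInner (G : Store α) (x c : ℕ) : Store α :=
  let d := G.fld .down c
  let e := G.fld .right d
  let f := G.fld .right e
  let t := G.fld .glob 0
  let n := G.fld .cnt d + G.fld .cnt e
  (((((((((G.set .right t (G.fld .right c)).set .right c t).set .down t f).set .nk c 2).set
    .nk t 2).set .nk x (G.fld .nk x + 1)).setKey t (G.lo f)).set .cnt c n).set
    .cnt t (G.fld .cnt c - n)).set .glob 0 (t + 1)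

/-- The effect of putting a new root on top. -/
noncomputable def growRoot (G : Store α) : Store α :=
  let t := G.fld .glob 0
  let r := G.fld .glob 1
  (((((((G.set .right t 0).set .down t r).set .nk t 1).setKey t 0).set .cnt t
    (G.fld .cnt r)).set .glob 1 t).set .glob 2 (G.fld .glob 2 + 1)).set .glob 0 (t + 1)

end Store

theorem countP_split {D : List ℝ} {a s b : ℝ} (h1 : a ≤ s) (h2 : s ≤ b) :
    D.countP (fun y => a ≤ y ∧ y < b) =
      D.countP (fun y => a ≤ y ∧ y < s) + D.countP (fun y => s ≤ y ∧ y < b) := by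
  induction D with
  | nil => simp
  | cons y D ih =>
    simp only [List.countP_cons, ih, decide_eq_true_eq]
    by_cases hy : y < s
    · have := hy.trans_le h2
      simp only [hy, this, and_true, not_le.2 hy, if_false]
      omega
    · have := h1.trans (not_lt.1 hy)
      simp only [hy, this, and_false, not_lt.1 hy, true_and, if_false]
      omega

/-- The common part of splitting an inner node and of putting a new root on top: one node number is
consumed, while the leaves, their intervals and their records stay as they are. -/
theorem TreeInv.inner {M n : ℕ} {G G' : Store A.Model} {ht ht' : ℕ → ℕ} (h : TreeInv M n G ht)
    (hv : (G'.shape ht').Valid) (hnext : G'.fld .glob 0 = G.fld .glob 0 + 1)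
    (hht : ∀ i, i ≠ G.fld .glob 0 → ht' i = ht i)
    (hlo : ∀ i, i ≠ G.fld .glob 0 → G'.lo i = G.lo i)
    (hlevel : (G'.shape ht').level 0 = (G.shape ht).level 0)
    (hhi : ∀ i ∈ (G.shape ht).level 0, (G'.shape ht').hi i = (G.shape ht).hi i)
    (hatom : G'.fld .atom = G.fld .atom) (htr : G'.fld .trained = G.fld .trained)
    (hbase : G'.fld .base = G.fld .base) (hmodel : G'.model = G.model) (hdata : G'.data = G.data)
    (hlast : G'.fld .glob 3 = G.fld .glob 3)
    (hfar : ∀ i, G.fld .glob 0 < i → (∀ f, G.fld f i = 0 → G'.fld f i = 0) ∧ G'.key i = G.key i)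
    (hbound : ∀ f i, f ≠ .glob → f ≠ .cnt →
      G'.fld f i = G.fld f i ∨ G'.fld f i ≤ n + (G.fld .glob 0 + 1))
    (hcz : G'.fld .cnt 0 = 0) (hgz : ∀ i, 4 ≤ i → G'.fld .glob i = 0) :
    TreeInv M n G' ht' ∧ ∀ R D, Leaves M R G ht D → Leaves M R G' ht' D := by
  have h4 := h.four_le
  have hleaf : ∀ i, (G'.shape ht').Node i → ht' i = 0 → (G.shape ht).Node i ∧ ht i = 0 := by
    intro i hi h0
    have := Shape.mem_level.2 ⟨hi, h0⟩
    rw [hlevel] at this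
    exact Shape.mem_level.1 this
  have hne : ∀ {i}, (G.shape ht).Node i → i ≠ G.fld .glob 0 := fun hi => hi.2.ne
  refine ⟨⟨hv, by omega, by rw [hht _ (by omega), h.ht_two], by rw [hlo _ (by omega), h.lo_two],
    by rw [hbase, hlast]; exact h.base_le, ?_, by rw [hlast, hlevel]; exact h.last,
    by rw [hmodel]; exact h.models, ?_, ?_, hcz, hgz⟩, ?_⟩
  · intro i j hi hj hi0 hj0 hij h1 h2
    obtain ⟨hi, hi0⟩ := hleaf i hi hi0
    obtain ⟨hj, hj0⟩ := hleaf j hj hj0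
    rw [hlo _ (hne hi)] at h1
    rw [hlo _ (hne hj)] at h2
    rw [hbase]
    exact h.sep i j hi hj hi0 hj0 hij h1 h2
  · intro i hi
    rw [hnext] at hi
    obtain ⟨h1, h2, h3⟩ := h.blank i (by omega)
    obtain ⟨k1, k2⟩ := hfar i hi
    exact ⟨fun f => k1 f (h1 f), k2.trans h2, by rw [hmodel]; exact h3⟩
  · intro f i h1 h2 h3
    rw [hnext]
    have := h.bound f i h1 h2 h3
    rcases hbound f i h1 h2 with e | e <;> omega
  · intro R D hL i hi h0
    obtain ⟨hi, h0⟩ := hleaf i hi h0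
    have := hL i hi h0
    rw [hhi i (Shape.mem_level.2 ⟨hi, h0⟩), show (G'.shape ht').lo i = (G.shape ht).lo i from
      hlo i (hne hi)]
    exact this.congr (by rw [hatom]) (by rw [htr]) (by rw [hbase]) (by rw [hmodel])
      (by rw [hdata]; exact fun _ _ => rfl)

/-- The two last children of `c` pass to a new right sibling, which begins at the third child. At
this moment the parent already counts the point under insertion, but `c` and its children do not; so
the counters of the halves can be computed from those of the children. -/
theorem TreeInv.splitInner {M n : ℕ} {G : Store A.Model} {ht : ℕ → ℕ} (h : TreeInv M n G ht)
    {x c k : ℕ} (hx : (G.shape ht).Node x) (hxn : G.fld .nk x ≤ 3) (hc : c ∈ (G.shape ht).kids x)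
    (hht : 0 < ht c) (h4 : G.fld .nk c = 4) {D : List ℝ} {v : ℝ} (hk : G.Counts ht D v (k + 1))
    (hkx : ht x = k + 1) :
    let G' := G.splitInner x c
    let t := G.fld .glob 0
    let ht' := Function.update ht t (ht c)
    TreeInv M n G' ht' ∧ (∀ R D, Leaves M R G ht D → Leaves M R G' ht' D) ∧
      G'.Counts ht' D v (k + 1) ∧
      (G'.shape ht').level 0 = (G.shape ht).level 0 ∧
      (G'.shape ht').hi x = (G.shape ht).hi x ∧
      (G'.shape ht').hi c = (G'.shape ht').lo t ∧
      (G'.shape ht').hi t = (G.shape ht).hi c ∧ G'.fld .glob 2 = G.fld .glob 2 ∧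
      (∀ i, i ≠ t → G'.lo i = G.lo i) ∧ G'.lo t = G.lo (G.fld .right (G.fld .right
        (G.fld .down c))) ∧ (G'.fld .nk x ≤ 4 ∧ G'.fld .nk c = 2 ∧ G'.fld .nk t = 2) := by
  classical
  intro G' t ht'
  have hS := h.valid
  set S := G.shape ht with hSdef
  obtain ⟨hcn, hcht, hlo, hhi⟩ := Shape.mem_kids.1 hc
  obtain ⟨he, hf, hhd, hhe, hcard1, hcard2⟩ := hS.third_child hcn hht h4
  set d := S.down c with hd
  set e := S.right d with he'
  set f := S.right e with hf'
  obtain ⟨hen, heht, helo, hehi⟩ := Shape.mem_kids.1 he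
  obtain ⟨hfn, hfht, hflo, hfhi⟩ := Shape.mem_kids.1 hf
  have hdn := hS.down_node c hcn hht
  have hdht := hS.ht_down c hcn hht
  have hdlo := hS.lo_down c hcn hht
  rw [← hd] at hdn hdht hdlo
  have hde : S.lo d < S.lo e := by have := hS.lo_lt_hi d hdn; rwa [hhd] at this
  have hef : S.lo e < S.lo f := by have := hS.lo_lt_hi e hen; rwa [hhe] at this
  have ht0 : t = S.next := rfl
  have hxt : x ≠ t := hx.2.ne
  have hct : c ≠ t := hcn.2.ne
  have hxc : x ≠ c := by rintro rfl; omega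
  have hc0 : ht c < k + 1 := by change ht c + 1 = ht x at hcht; omega
  have hshape : G'.shape ht' = S.insert c (S.lo f) (Function.update S.down t f)
      (Function.update (Function.update (Function.update S.nk c 2) t 2) x (S.nk x + 1)) := by
    simp [G', Store.shape, Store.splitInner, Shape.insert, Store.set_fld, S, ht', t, f, e, d]
  have hv : (G'.shape ht').Valid := by
    rw [hshape]
    refine Shape.Valid.insert hS hcn hx hcht hlo hhi hxn (hdlo ▸ hde.trans hef) hfhi
      (hS.lo_le f hfn) (fun i hi => Function.update_of_ne hi _ _) (fun _ => ?_) ?_ ?_ (fun _ => ?_)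
    · rw [← ht0, Function.update_self]; exact ⟨hfn, hfht, rfl⟩
    · intro i h1 h2 h3
      rw [Function.update_of_ne h3, Function.update_of_ne (show i ≠ t from h1),
        Function.update_of_ne h2]
    · rw [Function.update_self]
    · refine ⟨?_, ?_, hcard1, hcard2⟩
      · rw [Function.update_of_ne hxc.symm, Function.update_of_ne hct, Function.update_self]
      · rw [← ht0, Function.update_of_ne hxt.symm, Function.update_self]
  have hlevel : (G'.shape ht').level 0 = S.level 0 := by
    ext i
    rw [Shape.mem_level, Shape.mem_level, hshape, Shape.Valid.node_insert (hcn.1.trans hcn.2)]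
    constructor
    · rintro ⟨hi | rfl, h0⟩
      · rw [Shape.Valid.insert_ht hi] at h0; exact ⟨hi, h0⟩
      · rw [Shape.Valid.insert_ht_next] at h0; exact absurd h0 hht.ne'
    · rintro ⟨hi, h0⟩
      rw [Shape.Valid.insert_ht hi]; exact ⟨Or.inl hi, h0⟩
  have hcnt : G'.fld .cnt = Function.update (Function.update (G.fld .cnt) c
      (G.fld .cnt d + G.fld .cnt e)) t (G.fld .cnt c - (G.fld .cnt d + G.fld .cnt e)) := by
    simp [G', Store.splitInner, Store.set_fld, t, d, e, S, Store.shape]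
  -- The first two children are below the height from which `v` is counted, so their counters are
  -- exact for `D`.
  have hsum : G.fld .cnt d + G.fld .cnt e =
      D.countP (fun y => S.lo c ≤ y ∧ y < S.lo f) := by
    have h1 := hk d hdn
    have h2 := hk e hen
    have e1 : ht d + 1 = ht c := hdht
    have e2 : ht e + 1 = ht c := heht
    rw [if_neg (by omega)] at h1 h2
    rw [h1, h2, Store.count, Store.count, countP_split (hdlo ▸ hde.le) hef.le, ← hSdef, hhd, hhe,
      hdlo, add_zero, add_zero]
  have hctot : G.fld .cnt c = D.countP (fun y => S.lo c ≤ y ∧ y < S.lo f) +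
      D.countP (fun y => S.lo f ≤ y ∧ y < S.hi c) := by
    have h1 := hk c hcn
    rw [if_neg (by omega)] at h1
    rw [h1, Store.count, ← countP_split (hdlo ▸ (hde.trans hef).le) hfhi.le]
    rfl
  obtain ⟨T1, T2⟩ := h.inner hv (by simp [G', Store.splitInner])
    (fun i hi => Function.update_of_ne hi _ _)
    (fun i hi => by simp [G', Store.splitInner, hi]) hlevel
    (fun i hi => by
      obtain ⟨h1, h2⟩ := Shape.mem_level.1 hi
      rw [hshape]
      exact Shape.Valid.insert_hi hS h1 (by rintro rfl; exact hht.ne' h2))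
    (by simp [G', Store.splitInner, Store.set_fld]) (by simp [G', Store.splitInner, Store.set_fld])
    (by simp [G', Store.splitInner, Store.set_fld]) rfl rfl
    (by simp [G', Store.splitInner, Store.set_fld])
    (fun i hi => by
      have i1 : i ≠ t := hi.ne'
      have i2 : i ≠ c := by have := hcn.2; intro hh; subst hh; exact lt_asymm hi this
      have i3 : i ≠ x := by have := hx.2; intro hh; subst hh; exact lt_asymm hi this
      have i4 : i ≠ 0 := by omega
      refine ⟨fun g hg => ?_, ?_⟩
      · simp only [G', Store.splitInner]
        cases g <;> simp [Store.set_fld, i2, i3, i4, hg, hi.ne']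
      · simp [G', Store.splitInner, hi.ne'])
    (fun g i hg1 hg2 => by
      have hnx : G.fld .glob 0 = S.next := rfl
      have hf2 : f < G.fld .glob 0 := hfn.2
      have hr2 : G.fld .right c ≤ G.fld .glob 0 := by
        by_cases h0 : S.right c = 0
        · change S.right c ≤ _; omega
        · exact (hS.right_node c hcn h0).2.le
      have h44 := h.four_le
      change f < _ at hf2
      simp only [G', Store.splitInner]
      simp only [f, e, d, S, Store.shape] at hf2
      cases g <;> simp only [Store.set_fld, Store.setKey_fld, Function.update_apply, reduceCtorEq,
        if_true, if_false] <;>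
        first
        | exact absurd rfl hg2
        | exact absurd rfl hg1
        | exact Or.inl trivial
        | (split_ifs <;> omega))
    (by
      have hc0 : 0 ≠ c := hcn.1.ne
      have ht0' : 0 ≠ t := (hcn.1.trans hcn.2).ne
      rw [hcnt, Function.update_of_ne ht0', Function.update_of_ne hc0, h.cnt_zero])
    (fun i hi => by
      have i0 : i ≠ 0 := by omega
      simp [G', Store.splitInner, Store.set_fld, i0, h.glob_eq_zero i hi])
  refine ⟨T1, T2, ?_, hlevel, ?_, ?_, ?_, by simp [G', Store.splitInner, Store.set_fld],
    fun i hi => by simp [G', Store.splitInner, show i ≠ G.fld .glob 0 from hi],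
    by simp [G', Store.splitInner, t], ?_⟩
  · intro i hi
    rw [Store.count]
    rw [hshape, Shape.Valid.node_insert (hcn.1.trans hcn.2)] at hi
    rw [hshape]
    rcases hi with hi | rfl
    · rw [Shape.Valid.insert_lo hi]
      by_cases hic : i = c
      · subst hic
        rw [Shape.Valid.insert_hi_self hcn, hcnt, Function.update_of_ne hct, Function.update_self,
          hsum, if_neg, add_zero]
        simp only [ht']
        rw [Function.update_of_ne hct]
        omega
      · have hit : i ≠ t := hi.2.ne
        rw [Shape.Valid.insert_hi hS hi hic, hcnt, Function.update_of_ne hit,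
          Function.update_of_ne hic, hk i hi]
        have e1 : ht' i = ht i := Function.update_of_ne hit _ _
        simp only [e1]
        rfl
    · rw [Shape.Valid.insert_lo_next, Shape.Valid.insert_hi_next hS hcn, hcnt, ← ht0,
        Function.update_self, hsum, hctot, if_neg]
      · omega
      · simp only [ht']
        rw [Function.update_self]
        omega
  · rw [hshape]; exact Shape.Valid.insert_hi hS hx hxc
  · rw [hshape, Shape.Valid.insert_hi_self hcn, ht0, Shape.Valid.insert_lo_next]
  · rw [hshape, ht0, Shape.Valid.insert_hi_next hS hcn]
  · have e1 : G'.fld .nk = Function.update (Function.update (Function.update (G.fld .nk) c 2) t 2) x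
        (G.fld .nk x + 1) := by
      simp [G', Store.splitInner, Store.set_fld, t]
    rw [e1, Function.update_self, Function.update_of_ne hxc.symm, Function.update_of_ne hct,
      Function.update_self, Function.update_of_ne hxt.symm, Function.update_self]
    exact ⟨by omega, rfl, rfl⟩

/-- No node counts the new point yet, so the new root takes over the counter of the old one, whose
interval is the same. -/
theorem TreeInv.growRoot {M n : ℕ} {G : Store A.Model} {ht : ℕ → ℕ} (h : TreeInv M n G ht)
    (h4 : G.fld .nk (G.fld .glob 1) = 4) {D : List ℝ} {v : ℝ}
    (hk : G.Counts ht D v (G.fld .glob 2 + 1)) :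
    let G' := G.growRoot
    let ht' := Function.update ht (G.fld .glob 0) (G.fld .glob 2 + 1)
    TreeInv M n G' ht' ∧ (∀ R D, Leaves M R G ht D → Leaves M R G' ht' D) ∧
      G'.Counts ht' D v (G.fld .glob 2 + 2) ∧
      (G'.shape ht').level 0 = (G.shape ht).level 0 ∧
      ∀ i, i ≠ G.fld .glob 0 → G'.lo i = G.lo i := by
  classical
  intro G' ht'
  have hS := h.valid
  set S := G.shape ht with hSdef
  have hr := hS.root_node
  have h44 := h.four_le
  have hshape : G'.shape ht' = S.grow := by
    simp [G', Store.shape, Store.growRoot, Shape.grow, Store.set_fld, S, ht']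
  have hv : (G'.shape ht').Valid := by rw [hshape]; exact hS.grow h4
  have hnode : ∀ {i}, S.grow.Node i ↔ S.Node i ∨ i = S.next := by
    have := hr.1.trans hr.2
    intro i; simp only [Shape.Node, Shape.grow]; omega
  have hgt : ∀ {i}, S.Node i → S.grow.ht i = S.ht i := fun h => Function.update_of_ne h.2.ne _ _
  have hgl : ∀ {i}, S.Node i → S.grow.lo i = S.lo i := fun h => Function.update_of_ne h.2.ne _ _
  have hlevel : (G'.shape ht').level 0 = S.level 0 := by
    ext i
    rw [Shape.mem_level, Shape.mem_level, hshape, hnode]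
    constructor
    · rintro ⟨hi | rfl, h0⟩
      · rw [hgt hi] at h0; exact ⟨hi, h0⟩
      · simp [Shape.grow] at h0
    · rintro ⟨hi, h0⟩
      rw [hgt hi]; exact ⟨Or.inl hi, h0⟩
  obtain ⟨T1, T2⟩ := h.inner hv (by simp [G', Store.growRoot])
    (fun i hi => Function.update_of_ne hi _ _)
    (fun i hi => by simp [G', Store.growRoot, hi]) hlevel
    (fun i hi => by rw [hshape]; exact Shape.Valid.grow_hi hS (Shape.mem_level.1 hi).1)
    (by simp [G', Store.growRoot, Store.set_fld]) (by simp [G', Store.growRoot, Store.set_fld])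
    (by simp [G', Store.growRoot, Store.set_fld]) rfl rfl
    (by simp [G', Store.growRoot, Store.set_fld])
    (fun i hi => by
      have i1 : i ≠ G.fld .glob 0 := hi.ne'
      have i4 : i ≠ 0 := by omega
      have i5 : i ≠ 1 := by omega
      have i6 : i ≠ 2 := by omega
      refine ⟨fun g hg => ?_, ?_⟩
      · simp only [G', Store.growRoot]
        cases g <;> simp [Store.set_fld, i4, i5, i6, hg, hi.ne']
      · simp [G', Store.growRoot, hi.ne'])
    (fun g i hg1 hg2 => by
      have hr2 : G.fld .glob 1 < G.fld .glob 0 := hr.2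
      simp only [G', Store.growRoot]
      cases g <;> simp only [Store.set_fld, Store.setKey_fld, Function.update_apply, reduceCtorEq,
        if_true, if_false] <;>
        first
        | exact absurd rfl hg2
        | exact absurd rfl hg1
        | exact Or.inl trivial
        | (split_ifs <;> omega))
    (by
      have h0 : 0 ≠ G.fld .glob 0 := by omega
      simp [G', Store.growRoot, Store.set_fld, h0, h.cnt_zero])
    (fun i hi => by
      have i0 : i ≠ 0 := by omega
      have i1 : i ≠ 1 := by omega
      have i2 : i ≠ 2 := by omega
      simp [G', Store.growRoot, Store.set_fld, i0, i1, i2, h.glob_eq_zero i hi])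
  refine ⟨T1, T2, ?_, hlevel, fun i hi => by
    simp [G', Store.growRoot, hi]⟩
  have hcnt : G'.fld .cnt = Function.update (G.fld .cnt) (G.fld .glob 0)
      (G.fld .cnt (G.fld .glob 1)) := by
    simp [G', Store.growRoot, Store.set_fld]
  intro i hi
  rw [Store.count]
  rw [hshape, hnode] at hi
  rw [hshape]
  rcases hi with hi | rfl
  · have hit : i ≠ G.fld .glob 0 := hi.2.ne
    have hti : ht i ≤ G.fld .glob 2 := hS.ht_le i hi
    rw [hgl hi, Shape.Valid.grow_hi hS hi, hcnt, Function.update_of_ne hit, hk i hi, if_neg,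
      if_neg]
    · rfl
    · simp only [ht']; rw [Function.update_of_ne hit]; omega
    · omega
  · have h1 := hk _ hr
    have hti : ht S.root ≤ G.fld .glob 2 := hS.ht_le _ hr
    rw [if_neg (by omega), Store.count, ← hSdef, hS.lo_root, hS.hi_root] at h1
    have e1 : S.grow.lo S.next = 0 := Function.update_self ..
    have e2 : S.grow.hi S.next = 3 := Shape.hi_of_right_eq_zero (Function.update_self ..)
    rw [e1, e2, hcnt, if_neg, add_zero]
    · have : Function.update (G.fld .cnt) (G.fld .glob 0) (G.fld .cnt (G.fld .glob 1)) S.next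
          = G.fld .cnt S.root := Function.update_self ..
      rw [this, h1, add_zero]
    · have : ht' S.next = G.fld .glob 2 + 1 := Function.update_self ..
      rw [this]; omega

/-- The left end points of the leaves. -/
noncomputable def Store.leafPoints {α : Type} (G : Store α) (ht : ℕ → ℕ) : Finset ℝ :=
  ((G.shape ht).level 0).image G.lo

theorem Store.leafPoints_eq {α : Type} {G G' : Store α} {ht ht' : ℕ → ℕ}
    (h : (G'.shape ht').level 0 = (G.shape ht).level 0)
    (hlo : ∀ i, i ≠ G.fld .glob 0 → G'.lo i = G.lo i) : G'.leafPoints ht' = G.leafPoints ht := by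
  rw [Store.leafPoints, Store.leafPoints, h]
  refine Finset.image_congr fun i hi => hlo i ?_
  exact (Shape.mem_level.1 hi).1.2.ne

theorem TreeInv.bump {M n i : ℕ} {G : Store A.Model} {ht : ℕ → ℕ} (h : TreeInv M n G ht)
    (hi : (G.shape ht).Node i) :
    TreeInv M n (G.bump i) ht ∧ ∀ R D, Leaves M R G ht D → Leaves M R (G.bump i) ht D := by
  have e : ∀ f, f ≠ Field.cnt → (G.bump i).fld f = G.fld f :=
    fun f hf => Store.set_fld_of_ne _ _ _ hf
  refine ⟨⟨by rw [Store.bump_shape]; exact h.valid, by rw [e _ (by simp)]; exact h.four_le,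
    h.ht_two, h.lo_two, by rw [e _ (by simp), e _ (by simp)]; exact h.base_le, ?_, ?_, h.models,
    ?_, ?_, ?_, by rw [e _ (by simp)]; exact h.glob_eq_zero⟩, ?_⟩
  · rw [Store.bump_shape, e _ (by simp)]; exact h.sep
  · rw [Store.bump_shape, e _ (by simp)]; exact h.last
  · intro j hj
    rw [e _ (by simp)] at hj
    have h1 := h.blank j hj
    refine ⟨fun f => ?_, h1.2⟩
    by_cases hf : f = .cnt
    · subst hf
      rw [Store.bump, Store.set_fld_self, Function.update_of_ne, h1.1]
      rintro rfl
      exact absurd hi.2 (not_lt.2 hj)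
    · rw [e f hf, h1.1]
  · intro f j h1 h2 h3
    rw [e f h2, e _ (by simp)]
    exact h.bound f j h1 h2 h3
  · rw [Store.bump, Store.set_fld_self, Function.update_of_ne hi.1.ne, h.cnt_zero]
  · intro R D hL j hj hj0
    rw [Store.bump_shape] at hj ⊢
    exact (hL j hj hj0).congr (by rw [e _ (by simp)]) (by rw [e _ (by simp)])
      (by rw [e _ (by simp)]) rfl (fun _ _ => rfl)

@[simp] theorem Store.bump_leafPoints {α : Type} (G : Store α) (ht : ℕ → ℕ) (i : ℕ) :
    (G.bump i).leafPoints ht = G.leafPoints ht := by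
  rw [Store.leafPoints, Store.leafPoints, Store.bump_shape]; rfl

end LearnedCE

namespace LearnedCE

/-! ### Searching -/

variable {A : Learner}

/-- A program without effect. -/
def skip : Prog := block []

theorem exec_skip (c : Cfg A.Model) : Exec A skip c.toState 1 c.toState := by
  have := Exec.instr (A := A) (.const 0 0) c.toState
  rw [Cfg.toState_const] at this
  exact this

/-- Two configurations differ at most in the key register 4 and the number registers from `m`
to 7. -/
structure Cfg.Frame {α : Type} (m : ℕ) (c c' : Cfg α) : Prop where
  G : c'.G = c.G
  out : c'.out = c.out
  reg : ∀ r, r < m ∨ 8 ≤ r → c'.reg r = c.reg r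
  kreg : ∀ k, k ≠ 4 → c'.kreg k = c.kreg k

theorem Cfg.Frame.trans {α : Type} {m : ℕ} {c c' c'' : Cfg α} (h : c.Frame m c')
    (h' : c'.Frame m c'') : c.Frame m c'' :=
  ⟨h'.G.trans h.G, h'.out.trans h.out, fun r hr => (h'.reg r hr).trans (h.reg r hr),
    fun k hk => (h'.kreg k hk).trans (h.kreg k hk)⟩

theorem Cfg.Frame.mono {α : Type} {m m' : ℕ} {c c' : Cfg α} (h : c.Frame m c') (hm : m' ≤ m) :
    c.Frame m' c' :=
  ⟨h.G, h.out, fun r hr => h.reg r (by omega), h.kreg⟩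

/-- The number of points of `D` to the left of the node `i`. -/
noncomputable def Store.before {α : Type} (G : Store α) (D : List ℝ) (i : ℕ) : ℕ :=
  D.countP fun y => y < G.lo i

theorem countP_lt_add {D : List ℝ} {a b : ℝ} (h : a ≤ b) :
    D.countP (fun y => y < b) = D.countP (fun y => y < a) +
      D.countP (fun y => a ≤ y ∧ y < b) := by
  induction D with
  | nil => simp
  | cons y D ih =>
    simp only [List.countP_cons, ih, decide_eq_true_eq]
    by_cases hy : y < a
    · simp only [hy, hy.trans_le h, not_le.2 hy, false_and, if_true, if_false]; omega
    · simp only [hy, not_lt.1 hy, true_and, if_false]; omega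

theorem Store.before_right {α : Type} {G : Store α} {ht : ℕ → ℕ} (hS : (G.shape ht).Valid) {i : ℕ}
    (hi : (G.shape ht).Node i) (h0 : G.fld .right i ≠ 0) (D : List ℝ) :
    G.before D (G.fld .right i) = G.before D i + G.count ht D i := by
  have h1 := hS.lo_lt_hi i hi
  have h2 : (G.shape ht).hi i = G.lo (G.fld .right i) := Shape.hi_of_right_ne_zero h0
  rw [h2] at h1
  rw [Store.before, countP_lt_add h1.le, Store.before, Store.count, h2]
  rfl

/-- Move from the node in register 4 to the right, unless this passes the key in `kv`. Register 7
counts the points that are passed. -/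
def stepProg (kv : ℕ) : Prog :=
  .seq (block [.get 5 .right 4])
    (branch 0 5 (.seq (block [.getKey 4 5])
      (.ifKeyLt kv 4 skip (block [.get 6 .cnt 4, .add 7 7 6, .add 4 5 0]))) skip)

/-- The claim about register 7 is conditional on exact counters, because insertions use the same
search while the counters are only partly updated, and they ignore the rank. Key register 4 is
scratch space, so it cannot hold the key that is searched for. -/
theorem exec_step {kv : ℕ} (hkv : kv ≠ 4) {c : Cfg A.Model} {ht : ℕ → ℕ}
    (hS : (c.G.shape ht).Valid) (hn : (c.G.shape ht).Node (c.reg 4)) (h0 : c.reg 0 = 0) :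
    ∃ t c', Exec A (stepProg kv) c.toState t c'.toState ∧ t ≤ 50 ∧ c.Frame 4 c' ∧
      c'.reg 4 = (c.G.shape ht).stepRight (c.kreg kv) (c.reg 4) ∧
      (c.G.shape ht).Node (c'.reg 4) ∧
      ∀ D : List ℝ, (∀ i, (c.G.shape ht).Node i → c.G.fld .cnt i = c.G.count ht D i) →
        c.reg 7 = c.G.before D (c.reg 4) → c'.reg 7 = c.G.before D (c'.reg 4) := by
  obtain ⟨t1, e1, b1⟩ := exec_block (A := A) [.get 5 .right 4] c
  set c1 := effs [.get 5 .right 4] c with hc1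
  simp only [List.length_cons, List.length_nil] at b1
  have g1 : c1.G = c.G := rfl
  have r5 : c1.reg 5 = c.G.fld .right (c.reg 4) := by simp [hc1, Op.eff, Cfg.setReg_reg]
  have r4 : c1.reg 4 = c.reg 4 := by simp [hc1, Op.eff, Cfg.setReg_reg]
  have r0 : c1.reg 0 = 0 := by simp [hc1, Op.eff, Cfg.setReg_reg, h0]
  have f1 : c.Frame 4 c1 := by
    refine ⟨rfl, rfl, fun r hr => ?_, fun k hk => rfl⟩
    simp only [hc1, effs_cons, effs_nil, Op.eff, Cfg.setReg_reg]
    rw [if_neg (by omega)]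
  by_cases hr : c.G.fld .right (c.reg 4) = 0
  · refine ⟨_, c1, e1.seq (exec_branch_false (by rw [r0, r5, hr]; exact lt_irrefl _)
      (exec_skip c1)), by omega, f1, ?_, by rwa [r4], fun D _ h7 => ?_⟩
    · rw [r4, Shape.stepRight, if_neg]
      exact fun h => h.1 hr
    · rw [r4, ← h7]; simp [hc1, Op.eff, Cfg.setReg_reg]
  · obtain ⟨t2, e2, b2⟩ := exec_block (A := A) [.getKey 4 5] c1
    set c2 := effs [.getKey 4 5] c1 with hc2
    simp only [List.length_cons, List.length_nil] at b2
    have g2 : c2.G = c.G := rfl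
    have s5 : c2.reg 5 = c.G.fld .right (c.reg 4) := r5
    have s4 : c2.reg 4 = c.reg 4 := r4
    have kk : c2.kreg kv = c.kreg kv := by
      simp [hc2, Op.eff, Cfg.setKreg_kreg, hkv]; rfl
    have k4 : c2.kreg 4 = c.G.lo (c.G.fld .right (c.reg 4)) := by
      simp [hc2, Op.eff, Cfg.setKreg_kreg, r5, g1]
    have f2 : c.Frame 4 c2 := by
      refine f1.trans ⟨rfl, rfl, fun r _ => rfl, fun k hk => ?_⟩
      simp [hc2, Op.eff, Cfg.setKreg_kreg, hk]
    by_cases hv : c.kreg kv < c.G.lo (c.G.fld .right (c.reg 4))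
    · refine ⟨_, c2, e1.seq (exec_branch_true (by rw [r0, r5]; omega)
        (e2.seq (exec_key_true (by rw [kk, k4]; exact hv) (exec_skip c2)))), by omega, f2, ?_,
        by rwa [s4], fun D _ h7 => ?_⟩
      · rw [s4, Shape.stepRight, if_neg]
        exact fun h => absurd hv (not_lt.2 h.2)
      · rw [s4, ← h7]; simp [hc2, hc1, Op.eff, Cfg.setReg_reg]
    · obtain ⟨t3, e3, b3⟩ := exec_block (A := A) [.get 6 .cnt 4, .add 7 7 6, .add 4 5 0] c2
      set c3 := effs [.get 6 .cnt 4, .add 7 7 6, .add 4 5 0] c2 with hc3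
      simp only [List.length_cons, List.length_nil] at b3
      have u4 : c3.reg 4 = c.G.fld .right (c.reg 4) := by
        have : c2.reg 0 = 0 := r0
        simp [hc3, Op.eff, Cfg.setReg_reg, s5, this]
      have f3 : c.Frame 4 c3 := by
        refine f2.trans ⟨rfl, rfl, fun r hr => ?_, fun k hk => rfl⟩
        simp only [hc3, effs_cons, effs_nil, Op.eff, Cfg.setReg_reg]
        rw [if_neg (by omega), if_neg (by omega), if_neg (by omega)]
      refine ⟨_, c3, e1.seq (exec_branch_true (by rw [r0, r5]; omega)
        (e2.seq (exec_key_false (by rw [kk, k4]; exact hv) e3))), by omega, f3, ?_, ?_,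
        fun D hD h7 => ?_⟩
      · rw [u4, Shape.stepRight, if_pos]
        · rfl
        · exact ⟨hr, not_lt.1 hv⟩
      · rw [u4]; exact hS.right_node _ hn hr
      · rw [u4, Store.before_right hS hn hr, ← hD _ hn, ← h7]
        have : c2.reg 7 = c.reg 7 := by simp [hc2, hc1, Op.eff, Cfg.setReg_reg]
        simp [hc3, Op.eff, Cfg.setReg_reg, this, s4, g2]

/-- Move from the node in register 2 to its child around the key in `kv`; put it into
register 4. -/
def findProg (kv : ℕ) : Prog :=
  .seq (block [.get 4 .down 2]) (.seq (stepProg kv) (.seq (stepProg kv) (stepProg kv)))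

theorem exec_find {kv : ℕ} (hkv : kv ≠ 4) {c : Cfg A.Model} {ht : ℕ → ℕ}
    (hS : (c.G.shape ht).Valid) (hn : (c.G.shape ht).Node (c.reg 2)) (h0 : c.reg 0 = 0)
    (hpos : 0 < ht (c.reg 2)) :
    ∃ t c', Exec A (findProg kv) c.toState t c'.toState ∧ t ≤ 160 ∧ c.Frame 4 c' ∧
      c'.reg 4 = (c.G.shape ht).child (c.kreg kv) (c.reg 2) ∧
      ∀ D : List ℝ, (∀ i, (c.G.shape ht).Node i → c.G.fld .cnt i = c.G.count ht D i) →
        c.reg 7 = c.G.before D (c.reg 2) → c'.reg 7 = c.G.before D (c'.reg 4) := by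
  obtain ⟨t1, e1, b1⟩ := exec_block (A := A) [.get 4 .down 2] c
  set c1 := effs [.get 4 .down 2] c with hc1
  simp only [List.length_cons, List.length_nil] at b1
  have g1 : c1.G = c.G := rfl
  have r4 : c1.reg 4 = c.G.fld .down (c.reg 2) := by simp [hc1, Op.eff, Cfg.setReg_reg]
  have r7 : c1.reg 7 = c.reg 7 := by simp [hc1, Op.eff, Cfg.setReg_reg]
  have f1 : c.Frame 4 c1 := by
    refine ⟨rfl, rfl, fun r hr => ?_, fun k hk => rfl⟩
    simp only [hc1, effs_cons, effs_nil, Op.eff, Cfg.setReg_reg]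
    rw [if_neg (by omega)]
  have n1 : (c1.G.shape ht).Node (c1.reg 4) := by
    rw [g1, r4]; exact hS.down_node _ hn hpos
  obtain ⟨t2, c2, e2, b2, f2, r2, n2, a2⟩ := exec_step hkv (c := c1) (ht := ht) (g1 ▸ hS) n1
    (by rw [f1.reg 0 (by omega), h0])
  have g2 : c2.G = c.G := f2.G.trans g1
  have f2' := f1.trans f2
  obtain ⟨t3, c3, e3, b3, f3, r3, n3, a3⟩ := exec_step hkv (c := c2) (ht := ht) (g2 ▸ hS)
    (by rw [g2, ← g1]; exact n2) (by rw [f2'.reg 0 (by omega), h0])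
  have g3 : c3.G = c.G := f3.G.trans g2
  have f3' := f2'.trans f3
  obtain ⟨t4, c4, e4, b4, f4, r4', n4, a4⟩ := exec_step hkv (c := c3) (ht := ht) (g3 ▸ hS)
    (by rw [g3, ← g2]; exact n3) (by rw [f3'.reg 0 (by omega), h0])
  refine ⟨_, c4, e1.seq (e2.seq (e3.seq e4)), by omega, f3'.trans f4, ?_, fun D hD h7 => ?_⟩
  · rw [r4', r3, r2, r4, g1, g2, g3, f1.kreg kv hkv, f2'.kreg kv hkv, f3'.kreg kv hkv]
    rfl
  · have h1 : c1.reg 7 = c1.G.before D (c1.reg 4) := by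
      rw [r7, h7, r4, g1, Store.before, Store.before]
      have : c.G.lo (c.G.fld .down (c.reg 2)) = c.G.lo (c.reg 2) := hS.lo_down _ hn hpos
      rw [this]
    have h2 := a2 D (g1 ▸ hD) h1
    rw [g1, ← g2] at h2
    have h3 := a3 D (g2 ▸ hD) h2
    rw [g2, ← g3] at h3
    have h4 := a4 D (g3 ▸ hD) h3
    rwa [g3] at h4

/-- Move from the root to the leaf around the key in `kv`; put it into register 2. -/
def descendProg (kv : ℕ) : Prog :=
  .seq (block [.get 2 .glob 1, .const 4 2, .get 3 .glob 4, .const 7 0])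
    (loop 0 3 (.seq (findProg kv) (block [.add 2 4 0, .sub 3 3 1])))

theorem exec_descend_loop {kv : ℕ} (hkv : kv ≠ 4) {ht : ℕ → ℕ} {D : List ℝ} (k : ℕ) :
    ∀ {c : Cfg A.Model}, (c.G.shape ht).Valid → (c.G.shape ht).Node (c.reg 2) → c.reg 0 = 0 →
    c.reg 1 = 1 → ht (c.reg 2) = k → c.reg 3 = k → (c.G.shape ht).lo (c.reg 2) ≤ c.kreg kv →
    c.kreg kv < (c.G.shape ht).hi (c.reg 2) → c.kreg kv < 3 →
    (∀ i, (c.G.shape ht).Node i → c.G.fld .cnt i = c.G.count ht D i) →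
    c.reg 7 = c.G.before D (c.reg 2) →
    ∃ t c', Exec A (loop 0 3 (.seq (findProg kv) (block [.add 2 4 0, .sub 3 3 1])))
        c.toState t c'.toState ∧ t ≤ 180 * k + 1 ∧ c.Frame 2 c' ∧
      (c.G.shape ht).Node (c'.reg 2) ∧ ht (c'.reg 2) = 0 ∧
      (c.G.shape ht).lo (c'.reg 2) ≤ c.kreg kv ∧ c.kreg kv < (c.G.shape ht).hi (c'.reg 2) ∧
      c'.reg 7 = c.G.before D (c'.reg 2) := by
  induction k with
  | zero =>
    intro c hS hn h0 h1 hht h3 hlo hhi hv hD h7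
    exact ⟨1, c, exec_loop_false (by rw [h0, h3]; exact lt_irrefl _), by omega,
      ⟨rfl, rfl, fun _ _ => rfl, fun _ _ => rfl⟩, hn, hht, hlo, hhi, h7⟩
  | succ k ih =>
    intro c hS hn h0 h1 hht h3 hlo hhi hv hD h7
    obtain ⟨t1, c1, e1, b1, f1, r4, a1⟩ := exec_find hkv hS hn h0 (by omega)
    obtain ⟨m1, m2, m3⟩ := hS.child_spec hn (by simp only [Store.shape]; omega) hlo hhi hv
    rw [← r4] at m1 m2 m3
    obtain ⟨n1, n2, -, -⟩ := Shape.mem_kids.1 m1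
    obtain ⟨t2, e2, b2⟩ := exec_block (A := A) [.add 2 4 0, .sub 3 3 1] c1
    set c2 := effs [.add 2 4 0, .sub 3 3 1] c1 with hc2
    simp only [List.length_cons, List.length_nil] at b2
    have g2 : c2.G = c.G := f1.G
    have f2 : c.Frame 2 c2 := by
      refine (f1.mono (by norm_num)).trans ⟨rfl, rfl, fun r hr => ?_, fun k hk => rfl⟩
      simp only [hc2, effs_cons, effs_nil, Op.eff, Cfg.setReg_reg]
      rw [if_neg (by omega), if_neg (by omega)]
    have s0 : c1.reg 0 = 0 := by rw [f1.reg 0 (by omega), h0]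
    have s2 : c2.reg 2 = c1.reg 4 := by simp [hc2, Op.eff, Cfg.setReg_reg, s0]
    have s3 : c2.reg 3 = k := by
      have h3' := f1.reg 3 (by omega)
      have h1' := f1.reg 1 (by omega)
      simp [hc2, Op.eff, Cfg.setReg_reg, h3', h1', h3, h1]
    have s7 : c2.reg 7 = c1.reg 7 := by simp [hc2, Op.eff, Cfg.setReg_reg]
    have kv2 := f2.kreg kv hkv
    obtain ⟨t3, c3, e3, b3, f3, p1, p2, p3, p4, p5⟩ := ih (c := c2) (g2 ▸ hS)
      (by rw [g2, s2]; exact n1) (by rw [f2.reg 0 (by omega), h0])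
      (by rw [f2.reg 1 (by omega), h1])
      (by rw [s2]; simp only [Store.shape] at n2; omega) s3
      (by rw [g2, s2, kv2]; exact m2) (by rw [g2, s2, kv2]; exact m3) (by rw [kv2]; exact hv)
      (g2 ▸ hD) (by rw [g2, s7, s2]; exact a1 D hD h7)
    rw [g2] at p1 p3 p4 p5
    rw [kv2] at p3 p4
    exact ⟨_, c3, exec_loop_true (by rw [h0, h3]; omega) (e1.seq e2) e3, by omega, f2.trans f3,
      p1, p2, p3, p4, p5⟩

/-- The rank starts correctly at `0`: the root begins at `0`, and no data point is negative. -/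
theorem exec_descend {kv : ℕ} (hkv : kv ≠ 4) {c : Cfg A.Model} {ht : ℕ → ℕ} {D : List ℝ}
    (hS : (c.G.shape ht).Valid) (h0 : c.reg 0 = 0) (h1 : c.reg 1 = 1) (hv0 : 0 ≤ c.kreg kv)
    (hv : c.kreg kv < 3) (hD : ∀ i, (c.G.shape ht).Node i → c.G.fld .cnt i = c.G.count ht D i)
    (hD0 : ∀ x ∈ D, 0 ≤ x) :
    ∃ t c', Exec A (descendProg kv) c.toState t c'.toState ∧
      t ≤ 180 * c.G.fld .glob 2 + 40 ∧ c.Frame 2 c' ∧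
      (c.G.shape ht).Node (c'.reg 2) ∧ ht (c'.reg 2) = 0 ∧
      (c.G.shape ht).lo (c'.reg 2) ≤ c.kreg kv ∧ c.kreg kv < (c.G.shape ht).hi (c'.reg 2) ∧
      c'.reg 7 = c.G.before D (c'.reg 2) := by
  obtain ⟨t1, e1, b1⟩ := exec_block (A := A)
    [.get 2 .glob 1, .const 4 2, .get 3 .glob 4, .const 7 0] c
  set c1 := effs [.get 2 .glob 1, .const 4 2, .get 3 .glob 4, .const 7 0] c with hc1
  simp only [List.length_cons, List.length_nil] at b1
  have g1 : c1.G = c.G := rfl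
  have f1 : c.Frame 2 c1 := by
    refine ⟨rfl, rfl, fun r hr => ?_, fun k hk => rfl⟩
    simp only [hc1, effs_cons, effs_nil, Op.eff, Cfg.setReg_reg]
    rw [if_neg (by omega), if_neg (by omega), if_neg (by omega), if_neg (by omega)]
  have s2 : c1.reg 2 = (c.G.shape ht).root := by
    simp [hc1, Op.eff, Cfg.setReg_reg, h1, Store.shape]
  have s3 : c1.reg 3 = c.G.fld .glob 2 := by simp [hc1, Op.eff, Cfg.setReg_reg]
  have s7 : c1.reg 7 = 0 := by simp [hc1, Op.eff, Cfg.setReg_reg]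
  have kv1 : c1.kreg kv = c.kreg kv := rfl
  obtain ⟨t3, c3, e3, b3, f3, p1, p2, p3, p4, p5⟩ := exec_descend_loop (A := A) hkv (D := D)
    (c.G.fld .glob 2) (c := c1) (ht := ht) hS (by rw [s2]; exact hS.root_node)
    (by rw [f1.reg 0 (by omega), h0]) (by rw [f1.reg 1 (by omega), h1])
    (by rw [s2]; exact hS.ht_root) s3
    (by rw [g1, s2, kv1, hS.lo_root]; exact hv0) (by rw [g1, s2, kv1, hS.hi_root]; exact hv) hv hD
    (by
      have e : c.G.lo (c.G.shape ht).root = 0 := hS.lo_root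
      rw [s7, g1, s2, Store.before, e, eq_comm, List.countP_eq_zero]
      intro x hx
      simpa using hD0 x hx)
  exact ⟨_, c3, e1.seq e3, by omega, f1.trans f3, p1, p2, p3, p4, p5⟩

end LearnedCE

namespace LearnedCE

/-! ### Queries -/

variable {A : Learner}

theorem countP_interval {a b : ℝ} (h : a < b) (D : List ℝ) :
    D.countP (fun x => a ≤ x ∧ x < b) = D.countP (fun x => x = a) + (inside a b D).length := by
  rw [length_inside]
  refine countP_eq_add (fun x => ?_) (fun x hx h' => ?_)
  · constructor
    · rintro ⟨h1, h2⟩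
      exact h1.eq_or_lt.imp Eq.symm fun h1 => ⟨h1, h2⟩
    · rintro (rfl | ⟨h1, h2⟩)
      · exact ⟨le_rfl, h⟩
      · exact ⟨h1.le, h2⟩
  · exact h'.1.ne' hx

theorem Store.count_eq {α : Type} {G : Store α} {ht : ℕ → ℕ} {D : List ℝ} {i : ℕ}
    (h : (G.shape ht).lo i < (G.shape ht).hi i) :
    G.count ht D i = D.countP (fun x => x = (G.shape ht).lo i) +
      (inside ((G.shape ht).lo i) ((G.shape ht).hi i) D).length := countP_interval h D

/-- Output the estimate for the leaf in register `ri`, with end points in `ka` and `kb`, and the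
query with end points in `kl` and `ku`. -/
def estProg (ri ka kb kl ku : ℕ) : Prog :=
  .seq (block [.get 14 .cnt ri, .get 15 .atom ri, .sub 14 14 15, .get 15 .trained ri])
    (branch 0 15 (estimateProg ri 14 15 ka kb kl ku) skip)

/-- `τ` bounds the cost of the evaluation of the models of at most `M` points. -/
def EvalBound (A : Learner) (M : ℕ) (τ : ℝ) : Prop :=
  0 ≤ τ ∧ ∀ l : List ℝ, l ≠ [] → l.length ≤ M → (∀ y ∈ l, y ∈ Icc (0 : ℝ) 1) →
    ∀ q, IsQuery q → (A.evalCost (A.train l) q : ℝ) ≤ τ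

/-- The number of inner points is not stored; it is the counter of the leaf minus the multiplicity
of its left end point. A leaf without training contributes zero, in agreement with division by zero
in `leafEstimate`; so right end points need to be known only for leaves with a model. -/
theorem exec_est {ri ka kb kl ku M R n : ℕ} (hri : ri < 14) {c : Cfg A.Model} {G : Store A.Model}
    {ht : ℕ → ℕ} {D : List ℝ} {τ l u : ℝ} (hτ : EvalBound A M τ) (hG : TreeInv M n G ht)
    (hfld : c.G.fld = G.fld) (hmodel : c.G.model = G.model) (h0 : c.reg 0 = 0)
    (hn : (G.shape ht).Node (c.reg ri))
    (hL : LeafInv M R G D ((G.shape ht).lo (c.reg ri)) ((G.shape ht).hi (c.reg ri)) (c.reg ri))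
    (hcnt : G.fld .cnt (c.reg ri) = G.count ht D (c.reg ri))
    (ha : c.kreg ka = (G.shape ht).lo (c.reg ri))
    (hb : 0 < G.fld .trained (c.reg ri) → c.kreg kb = (G.shape ht).hi (c.reg ri))
    (hl : c.kreg kl = max l ((G.shape ht).lo (c.reg ri)))
    (hu : 0 < G.fld .trained (c.reg ri) → c.kreg ku = min u ((G.shape ht).hi (c.reg ri)))
    (hlu : c.kreg kl ≤ c.kreg ku) :
    ∃ (t : ℕ) (c' : Cfg A.Model), Exec A (estProg ri ka kb kl ku) c.toState t c'.toState ∧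
      (t : ℝ) ≤ 40 + τ ∧
      c'.G = c.G ∧ (∀ r, r < 14 → c'.reg r = c.reg r) ∧ c'.kreg = c.kreg ∧
      c'.out = c.out + leafEstimate A l u ((G.shape ht).lo (c.reg ri),
        (G.shape ht).hi (c.reg ri), G.fld .trained (c.reg ri))
        (inside ((G.shape ht).lo (c.reg ri)) ((G.shape ht).hi (c.reg ri)) D) := by
  obtain ⟨t1, e1, b1⟩ := exec_block (A := A)
    [.get 14 .cnt ri, .get 15 .atom ri, .sub 14 14 15, .get 15 .trained ri] c
  set c1 := effs [.get 14 .cnt ri, .get 15 .atom ri, .sub 14 14 15, .get 15 .trained ri] c with hc1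
  simp only [List.length_cons, List.length_nil] at b1
  set i := c.reg ri with hi
  set a := (G.shape ht).lo i
  set b := (G.shape ht).hi i
  have hab : a < b := hG.valid.lo_lt_hi i hn
  have f1 : ∀ r, r < 14 → c1.reg r = c.reg r := by
    intro r hr
    simp only [hc1, effs_cons, effs_nil, Op.eff, Cfg.setReg_reg]
    rw [if_neg (by omega), if_neg (by omega), if_neg (by omega), if_neg (by omega)]
  have n14 : ri ≠ 14 := by omega
  have n15 : ri ≠ 15 := by omega
  have s14 : c1.reg 14 = (inside a b D).length := by
    have : c1.reg 14 = c.G.fld .cnt i - c.G.fld .atom i := by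
      simp [hc1, Op.eff, Cfg.setReg_reg, n14, ← hi]
    have hc : G.count ht D i = D.countP (fun x => x = a) + (inside a b D).length :=
      Store.count_eq hab
    rw [this, hfld, hcnt, hL.atom, hc]
    omega
  have s15 : c1.reg 15 = G.fld .trained i := by
    simp [hc1, Op.eff, Cfg.setReg_reg, n14, n15, ← hi, hfld]
  have k1 : c1.kreg = c.kreg := rfl
  have b1' : (t1 : ℝ) ≤ 33 := by exact_mod_cast (by omega : t1 ≤ 33)
  by_cases h : 0 < G.fld .trained i
  · have hm := hL.model h
    obtain ⟨z, z1, z2, z3, z4⟩ := hG.models _ _ hm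
    have e2 := exec_estimate (A := A) ri 14 15 ka kb kl ku c1 (f := A.train z)
      (by rw [f1 ri hri, ← hi, ← z4, ← hm]; exact congrFun hmodel i) rfl
    have hq : leafQuery a b l u = (rescale (c1.kreg ka) (c1.kreg kb) (c1.kreg kl),
        rescale (c1.kreg ka) (c1.kreg kb) (c1.kreg ku) -
          rescale (c1.kreg ka) (c1.kreg kb) (c1.kreg kl)) := by
      rw [leafQuery, k1, ha, hb h, hl, hu h]
    have hq' : IsQuery (leafQuery a b l u) := by
      refine isQuery_rescale hab (le_max_right _ _) ?_ (min_le_right _ _)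
      rw [← hl, ← hu h]; exact hlu
    rw [← hq] at e2
    refine ⟨_, _, e1.seq (exec_branch_true (by rw [f1 0 (by norm_num), h0, s15]; exact h) e2),
      ?_, rfl, fun r hr => f1 r hr, rfl, ?_⟩
    · push_cast
      have := hτ.2 z z1 z2 z3 _ hq'
      linarith
    · rw [Cfg.addOut_out, s14, s15, leafEstimate, z4]
      rfl
  · have h' : G.fld .trained i = 0 := by omega
    refine ⟨_, _, e1.seq (exec_branch_false (by rw [f1 0 (by norm_num), h0, s15]; exact h)
      (exec_skip c1)), ?_, rfl, fun r hr => f1 r hr, rfl, ?_⟩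
    · push_cast
      have := hτ.1
      linarith
    · rw [h', leafEstimate]
      simp; rfl

/-- Output the number of points at the left end point of the leaf in register 10, which is in the
key register 5, if the query matches it. -/
def atomProg : Prog :=
  .ifKeyLt 5 0 skip (block [.get 14 .atom 10, .output 14])

theorem exec_atom (c : Cfg A.Model) :
    ∃ (t : ℕ) (c' : Cfg A.Model), Exec A atomProg c.toState t c'.toState ∧ t ≤ 20 ∧
      c'.G = c.G ∧ (∀ r, r < 14 → c'.reg r = c.reg r) ∧ c'.kreg = c.kreg ∧
      c'.out = c.out + if c.kreg 5 < c.kreg 0 then 0 else (c.G.fld .atom (c.reg 10) : ℝ) := by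
  by_cases h : c.kreg 5 < c.kreg 0
  · exact ⟨_, c, exec_key_true h (exec_skip c), by norm_num, rfl, fun _ _ => rfl, rfl,
      by rw [if_pos h, add_zero]⟩
  · obtain ⟨t1, e1, b1⟩ := exec_block (A := A) [.get 14 .atom 10, .output 14] c
    simp only [List.length_cons, List.length_nil] at b1
    refine ⟨_, _, exec_key_false h e1, by omega, rfl, fun r hr => ?_, rfl, ?_⟩
    · simp only [effs_cons, effs_nil, Op.eff, Cfg.setReg_reg, Cfg.addOut_reg]
      rw [if_neg (by omega)]
    · rw [if_neg h]
      simp [Op.eff, Cfg.setReg_reg]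

/-- The program for queries of a nonempty estimator. -/
def queryMain : Prog :=
  .seq (descendProg 0) (.seq (block [.add 10 2 0, .add 11 7 0]) (.seq (descendProg 1)
    (.seq (block [.add 12 2 0, .add 13 7 0, .getKey 5 10, .get 14 .right 10, .getKey 6 14,
        .getKey 7 12, .get 14 .right 12, .getKey 8 14])
      (.seq atomProg (.ifKeyLt 5 7
        (.seq (estProg 10 5 6 0 6) (.seq (block [.get 14 .cnt 10, .add 14 14 11, .sub 14 13 14,
          .output 14, .get 14 .atom 12, .output 14]) (estProg 12 7 8 7 1)))
        (estProg 10 5 6 0 1))))))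

/-- The right end of a leaf is read off as the key of its right neighbour. The leaf without a
neighbour is the one that begins at `1`; it has no inner points, hence no training set. -/
theorem leaf_hi_eq {M R n : ℕ} {G : Store A.Model} {ht : ℕ → ℕ} {D : List ℝ}
    (hG : TreeInv M n G ht) (hL : Leaves M R G ht D) (hD : ∀ x ∈ D, x ∈ Icc (0 : ℝ) 1) {i : ℕ}
    (hi : (G.shape ht).Node i) (hi0 : ht i = 0) (hm : 0 < G.fld .trained i) :
    G.lo (G.fld .right i) = (G.shape ht).hi i := by
  have hS := hG.valid
  by_cases h0 : G.fld .right i = 0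
  · exfalso
    have h2 : (G.shape ht).Node 2 := 
      ⟨by norm_num, hG.four_le.trans_lt' (by norm_num)⟩
    have hhi : (G.shape ht).hi i = 3 := Shape.hi_of_right_eq_zero h0
    have e2 : (G.shape ht).lo 2 = 1 := hG.lo_two
    have h22 := hS.lo_lt_hi 2 h2
    rw [e2] at h22
    have := hS.eq_of_mem (v := 1) hi h2 (hi0.trans hG.ht_two.symm) (hS.lo_le i hi)
      (by rw [hhi]; norm_num) e2.le h22
    subst this
    have hg := (hL 2 hi hi0).good (hS.lo_nonneg 2 hi) (by rw [e2]; exact h22) (hS.hi_le hi)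
    have h3 := hg.trained_le
    simp only [hhi, e2] at h3
    have : inside 1 3 D = [] := by
      rw [inside, List.filter_eq_nil_iff]
      intro x hx
      have := (hD x hx).2
      simp only [decide_eq_true_eq, not_and, not_lt]
      intro h; linarith
    rw [this] at h3
    simp at h3
    omega
  · exact (Shape.hi_of_right_ne_zero (S := G.shape ht) h0).symm

/-- Two descents yield the outer leaves and their ranks, and the difference of the ranks gives the
exact middle part. The configuration has to agree with `G` only in fields, keys and models, since
queries do not see the stored data. -/
theorem exec_queryMain {M R n : ℕ} {c : Cfg A.Model} {G : Store A.Model}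
    {ht : ℕ → ℕ} {D : List ℝ} {τ : ℝ} (hτ : EvalBound A M τ) (hG : TreeInv M n G ht)
    (hL : Leaves M R G ht D) (hD : ∀ x ∈ D, x ∈ Icc (0 : ℝ) 1)
    (hcnt : ∀ i, (G.shape ht).Node i → G.fld .cnt i = G.count ht D i)
    (hfld : c.G.fld = G.fld) (hkey : c.G.key = G.key) (hmodel : c.G.model = G.model)
    (h0 : c.reg 0 = 0) (h1 : c.reg 1 = 1) (hout : c.out = 0) (hl : 0 ≤ c.kreg 0)
    (hlu : c.kreg 0 ≤ c.kreg 1) (hu : c.kreg 1 < 3) :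
    ∃ (t : ℕ) (c' : Cfg A.Model), Exec A queryMain c.toState t c'.toState ∧
      (t : ℝ) ≤ 360 * G.fld .glob 2 + 2 * τ + 400 ∧
      c'.out = rangeEstimate A M R D (c.kreg 0) (c.kreg 1) := by
  have hS := hG.valid
  have hlo : c.G.lo = G.lo := by unfold Store.lo; rw [hkey]
  have hshape : c.G.shape ht = G.shape ht := by unfold Store.shape; rw [hfld, hlo]
  have hcount : ∀ i, c.G.count ht D i = G.count ht D i := by
    intro i; unfold Store.count; rw [hshape]
  have hbefore : ∀ i, c.G.before D i = G.before D i := by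
    intro i; unfold Store.before; rw [hlo]
  have hcnt' : ∀ i, (c.G.shape ht).Node i → c.G.fld .cnt i = c.G.count ht D i := by
    intro i hi; rw [hshape] at hi; rw [hfld, hcount]; exact hcnt i hi
  have hD0 : ∀ x ∈ D, 0 ≤ x := fun x hx => (hD x hx).1
  obtain ⟨t1, c1, e1, b1, f1, p1, p2, p3, p4, p5⟩ := exec_descend (kv := 0) (by norm_num) (c := c)
    (ht := ht) (D := D) (hshape ▸ hS) h0 h1 hl (hlu.trans_lt hu) hcnt' hD0
  rw [hshape] at p1 p3 p4
  rw [hbefore] at p5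
  obtain ⟨t2, e2, b2⟩ := exec_block (A := A) [.add 10 2 0, .add 11 7 0] c1
  set c2 := effs [.add 10 2 0, .add 11 7 0] c1 with hc2
  simp only [List.length_cons, List.length_nil] at b2
  have s10 : c2.reg 10 = c1.reg 2 := by
    simp [hc2, Op.eff, Cfg.setReg_reg, f1.reg 0 (by norm_num), h0]
  have s11 : c2.reg 11 = c1.reg 7 := by
    simp [hc2, Op.eff, Cfg.setReg_reg, f1.reg 0 (by norm_num), h0]
  have s0 : c2.reg 0 = 0 := by
    simp [hc2, Op.eff, Cfg.setReg_reg, f1.reg 0 (by norm_num), h0]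
  have s1 : c2.reg 1 = 1 := by
    simp [hc2, Op.eff, Cfg.setReg_reg, f1.reg 1 (by norm_num), h1]
  have k2 : ∀ k, k ≠ 4 → c2.kreg k = c.kreg k := f1.kreg
  have g2 : c2.G = c.G := f1.G
  have o2 : c2.out = 0 := f1.out.trans hout
  obtain ⟨t3, c3, e3, b3, f3, q1, q2, q3, q4, q5⟩ := exec_descend (kv := 1) (by norm_num) (c := c2)
    (ht := ht) (D := D) (by rw [g2, hshape]; exact hS) s0 s1
    (by rw [k2 1 (by norm_num)]; exact hl.trans hlu) (by rw [k2 1 (by norm_num)]; exact hu)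
    (by rw [g2]; exact hcnt') hD0
  rw [g2, hfld] at b3
  rw [hfld] at b1
  rw [g2, hshape] at q1 q3 q4
  rw [k2 1 (by norm_num)] at q3 q4
  rw [g2, hbefore] at q5
  set i := c1.reg 2 with hi
  set j := c3.reg 2 with hj
  have g3 : c3.G = c.G := f3.G.trans g2
  obtain ⟨t4, e4, b4⟩ := exec_block (A := A) [.add 12 2 0, .add 13 7 0, .getKey 5 10,
    .get 14 .right 10, .getKey 6 14, .getKey 7 12, .get 14 .right 12, .getKey 8 14] c3
  set c4 := effs [.add 12 2 0, .add 13 7 0, .getKey 5 10,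
    .get 14 .right 10, .getKey 6 14, .getKey 7 12, .get 14 .right 12, .getKey 8 14] c3 with hc4
  simp only [List.length_cons, List.length_nil] at b4
  have z3 : c3.reg 0 = 0 := (f3.reg 0 (by norm_num)).trans s0
  have z10 : c3.reg 10 = i := (f3.reg 10 (by norm_num)).trans s10
  have z11 : c3.reg 11 = c1.reg 7 := (f3.reg 11 (by norm_num)).trans s11
  have g4 : c4.G = c.G := g3
  have o4 : c4.out = 0 := f3.out.trans o2
  have w0 : c4.reg 0 = 0 := by simp [hc4, Op.eff, Cfg.setReg_reg, z3]
  have w10 : c4.reg 10 = i := by simp [hc4, Op.eff, Cfg.setReg_reg, z10]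
  have w11 : c4.reg 11 = c1.reg 7 := by simp [hc4, Op.eff, Cfg.setReg_reg, z11]
  have w12 : c4.reg 12 = j := by simp [hc4, Op.eff, Cfg.setReg_reg, z3, hj]
  have w13 : c4.reg 13 = c3.reg 7 := by simp [hc4, Op.eff, Cfg.setReg_reg, z3]
  have v5 : c4.kreg 5 = (G.shape ht).lo i := by
    simp [hc4, Op.eff, Cfg.setReg_reg, Cfg.setKreg_kreg, z10, g3, hlo]; rfl
  have v6 : c4.kreg 6 = G.lo (G.fld .right i) := by
    simp [hc4, Op.eff, Cfg.setReg_reg, Cfg.setKreg_kreg, z10, g3, hlo, hfld]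
  have v7 : c4.kreg 7 = (G.shape ht).lo j := by
    simp [hc4, Op.eff, Cfg.setReg_reg, Cfg.setKreg_kreg, z3, ← hj, g3, hlo]; rfl
  have v8 : c4.kreg 8 = G.lo (G.fld .right j) := by
    simp [hc4, Op.eff, Cfg.setReg_reg, Cfg.setKreg_kreg, z3, ← hj, g3, hlo, hfld]
  have v0 : c4.kreg 0 = c.kreg 0 := by
    rw [← k2 0 (by norm_num), ← f3.kreg 0 (by norm_num)]
    simp [hc4, Op.eff, Cfg.setKreg_kreg]
  have v1 : c4.kreg 1 = c.kreg 1 := by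
    rw [← k2 1 (by norm_num), ← f3.kreg 1 (by norm_num)]
    simp [hc4, Op.eff, Cfg.setKreg_kreg]
  obtain ⟨t5, c5, e5, b5, g5, w5, k5, o5⟩ := exec_atom c4
  rw [g4] at g5
  rw [v5, v0, o4, zero_add, g4, w10, hfld] at o5
  have hLi := hL i p1 p2
  have hLj := hL j q1 q2
  have hsi : leafState M R (c.kreg 0) D = _ := hLi.state _ p3 p4
  have hsj : leafState M R (c.kreg 1) D = _ := hLj.state _ q3 q4
  set l := c.kreg 0 with hldef
  set u := c.kreg 1 with hudef
  set ai := (G.shape ht).lo i with hai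
  set bi := (G.shape ht).hi i with hbi
  set aj := (G.shape ht).lo j with haj
  set bj := (G.shape ht).hi j with hbj
  have b1' : (t1 : ℝ) ≤ 180 * G.fld .glob 2 + 40 := by exact_mod_cast b1
  have b3' : (t3 : ℝ) ≤ 180 * G.fld .glob 2 + 40 := by exact_mod_cast b3
  have b2' : (t2 : ℝ) ≤ 17 := by exact_mod_cast b2
  have b4' : (t4 : ℝ) ≤ 65 := by exact_mod_cast b4
  have b5' : (t5 : ℝ) ≤ 20 := by exact_mod_cast b5
  have hτ0 := hτ.1
  have x0 : c5.reg 0 = 0 := (w5 0 (by norm_num)).trans w0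
  have x10 : c5.reg 10 = i := (w5 10 (by norm_num)).trans w10
  have hatom : (if ai < l then 0 else (G.fld .atom i : ℝ)) =
      if ai < l then 0 else (D.countP fun x => x = ai : ℝ) := by rw [hLi.atom]
  rw [hatom] at o5
  by_cases hij : ai < aj
  · have hbiaj : bi ≤ aj := hS.sep i j p1 q1 (p2.trans q2.symm) hij
    have hl_bi : l ≤ bi := p4.le
    obtain ⟨t6, c6, e6, b6, g6, w6, k6, o6⟩ := exec_est (ri := 10) (ka := 5) (kb := 6) (kl := 0)
      (ku := 6) (R := R) (D := D) (l := l) (u := u) (by norm_num) (c := c5) hτ hG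
      (by rw [g5, hfld]) (by rw [g5, hmodel]) x0 (by rw [x10]; exact p1) (by rw [x10]; exact hLi)
      (by rw [x10]; exact hcnt i p1) (by rw [x10, k5, v5])
      (by rw [x10, k5, v6]; exact leaf_hi_eq hG hL hD p1 p2)
      (by rw [x10, k5, v0, ← hai, max_eq_left p3])
      (by
        rw [x10, k5, v6, ← hbi, min_eq_right (hbiaj.trans q3)]
        exact leaf_hi_eq hG hL hD p1 p2)
      (by
        rw [k5, v0, v6]
        by_cases h00 : G.fld .right i = 0
        · have : bi = 3 := Shape.hi_of_right_eq_zero h00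
          have := hS.lo_le j q1
          linarith
        · have : bi = _ := Shape.hi_of_right_ne_zero h00
          exact hl_bi.trans this.le)
    rw [x10, o5] at o6
    obtain ⟨t7, e7, b7⟩ := exec_block (A := A) [.get 14 .cnt 10, .add 14 14 11, .sub 14 13 14,
          .output 14, .get 14 .atom 12, .output 14] c6
    set c7 := effs [.get 14 .cnt 10, .add 14 14 11, .sub 14 13 14,
          .output 14, .get 14 .atom 12, .output 14] c6 with hc7
    simp only [List.length_cons, List.length_nil] at b7
    have b7' : (t7 : ℝ) ≤ 49 := by exact_mod_cast b7
    have y10 : c6.reg 10 = i := (w6 10 (by norm_num)).trans x10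
    have y11 : c6.reg 11 = G.before D i := by
      rw [w6 11 (by norm_num), w5 11 (by norm_num), w11, p5]
    have y12 : c6.reg 12 = j := by rw [w6 12 (by norm_num), w5 12 (by norm_num), w12]
    have y13 : c6.reg 13 = G.before D j := by
      rw [w6 13 (by norm_num), w5 13 (by norm_num), w13, q5]
    have g6' : c6.G = c.G := g6.trans g5
    -- The rank of the second leaf, minus all points up to the end of the first one. The truncated
    -- subtraction is exact because the first leaf lies to the left of the second.
    have hcount2 : G.before D j - (G.count ht D i + G.before D i) =
        D.countP fun x => bi ≤ x ∧ x < aj := by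
      have h1 : G.before D j = D.countP fun y => y < aj := rfl
      have h2 : D.countP (fun y => y < bi) = G.before D i + G.count ht D i :=
        countP_lt_add (hS.lo_lt_hi i p1).le
      rw [h1, countP_lt_add hbiaj, h2]
      omega
    have hcount3 : D.countP (fun x => bi ≤ x ∧ x ≤ aj) =
        D.countP (fun x => bi ≤ x ∧ x < aj) + D.countP fun x => x = aj := by
      refine countP_eq_add (fun x => ?_) (fun x hx h' => hx.2.ne h')
      constructor
      · rintro ⟨h1, h2⟩
        exact h2.lt_or_eq.imp (fun h2 => ⟨h1, h2⟩) id
      · rintro (⟨h1, h2⟩ | rfl)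
        · exact ⟨h1, h2.le⟩
        · exact ⟨hbiaj, le_rfl⟩
    have o7 : c7.out = c6.out + (D.countP fun x => bi ≤ x ∧ x ≤ aj : ℝ) := by
      have : c7.out = c6.out + ((G.before D j -
          (G.fld .cnt i + G.before D i) : ℕ)) + (G.fld .atom j : ℝ) := by
        simp [hc7, Op.eff, Cfg.setReg_reg, y10, y11, y12, y13, g6', hfld]
      rw [this, hcnt i p1, hcount2, hLj.atom, hcount3]
      push_cast; ring
    have u0 : c7.reg 0 = 0 := by
      simp [hc7, Op.eff, Cfg.setReg_reg, w6 0 (by norm_num), x0]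
    have u12 : c7.reg 12 = j := by
      simp [hc7, Op.eff, Cfg.setReg_reg, y12]
    have k7 : c7.kreg = c4.kreg := k6.trans k5
    obtain ⟨t8, c8, e8, b8, g8, w8, k8, o8⟩ := exec_est (ri := 12) (ka := 7) (kb := 8) (kl := 7)
      (ku := 1) (R := R) (D := D) (l := l) (u := u) (by norm_num) (c := c7) hτ hG
      (by change c6.G.fld = _; rw [g6', hfld]) (by change c6.G.model = _; rw [g6', hmodel]) u0
      (by rw [u12]; exact q1) (by rw [u12]; exact hLj)
      (by rw [u12]; exact hcnt j q1) (by rw [u12, k7, v7])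
      (by rw [u12, k7, v8]; exact leaf_hi_eq hG hL hD q1 q2)
      (by rw [u12, k7, v7, ← haj, max_eq_right (hl_bi.trans hbiaj)])
      (by rw [u12, k7, v1, ← hbj, min_eq_left q4.le]; exact fun _ => rfl)
      (by rw [k7, v7, v1]; exact q3)
    rw [u12, o7, o6] at o8
    refine ⟨_, c8, e1.seq (e2.seq (e3.seq (e4.seq (e5.seq (exec_key_true
      (by rw [k5, v5, v7]; exact hij) (e6.seq (e7.seq e8))))))), ?_, ?_⟩
    · push_cast
      linarith
    · rw [o8, rangeEstimate, hsi, hsj]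
      simp only
      rw [if_pos hij]
      ring
  · have heq : i = j := by
      rcases lt_or_eq_of_le (not_lt.1 hij) with h | h
      · have := hS.sep j i q1 p1 (q2.trans p2.symm) h
        have h3 : bj ≤ ai := this
        linarith
      · exact hS.inj i j p1 q1 (p2.trans q2.symm) h.symm
    obtain ⟨t6, c6, e6, b6, g6, w6, k6, o6⟩ := exec_est (ri := 10) (ka := 5) (kb := 6) (kl := 0)
      (ku := 1) (R := R) (D := D) (l := l) (u := u) (by norm_num) (c := c5) hτ hG
      (by rw [g5, hfld]) (by rw [g5, hmodel]) x0 (by rw [x10]; exact p1) (by rw [x10]; exact hLi)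
      (by rw [x10]; exact hcnt i p1) (by rw [x10, k5, v5])
      (by rw [x10, k5, v6]; exact leaf_hi_eq hG hL hD p1 p2)
      (by rw [x10, k5, v0, ← hai, max_eq_left p3])
      (by
        have : u < bi := by rw [hbi, heq]; exact q4
        rw [x10, k5, v1, ← hbi, min_eq_left this.le]; exact fun _ => rfl)
      (by rw [k5, v0, v1]; exact hlu)
    rw [x10, o5] at o6
    refine ⟨_, c6, e1.seq (e2.seq (e3.seq (e4.seq (e5.seq (exec_key_false
      (by rw [k5, v5, v7]; exact hij) e6))))), ?_, ?_⟩
    · push_cast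
      linarith
    · rw [o6, rangeEstimate, hsi, hsj]
      simp only
      rw [if_neg hij, add_zero]

/-- The program for queries. -/
def queryProg : Prog :=
  .seq (block [.const 1 1, .get 8 .glob 0]) (branch 0 8 queryMain skip)

end LearnedCE

namespace LearnedCE

/-! ### The initial tree -/

variable {A : Learner}

/-- The store with two empty leaves, one of which is for the points that are at least 1. -/
noncomputable def Store.initial (α : Type) : Store α :=
  (((((((((Store.blank α).set .right 1 2).set .down 3 1).set .nk 3 2).set .glob 1 3).set
    .glob 2 1).setKey 1 0).setKey 2 1).setKey 3 0).set .glob 0 4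

/-- Nodes 1 and 2 are the leaves that begin at `0` and `1`, and node 3 is the root. All bases are
`0`, which the formula in `last` accommodates by subtracting two blocks. -/
theorem initial_invariant (A : Learner) (M R : ℕ) (v : ℝ) :
    let G := Store.initial A.Model
    let ht : ℕ → ℕ := fun i => if i = 3 then 1 else 0
    TreeInv M 0 G ht ∧ Leaves M R G ht [] ∧ G.Counts ht [] v (G.fld .glob 2 + 1) ∧
      G.leafPoints ht = {0, 1} := by
  classical
  intro G ht
  have fr : G.fld .right = Function.update (fun _ => 0) 1 2 := by
    simp [G, Store.initial, Store.set_fld, Store.blank]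
  have fd : G.fld .down = Function.update (fun _ => 0) 3 1 := by
    simp [G, Store.initial, Store.set_fld, Store.blank]
  have fn : G.fld .nk = Function.update (fun _ => 0) 3 2 := by
    simp [G, Store.initial, Store.set_fld, Store.blank]
  have fg : G.fld .glob = Function.update (Function.update (Function.update (fun _ => 0) 1 3) 2 1)
      0 4 := by
    simp [G, Store.initial, Store.set_fld, Store.blank]
  have fz : ∀ f, f ≠ .right → f ≠ .down → f ≠ .nk → f ≠ .glob → G.fld f = fun _ => 0 := by
    intro f h1 h2 h3 h4
    simp [G, Store.initial, Store.set_fld, Store.blank, h1, h2, h3, h4]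
  have fl : G.lo =
      Function.update (Function.update (Function.update (fun _ => 0) 1 0) 2 1) 3 0 := by
    simp only [G, Store.initial, Store.set_lo, Store.setKey_lo]
    rfl
  have l1 : G.lo 1 = 0 := by simp [fl]
  have l2 : G.lo 2 = 1 := by simp [fl]
  have l3 : G.lo 3 = 0 := by simp [fl]
  have r1 : G.fld .right 1 = 2 := by simp [fr]
  have r2 : G.fld .right 2 = 0 := by simp [fr]
  have r3 : G.fld .right 3 = 0 := by simp [fr]
  have h1 : (G.shape ht).hi 1 = 1 := by
    rw [Shape.hi_of_right_ne_zero (by simp [Store.shape, fr])]; simp [Store.shape, fr, l2]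
  have h2 : (G.shape ht).hi 2 = 3 := Shape.hi_of_right_eq_zero r2
  have h3 : (G.shape ht).hi 3 = 3 := Shape.hi_of_right_eq_zero r3
  have hl : (G.shape ht).lo = G.lo := rfl
  have hr : (G.shape ht).right = G.fld .right := rfl
  have hd : (G.shape ht).down = G.fld .down := rfl
  have hk : (G.shape ht).nk = G.fld .nk := rfl
  have hht : (G.shape ht).ht = ht := rfl
  have t1 : ht 1 = 0 := rfl
  have t2 : ht 2 = 0 := rfl
  have t3 : ht 3 = 1 := rfl
  have g0 : G.fld .glob 0 = 4 := by simp [fg]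
  have g1 : G.fld .glob 1 = 3 := by simp [fg]
  have g2 : G.fld .glob 2 = 1 := by simp [fg]
  have g3 : G.fld .glob 3 = 0 := by simp [fg]
  have hroot : (G.shape ht).root = 3 := g1
  have hheight : (G.shape ht).height = 1 := g2
  have hnode : ∀ i, (G.shape ht).Node i ↔ i = 1 ∨ i = 2 ∨ i = 3 := by
    intro i; simp only [Shape.Node, Store.shape, g0]; omega
  have hkids : (G.shape ht).kids 3 = {1, 2} := by
    ext j
    rw [Shape.mem_kids, hnode, hht, hl, h3, l3, t3]
    simp only [Finset.mem_insert, Finset.mem_singleton]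
    constructor
    · rintro ⟨rfl | rfl | rfl, h, -⟩
      · simp
      · simp
      · simp [t3] at h
    · rintro (rfl | rfl)
      · rw [l1, t1]; norm_num
      · rw [l2, t2]; norm_num
  have d3 : G.fld .down 3 = 1 := by simp [fd]
  have n3 : G.fld .nk 3 = 2 := by simp [fn]
  have hlevel : (G.shape ht).level 0 = {1, 2} := by
    ext j
    rw [Shape.mem_level, hnode, hht]
    simp only [Finset.mem_insert, Finset.mem_singleton]
    constructor
    · rintro ⟨rfl | rfl | rfl, h⟩
      · simp
      · simp
      · simp [t3] at h
    · rintro (rfl | rfl) <;> simp [t1, t2]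
  have hv : (G.shape ht).Valid := by
    constructor
    · rw [hnode, hroot]; simp
    · rw [hroot, hht, hheight, t3]
    · rw [hheight]
    · intro i hi; rw [hnode] at hi; rw [hht, hheight]; rcases hi with rfl | rfl | rfl <;> simp [ht]
    · intro i hi h; rw [hnode] at hi; rw [hht, hheight] at h; rw [hroot]
      rcases hi with rfl | rfl | rfl <;> simp_all
    · rw [hroot, hl, l3]
    · intro i hi; rw [hnode] at hi; rw [hl]
      rcases hi with rfl | rfl | rfl <;> simp [l1, l2, l3]
    · intro i hi; rw [hnode] at hi; rw [hl]
      rcases hi with rfl | rfl | rfl <;> simp [l1, l2, l3]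
    · intro i j hi hj h h'; rw [hnode] at hi hj; rw [hht] at h; rw [hl] at h'
      rcases hi with rfl | rfl | rfl <;> rcases hj with rfl | rfl | rfl <;> simp_all
    · intro i hi h; rw [hnode] at hi ⊢; rw [hr] at h ⊢
      rcases hi with rfl | rfl | rfl <;> simp_all
    · intro i hi h; rw [hnode] at hi; rw [hr] at h ⊢; rw [hht]
      rcases hi with rfl | rfl | rfl <;> simp_all
    · intro i hi; rw [hnode] at hi; rw [hl]
      rcases hi with rfl | rfl | rfl
      · rw [l1, h1]; norm_num
      · rw [l2, h2]; norm_num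
      · rw [l3, h3]; norm_num
    · intro i j hi hj h h'; rw [hnode] at hi hj; rw [hht] at h; rw [hl] at h' ⊢
      rcases hi with rfl | rfl | rfl <;> rcases hj with rfl | rfl | rfl <;>
        first
        | (rw [h1, l2])
        | (exfalso; simp [ht] at h; done)
        | (exfalso; simp [l1, l2, l3] at h'; done)
        | (exfalso; linarith)
    · intro i hi h; rw [hnode] at hi ⊢; rw [hht] at h; rw [hd]
      rcases hi with rfl | rfl | rfl <;> simp_all
    · intro i hi h; rw [hnode] at hi; rw [hht] at h ⊢; rw [hd]
      rcases hi with rfl | rfl | rfl <;> simp_all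
    · intro i hi h; rw [hnode] at hi; rw [hht] at h; rw [hd, hl]
      rcases hi with rfl | rfl | rfl <;> simp_all
    · intro i hi h; rw [hnode] at hi; rw [hht] at h; rw [hk]
      rcases hi with rfl | rfl | rfl
      · simp [t1] at h
      · simp [t2] at h
      · rw [hkids, n3]; rfl
    · intro i hi h; rw [hnode] at hi; rw [hht] at h; rw [hk]
      rcases hi with rfl | rfl | rfl
      · simp [t1] at h
      · simp [t2] at h
      · rw [n3]; norm_num
    · intro i hi h h'; rw [hnode] at hi; rw [hht] at h; rw [hroot] at h'
      rcases hi with rfl | rfl | rfl <;> simp_all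
  refine ⟨⟨hv, g0.ge, t2, l2, ?_, ?_, ?_, ?_, ?_, ?_, by
    rw [fz .cnt (by simp) (by simp) (by simp) (by simp)], fun i hi => by
    rw [fg, Function.update_of_ne (by omega), Function.update_of_ne (by omega),
      Function.update_of_ne (by omega)]⟩, ?_, ?_, ?_⟩
  · intro i; rw [fz .base (by simp) (by simp) (by simp) (by simp)]; exact Nat.zero_le _
  · intro i j hi hj hi0 hj0 hij hi1 hj1
    rw [hnode] at hi hj
    rcases hi with rfl | rfl | rfl <;> rcases hj with rfl | rfl | rfl <;> simp_all
  · rw [g3, hlevel]; simp; ring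
  · intro i f h; cases h
  · intro i hi
    rw [g0] at hi
    refine ⟨fun f => ?_, ?_, rfl⟩
    · have i0 : i ≠ 0 := by omega
      have i1 : i ≠ 1 := by omega
      have i2 : i ≠ 2 := by omega
      have i3 : i ≠ 3 := by omega
      by_cases k1 : f = .right
      · subst k1; simp [fr, i1]
      by_cases k2 : f = .down
      · subst k2; simp [fd, i3]
      by_cases k3 : f = .nk
      · subst k3; simp [fn, i3]
      by_cases k4 : f = .glob
      · subst k4; simp [fg, i0, i1, i2]
      · rw [fz f k1 k2 k3 k4]
    · have i1 : i ≠ 1 := by omega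
      have i2 : i ≠ 2 := by omega
      have i3 : i ≠ 3 := by omega
      simp [G, Store.initial, i1, i2, i3, Store.blank]
  · intro f i h1 h2 h3
    rw [g0]
    by_cases k1 : f = .right
    · subst k1; simp only [fr, Function.update_apply]; split_ifs <;> omega
    by_cases k2 : f = .down
    · subst k2; simp only [fd, Function.update_apply]; split_ifs <;> omega
    by_cases k3 : f = .nk
    · subst k3; simp only [fn, Function.update_apply]; split_ifs <;> omega
    · rw [fz f k1 k2 k3 h1]; exact Nat.zero_le _
  · intro i hi hi0
    rw [hnode] at hi
    rw [hl]
    have z1 : G.fld .atom = fun _ => 0 := fz _ (by simp) (by simp) (by simp) (by simp)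
    have z2 : G.fld .trained = fun _ => 0 := fz _ (by simp) (by simp) (by simp) (by simp)
    refine ⟨by rw [z1]; rfl, fun j h => absurd h (by simp [inside]), ?_, by rw [z2]; simp⟩
    intro w hw hw'
    rw [leafState_nil, z2]
    rcases hi with rfl | rfl | rfl
    · rw [l1] at hw ⊢; rw [h1] at hw' ⊢; rw [if_pos hw']
    · rw [l2] at hw ⊢; rw [h2] at hw' ⊢; rw [if_neg (not_lt.2 hw)]
    · simp [t3] at hi0
  · intro i hi
    rw [fz .cnt (by simp) (by simp) (by simp) (by simp), Store.count]
    rw [hnode] at hi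
    rw [g2, if_neg]
    · rfl
    · rcases hi with rfl | rfl | rfl <;> simp [ht]
  · rw [Store.leafPoints, hlevel, Finset.image_insert, Finset.image_singleton, l1, l2]

end LearnedCE

namespace LearnedCE

/-! ### Insertion: the way to the leaf -/

variable {A : Learner}

/-- The registers that hold constants during an insertion of the point `v`. -/
structure Cfg.Ready {α : Type} (c : Cfg α) (v : ℝ) : Prop where
  r0 : c.reg 0 = 0
  r1 : c.reg 1 = 1
  r8 : c.reg 8 = 2
  r9 : c.reg 9 = 3
  k0 : c.kreg 0 = v
  k2 : c.kreg 2 = 0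
  k3 : c.kreg 3 = 1

theorem Cfg.Frame.ready {α : Type} {c c' : Cfg α} {v : ℝ} {m : ℕ} (h : c.Frame m c')
    (hc : c.Ready v) (hm : 2 ≤ m) : c'.Ready v :=
  ⟨by rw [h.reg 0 (by omega), hc.r0], by rw [h.reg 1 (by omega), hc.r1],
    by rw [h.reg 8 (by omega), hc.r8], by rw [h.reg 9 (by omega), hc.r9],
    by rw [h.kreg 0 (by omega), hc.k0], by rw [h.kreg 2 (by omega), hc.k2],
    by rw [h.kreg 3 (by omega), hc.k3]⟩

/-- During the insertion of `v`, the node in register 2 is reached, at the height `k`. -/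
structure Path (M R : ℕ) (D : List ℝ) (v : ℝ) (k : ℕ) (ht : ℕ → ℕ) (c : Cfg A.Model) : Prop where
  ready : c.Ready v
  tree : TreeInv M D.length c.G ht
  leaves : Leaves M R c.G ht D
  counts : c.G.Counts ht D v k
  node : (c.G.shape ht).Node (c.reg 2)
  ht_eq : ht (c.reg 2) = k
  r3 : c.reg 3 = k
  lo_le : (c.G.shape ht).lo (c.reg 2) ≤ v
  lt_hi : v < (c.G.shape ht).hi (c.reg 2)
  nk_le : c.G.fld .nk (c.reg 2) ≤ 3

/-- Split the child in register 4 of the node in register 2. Continue in the half around the new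
point. -/
def splitProg : Prog :=
  .seq (block [.get 10 .down 4, .get 11 .right 10, .get 12 .right 11, .get 13 .glob 0,
    .get 14 .right 4, .get 15 .nk 2, .add 15 15 1, .get 16 .cnt 10, .get 17 .cnt 11,
    .add 16 16 17, .get 17 .cnt 4, .sub 17 17 16, .getKey 4 12, .add 18 13 1, .put .right 13 14,
    .put .right 4 13, .put .down 13 12, .put .nk 4 8, .put .nk 13 8, .put .nk 2 15, .putKey 13 4,
    .put .cnt 4 16, .put .cnt 13 17, .put .glob 0 18])
  (.ifKeyLt 0 4 skip (block [.add 4 13 0]))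

theorem exec_split {c : Cfg A.Model} {v : ℝ} (hc : c.Ready v) :
    ∃ (t : ℕ) (c' : Cfg A.Model), Exec A splitProg c.toState t c'.toState ∧ t ≤ 210 ∧
      c'.Ready v ∧ c'.G = c.G.splitInner (c.reg 2) (c.reg 4) ∧ c'.reg 2 = c.reg 2 ∧
      c'.reg 3 = c.reg 3 ∧ c'.reg 4 = if v < c.G.lo (c.G.fld .right (c.G.fld .right
        (c.G.fld .down (c.reg 4)))) then c.reg 4 else c.G.fld .glob 0 := by
  set ops : List Op := [.get 10 .down 4, .get 11 .right 10, .get 12 .right 11, .get 13 .glob 0,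
    .get 14 .right 4, .get 15 .nk 2, .add 15 15 1, .get 16 .cnt 10, .get 17 .cnt 11,
    .add 16 16 17, .get 17 .cnt 4, .sub 17 17 16, .getKey 4 12, .add 18 13 1, .put .right 13 14,
    .put .right 4 13, .put .down 13 12, .put .nk 4 8, .put .nk 13 8, .put .nk 2 15, .putKey 13 4,
    .put .cnt 4 16, .put .cnt 13 17, .put .glob 0 18] with hops
  obtain ⟨t1, e1, b1⟩ := exec_block (A := A) ops c
  set c1 := effs ops c with hc1
  have b1' : t1 ≤ 193 := b1
  have hG : c1.G = c.G.splitInner (c.reg 2) (c.reg 4) := by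
    simp [hc1, hops, Op.eff, Cfg.setReg_reg, Cfg.setKreg_kreg, Store.splitInner, hc.r0, hc.r1,
      hc.r8]
  have s4 : c1.reg 4 = c.reg 4 := by simp [hc1, hops, Op.eff, Cfg.setReg_reg]
  have s2 : c1.reg 2 = c.reg 2 := by simp [hc1, hops, Op.eff, Cfg.setReg_reg]
  have s3 : c1.reg 3 = c.reg 3 := by simp [hc1, hops, Op.eff, Cfg.setReg_reg]
  have s13 : c1.reg 13 = c.G.fld .glob 0 := by
    simp [hc1, hops, Op.eff, Cfg.setReg_reg, hc.r0]
  have k4 : c1.kreg 4 = c.G.lo (c.G.fld .right (c.G.fld .right (c.G.fld .down (c.reg 4)))) := by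
    simp [hc1, hops, Op.eff, Cfg.setReg_reg, Cfg.setKreg_kreg]
  have hr : c1.Ready v := by
    constructor <;> simp [hc1, hops, Op.eff, Cfg.setReg_reg, Cfg.setKreg_kreg, hc.r0, hc.r1,
      hc.r8, hc.r9, hc.k0, hc.k2, hc.k3]
  by_cases h : v < c.G.lo (c.G.fld .right (c.G.fld .right (c.G.fld .down (c.reg 4))))
  · refine ⟨_, c1, e1.seq (exec_key_true (by rw [hr.k0, k4]; exact h) (exec_skip c1)), by omega, hr,
      hG, s2, s3, by rw [if_pos h, s4]⟩
  · obtain ⟨t2, e2, b2⟩ := exec_block (A := A) [.add 4 13 0] c1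
    simp only [List.length_cons, List.length_nil] at b2
    refine ⟨_, _, e1.seq (exec_key_false (by rw [hr.k0, k4]; exact h) e2), by omega, ?_, hG, ?_,
      ?_, ?_⟩
    · constructor <;> simp [Op.eff, Cfg.setReg_reg, hr.r0, hr.r1,
        hr.r8, hr.r9, hr.k0, hr.k2, hr.k3]
    · simp [Op.eff, Cfg.setReg_reg, s2]
    · simp [Op.eff, Cfg.setReg_reg, s3]
    · rw [if_neg h]; simp [Op.eff, Cfg.setReg_reg, s13, hr.r0]

/-- One level of the way to the leaf. -/
def levelProg : Prog :=
  .seq (findProg 0) (.seq (block [.get 5 .nk 4, .const 6 4]) (.seq (branch 5 6 skip splitProg)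
    (block [.get 6 .cnt 4, .add 6 6 1, .put .cnt 4 6, .add 2 4 0, .sub 3 3 1])))

theorem exec_level_end {c : Cfg A.Model} {v : ℝ} (hc : c.Ready v) {k : ℕ} (h3 : c.reg 3 = k + 1) :
    ∃ (t : ℕ) (c' : Cfg A.Model), Exec A (block [.get 6 .cnt 4, .add 6 6 1, .put .cnt 4 6,
        .add 2 4 0, .sub 3 3 1]) c.toState t c'.toState ∧ t ≤ 41 ∧
      c'.Ready v ∧ c'.G = c.G.bump (c.reg 4) ∧ c'.reg 2 = c.reg 4 ∧ c'.reg 3 = k := by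
  obtain ⟨t1, e1, b1⟩ := exec_block (A := A) [.get 6 .cnt 4, .add 6 6 1, .put .cnt 4 6,
        .add 2 4 0, .sub 3 3 1] c
  refine ⟨t1, _, e1, b1, ?_, ?_, ?_, ?_⟩
  · constructor <;> simp [Op.eff, Cfg.setReg_reg, hc.r0, hc.r1,
      hc.r8, hc.r9, hc.k0, hc.k2, hc.k3]
  · simp [Op.eff, Cfg.setReg_reg, hc.r1, Store.bump]
  · simp [Op.eff, Cfg.setReg_reg, hc.r0]
  · simp [Op.eff, Cfg.setReg_reg, hc.r1, h3]

/-- A child with four children is split before the search enters it. The node that is entered then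
has at most three, so a split further down never propagates upwards, and one pass suffices. -/
theorem exec_level {M R k : ℕ} {D : List ℝ} {v : ℝ} (hv : v < 3) {ht : ℕ → ℕ} {c : Cfg A.Model}
    (hp : Path M R D v (k + 2) ht c) :
    ∃ (t : ℕ) (c' : Cfg A.Model) (ht' : ℕ → ℕ), Exec A levelProg c.toState t c'.toState ∧
      t ≤ 500 ∧ Path M R D v (k + 1) ht' c' ∧ c'.G.fld .glob 2 = c.G.fld .glob 2 ∧
      c'.G.leafPoints ht' = c.G.leafPoints ht := by
  have hS := hp.tree.valid
  obtain ⟨t1, c1, e1, b1, f1, r4, -⟩ := exec_find (kv := 0) (by norm_num) hS hp.node hp.ready.r0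
    (by have := hp.ht_eq; omega)
  rw [hp.ready.k0] at r4
  obtain ⟨m1, m2, m3⟩ := hS.child_spec hp.node (by have := hp.ht_eq; simp only [Store.shape]; omega)
    hp.lo_le hp.lt_hi hv
  rw [← r4] at m1 m2 m3
  set i := c1.reg 4 with hi
  obtain ⟨n1, n2, n3, n4⟩ := Shape.mem_kids.1 m1
  have hti : ht i = k + 1 := by
    have : ht i + 1 = ht (c.reg 2) := n2
    have := hp.ht_eq
    omega
  have q1 := f1.ready hp.ready (by norm_num)
  obtain ⟨t2, e2, b2⟩ := exec_block (A := A) [.get 5 .nk 4, .const 6 4] c1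
  set c2 := effs [.get 5 .nk 4, .const 6 4] c1 with hc2
  simp only [List.length_cons, List.length_nil] at b2
  have g2 : c2.G = c.G := f1.G
  have q2 : c2.Ready v := by
    constructor <;> simp [hc2, Op.eff, Cfg.setReg_reg, q1.r0, q1.r1, q1.r8, q1.r9, q1.k0, q1.k2,
      q1.k3]
  have s5 : c2.reg 5 = c.G.fld .nk i := by simp [hc2, Op.eff, Cfg.setReg_reg, f1.G, hi]
  have s6 : c2.reg 6 = 4 := by simp [hc2, Op.eff, Cfg.setReg_reg]
  have s4 : c2.reg 4 = i := by simp [hc2, Op.eff, Cfg.setReg_reg, hi]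
  have s2 : c2.reg 2 = c.reg 2 := by simp [hc2, Op.eff, Cfg.setReg_reg, f1.reg 2 (by norm_num)]
  have s3 : c2.reg 3 = k + 2 := by
    simp [hc2, Op.eff, Cfg.setReg_reg, f1.reg 3 (by norm_num), hp.r3]
  by_cases h4 : c.G.fld .nk i < 4
  · obtain ⟨t3, c3, e3, b3, q3, g3, u2, u3⟩ := exec_level_end q2 (k := k + 1) s3
    rw [g2, s4] at g3
    rw [s4] at u2
    obtain ⟨T1, T2⟩ := hp.tree.bump n1
    refine ⟨_, c3, ht, e1.seq (e2.seq (.seq (exec_branch_true (by rw [s5, s6]; exact h4)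
      (exec_skip c2)) e3)), by omega, ⟨q3, ?_, ?_, ?_, ?_, ?_, u3, ?_, ?_, ?_⟩, ?_, ?_⟩
    · rw [g3]; exact T1
    · rw [g3]; exact T2 R D hp.leaves
    · rw [g3]; exact hp.counts.bump hS n1 hti m2 m3
    · rw [g3, u2, Store.bump_shape]; exact n1
    · rw [u2, hti]
    · rw [g3, u2, Store.bump_shape]; exact m2
    · rw [g3, u2, Store.bump_shape]; exact m3
    · rw [g3, u2, Store.bump, Store.set_fld_of_ne _ _ _ (by simp)]; omega
    · rw [g3, Store.bump, Store.set_fld_of_ne _ _ _ (by simp)]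
    · rw [g3, Store.bump_leafPoints]
  · have hti' : 0 < (c.G.shape ht).ht i := by change 0 < ht i; omega
    have h4' : c.G.fld .nk i = 4 := by
      have : c.G.fld .nk i ≤ 4 := hS.nk_le i n1 hti'
      omega
    obtain ⟨t3, c3, e3, b3, q3, g3, u2, u3, u4⟩ := exec_split q2
    rw [g2, s2, s4] at g3
    rw [g2, s4] at u4
    rw [s2] at u2
    rw [s3] at u3
    obtain ⟨T1, T2, T3, T4, T5, T6, T7, T8, T9, T10, T11, T12, T13⟩ := hp.tree.splitInner hp.node
      hp.nk_le m1 hti' h4' hp.counts hp.ht_eq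
    set ht' := Function.update ht (c.G.fld .glob 0) (ht i)
    rw [← g3] at T1 T2 T3 T4 T5 T6 T7 T8 T9 T10 T11 T12 T13
    have hit : i ≠ c.G.fld .glob 0 := n1.2.ne
    have hlevel := T1.valid
    have hloi : (c3.G.shape ht').lo i = (c.G.shape ht).lo i := T9 i hit
    have hlot : (c3.G.shape ht').lo (c.G.fld .glob 0) = c.G.lo (c.G.fld .right (c.G.fld .right
        (c.G.fld .down i))) := T10
    rw [hlot] at T6
    have hnext : c3.G.fld .glob 0 = c.G.fld .glob 0 + 1 := by
      rw [g3]; simp [Store.splitInner]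
    have hj : (c3.G.shape ht').Node (c3.reg 4) ∧ ht' (c3.reg 4) = k + 1 ∧
        (c3.G.shape ht').lo (c3.reg 4) ≤ v ∧ v < (c3.G.shape ht').hi (c3.reg 4) ∧
        c3.G.fld .nk (c3.reg 4) = 2 := by
      rw [u4]
      split_ifs with hv'
      · refine ⟨⟨n1.1, ?_⟩, ?_, hloi ▸ m2, by rw [T6]; exact hv', T12⟩
        · have : i < c.G.fld .glob 0 := n1.2
          change i < c3.G.fld .glob 0
          omega
        · rw [← hti]; exact Function.update_of_ne hit _ _
      · refine ⟨⟨?_, ?_⟩, ?_, by rw [hlot]; exact not_lt.1 hv', by rw [T7]; exact m3, T13⟩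
        · have := hp.tree.four_le; omega
        · change _ < c3.G.fld .glob 0
          omega
        · rw [← hti]; exact Function.update_self ..
    obtain ⟨j1, j2, j3, j4, j5⟩ := hj
    obtain ⟨t4, c4, e4, b4, q4, g4, w2, w3⟩ := exec_level_end q3 (k := k + 1) u3
    obtain ⟨V1, V2⟩ := T1.bump j1
    rw [← g4] at V1 V2
    refine ⟨_, c4, ht', e1.seq (e2.seq (.seq (exec_branch_false (by rw [s5, s6]; exact h4) e3) e4)),
      by omega, ⟨q4, V1, V2 R D (T2 R D hp.leaves), ?_, ?_, ?_, w3, ?_, ?_, ?_⟩, ?_, ?_⟩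
    · rw [g4]; exact T3.bump T1.valid j1 j2 j3 j4
    · rw [g4, w2, Store.bump_shape]; exact j1
    · rw [w2, j2]
    · rw [g4, w2, Store.bump_shape]; exact j3
    · rw [g4, w2, Store.bump_shape]; exact j4
    · rw [g4, w2, Store.bump, Store.set_fld_of_ne _ _ _ (by simp)]; omega
    · rw [g4, Store.bump, Store.set_fld_of_ne _ _ _ (by simp)]; exact T8
    · rw [g4, Store.bump_leafPoints]
      exact Store.leafPoints_eq T4 T9

theorem exec_levels {M R : ℕ} {D : List ℝ} {v : ℝ} (hv : v < 3) (k : ℕ) :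
    ∀ {ht : ℕ → ℕ} {c : Cfg A.Model}, Path M R D v (k + 1) ht c →
    ∃ (t : ℕ) (c' : Cfg A.Model) (ht' : ℕ → ℕ), Exec A (loop 1 3 levelProg) c.toState t c'.toState ∧
      t ≤ 501 * k + 1 ∧ Path M R D v 1 ht' c' ∧ c'.G.fld .glob 2 = c.G.fld .glob 2 ∧
      c'.G.leafPoints ht' = c.G.leafPoints ht := by
  induction k with
  | zero =>
    intro ht c hp
    exact ⟨1, c, ht, exec_loop_false (by rw [hp.ready.r1, hp.r3]; omega), by omega, hp, rfl, rfl⟩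
  | succ k ih =>
    intro ht c hp
    obtain ⟨t1, c1, ht1, e1, b1, p1, g1, l1⟩ := exec_level hv hp
    obtain ⟨t2, c2, ht2, e2, b2, p2, g2, l2⟩ := ih p1
    exact ⟨_, c2, ht2, exec_loop_true (by rw [hp.ready.r1, hp.r3]; omega) e1 e2, by omega, p2,
      g2.trans g1, l2.trans l1⟩

/-- Create the initial tree. -/
def initProg : Prog :=
  block [.put .right 1 8, .put .down 9 1, .put .nk 9 8, .put .glob 1 9, .put .glob 8 1,
    .putKey 1 2, .putKey 8 3, .putKey 9 2, .const 6 4, .put .glob 0 6]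

/-- Put a new root on top of the root in register 2. -/
def growProg : Prog :=
  block [.get 4 .glob 0, .get 6 .cnt 2, .add 3 3 1, .add 5 4 1, .put .right 4 0, .put .down 4 2,
    .put .nk 4 1, .putKey 4 2, .put .cnt 4 6, .put .glob 1 4, .put .glob 8 3, .put .glob 0 5,
    .add 2 4 0]

/-- Load the root, after splitting it if it has four children, and count the new point there. -/
def rootProg : Prog :=
  .seq (block [.get 2 .glob 1, .get 3 .glob 8, .get 5 .nk 2, .const 6 4])
    (.seq (branch 5 6 skip growProg) (block [.get 6 .cnt 2, .add 6 6 1, .put .cnt 2 6]))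

theorem exec_root_end {c : Cfg A.Model} {v : ℝ} (hc : c.Ready v) :
    ∃ (t : ℕ) (c' : Cfg A.Model), Exec A (block [.get 6 .cnt 2, .add 6 6 1, .put .cnt 2 6])
        c.toState t c'.toState ∧ t ≤ 25 ∧
      c'.Ready v ∧ c'.G = c.G.bump (c.reg 2) ∧ c'.reg 2 = c.reg 2 ∧ c'.reg 3 = c.reg 3 := by
  obtain ⟨t1, e1, b1⟩ := exec_block (A := A) [.get 6 .cnt 2, .add 6 6 1, .put .cnt 2 6] c
  refine ⟨t1, _, e1, b1, ?_, ?_, ?_, ?_⟩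
  · constructor <;> simp [Op.eff, Cfg.setReg_reg, hc.r0, hc.r1,
      hc.r8, hc.r9, hc.k0, hc.k2, hc.k3]
  · simp [Op.eff, Cfg.setReg_reg, hc.r1, Store.bump]
  · simp [Op.eff, Cfg.setReg_reg]
  · simp [Op.eff, Cfg.setReg_reg]

/-- A full root is put below a new root with a single child; the split of the old root is left to
the next level of the descent, where it is an ordinary full child. -/
theorem exec_root {M R : ℕ} {D : List ℝ} {v : ℝ} (hv0 : 0 ≤ v) (hv : v < 3) {ht : ℕ → ℕ}
    {c : Cfg A.Model} (hc : c.Ready v) (hT : TreeInv M D.length c.G ht)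
    (hL : Leaves M R c.G ht D) (hC : c.G.Counts ht D v (c.G.fld .glob 2 + 1)) :
    ∃ (t : ℕ) (c' : Cfg A.Model) (ht' : ℕ → ℕ) (k : ℕ), Exec A rootProg c.toState t c'.toState ∧
      t ≤ 170 ∧ Path M R D v (k + 1) ht' c' ∧ c'.G.fld .glob 2 = k + 1 ∧
      c'.G.leafPoints ht' = c.G.leafPoints ht := by
  have hS := hT.valid
  obtain ⟨t2, e2, b2⟩ := exec_block (A := A)
    [.get 2 .glob 1, .get 3 .glob 8, .get 5 .nk 2, .const 6 4] c
  set c2 := effs [.get 2 .glob 1, .get 3 .glob 8, .get 5 .nk 2, .const 6 4] c with hc2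
  simp only [List.length_cons, List.length_nil] at b2
  set r := c.G.fld .glob 1 with hr
  have hrn : (c.G.shape ht).Node r := hS.root_node
  have hrt : ht r = c.G.fld .glob 2 := hS.ht_root
  have hpos : 1 ≤ c.G.fld .glob 2 := hS.height_pos
  have g2 : c2.G = c.G := rfl
  have q2 : c2.Ready v := by
    constructor <;> simp [hc2, Op.eff, Cfg.setReg_reg, hc.r0, hc.r1, hc.r8, hc.r9, hc.k0, hc.k2,
      hc.k3]
  have s5 : c2.reg 5 = c.G.fld .nk r := by simp [hc2, Op.eff, Cfg.setReg_reg, hc.r1, hr]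
  have s6 : c2.reg 6 = 4 := by simp [hc2, Op.eff, Cfg.setReg_reg]
  have s2 : c2.reg 2 = r := by simp [hc2, Op.eff, Cfg.setReg_reg, hc.r1, hr]
  have s3 : c2.reg 3 = c.G.fld .glob 2 := by
    simp [hc2, Op.eff, Cfg.setReg_reg, hc.r8]
  by_cases h4 : c.G.fld .nk r < 4
  · obtain ⟨t3, c3, e3, b3, q3, g3, u2, u3⟩ := exec_root_end q2
    rw [g2, s2] at g3
    rw [s2] at u2
    rw [s3] at u3
    obtain ⟨T1, T2⟩ := hT.bump hrn
    have m2 : (c.G.shape ht).lo r ≤ v := by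
      have : (c.G.shape ht).lo r = 0 := hS.lo_root
      rw [this]; exact hv0
    have m3 : v < (c.G.shape ht).hi r := by
      have : (c.G.shape ht).hi r = 3 := hS.hi_root
      rw [this]; exact hv
    rw [show c.G.fld .glob 2 = c.G.fld .glob 2 - 1 + 1 by omega] at hrt u3
    refine ⟨_, c3, ht, c.G.fld .glob 2 - 1, e2.seq (.seq (exec_branch_true
      (by rw [s5, s6]; exact h4) (exec_skip c2)) e3), by omega, ⟨q3, ?_, ?_, ?_, ?_, ?_, u3, ?_,
      ?_, ?_⟩, ?_, ?_⟩
    · rw [g3]; exact T1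
    · rw [g3]; exact T2 R D hL
    · rw [g3]
      refine Store.Counts.bump hS ?_ hrn hrt m2 m3
      rwa [show c.G.fld .glob 2 - 1 + 1 = c.G.fld .glob 2 by omega]
    · rw [g3, u2, Store.bump_shape]; exact hrn
    · rw [u2, hrt]
    · rw [g3, u2, Store.bump_shape]; exact m2
    · rw [g3, u2, Store.bump_shape]; exact m3
    · rw [g3, u2, Store.bump, Store.set_fld_of_ne _ _ _ (by simp)]; omega
    · rw [g3, Store.bump, Store.set_fld_of_ne _ _ _ (by simp)]; omega
    · rw [g3, Store.bump_leafPoints]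
  · have h4' : c.G.fld .nk r = 4 := by
      have : c.G.fld .nk r ≤ 4 := hS.nk_le r hrn (by change 0 < ht r; omega)
      omega
    obtain ⟨T1, T2, T3, T4, T5⟩ := hT.growRoot h4' hC
    set ht' := Function.update ht (c.G.fld .glob 0) (c.G.fld .glob 2 + 1)
    set ops : List Op := [.get 4 .glob 0, .get 6 .cnt 2, .add 3 3 1, .add 5 4 1, .put .right 4 0,
      .put .down 4 2, .put .nk 4 1, .putKey 4 2, .put .cnt 4 6, .put .glob 1 4, .put .glob 8 3,
      .put .glob 0 5, .add 2 4 0] with hops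
    obtain ⟨t3, e3, b3⟩ := exec_block (A := A) ops c2
    set c3 := effs ops c2 with hc3
    have b3' : t3 ≤ 105 := b3
    have g3 : c3.G = c.G.growRoot := by
      simp [hc3, hops, Op.eff, Cfg.setReg_reg, Store.growRoot, q2.r0, q2.r1, q2.r8, q2.k2,
        s2, s3, g2, hr]
    have q3 : c3.Ready v := by
      constructor <;> simp [hc3, hops, Op.eff, Cfg.setReg_reg, q2.r0, q2.r1, q2.r8, q2.r9,
        q2.k0, q2.k2, q2.k3]
    have u2 : c3.reg 2 = c.G.fld .glob 0 := by
      simp [hc3, hops, Op.eff, Cfg.setReg_reg, q2.r0, g2]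
    have u3 : c3.reg 3 = c.G.fld .glob 2 + 1 := by
      simp [hc3, hops, Op.eff, Cfg.setReg_reg, s3, q2.r1]
    rw [← g3] at T1 T2 T3 T4 T5
    have hroot : (c3.G.shape ht').root = c.G.fld .glob 0 := by
      rw [g3]; simp [Store.shape, Store.growRoot]
    have hn := T1.valid.root_node
    have hlo := T1.valid.lo_root
    have hhi := T1.valid.hi_root
    rw [hroot] at hn hlo hhi
    have htn : ht' (c.G.fld .glob 0) = c.G.fld .glob 2 + 1 := Function.update_self ..
    obtain ⟨t4, c4, e4, b4, q4, g4, w2, w3⟩ := exec_root_end q3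
    rw [u2] at g4 w2
    rw [u3] at w3
    obtain ⟨V1, V2⟩ := T1.bump hn
    rw [← g4] at V1 V2
    refine ⟨_, c4, ht', c.G.fld .glob 2, e2.seq (.seq (exec_branch_false
      (by rw [s5, s6]; exact h4) e3) e4), by omega, ⟨q4, V1, V2 R D (T2 R D hL), ?_, ?_, ?_, w3,
      ?_, ?_, ?_⟩, ?_, ?_⟩
    · rw [g4]
      exact T3.bump T1.valid hn htn (by rw [hlo]; exact hv0) (by rw [hhi]; exact hv)
    · rw [g4, w2, Store.bump_shape]; exact hn
    · rw [w2, htn]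
    · rw [g4, w2, Store.bump_shape, hlo]; exact hv0
    · rw [g4, w2, Store.bump_shape, hhi]; exact hv
    · rw [g4, w2, Store.bump, Store.set_fld_of_ne _ _ _ (by simp), g3]
      simp [Store.growRoot, Store.set_fld]
    · rw [g4, Store.bump, Store.set_fld_of_ne _ _ _ (by simp), g3]
      simp [Store.growRoot, Store.set_fld]
    · rw [g4, Store.bump_leafPoints]
      exact Store.leafPoints_eq T4 T5

end LearnedCE

namespace LearnedCE

/-! ### Sorting keys -/

variable {A : Learner}

/-- Insert the key register `k` into a sorted list `pre ++ l ++ post` of key registers, by binary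
search in `l`, and continue with the result. -/
def placeProg (k : ℕ) (cont : List ℕ → Prog) : ℕ → List ℕ → List ℕ → List ℕ → Prog
  | 0, pre, l, post => cont (pre ++ k :: (l ++ post))
  | d + 1, pre, l, post =>
    match l.drop (l.length / 2) with
    | [] => cont (pre ++ k :: post)
    | m :: r => .ifKeyLt k m (placeProg k cont d pre (l.take (l.length / 2)) (m :: r ++ post))
        (placeProg k cont d (pre ++ (l.take (l.length / 2) ++ [m])) r post)

/-- The binary search is unfolded into a decision tree: keys stay in their registers, and each
branch of the program knows the order of the register names, which it passes to the continuation.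
Hence `d` comparisons suffice for fewer than `2 ^ d` keys, and nothing is moved. -/
theorem exec_place (k : ℕ) (cont : List ℕ → Prog) (c : Cfg A.Model) (d : ℕ) :
    ∀ pre l post : List ℕ, l.length < 2 ^ d →
      (pre ++ l ++ post).Pairwise (fun i j => c.kreg i ≤ c.kreg j) →
      (∀ i ∈ pre, c.kreg i ≤ c.kreg k) → (∀ i ∈ post, c.kreg k ≤ c.kreg i) →
      ∃ l' : List ℕ, l'.Perm (k :: (pre ++ l ++ post)) ∧
        l'.Pairwise (fun i j => c.kreg i ≤ c.kreg j) ∧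
        ∀ (t : ℕ) (c' : Cfg A.Model), Exec A (cont l') c.toState t c'.toState →
          ∃ t' ≤ t + d, Exec A (placeProg k cont d pre l post) c.toState t' c'.toState := by
  have final : ∀ pre post : List ℕ,
      (pre ++ post).Pairwise (fun i j => c.kreg i ≤ c.kreg j) →
      (∀ i ∈ pre, c.kreg i ≤ c.kreg k) → (∀ i ∈ post, c.kreg k ≤ c.kreg i) →
      (pre ++ k :: post).Perm (k :: (pre ++ post)) ∧
        (pre ++ k :: post).Pairwise (fun i j => c.kreg i ≤ c.kreg j) := by
    intro pre post hs hpre hpost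
    refine ⟨List.perm_middle, ?_⟩
    rw [List.pairwise_append] at hs ⊢
    refine ⟨hs.1, List.pairwise_cons.2 ⟨hpost, hs.2.1⟩, fun i hi j hj => ?_⟩
    rcases List.mem_cons.1 hj with rfl | hj
    · exact hpre i hi
    · exact (hpre i hi).trans (hpost j hj)
  induction d with
  | zero =>
    intro pre l post hl hs hpre hpost
    have : l = [] := List.length_eq_zero_iff.1 (by simpa using hl)
    subst this
    rw [List.append_nil] at hs
    obtain ⟨h1, h2⟩ := final pre post hs hpre hpost
    refine ⟨_, by rw [List.append_nil]; exact h1, h2, fun t c' h => ⟨t, by omega, h⟩⟩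
  | succ d ih =>
    intro pre l post hl hs hpre hpost
    have hdrop : (l.drop (l.length / 2)).length = l.length - l.length / 2 := List.length_drop
    have hsplit := List.take_append_drop (l.length / 2) l
    have hlt : (l.take (l.length / 2)).length = l.length / 2 := by
      rw [List.length_take]; omega
    rcases hd : l.drop (l.length / 2) with _ | ⟨m, r⟩
    · have : l = [] := by
        rw [hd, List.length_nil] at hdrop
        exact List.length_eq_zero_iff.1 (by omega)
      subst this
      rw [List.append_nil] at hs
      obtain ⟨h1, h2⟩ := final pre post hs hpre hpost
      refine ⟨_, by rw [List.append_nil]; exact h1, h2, fun t c' h => ⟨t, by omega, ?_⟩⟩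
      simpa only [placeProg, List.drop_nil] using h
    · rw [hd] at hdrop hsplit
      rw [List.length_cons] at hdrop
      rw [pow_succ] at hl
      set q := l.take (l.length / 2) with hq
      rw [← hsplit] at hs
      have hs' : (pre ++ q ++ (m :: r ++ post)).Pairwise fun i j => c.kreg i ≤ c.kreg j := by
        simpa only [List.append_assoc] using hs
      by_cases hkm : c.kreg k < c.kreg m
      · have hm : ∀ i ∈ m :: r ++ post, c.kreg k ≤ c.kreg i := by
          have h1 := (List.pairwise_append.1 hs').2.1
          rw [List.cons_append, List.pairwise_cons] at h1
          intro i hi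
          rcases List.mem_cons.1 hi with rfl | hi
          · exact hkm.le
          · exact hkm.le.trans (h1.1 i hi)
        obtain ⟨l', p1, p2, p3⟩ := ih pre q (m :: r ++ post) (by omega) hs' hpre hm
        refine ⟨l', p1.trans (by rw [← hsplit]; simp), p2, fun t c' h => ?_⟩
        obtain ⟨t', ht', h'⟩ := p3 t c' h
        refine ⟨1 + t', by omega, ?_⟩
        rw [placeProg, hd]
        exact exec_key_true hkm h'
      · have hs'' : (pre ++ (q ++ [m]) ++ r ++ post).Pairwise
            fun i j => c.kreg i ≤ c.kreg j := by
          simpa only [List.append_assoc, List.cons_append, List.nil_append] using hs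
        have hm : ∀ i ∈ pre ++ (q ++ [m]), c.kreg i ≤ c.kreg k := by
          have h1 := (List.pairwise_append.1 (List.pairwise_append.1 hs'').1).1
          rw [← List.append_assoc] at h1 ⊢
          intro i hi
          rcases List.mem_append.1 hi with hi | hi
          · exact ((List.pairwise_append.1 h1).2.2 i hi m (by simp)).trans (not_lt.1 hkm)
          · rw [List.mem_singleton.1 hi]; exact not_lt.1 hkm
        obtain ⟨l', p1, p2, p3⟩ := ih (pre ++ (q ++ [m])) r post (by omega) hs'' hm hpost
        refine ⟨l', p1.trans (by rw [← hsplit]; simp), p2, fun t c' h => ?_⟩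
        obtain ⟨t', ht', h'⟩ := p3 t c' h
        refine ⟨1 + t', by omega, ?_⟩
        rw [placeProg, hd]
        exact exec_key_false hkm h'

/-- Insert the given key registers into a sorted list of key registers, and continue with the
result. -/
def sortProg (d : ℕ) (cont : List ℕ → Prog) : List ℕ → List ℕ → Prog
  | [], l => cont l
  | k :: ks, l => placeProg k (fun l' => sortProg d cont ks l') d [] l []

/-- Insertion sort by binary search. The program is huge but fixed, as it depends only on the
capacity of the leaves; the running time is `d` comparisons per key. -/
theorem exec_sort (d : ℕ) (cont : List ℕ → Prog) (c : Cfg A.Model) (ks : List ℕ) :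
    ∀ l : List ℕ, (ks ++ l).length ≤ 2 ^ d →
      l.Pairwise (fun i j => c.kreg i ≤ c.kreg j) →
      ∃ l' : List ℕ, l'.Perm (ks ++ l) ∧ l'.Pairwise (fun i j => c.kreg i ≤ c.kreg j) ∧
        ∀ (t : ℕ) (c' : Cfg A.Model), Exec A (cont l') c.toState t c'.toState →
          ∃ t' ≤ t + d * ks.length, Exec A (sortProg d cont ks l) c.toState t' c'.toState := by
  induction ks with
  | nil =>
    intro l _ hs
    exact ⟨l, List.Perm.refl _, hs, fun t c' h => ⟨t, by omega, h⟩⟩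
  | cons k ks ih =>
    intro l hl hs
    simp only [List.cons_append, List.length_cons, List.length_append] at hl
    obtain ⟨l1, p1, p2, p3⟩ := exec_place k (fun l' => sortProg d cont ks l') c d [] l []
      (by omega) (by simpa using hs) (by simp) (by simp)
    rw [List.nil_append, List.append_nil] at p1
    obtain ⟨l2, q1, q2, q3⟩ := ih l1
      (by rw [List.length_append, p1.length_eq, List.length_cons]; omega) p2
    refine ⟨l2, ?_, q2, fun t c' h => ?_⟩
    · refine q1.trans ((p1.append_left ks).trans ?_)
      exact List.perm_middle
    · obtain ⟨t1, h1, e1⟩ := q3 t c' h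
      obtain ⟨t2, h2, e2⟩ := p3 t1 c' e1
      refine ⟨t2, ?_, e2⟩
      rw [List.length_cons, Nat.mul_succ]
      omega

/-- Put the key with index `j` among the registers `ks` into register 7. -/
def medianProg (d j : ℕ) (ks : List ℕ) : Prog :=
  sortProg d (fun l => block [.moveKey 7 (l.getD j 0)]) ks []

theorem exec_median (d j : ℕ) (ks : List ℕ) (c : Cfg A.Model) (hd : ks.length ≤ 2 ^ d)
    (hj : j < ks.length) : ∃ t ≤ d * ks.length + 9, Exec A (medianProg d j ks) c.toState t
      (c.setKreg 7 (kth j (ks.map c.kreg))).toState := by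
  obtain ⟨l, p1, p2, p3⟩ := exec_sort d (fun l => block [.moveKey 7 (l.getD j 0)]) c ks []
    (by simpa using hd) (by simp)
  rw [List.append_nil] at p1
  have hjl : j < l.length := by rw [p1.length_eq]; exact hj
  have hk : kth j (ks.map c.kreg) = c.kreg (l.getD j 0) := by
    have h1 := IsKth.of_pairwise (List.pairwise_map.2 p2)
      (show j < (l.map c.kreg).length by rw [List.length_map]; exact hjl)
    rw [List.getElem_map] at h1
    rw [(h1.perm (p1.map c.kreg)).kth_eq, List.getD_eq_getElem _ _ hjl]
  obtain ⟨t, e, ht⟩ := exec_block (A := A) [.moveKey 7 (l.getD j 0)] c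
  simp only [List.length_cons, List.length_nil] at ht
  obtain ⟨t', ht', e'⟩ := p3 t _ e
  refine ⟨t', by omega, ?_⟩
  rw [hk]
  exact e'

/-! ### Loading and partitioning the points of a leaf -/

/-- The operations that load `n` data cells, from the address in register 14 on, into the key
registers from `k` on. -/
def loadOps : ℕ → ℕ → List Op
  | 0, _ => []
  | n + 1, k => .loadData k 14 :: .add 14 14 1 :: loadOps n (k + 1)

theorem length_loadOps (n k : ℕ) : (loadOps n k).length = 2 * n := by
  induction n generalizing k with
  | zero => rfl
  | succ n ih => simp only [loadOps, List.length_cons, ih]; omega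

theorem effs_loadOps (n : ℕ) : ∀ (k : ℕ) (c : Cfg A.Model), c.reg 1 = 1 →
    (effs (loadOps n k) c).G = c.G ∧ (∀ r, r ≠ 14 → (effs (loadOps n k) c).reg r = c.reg r) ∧
    (∀ j, j < k → (effs (loadOps n k) c).kreg j = c.kreg j) ∧
    ∀ i < n, (effs (loadOps n k) c).kreg (k + i) = c.G.data (c.reg 14 + i) := by
  induction n with
  | zero => intro k c _; simp [loadOps]
  | succ n ih =>
    intro k c h1
    set c1 := effs [.loadData k 14, .add 14 14 1] c with hc1
    have hE : effs (loadOps (n + 1) k) c = effs (loadOps n (k + 1)) c1 := rfl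
    have g1 : c1.G = c.G := rfl
    have r1 : ∀ r, r ≠ 14 → c1.reg r = c.reg r := by
      intro r hr; simp [hc1, Op.eff, Cfg.setReg_reg, hr]
    have s14 : c1.reg 14 = c.reg 14 + 1 := by simp [hc1, Op.eff, Cfg.setReg_reg, h1]
    have k1 : ∀ j, j ≠ k → c1.kreg j = c.kreg j := by
      intro j hj; simp [hc1, Op.eff, Cfg.setKreg_kreg, hj]
    have kk : c1.kreg k = c.G.data (c.reg 14) := by simp [hc1, Op.eff, Cfg.setKreg_kreg]
    obtain ⟨a1, a2, a3, a4⟩ := ih (k + 1) c1 ((r1 1 (by norm_num)).trans h1)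
    rw [hE]
    refine ⟨a1, fun r hr => (a2 r hr).trans (r1 r hr),
      fun j hj => (a3 j (by omega)).trans (k1 j (by omega)), fun i hi => ?_⟩
    rcases i with _ | i
    · rw [add_zero, a3 k (by omega), kk, add_zero]
    · rw [show k + (i + 1) = k + 1 + i by ring, a4 i (by omega), s14, g1]
      congr 1; ring

/-- The data cells from `p` on hold the list `z`. -/
def Holds (f : ℕ → ℝ) (p : ℕ) (z : List ℝ) : Prop :=
  ∀ j (h : j < z.length), f (p + j) = z[j]

theorem Holds.concat {f : ℕ → ℝ} {p : ℕ} {z : List ℝ} (h : Holds f p z) (y : ℝ) :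
    Holds (Function.update f (p + z.length) y) p (z ++ [y]) := by
  intro j hj
  rw [List.length_append, List.length_singleton] at hj
  by_cases hjz : j < z.length
  · rw [Function.update_of_ne (by omega), List.getElem_append_left hjz]; exact h j hjz
  · have : j = z.length := by omega
    subst this
    simp

theorem Holds.congr {f g : ℕ → ℝ} {p : ℕ} {z : List ℝ} (h : Holds f p z)
    (hg : ∀ a, p ≤ a → a < p + z.length → g a = f a) : Holds g p z :=
  fun j hj => by rw [hg _ (by omega) (by omega)]; exact h j hj

theorem Holds.map_range {f : ℕ → ℝ} {p : ℕ} {z : List ℝ} (h : Holds f p z) (g : ℝ → ℝ) :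
    (List.range z.length).map (fun i => g (f (p + i))) = z.map g := by
  refine List.ext_getElem (by simp) fun i h1 h2 => ?_
  simp only [List.length_map] at h2
  simp [h i h2]

/-- Copy the points in the key registers `ks` that are less than the key in register 7 to the
address in register 16, the larger ones to the address in register 17, and count the equal
ones. -/
def partProg : List ℕ → Prog
  | [] => skip
  | k :: ks => .seq (.ifKeyLt k 7 (block [.saveData 16 k, .add 16 16 1])
      (.ifKeyLt 7 k (block [.saveData 17 k, .add 17 17 1]) (block [.add 18 18 1]))) (partProg ks)

/-- The keys are read from registers, so the smaller ones may overwrite the old block. Both halves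
keep the insertion order, as the invariant of the leaves demands. The condition on `p` and `q`
prevents the left block from running into the right one. -/
theorem exec_part {s : ℝ} {p q : ℕ} (ks : List ℕ) : ∀ {c : Cfg A.Model} {zl zr : List ℝ},
    c.reg 16 = p + zl.length → c.reg 17 = q + zr.length → c.reg 1 = 1 → c.kreg 7 = s →
    Holds c.G.data p zl → Holds c.G.data q zr → p + (zl.length + ks.length) ≤ q →
    ∃ (t : ℕ) (c' : Cfg A.Model), Exec A (partProg ks) c.toState t c'.toState ∧
      t ≤ 19 * ks.length + 1 ∧ c'.G = { c.G with data := c'.G.data } ∧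
      c'.kreg = c.kreg ∧ (∀ r, r < 16 ∨ 18 < r → c'.reg r = c.reg r) ∧
      c'.reg 16 = p + (zl ++ (ks.map c.kreg).filter fun y => y < s).length ∧
      c'.reg 17 = q + (zr ++ (ks.map c.kreg).filter fun y => s < y).length ∧
      c'.reg 18 = c.reg 18 + (ks.map c.kreg).countP (fun y => y = s) ∧
      Holds c'.G.data p (zl ++ (ks.map c.kreg).filter fun y => y < s) ∧
      Holds c'.G.data q (zr ++ (ks.map c.kreg).filter fun y => s < y) ∧
      ∀ a, a < p ∨ (p + (zl.length + ks.length) ≤ a ∧ a < q) → c'.G.data a = c.G.data a := by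
  induction ks with
  | nil =>
    intro c zl zr h16 h17 h1 h7 hl hr hpq
    refine ⟨1, c, exec_skip c, by simp, rfl, rfl, fun _ _ => rfl, ?_, ?_, ?_, ?_, ?_,
      fun _ _ => rfl⟩
    · simpa using h16
    · simpa using h17
    · simp
    · simpa using hl
    · simpa using hr
  | cons k ks ih =>
    intro c zl zr h16 h17 h1 h7 hl hr hpq
    rw [List.length_cons] at hpq
    rcases lt_trichotomy (c.kreg k) s with h | h | h
    · obtain ⟨t1, e1, b1⟩ := exec_block (A := A) [.saveData 16 k, .add 16 16 1] c
      set c1 := effs [.saveData 16 k, .add 16 16 1] c with hc1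
      simp only [List.length_cons, List.length_nil] at b1
      have hd : c1.G.data = Function.update c.G.data (p + zl.length) (c.kreg k) := by
        simp [hc1, Op.eff, h16]
      obtain ⟨t2, c2, e2, b2, g2, k2, r2, a1, a2, a3, a4, a5, a6⟩ := ih (c := c1)
        (zl := zl ++ [c.kreg k]) (zr := zr)
        (by simp [hc1, Op.eff, Cfg.setReg_reg, h16, h1, add_assoc])
        (by simp [hc1, Op.eff, Cfg.setReg_reg, h17])
        (by simp [hc1, Op.eff, Cfg.setReg_reg, h1]) h7
        (by rw [hd]; exact hl.concat _)
        (by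
          rw [hd]
          exact hr.congr fun a ha _ => Function.update_of_ne (by omega) _ _)
        (by simp; omega)
      have hk1 : c1.kreg = c.kreg := rfl
      have h18 : c1.reg 18 = c.reg 18 := by simp [hc1, Op.eff, Cfg.setReg_reg]
      rw [hk1] at k2 a1 a2 a3 a4 a5
      refine ⟨_, c2, (exec_key_true (by rw [h7]; exact h) e1).seq e2, by
        rw [List.length_cons]; omega, g2, k2, fun r hr' => ?_, ?_, ?_, ?_, ?_, ?_, fun a ha => ?_⟩
      · rw [r2 r hr']
        simp only [hc1, effs_cons, effs_nil, Op.eff, Cfg.setReg_reg, Cfg.setG_reg]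
        rw [if_neg (by omega)]
      · rw [a1]; simp [h]
      · rw [a2]; simp [h.le]
      · rw [a3, h18]; simp [h.ne]
      · simpa [h] using a4
      · simpa [h.le] using a5
      · rw [List.length_cons] at ha
        rw [a6 a (by simp; omega), hd, Function.update_of_ne (by omega)]
    · obtain ⟨t1, e1, b1⟩ := exec_block (A := A) [.add 18 18 1] c
      set c1 := effs [.add 18 18 1] c with hc1
      simp only [List.length_cons, List.length_nil] at b1
      have hd : c1.G = c.G := rfl
      obtain ⟨t2, c2, e2, b2, g2, k2, r2, a1, a2, a3, a4, a5, a6⟩ := ih (c := c1)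
        (zl := zl) (zr := zr)
        (by simp [hc1, Op.eff, Cfg.setReg_reg, h16])
        (by simp [hc1, Op.eff, Cfg.setReg_reg, h17])
        (by simp [hc1, Op.eff, Cfg.setReg_reg, h1]) h7 hl hr (by omega)
      have hk1 : c1.kreg = c.kreg := rfl
      have h18 : c1.reg 18 = c.reg 18 + 1 := by simp [hc1, Op.eff, Cfg.setReg_reg, h1]
      rw [hk1] at k2 a1 a2 a3 a4 a5
      refine ⟨_, c2, (exec_key_false (by rw [h7, h]; exact lt_irrefl _) (exec_key_false
        (by rw [h7, h]; exact lt_irrefl _) e1)).seq e2, by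
        rw [List.length_cons]; omega, g2, k2, fun r hr' => ?_, ?_, ?_, ?_, ?_, ?_, fun a ha => ?_⟩
      · rw [r2 r hr']
        simp only [hc1, effs_cons, effs_nil, Op.eff, Cfg.setReg_reg]
        rw [if_neg (by omega)]
      · rw [a1]; simp [h]
      · rw [a2]; simp [h]
      · rw [a3, h18]; simp [h]; ring
      · simpa [h] using a4
      · simpa [h] using a5
      · rw [List.length_cons] at ha
        rw [a6 a (by omega), hd]
    · obtain ⟨t1, e1, b1⟩ := exec_block (A := A) [.saveData 17 k, .add 17 17 1] c
      set c1 := effs [.saveData 17 k, .add 17 17 1] c with hc1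
      simp only [List.length_cons, List.length_nil] at b1
      have hd : c1.G.data = Function.update c.G.data (q + zr.length) (c.kreg k) := by
        simp [hc1, Op.eff, h17]
      obtain ⟨t2, c2, e2, b2, g2, k2, r2, a1, a2, a3, a4, a5, a6⟩ := ih (c := c1)
        (zl := zl) (zr := zr ++ [c.kreg k])
        (by simp [hc1, Op.eff, Cfg.setReg_reg, h16])
        (by simp [hc1, Op.eff, Cfg.setReg_reg, h17, h1, add_assoc])
        (by simp [hc1, Op.eff, Cfg.setReg_reg, h1]) h7
        (by
          rw [hd]
          exact hl.congr fun a _ ha => Function.update_of_ne (by omega) _ _)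
        (by rw [hd]; exact hr.concat _) (by omega)
      have hk1 : c1.kreg = c.kreg := rfl
      have h18 : c1.reg 18 = c.reg 18 := by simp [hc1, Op.eff, Cfg.setReg_reg]
      rw [hk1] at k2 a1 a2 a3 a4 a5
      refine ⟨_, c2, (exec_key_false (by rw [h7]; exact h.not_gt) (exec_key_true
        (by rw [h7]; exact h) e1)).seq e2, by
        rw [List.length_cons]; omega, g2, k2, fun r hr' => ?_, ?_, ?_, ?_, ?_, ?_, fun a ha => ?_⟩
      · rw [r2 r hr']
        simp only [hc1, effs_cons, effs_nil, Op.eff, Cfg.setReg_reg, Cfg.setG_reg]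
        rw [if_neg (by omega)]
      · rw [a1]; simp [h.le]
      · rw [a2]; simp [h]
      · rw [a3, h18]; simp [h.ne']
      · simpa [h.le] using a4
      · simpa [h] using a5
      · rw [List.length_cons] at ha
        rw [a6 a (by omega), hd, Function.update_of_ne (by omega)]

/-! ### Training -/

/-- The effect of training the model of the leaf `i` with inner points `z`, unless the last
training is recent enough. -/
noncomputable def Store.refit (G : Store A.Model) (R i : ℕ) (a b : ℝ) (z : List ℝ) :
    Store A.Model :=
  if G.fld .trained i + min (G.fld .trained i) R < z.length then
    (G.setModel i (A.train (z.map (rescale a b)))).set .trained i z.length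
  else G

/-- Train the model of the leaf in register `ri` with its points, the number of which is in register
`rc`, unless the last training is recent enough. -/
def refitProg (R ri rb rc ka kb : ℕ) : Prog :=
  .seq (block [.get 14 .trained ri, .const 15 R]) (.seq
    (branch 14 15 (block [.add 15 14 14]) (block [.add 15 14 15]))
    (branch 15 rc (.seq (trainProg ri rb rc ka kb) (block [.put .trained ri rc])) skip))

theorem exec_refit {R ri rb rc ka kb : ℕ} (hri : ri < 14 ∨ 15 < ri) (hrb : rb < 14 ∨ 15 < rb)
    (hrc : rc < 14 ∨ 15 < rc) {c : Cfg A.Model} {z : List ℝ} {a b : ℝ} (hz : c.reg rc = z.length)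
    (hd : Holds c.G.data (c.reg rb) z) (ha : c.kreg ka = a) (hb : c.kreg kb = b) :
    ∃ (t : ℕ) (c' : Cfg A.Model), Exec A (refitProg R ri rb rc ka kb) c.toState t c'.toState ∧
      t ≤ 50 + (if c.G.fld .trained (c.reg ri) + min (c.G.fld .trained (c.reg ri)) R < z.length
        then A.trainCost (z.map (rescale a b)) else 0) ∧
      c'.G = c.G.refit R (c.reg ri) a b z ∧ c'.kreg = c.kreg ∧
      ∀ r, r < 14 ∨ 15 < r → c'.reg r = c.reg r := by
  obtain ⟨t1, e1, b1⟩ := exec_block (A := A) [.get 14 .trained ri, .const 15 R] c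
  set c1 := effs [.get 14 .trained ri, .const 15 R] c with hc1
  simp only [List.length_cons, List.length_nil] at b1
  set m := c.G.fld .trained (c.reg ri) with hm
  have r1 : ∀ r, r < 14 ∨ 15 < r → c1.reg r = c.reg r := by
    intro r hr
    simp only [hc1, effs_cons, effs_nil, Op.eff, Cfg.setReg_reg]
    rw [if_neg (by omega), if_neg (by omega)]
  have s14 : c1.reg 14 = m := by simp [hc1, Op.eff, Cfg.setReg_reg, hm]
  have s15 : c1.reg 15 = R := by simp [hc1, Op.eff, Cfg.setReg_reg]
  obtain ⟨t2, c2, e2, b2, g2, k2, r2, s2⟩ : ∃ (t : ℕ) (c2 : Cfg A.Model),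
      Exec A (branch 14 15 (block [.add 15 14 14]) (block [.add 15 14 15])) c1.toState t
        c2.toState ∧ t ≤ 10 ∧ c2.G = c.G ∧ c2.kreg = c.kreg ∧
      (∀ r, r < 14 ∨ 15 < r → c2.reg r = c.reg r) ∧ c2.reg 15 = m + min m R := by
    by_cases h : m < R
    · obtain ⟨t2, e2, b2⟩ := exec_block (A := A) [.add 15 14 14] c1
      simp only [List.length_cons, List.length_nil] at b2
      refine ⟨_, _, exec_branch_true (by rw [s14, s15]; exact h) e2, by omega, rfl, rfl,
        fun r hr => ?_, ?_⟩
      · simp only [effs_cons, effs_nil, Op.eff, Cfg.setReg_reg]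
        rw [if_neg (by omega), r1 r hr]
      · simp [Op.eff, Cfg.setReg_reg, s14]; omega
    · obtain ⟨t2, e2, b2⟩ := exec_block (A := A) [.add 15 14 15] c1
      simp only [List.length_cons, List.length_nil] at b2
      refine ⟨_, _, exec_branch_false (by rw [s14, s15]; exact h) e2, by omega, rfl, rfl,
        fun r hr => ?_, ?_⟩
      · simp only [effs_cons, effs_nil, Op.eff, Cfg.setReg_reg]
        rw [if_neg (by omega), r1 r hr]
      · simp [Op.eff, Cfg.setReg_reg, s14, s15]; omega
  by_cases h : m + min m R < z.length
  · have e3 := exec_train (A := A) ri rb rc ka kb c2 (l := z.map (rescale a b)) (by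
      rw [r2 rc hrc, r2 rb hrb, hz, k2, ha, hb, g2]
      exact hd.map_range _)
    set c3 := c2.setG (c2.G.setModel (c2.reg ri) (A.train (z.map (rescale a b)))) with hc3
    obtain ⟨t4, e4, b4⟩ := exec_block (A := A) [.put .trained ri rc] c3
    simp only [List.length_cons, List.length_nil] at b4
    refine ⟨_, _, e1.seq (e2.seq (exec_branch_true (by rw [s2, r2 rc hrc, hz]; exact h)
      (e3.seq e4))), by rw [if_pos h]; omega, ?_, ?_, ?_⟩
    · rw [Store.refit, if_pos h]
      simp [Op.eff, hc3, r2 ri hri, r2 rc hrc, hz, g2]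
    · exact k2
    · exact r2
  · refine ⟨_, c2, e1.seq (e2.seq (exec_branch_false (by rw [s2, r2 rc hrc, hz]; exact h)
      (exec_skip c2))), by rw [if_neg h]; omega, ?_, k2, r2⟩
    rw [Store.refit, if_neg h, g2]

end LearnedCE

namespace LearnedCE

/-! ### Changes of a leaf -/

variable {A : Learner}

namespace Store

variable {α : Type}

/-- All counters are correct for `D`. -/
def Exact (G : Store α) (ht : ℕ → ℕ) (D : List ℝ) : Prop :=
  ∀ i, (G.shape ht).Node i → G.fld .cnt i = G.count ht D i

/-- When the descent has reached height `0`, every node that contains the new point counts it. -/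
theorem Counts.exact {G : Store α} {ht : ℕ → ℕ} {D : List ℝ} {v : ℝ} (h : G.Counts ht D v 0) :
    G.Exact ht (D ++ [v]) := by
  classical
  intro i hi
  rw [h i hi, count_concat]
  simp

theorem Exact.counts {G : Store α} {ht : ℕ → ℕ} {D : List ℝ} (h : G.Exact ht D)
    (hS : (G.shape ht).Valid) (v : ℝ) : G.Counts ht D v (G.fld .glob 2 + 1) := by
  classical
  intro i hi
  have : ht i ≤ G.fld .glob 2 := hS.ht_le i hi
  rw [h i hi, if_neg (by omega), add_zero]

/-- The effect of inserting a leaf with left end point `s` to the right of the leaf `i`, a child of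
`x`. The new leaf has the data cells from `nb` on, `aj` points at `s` and `cj` points in total;
`ci` points remain in the leaf `i`. -/
noncomputable def linkLeaf (G : Store α) (x i : ℕ) (s : ℝ) (nb aj ci cj : ℕ) : Store α :=
  let t := G.fld .glob 0
  (((((((((((G.set .right t (G.fld .right i)).set .right i t).setKey t s).set .nk x
    (G.fld .nk x + 1)).set .base t nb).set .glob 3 nb).set .atom t aj).set .cnt i ci).set
    .cnt t cj).set .trained i 0).set .trained t 0).set .glob 0 (t + 1)

end Store

theorem TreeInv.mono {M n n' : ℕ} {G : Store A.Model} {ht : ℕ → ℕ} (h : TreeInv M n G ht)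
    (hn : n ≤ n') : TreeInv M n' G ht :=
  ⟨h.valid, h.four_le, h.ht_two, h.lo_two, h.base_le, h.sep, h.last, h.models, h.blank,
    fun f i h1 h2 h3 => (h.bound f i h1 h2 h3).trans (by omega), h.cnt_zero, h.glob_eq_zero⟩

theorem TreeInv.withData {M n : ℕ} {G : Store A.Model} {ht : ℕ → ℕ} (h : TreeInv M n G ht)
    (d : ℕ → ℝ) : TreeInv M n { G with data := d } ht :=
  ⟨h.valid, h.four_le, h.ht_two, h.lo_two, h.base_le, h.sep, h.last, h.models, h.blank, h.bound,
    h.cnt_zero, h.glob_eq_zero⟩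

theorem TreeInv.set {M n i w : ℕ} {G : Store A.Model} {ht : ℕ → ℕ} (h : TreeInv M n G ht)
    (hi : (G.shape ht).Node i) (hw : w ≤ n) {f : Field} (hf : f = .atom ∨ f = .trained) :
    TreeInv M n (G.set f i w) ht := by
  have e : ∀ g, g ≠ f → (G.set f i w).fld g = G.fld g := fun g hg => Store.set_fld_of_ne _ _ _ hg
  have e' : ∀ g, g ≠ .atom → g ≠ .trained → (G.set f i w).fld g = G.fld g := by
    rintro g h1 h2; rcases hf with rfl | rfl
    · exact e g h1
    · exact e g h2
  have hs : (G.set f i w).shape ht = G.shape ht := by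
    unfold Store.shape
    rw [e' _ (by simp) (by simp), e' _ (by simp) (by simp), e' _ (by simp) (by simp),
      e' _ (by simp) (by simp), Store.set_lo]
  refine ⟨by rw [hs]; exact h.valid, by rw [e' _ (by simp) (by simp)]; exact h.four_le,
    h.ht_two, h.lo_two, by rw [e' _ (by simp) (by simp), e' _ (by simp) (by simp)]; exact h.base_le,
    ?_, ?_, h.models, ?_, ?_, by rw [e' _ (by simp) (by simp)]; exact h.cnt_zero,
    by rw [e' _ (by simp) (by simp)]; exact h.glob_eq_zero⟩
  · rw [hs, e' _ (by simp) (by simp)]; exact h.sep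
  · rw [hs, e' _ (by simp) (by simp)]; exact h.last
  · intro j hj
    rw [e' _ (by simp) (by simp)] at hj
    have h1 := h.blank j hj
    refine ⟨fun g => ?_, h1.2⟩
    by_cases hg : g = f
    · subst hg
      rw [Store.set_fld_self, Function.update_of_ne, h1.1]
      rintro rfl
      exact absurd hi.2 (not_lt.2 hj)
    · rw [e g hg, h1.1]
  · intro g j h1 h2 h3
    rw [e' .glob (by simp) (by simp)]
    by_cases hg : g = f
    · subst hg
      rw [Store.set_fld_self, Function.update_apply]
      split_ifs
      · omega
      · exact h.bound g j h1 h2 h3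
    · rw [e g hg]
      exact h.bound g j h1 h2 h3

theorem TreeInv.refit {M n i R : ℕ} {G : Store A.Model} {ht : ℕ → ℕ} (h : TreeInv M n G ht)
    (hi : (G.shape ht).Node i) {a b : ℝ} {z : List ℝ} (hz : z.length ≤ M) (hzn : z.length ≤ n)
    (hab : a < b) (hmem : ∀ y ∈ z, a ≤ y ∧ y ≤ b) : TreeInv M n (G.refit R i a b z) ht := by
  unfold Store.refit
  split_ifs with hm
  · refine TreeInv.set (G := G.setModel i _) ?_ hi hzn (Or.inr rfl)
    refine ⟨h.valid, h.four_le, h.ht_two, h.lo_two, h.base_le, h.sep, h.last, ?_, ?_, h.bound,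
      h.cnt_zero, h.glob_eq_zero⟩
    · intro j f hf
      rw [Store.setModel_model, Function.update_apply] at hf
      split_ifs at hf with hji
      · refine ⟨z.map (rescale a b), ?_, by rwa [List.length_map], ?_, (Option.some.inj hf).symm⟩
        · intro h0
          rw [List.map_eq_nil_iff] at h0
          rw [h0] at hm
          simp at hm
        · intro y hy
          obtain ⟨w, hw, rfl⟩ := List.mem_map.1 hy
          exact rescale_mem_Icc hab (hmem w hw).1 (hmem w hw).2
      · exact h.models j f hf
    · intro j hj
      obtain ⟨h1, h2, h3⟩ := h.blank j hj
      refine ⟨h1, h2, ?_⟩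
      rw [Store.setModel_model, Function.update_of_ne, h3]
      rintro rfl
      exact absurd hi.2 (not_lt.2 hj)
  · exact h

namespace Store

variable {G : Store A.Model} {R i : ℕ} {a b : ℝ} {z : List ℝ}

theorem refit_fld {f : Field} (hf : f ≠ .trained) : (G.refit R i a b z).fld f = G.fld f := by
  unfold refit
  split_ifs
  · exact set_fld_of_ne _ _ _ hf
  · rfl

theorem refit_trained_of_ne {j : ℕ} (hj : j ≠ i) :
    (G.refit R i a b z).fld .trained j = G.fld .trained j := by
  unfold refit
  split_ifs
  · rw [set_fld_self, Function.update_of_ne hj]; rfl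
  · rfl

theorem refit_model_of_ne {j : ℕ} (hj : j ≠ i) :
    (G.refit R i a b z).model j = G.model j := by
  unfold refit
  split_ifs
  · rw [set_model, setModel_model, Function.update_of_ne hj]
  · rfl

theorem refit_data : (G.refit R i a b z).data = G.data := by
  unfold refit; split_ifs <;> rfl

theorem refit_lo : (G.refit R i a b z).lo = G.lo := by
  unfold refit; split_ifs <;> rfl

theorem refit_shape (ht : ℕ → ℕ) : (G.refit R i a b z).shape ht = G.shape ht := by
  unfold shape
  rw [refit_fld (by simp), refit_fld (by simp), refit_fld (by simp), refit_fld (by simp), refit_lo]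

theorem refit_leafPoints (ht : ℕ → ℕ) :
    (G.refit R i a b z).leafPoints ht = G.leafPoints ht := by
  rw [leafPoints, leafPoints, refit_shape, refit_lo]

theorem Exact.refit {ht : ℕ → ℕ} {D : List ℝ} (h : G.Exact ht D) :
    (G.refit R i a b z).Exact ht D := by
  intro j hj
  rw [count, refit_shape, refit_fld (by simp)]
  rw [refit_shape] at hj
  exact h j hj

end Store

theorem LeafInv.refit_other {M R i j : ℕ} {G : Store A.Model} {D : List ℝ} {a b a' b' : ℝ}
    {z : List ℝ} (h : LeafInv M R G D a' b' j) (hj : j ≠ i) :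
    LeafInv M R (G.refit R i a b z) D a' b' j :=
  h.congr (by rw [Store.refit_fld (by simp)]) (Store.refit_trained_of_ne hj)
    (by rw [Store.refit_fld (by simp)]) (Store.refit_model_of_ne hj)
    (by rw [Store.refit_data]; exact fun _ _ => rfl)

/-- `Store.refit` follows the retraining rule of `refresh`. The lemma also covers new halves of a
leaf: with a training counter reset to `0`, the rule trains every nonempty half. -/
theorem LeafInv.of_refit {M R i : ℕ} {G : Store A.Model} {D : List ℝ} {a b : ℝ}
    (hatom : G.fld .atom i = D.countP fun x => x = a)
    (hdata : Holds G.data (G.fld .base i) (inside a b D))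
    (hstate : ∀ w, a ≤ w → w < b → leafState M R w D =
      if G.fld .trained i + min (G.fld .trained i) R < (inside a b D).length then
        (a, b, (inside a b D).length) else (a, b, G.fld .trained i))
    (hmodel : 0 < G.fld .trained i →
      ¬ G.fld .trained i + min (G.fld .trained i) R < (inside a b D).length → G.model i =
      some (A.train (((inside a b D).take (G.fld .trained i)).map (rescale a b)))) :
    LeafInv M R (G.refit R i a b (inside a b D)) D a b i := by
  by_cases h : G.fld .trained i + min (G.fld .trained i) R < (inside a b D).length
  · simp only [h, if_true] at hstate
    have e : G.refit R i a b (inside a b D) = (G.setModel i (A.train ((inside a b D).map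
        (rescale a b)))).set .trained i (inside a b D).length := by rw [Store.refit, if_pos h]
    have et : (G.refit R i a b (inside a b D)).fld .trained i = (inside a b D).length := by
      rw [e, Store.set_fld_self, Function.update_self]
    refine ⟨by rw [Store.refit_fld (by simp)]; exact hatom, ?_, ?_, ?_⟩
    · rw [Store.refit_fld (by simp), Store.refit_data]; exact hdata
    · rw [et]; exact hstate
    · rw [et, List.take_length, e]
      simp
  · simp only [h, if_false] at hstate
    have e : G.refit R i a b (inside a b D) = G := by rw [Store.refit, if_neg h]
    rw [e]
    exact ⟨hatom, hdata, hstate, fun hm => hmodel hm h⟩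

/-- The new leaf gets the block of data cells after the last one assigned, so it is disjoint from
all the others. The dataset `D` already includes the new point here, so the counters are exact and
only those of the two halves change. -/
theorem TreeInv.linkLeaf {M n : ℕ} {G : Store A.Model} {ht : ℕ → ℕ} (h : TreeInv M n G ht)
    {x i : ℕ} (hx : (G.shape ht).Node x) (hxn : G.fld .nk x ≤ 3) (hi : i ∈ (G.shape ht).kids x)
    (hi0 : ht i = 0) {s : ℝ} (hs : G.lo i < s) (hs' : s < (G.shape ht).hi i) (hs1 : s ≤ 1)
    {aj ci cj : ℕ} (haj : aj ≤ n) {D : List ℝ} (hE : G.Exact ht D)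
    (hci : ci = D.countP fun y => G.lo i ≤ y ∧ y < s)
    (hcj : cj = D.countP fun y => s ≤ y ∧ y < (G.shape ht).hi i) :
    let G' := G.linkLeaf x i s (G.fld .glob 3 + (M + 1)) aj ci cj
    let t := G.fld .glob 0
    let ht' := Function.update ht t 0
    TreeInv M n G' ht' ∧ G'.Exact ht' D ∧
      (∀ j, (G'.shape ht').Node j ↔ (G.shape ht).Node j ∨ j = t) ∧
      (∀ j, j ≠ t → G'.lo j = G.lo j) ∧ G'.lo t = s ∧
      (∀ j, (G.shape ht).Node j → j ≠ i → (G'.shape ht').hi j = (G.shape ht).hi j) ∧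
      (G'.shape ht').hi i = s ∧ (G'.shape ht').hi t = (G.shape ht).hi i ∧
      G'.leafPoints ht' = insert s (G.leafPoints ht) ∧ s ∉ G.leafPoints ht := by
  classical
  intro G' t ht'
  have hS := h.valid
  set S := G.shape ht with hSdef
  obtain ⟨hin, hiht, hlo, hhi⟩ := Shape.mem_kids.1 hi
  have ht0 : t = S.next := rfl
  have hxt : x ≠ t := hx.2.ne
  have hit : i ≠ t := hin.2.ne
  have hxi : x ≠ i := by rintro rfl; omega
  have hSi : S.ht i = 0 := hi0
  have hshape : G'.shape ht' = S.insert i s S.down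
      (Function.update S.nk x (S.nk x + 1)) := by
    simp [G', Store.shape, Store.linkLeaf, Shape.insert, Store.set_fld, S, ht', t, hi0]
  have hv : (G'.shape ht').Valid := by
    rw [hshape]
    refine Shape.Valid.insert hS hin hx hiht hlo hhi hxn hs hs' hs1 (fun _ _ => rfl) ?_ ?_ ?_ ?_
    · intro h0; omega
    · intro j h1 h2 h3; exact Function.update_of_ne h3 _ _
    · rw [Function.update_self]
    · intro h0; omega
  have hnode : ∀ j, (G'.shape ht').Node j ↔ S.Node j ∨ j = t := by
    intro j; rw [hshape]; exact Shape.Valid.node_insert (hin.1.trans hin.2)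
  have hlevel : (G'.shape ht').level 0 = insert t (S.level 0) := by
    ext j
    rw [Finset.mem_insert, Shape.mem_level, Shape.mem_level, hnode, hshape]
    constructor
    · rintro ⟨hj | rfl, h0⟩
      · rw [Shape.Valid.insert_ht hj] at h0; exact Or.inr ⟨hj, h0⟩
      · exact Or.inl rfl
    · rintro (rfl | ⟨hj, h0⟩)
      · rw [ht0, Shape.Valid.insert_ht_next]; exact ⟨Or.inr rfl, hSi⟩
      · rw [Shape.Valid.insert_ht hj]; exact ⟨Or.inl hj, h0⟩
  have htl : t ∉ S.level 0 := fun hh => lt_irrefl _ (Shape.mem_level.1 hh).1.2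
  have hl1 : ∀ j, j ≠ t → G'.lo j = G.lo j := fun j hj => by
    simp [G', Store.linkLeaf, show j ≠ G.fld .glob 0 from hj]
  have hl2 : G'.lo t = s := by simp [G', Store.linkLeaf, t]
  have hh1 : ∀ j, S.Node j → j ≠ i → (G'.shape ht').hi j = S.hi j := by
    intro j hj hji; rw [hshape]; exact Shape.Valid.insert_hi hS hj hji
  have hh2 : (G'.shape ht').hi i = s := by rw [hshape]; exact Shape.Valid.insert_hi_self hin
  have hh3 : (G'.shape ht').hi t = S.hi i := by
    rw [hshape]; exact Shape.Valid.insert_hi_next hS hin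
  have fb : G'.fld .base = Function.update (G.fld .base) t (G.fld .glob 3 + (M + 1)) := by
    simp [G', Store.linkLeaf, Store.set_fld, t]
  have fc : G'.fld .cnt = Function.update (Function.update (G.fld .cnt) i ci) t cj := by
    simp [G', Store.linkLeaf, Store.set_fld, t]
  have f3 : G'.fld .glob 3 = G.fld .glob 3 + (M + 1) := by
    simp [G', Store.linkLeaf, Store.set_fld]
  have f0 : G'.fld .glob 0 = G.fld .glob 0 + 1 := by
    simp [G', Store.linkLeaf]
  have h44 := h.four_le
  have hsP : s ∉ G.leafPoints ht := by
    rw [Store.leafPoints, Finset.mem_image]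
    rintro ⟨j, hj, hjs⟩
    obtain ⟨j1, j2⟩ := Shape.mem_level.1 hj
    have h1 : S.lo i < S.lo j := by
      have : S.lo j = s := hjs
      rw [this]; exact hs
    have h2 := hS.sep i j hin j1 (hSi.trans j2.symm) h1
    have : S.lo j = s := hjs
    linarith
  refine ⟨⟨hv, by omega, ?_, ?_, ?_, ?_, ?_, ?_, ?_, ?_, ?_, ?_⟩, ?_, hnode, hl1, hl2, hh1, hh2,
    hh3, ?_,
    hsP⟩
  · rw [← h.ht_two]; exact Function.update_of_ne (by omega) _ _
  · rw [hl1 2 (by omega), h.lo_two]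
  · intro j
    rw [fb, f3, Function.update_apply]
    have := h.base_le j
    split_ifs <;> omega
  · intro j k hj hk hj0 hk0 hjk hj1 hk1
    rw [hnode] at hj hk
    rw [fb]
    rcases hj with hj | rfl <;> rcases hk with hk | rfl
    · have e1 : ht' j = ht j := Function.update_of_ne (show j ≠ t from hj.2.ne) _ _
      have e2 : ht' k = ht k := Function.update_of_ne (show k ≠ t from hk.2.ne) _ _
      rw [e1] at hj0
      rw [e2] at hk0
      rw [hl1 j (show j ≠ t from hj.2.ne)] at hj1
      rw [hl1 k (show k ≠ t from hk.2.ne)] at hk1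
      rw [Function.update_of_ne (show j ≠ t from hj.2.ne), Function.update_of_ne (show k ≠ t from hk.2.ne)]
      exact h.sep j k hj hk hj0 hk0 hjk hj1 hk1
    · left
      rw [Function.update_self, Function.update_of_ne (show j ≠ t from hj.2.ne)]
      have := h.base_le j; omega
    · right
      rw [Function.update_self, Function.update_of_ne (show k ≠ t from hk.2.ne)]
      have := h.base_le k; omega
    · exact absurd rfl hjk
  · rw [f3, hlevel, Finset.card_insert_of_notMem htl]
    have := h.last
    rw [← hSdef] at this
    linarith [Nat.mul_add (M + 1) (S.level 0).card 1]
  · exact h.models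
  · intro j hj
    rw [f0] at hj
    obtain ⟨h1, h2, h3⟩ := h.blank j (by omega)
    have i1 : j ≠ G.fld .glob 0 := by omega
    have i2 : j ≠ i := by have : i < G.fld .glob 0 := hin.2; omega
    have i3 : j ≠ x := by have : x < G.fld .glob 0 := hx.2; omega
    have i4 : j ≠ 0 := by omega
    have i5 : j ≠ 3 := by omega
    refine ⟨fun g => ?_, ?_, h3⟩
    · simp only [G', Store.linkLeaf]
      cases g <;> simp [Store.set_fld, i1, i2, i3, i4, i5, h1]
    · simp [G', Store.linkLeaf, i1, h2]
  · intro g j hg1 hg2 hg3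
    have hb := h.bound g j hg1 hg2 hg3
    have hr2 : G.fld .right i ≤ G.fld .glob 0 := by
      by_cases h0 : S.right i = 0
      · change S.right i ≤ _; omega
      · exact (hS.right_node i hin h0).2.le
    rw [f0]
    simp only [G', Store.linkLeaf]
    cases g <;> simp only [Store.set_fld, Store.setKey_fld, Function.update_apply, reduceCtorEq,
        if_true, if_false] <;>
      first
      | exact absurd rfl hg1
      | exact absurd rfl hg2
      | exact absurd rfl hg3
      | exact hb.trans (by omega)
      | (split_ifs <;> omega)
  · have h0 : 0 ≠ t := by change 0 ≠ G.fld .glob 0; omega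
    rw [fc, Function.update_of_ne h0, Function.update_of_ne hin.1.ne, h.cnt_zero]
  · intro j hj
    have i0 : j ≠ 0 := by omega
    have i3 : j ≠ 3 := by omega
    simp [G', Store.linkLeaf, Store.set_fld, i0, i3, h.glob_eq_zero j hj]
  · intro j hj
    rw [hnode] at hj
    rw [Store.count, fc]
    have el : ∀ j, (G'.shape ht').lo j = G'.lo j := fun _ => rfl
    rcases hj with hj | rfl
    · rw [Function.update_of_ne (show j ≠ t from hj.2.ne), el, hl1 j (show j ≠ t from hj.2.ne)]
      by_cases hji : j = i
      · subst hji
        rw [Function.update_self, hh2, hci]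
      · rw [Function.update_of_ne hji, hh1 j hj hji]
        exact hE j hj
    · rw [Function.update_self, el, hl2, hh3, hcj]
  · rw [Store.leafPoints, hlevel, Finset.image_insert, hl2, Store.leafPoints]
    congr 1
    refine Finset.image_congr fun j hj => hl1 j ?_
    rintro rfl
    exact htl hj

/-! ### The other leaves -/

/-- A leaf that does not contain `v` keeps its inner points, and the cells written to lie in the
block of `i` or beyond all the blocks assigned so far. The leaf that begins at `1` has no cells to
protect. -/
theorem Leaves.other {M R n i j : ℕ} {G G' : Store A.Model} {ht : ℕ → ℕ} {D : List ℝ} {v : ℝ}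
    (hT : TreeInv M n G ht) (hL : Leaves M R G ht D) (hD : ∀ y ∈ D ++ [v], y ∈ Icc (0 : ℝ) 1)
    (hi : (G.shape ht).Node i) (hi0 : ht i = 0) (hv : G.lo i ≤ v) (hv' : v < (G.shape ht).hi i)
    (hi1 : G.lo i < 1) (hj : (G.shape ht).Node j) (hj0 : ht j = 0) (hji : j ≠ i)
    (hatom : G'.fld .atom j = G.fld .atom j) (htr : G'.fld .trained j = G.fld .trained j)
    (hbase : G'.fld .base j = G.fld .base j) (hmodel : G'.model j = G.model j)
    (hdata : ∀ a, a < G.fld .base i ∨ (G.fld .base i + (M + 1) ≤ a ∧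
      a < G.fld .glob 3 + (M + 1)) → G'.data a = G.data a) :
    LeafInv M R G' (D ++ [v]) ((G.shape ht).lo j) ((G.shape ht).hi j) j := by
  have hS := hT.valid
  have h0 := hS.lo_nonneg j hj
  have hlt := hS.lo_lt_hi j hj
  have h3 := hS.hi_le hj
  have h1 : LeafInv M R G (D ++ [v]) ((G.shape ht).lo j) ((G.shape ht).hi j) j := by
    refine (hL j hj hj0).concat_of_not_mem h0 hlt h3 fun h => ?_
    exact hji (hS.eq_of_mem hj hi (hj0.trans hi0.symm) h.1 h.2 hv hv')
  refine h1.congr hatom htr hbase hmodel fun k hk => hdata _ ?_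
  by_cases hj1 : G.lo j < 1
  · have hg := (h1.good h0 hlt h3).card_le
    simp only at hg
    have hb := hT.base_le j
    rcases hT.sep i j hi hj hi0 hj0 hji.symm hi1 hj1 with hs | hs
    · right; omega
    · left; omega
  · exfalso
    obtain ⟨y, hy⟩ := List.exists_mem_of_length_pos (Nat.zero_lt_of_lt hk)
    obtain ⟨y1, y2, -⟩ := mem_inside.1 hy
    have := (hD y y1).2
    have e : (G.shape ht).lo j = G.lo j := rfl
    rw [e] at y2
    linarith

/-! ### Bookkeeping for the amortized analysis -/

/-- A quantity that depends on the number of inner points and the size of the training set of the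
leaf around `a`. -/
noncomputable def weight (M R : ℕ) (F : ℕ → ℕ → ℕ) (D : List ℝ) (a : ℝ) : ℕ :=
  F (inside (leafState M R a D).1 (leafState M R a D).2.1 D).length (leafState M R a D).2.2

theorem LeafInv.weight_eq {M R i : ℕ} {G : Store A.Model} {D : List ℝ} {a b : ℝ}
    (h : LeafInv M R G D a b i) (hab : a < b) (F : ℕ → ℕ → ℕ) :
    weight M R F D a = F (inside a b D).length (G.fld .trained i) := by
  rw [weight, h.state a le_rfl hab]

/-- Only the leaf that contains `v` changes its weight. The sums range over the old leaf points, and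
the terms are arranged so as to avoid subtraction of natural numbers. -/
theorem sum_weight {M R n i : ℕ} {G : Store A.Model} {ht : ℕ → ℕ} {D : List ℝ} {v : ℝ}
    (hT : TreeInv M n G ht) (hL : Leaves M R G ht D) (hi : (G.shape ht).Node i) (hi0 : ht i = 0)
    (hv : G.lo i ≤ v) (hv' : v < (G.shape ht).hi i) (F : ℕ → ℕ → ℕ) :
    ∑ a ∈ G.leafPoints ht, weight M R F (D ++ [v]) a + weight M R F D (G.lo i) =
      ∑ a ∈ G.leafPoints ht, weight M R F D a + weight M R F (D ++ [v]) (G.lo i) := by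
  classical
  have hS := hT.valid
  have hmem : G.lo i ∈ G.leafPoints ht :=
    Finset.mem_image_of_mem _ (Shape.mem_level.2 ⟨hi, hi0⟩)
  rw [← Finset.add_sum_erase _ _ hmem, ← Finset.add_sum_erase (G.leafPoints ht)
    (fun a => weight M R F D a) hmem]
  have : ∑ a ∈ (G.leafPoints ht).erase (G.lo i), weight M R F (D ++ [v]) a =
      ∑ a ∈ (G.leafPoints ht).erase (G.lo i), weight M R F D a := by
    refine Finset.sum_congr rfl fun a ha => ?_
    obtain ⟨ha1, ha2⟩ := Finset.mem_erase.1 ha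
    obtain ⟨j, hj, rfl⟩ := Finset.mem_image.1 ha2
    obtain ⟨hjn, hj0⟩ := Shape.mem_level.1 hj
    have hji : j ≠ i := by rintro rfl; exact ha1 rfl
    have hlt := hS.lo_lt_hi j hjn
    have hnot : ¬ ((G.shape ht).lo j ≤ v ∧ v < (G.shape ht).hi j) := fun h =>
      hji (hS.eq_of_mem hjn hi (hj0.trans hi0.symm) h.1 h.2 hv hv')
    have h1 := hL j hjn hj0
    have h2 := h1.concat_of_not_mem (hS.lo_nonneg j hjn) hlt (hS.hi_le hjn) hnot
    have e1 := h1.weight_eq hlt F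
    have e2 := h2.weight_eq hlt F
    have e3 : (G.shape ht).lo j = G.lo j := rfl
    rw [e3] at e1 e2
    rw [e1, e2, inside_append, inside_singleton_of_not_mem, List.append_nil]
    exact fun h => hnot ⟨h.1.le, h.2⟩
  rw [this]
  ring

end LearnedCE

namespace LearnedCE

/-! ### Insertion of a point into a leaf: the effect on the store -/

variable {A : Learner}

/-- The number of points by which the leaves around the points of `P` exceed half of their
capacity. -/
noncomputable def excess (M R : ℕ) (D : List ℝ) (P : Finset ℝ) : ℕ :=
  ∑ a ∈ P, weight M R (fun c _ => c - (M + 1) / 2) D a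

/-- The number of inner points of the leaves around the points of `P` on which their models are not
trained. -/
noncomputable def stale (M R : ℕ) (D : List ℝ) (P : Finset ℝ) : ℕ :=
  ∑ a ∈ P, weight M R (fun c m => c - m) D a

/-- The bookkeeping for the insertion of `v`, when the leaf points change from `P` to `P'` by `sp`
leaf splits and models are trained on the datasets `zs`. -/
structure Ledger (M R : ℕ) (D : List ℝ) (v : ℝ) (P P' : Finset ℝ) (sp : ℕ)
    (zs : List (List ℝ)) : Prop where
  card : P'.card = P.card + sp
  sp_le : sp ≤ 1
  le_length : sp ≠ 0 → M ≤ D.length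
  -- A full leaf has `M - (M + 1) / 2` units, its two halves have none, and the insertion supplies
  -- the missing one.
  excess : sp * (M + 1 - (M + 1) / 2) + excess M R (D ++ [v]) P' ≤ excess M R D P + 1
  -- Each stale point carries `ρ` units of credit for the next retraining, each unit of excess two
  -- for the training of the halves. The factor `ρ` stays free until the parameters are chosen.
  train : ∀ ρ, 2 ≤ ρ → M ≤ ρ * (R + 1) → (zs.map List.length).sum +
    ρ * stale M R (D ++ [v]) P' + 2 * LearnedCE.excess M R (D ++ [v]) P' ≤
      ρ * stale M R D P + 2 * LearnedCE.excess M R D P + ρ + 2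
  length_le : zs.length ≤ 2
  good : ∀ z ∈ zs, z ≠ [] ∧ z.length ≤ M ∧ ∀ y ∈ z, y ∈ Icc (0 : ℝ) 1

/-- The insertion of `v` has reached the leaf `i`, a child of `x`. -/
structure Arrival (M R : ℕ) (D : List ℝ) (v : ℝ) (G : Store A.Model) (ht : ℕ → ℕ) (x i : ℕ) :
    Prop where
  tree : TreeInv M (D ++ [v]).length G ht
  leaves : Leaves M R G ht D
  exact : G.Exact ht (D ++ [v])
  node : (G.shape ht).Node x
  kid : i ∈ (G.shape ht).kids x
  leaf : ht i = 0
  lo_le : G.lo i ≤ v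
  lt_hi : v < (G.shape ht).hi i
  nk_le : G.fld .nk x ≤ 3
  mem : ∀ y ∈ D ++ [v], y ∈ Icc (0 : ℝ) 1

namespace Arrival

variable {M R : ℕ} {D : List ℝ} {v : ℝ} {G : Store A.Model} {ht : ℕ → ℕ} {x i : ℕ}

theorem node_leaf (h : Arrival M R D v G ht x i) : (G.shape ht).Node i :=
  (Shape.mem_kids.1 h.kid).1

theorem lo_nonneg (h : Arrival M R D v G ht x i) : 0 ≤ G.lo i :=
  h.tree.valid.lo_nonneg i h.node_leaf

theorem lo_lt_hi (h : Arrival M R D v G ht x i) : G.lo i < (G.shape ht).hi i :=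
  h.tree.valid.lo_lt_hi i h.node_leaf

theorem hi_le (h : Arrival M R D v G ht x i) : (G.shape ht).hi i ≤ 3 :=
  h.tree.valid.hi_le h.node_leaf

theorem leafInv (h : Arrival M R D v G ht x i) :
    LeafInv M R G D (G.lo i) ((G.shape ht).hi i) i :=
  h.leaves i h.node_leaf h.leaf

theorem good (h : Arrival M R D v G ht x i) :
    GoodLeaf M R (G.lo i) D (G.lo i, (G.shape ht).hi i, G.fld .trained i) :=
  h.leafInv.good h.lo_nonneg h.lo_lt_hi h.hi_le

theorem lo_lt_one (h : Arrival M R D v G ht x i) (hv : G.lo i < v) : G.lo i < 1 :=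
  hv.trans_le (h.mem v (by simp)).2

theorem inside_concat (h : Arrival M R D v G ht x i) (hv : G.lo i < v) :
    inside (G.lo i) ((G.shape ht).hi i) (D ++ [v]) =
      inside (G.lo i) ((G.shape ht).hi i) D ++ [v] := by
  rw [inside_append, inside_singleton_of_mem ⟨hv, h.lt_hi⟩]

theorem sum (h : Arrival M R D v G ht x i) (F : ℕ → ℕ → ℕ) :
    ∑ a ∈ G.leafPoints ht, weight M R F (D ++ [v]) a +
        F (inside (G.lo i) ((G.shape ht).hi i) D).length (G.fld .trained i) =
      ∑ a ∈ G.leafPoints ht, weight M R F D a + weight M R F (D ++ [v]) (G.lo i) := by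
  rw [← h.leafInv.weight_eq h.lo_lt_hi F]
  exact sum_weight h.tree h.leaves h.node_leaf h.leaf h.lo_le h.lt_hi F

/-- A point at the left end of its leaf only raises the multiplicity there. Inner points, and with
them all potentials, stay the same; this is how arbitrarily many equal points are absorbed without
further splits. -/
theorem insert_atom (h : Arrival M R D v G ht x i) (hv : ¬ G.lo i < v)
    (ha : G.fld .atom i + 1 ≤ (D ++ [v]).length) :
    TreeInv M (D ++ [v]).length (G.set .atom i (G.fld .atom i + 1)) ht ∧
    Leaves M R (G.set .atom i (G.fld .atom i + 1)) ht (D ++ [v]) ∧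
    (G.set .atom i (G.fld .atom i + 1)).Exact ht (D ++ [v]) ∧
    Ledger M R D v (G.leafPoints ht)
      ((G.set .atom i (G.fld .atom i + 1)).leafPoints ht) 0 [] := by
  have hva : v = G.lo i := le_antisymm (not_lt.1 hv) h.lo_le
  set G' := G.set .atom i (G.fld .atom i + 1) with hG'
  have e : ∀ f, f ≠ .atom → G'.fld f = G.fld f := fun f hf => Store.set_fld_of_ne _ _ _ hf
  have hs : G'.shape ht = G.shape ht := by
    unfold Store.shape
    rw [e _ (by simp), e _ (by simp), e _ (by simp), e _ (by simp), hG', Store.set_lo]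
  have hi' : LeafInv M R G' (D ++ [v]) (G.lo i) ((G.shape ht).hi i) i := by
    have := h.leafInv.concat_atom h.lo_nonneg h.lo_lt_hi h.hi_le
    rwa [← hva] at this ⊢
  have hP : G'.leafPoints ht = G.leafPoints ht := by
    rw [Store.leafPoints, Store.leafPoints, hs, hG', Store.set_lo]
  have hin : inside (G.lo i) ((G.shape ht).hi i) (D ++ [v]) =
      inside (G.lo i) ((G.shape ht).hi i) D := by
    rw [inside_append, inside_singleton_of_not_mem, List.append_nil]
    exact fun h' => hv h'.1
  have hsum : ∀ F : ℕ → ℕ → ℕ, ∑ a ∈ G.leafPoints ht, weight M R F (D ++ [v]) a =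
      ∑ a ∈ G.leafPoints ht, weight M R F D a := by
    intro F
    have h1 := h.sum F
    rw [hi'.weight_eq h.lo_lt_hi F, hin, e _ (by simp)] at h1
    omega
  refine ⟨h.tree.set h.node_leaf ha (Or.inl rfl), ?_, ?_, ?_⟩
  · intro j hj hj0
    rw [hs] at hj ⊢
    by_cases hji : j = i
    · subst hji; exact hi'
    · have h1 := (h.leaves j hj hj0).concat_of_not_mem (h.tree.valid.lo_nonneg j hj)
        (h.tree.valid.lo_lt_hi j hj) (h.tree.valid.hi_le hj) (v := v) fun hh =>
          hji (h.tree.valid.eq_of_mem hj h.node_leaf (hj0.trans h.leaf.symm) hh.1 hh.2 h.lo_le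
            h.lt_hi)
      refine h1.congr ?_ (by rw [e _ (by simp)]) (by rw [e _ (by simp)]) rfl fun _ _ => rfl
      rw [hG', Store.set_fld_self, Function.update_of_ne hji]
  · intro j hj
    rw [Store.count, hs, e _ (by simp)]
    rw [hs] at hj
    exact h.exact j hj
  · rw [hP]
    refine ⟨rfl, by omega, fun h0 => absurd rfl h0, ?_, fun ρ _ _ => ?_, by simp, by simp⟩
    · simp only [LearnedCE.excess, hsum]; omega
    · simp only [LearnedCE.excess, stale, hsum]; simp; omega

theorem length_le (D : List ℝ) (a b : ℝ) : (inside a b D).length ≤ D.length :=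
  List.length_filter_le _ _

/-- The case of a new inner point without overflow. The excess grows by at most one; either one more
point becomes stale, or the leaf is retrained and its stale points disappear. -/
theorem insert_refit (h : Arrival M R D v G ht x i) (hv : G.lo i < v) {z : List ℝ}
    (hz : z = inside (G.lo i) ((G.shape ht).hi i) (D ++ [v])) (hM : z.length ≤ M) {d : ℕ → ℝ}
    (hd : Holds d (G.fld .base i) z)
    (hd' : ∀ a, a < G.fld .base i ∨ G.fld .base i + (M + 1) ≤ a → d a = G.data a) :
    let G' := Store.refit { G with data := d } R i (G.lo i) ((G.shape ht).hi i) z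
    TreeInv M (D ++ [v]).length G' ht ∧ Leaves M R G' ht (D ++ [v]) ∧ G'.Exact ht (D ++ [v]) ∧
    Ledger M R D v (G.leafPoints ht) (G'.leafPoints ht) 0
      (if G.fld .trained i + min (G.fld .trained i) R < z.length then
        [z.map (rescale (G.lo i) ((G.shape ht).hi i))] else []) := by
  intro G'
  set a := G.lo i with ha
  set b := (G.shape ht).hi i with hb
  set m := G.fld .trained i with hm
  have hzl : z.length = (inside a b D).length + 1 := by
    rw [hz, h.inside_concat hv, List.length_append, List.length_singleton]
  have hlt : a < b := h.lo_lt_hi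
  have hg1 : (inside a b D).length ≤ M := h.good.card_le
  have hg2 : m ≤ (inside a b D).length := h.good.trained_le
  have hg3 : (inside a b D).length ≤ m + min m R := h.good.card_le_trained
  have hs : G'.shape ht = G.shape ht := Store.refit_shape ht
  have hlo : G'.lo = G.lo := Store.refit_lo
  have hP : G'.leafPoints ht = G.leafPoints ht := Store.refit_leafPoints ht
  have hi' : LeafInv M R G' (D ++ [v]) a b i := by
    simp only [G', hz]
    refine LeafInv.of_refit ?_ ?_ ?_ ?_
    · change G.fld .atom i = _
      rw [h.leafInv.atom, List.countP_append, List.countP_singleton, if_neg]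
      · rfl
      · simpa using hv.ne'
    · rw [← hz]; exact hd
    · intro w hw hw'
      have h1 := h.leafInv.state w hw hw'
      rw [leafState_concat, h1]
      unfold refresh
      simp only
      rw [← ha, ← hb, ← hz, if_neg (by omega)]
    · intro h1 _
      change 0 < m at h1
      change G.model i = some (A.train (((inside a b (D ++ [v])).take m).map (rescale a b)))
      rw [h.leafInv.model h1, h.inside_concat hv, List.take_append_of_le_length hg2]
  have hin : ∀ y ∈ z, a ≤ y ∧ y ≤ b := by
    intro y hy
    rw [hz] at hy
    have := (mem_inside.1 hy).2
    exact ⟨this.1.le, this.2.le⟩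
  refine ⟨?_, ?_, Store.Exact.refit h.exact, ?_⟩
  · refine (h.tree.withData d).refit h.node_leaf hM ?_ hlt hin
    rw [hz]; exact length_le _ _ _
  · intro j hj hj0
    rw [hs] at hj ⊢
    by_cases hji : j = i
    · subst hji; exact hi'
    · refine Leaves.other h.tree h.leaves h.mem h.node_leaf h.leaf h.lo_le h.lt_hi
        (h.lo_lt_one hv) hj hj0 hji ?_ (Store.refit_trained_of_ne hji) ?_
        (Store.refit_model_of_ne hji) ?_
      · exact congrFun (Store.refit_fld (by simp)) j
      · exact congrFun (Store.refit_fld (by simp)) j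
      · intro c hc
        simp only [G']
        rw [Store.refit_data]
        exact hd' c (by omega)
  · rw [hP]
    have ht' : G'.fld .trained i = if m + min m R < z.length then z.length else m := by
      simp only [G', Store.refit]
      split_ifs with h1
      · simp
      · rfl
    have hsum : ∀ F : ℕ → ℕ → ℕ, ∑ a ∈ G.leafPoints ht, weight M R F (D ++ [v]) a +
        F (inside a b D).length m = ∑ a ∈ G.leafPoints ht, weight M R F D a +
          F ((inside a b D).length + 1) (if m + min m R < z.length then z.length else m) := by
      intro F
      have h1 := h.sum F
      rw [hzl]
      rwa [hi'.weight_eq hlt F, ← hz, hzl, ht', hzl] at h1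
    have h1 := hsum fun c _ => c - (M + 1) / 2
    have h2 := hsum fun c m => c - m
    refine ⟨rfl, by omega, fun h0 => absurd rfl h0, ?_, fun ρ hρ hρM => ?_, ?_, ?_⟩
    · simp only [LearnedCE.excess]; omega
    · simp only [LearnedCE.excess, stale]
      set E' := ∑ a ∈ G.leafPoints ht, weight M R (fun c _ => c - (M + 1) / 2) (D ++ [v]) a
      set E := ∑ a ∈ G.leafPoints ht, weight M R (fun c _ => c - (M + 1) / 2) D a
      set T' := ∑ a ∈ G.leafPoints ht, weight M R (fun c m => c - m) (D ++ [v]) a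
      set T := ∑ a ∈ G.leafPoints ht, weight M R (fun c m => c - m) D a
      have hE : E' ≤ E + 1 := by omega
      split_ifs at h2 ⊢ with h3
      · simp only [List.map_cons, List.map_nil, List.sum_cons, List.sum_nil, List.length_map]
        obtain ⟨k, hk⟩ := Nat.exists_eq_add_of_le hg2
        have hT : T' + k = T := by omega
        -- Before the insertion the threshold was met with equality, so `k = min m R`. If `m ≤ R`,
        -- then `z.length = 2 * k + 1`; otherwise `k = R`, and the capacity bounds `z.length`.
        have key : z.length ≤ ρ * (k + 1) := by
          by_cases hmR : m ≤ R
          · calc z.length ≤ 2 * (k + 1) := by omega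
              _ ≤ ρ * (k + 1) := Nat.mul_le_mul_right _ hρ
          · calc z.length ≤ ρ * (R + 1) := hM.trans hρM
              _ ≤ ρ * (k + 1) := Nat.mul_le_mul_left _ (by omega)
        rw [← hT]
        calc z.length + 0 + ρ * T' + 2 * E' ≤ ρ * (k + 1) + 0 + ρ * T' + 2 * (E + 1) := by omega
          _ = _ := by ring
      · simp only [List.map_nil, List.sum_nil]
        have hT : T' ≤ T + 1 := by omega
        calc 0 + ρ * T' + 2 * E' ≤ 0 + ρ * (T + 1) + 2 * (E + 1) := by gcongr
          _ = _ := by ring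
    · split_ifs <;> simp
    · intro y hy
      split_ifs at hy with h3
      · rw [List.mem_singleton] at hy
        subst hy
        refine ⟨?_, by rwa [List.length_map], ?_⟩
        · rw [ne_eq, List.map_eq_nil_iff]
          rintro h0
          rw [h0] at hzl
          simp at hzl
        · intro y hy
          obtain ⟨w, hw, rfl⟩ := List.mem_map.1 hy
          exact rescale_mem_Icc hlt (hin w hw).1 (hin w hw).2
      · simp at hy

/-- The store is changed as `refresh` prescribes: the old node becomes the left half, and the new
one takes the right half and the points equal to the median as its multiplicity. Resetting both
training counters forces fresh models for the nonempty halves. -/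
theorem insert_split (h : Arrival M R D v G ht x i) (hv : G.lo i < v) {z : List ℝ}
    (hz : z = inside (G.lo i) ((G.shape ht).hi i) (D ++ [v])) (hM : M < z.length) {s : ℝ}
    (hs : s = kth (M / 2) z) {d : ℕ → ℝ} (hdl : Holds d (G.fld .base i) (z.filter fun y => y < s))
    (hdr : Holds d (G.fld .glob 3 + (M + 1)) (z.filter fun y => s < y))
    (hd' : ∀ a, a < G.fld .base i ∨ (G.fld .base i + (M + 1) ≤ a ∧ a < G.fld .glob 3 + (M + 1)) →
      d a = G.data a) :
    let zl := z.filter fun y => y < s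
    let zr := z.filter fun y => s < y
    let aj := z.countP fun y => y = s
    let t := G.fld .glob 0
    let ht' := Function.update ht t 0
    let G' := ((Store.linkLeaf { G with data := d } x i s (G.fld .glob 3 + (M + 1)) aj
      (G.fld .atom i + zl.length) (aj + zr.length)).refit R i (G.lo i) s zl).refit R t s
        ((G.shape ht).hi i) zr
    TreeInv M (D ++ [v]).length G' ht' ∧ Leaves M R G' ht' (D ++ [v]) ∧
    G'.Exact ht' (D ++ [v]) ∧
    Ledger M R D v (G.leafPoints ht) (G'.leafPoints ht') 1
      ((if 0 < zl.length then [zl.map (rescale (G.lo i) s)] else []) ++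
        if 0 < zr.length then [zr.map (rescale s ((G.shape ht).hi i))] else []) := by
  intro zl zr aj t ht' G'
  set a := G.lo i with ha
  set b := (G.shape ht).hi i with hb
  set m := G.fld .trained i with hm
  have hin := h.node_leaf
  have hit : i ≠ t := hin.2.ne
  have hzc : z.length = (inside a b D).length + 1 := by
    rw [hz, h.inside_concat hv, List.length_append, List.length_singleton]
  have hg1 : (inside a b D).length ≤ M := h.good.card_le
  have hg2 : m ≤ (inside a b D).length := h.good.trained_le
  have hk : IsKth (M / 2) (inside a b (D ++ [v])) s := by
    rw [hs, ← hz]; exact isKth_kth (by omega)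
  obtain ⟨k1, k2, has, hsb⟩ := hk.length_inside_le
  rw [← hz] at k2
  have hzl : zl = inside a s (D ++ [v]) := by rw [inside_left hsb.le, ← hz]
  have hzr : zr = inside s b (D ++ [v]) := by rw [inside_right has.le, ← hz]
  rw [← hzl] at k1
  rw [← hzr] at k2
  have hs1 : s ≤ 1 := (h.mem s (mem_inside.1 hk.1).1).2
  have haj : aj = (D ++ [v]).countP fun y => y = s := by
    simp only [aj]
    rw [hz, countP_inside]
    refine List.countP_congr fun y _ => ?_
    simp only [decide_eq_true_eq]
    constructor
    · exact fun hh => hh.1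
    · rintro rfl; exact ⟨rfl, has, hsb⟩
  have hatom : G.fld .atom i = (D ++ [v]).countP fun y => y = a := by
    rw [h.leafInv.atom, List.countP_append, List.countP_singleton, if_neg]
    · rfl
    · simpa using hv.ne'
  set Gd : Store A.Model := { G with data := d } with hGd
  set G1 := Gd.linkLeaf x i s (G.fld .glob 3 + (M + 1)) aj (G.fld .atom i + zl.length)
    (aj + zr.length) with hG1
  obtain ⟨T1, T2, T3, T4, T5, T6, T7, T8, T9, T10⟩ := (h.tree.withData d).linkLeaf (s := s) h.node
    h.nk_le h.kid h.leaf has hsb hs1 (aj := aj) (ci := G.fld .atom i + zl.length)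
    (cj := aj + zr.length) (haj ▸ List.countP_le_length) h.exact
    (by rw [hatom, hzl]; exact (countP_interval has _).symm)
    (by rw [haj, hzr]; exact (countP_interval hsb _).symm)
  change TreeInv M (D ++ [v]).length G1 ht' at T1
  change G1.Exact ht' (D ++ [v]) at T2
  change ∀ j, (G1.shape ht').Node j ↔ (G.shape ht).Node j ∨ j = t at T3
  change ∀ j, j ≠ t → G1.lo j = G.lo j at T4
  change G1.lo t = s at T5
  change ∀ j, (G.shape ht).Node j → j ≠ i → (G1.shape ht').hi j = (G.shape ht).hi j at T6
  change (G1.shape ht').hi i = s at T7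
  change (G1.shape ht').hi t = b at T8
  change G1.leafPoints ht' = insert s (G.leafPoints ht) at T9
  change s ∉ G.leafPoints ht at T10
  set G2 := G1.refit R i a s zl with hG2
  have hG' : G' = G2.refit R t s b zr := rfl
  have hshape : G'.shape ht' = G1.shape ht' :=
    (Store.refit_shape ht').trans (Store.refit_shape ht')
  have hP : G'.leafPoints ht' = insert s (G.leafPoints ht) :=
    ((Store.refit_leafPoints ht').trans (Store.refit_leafPoints ht')).trans T9
  have hdata : G1.data = d := rfl
  have ftr : G1.fld .trained = Function.update (Function.update (G.fld .trained) i 0) t 0 := by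
    simp [hG1, Store.linkLeaf, Store.set_fld, hGd, t]
  have fat : G1.fld .atom = Function.update (G.fld .atom) t aj := by
    simp [hG1, Store.linkLeaf, Store.set_fld, hGd, t]
  have fba : G1.fld .base = Function.update (G.fld .base) t (G.fld .glob 3 + (M + 1)) := by
    simp [hG1, Store.linkLeaf, Store.set_fld, hGd, t]
  have hmodel : G1.model = G.model := rfl
  have ftri : G1.fld .trained i = 0 := by
    rw [ftr, Function.update_of_ne hit, Function.update_self]
  have ftrt : G2.fld .trained t = 0 := by
    rw [hG2, Store.refit_trained_of_ne hit.symm, ftr, Function.update_self]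
  have hstate : ∀ w, a ≤ w → w < b → leafState M R w (D ++ [v]) =
      if w < s then (a, s, zl.length) else (s, b, zr.length) := by
    intro w hw hw'
    have h1 := h.leafInv.state w hw hw'
    rw [leafState_concat, h1]
    unfold refresh
    simp only
    rw [← ha, ← hb, ← hz, if_pos hM, ← hs, hzl, hzr]
  have hi2 : LeafInv M R G2 (D ++ [v]) a s i := by
    rw [hG2, hzl]
    refine LeafInv.of_refit ?_ ?_ ?_ ?_
    · rw [fat, Function.update_of_ne hit, hatom]
    · rw [fba, Function.update_of_ne hit, hdata, ← hzl]; exact hdl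
    · intro w hw hw'
      rw [hstate w hw (hw'.trans hsb), if_pos hw', ftri, ← hzl]
      split_ifs with h0
      · rfl
      · rw [show zl.length = 0 by simpa using h0]
    · rw [ftri]; intro h0; exact absurd h0 (lt_irrefl _)
  have hi' : LeafInv M R G' (D ++ [v]) a s i := hi2.refit_other hit
  have ht2 : LeafInv M R G' (D ++ [v]) s b t := by
    rw [hG', hzr]
    refine LeafInv.of_refit ?_ ?_ ?_ ?_
    · rw [hG2, Store.refit_fld (by simp), fat, Function.update_self, haj]
    · rw [hG2, Store.refit_fld (by simp), Store.refit_data, fba, Function.update_self, hdata, ← hzr]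
      exact hdr
    · intro w hw hw'
      rw [hstate w (has.le.trans hw) hw', if_neg (not_lt.2 hw), ftrt, ← hzr]
      split_ifs with h0
      · rfl
      · rw [show zr.length = 0 by simpa using h0]
    · rw [ftrt]; intro h0; exact absurd h0 (lt_irrefl _)
  have hml : ∀ y ∈ zl, a ≤ y ∧ y ≤ s := by
    intro y hy
    rw [hzl] at hy
    have := (mem_inside.1 hy).2
    exact ⟨this.1.le, this.2.le⟩
  have hmr : ∀ y ∈ zr, s ≤ y ∧ y ≤ b := by
    intro y hy
    rw [hzr] at hy
    have := (mem_inside.1 hy).2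
    exact ⟨this.1.le, this.2.le⟩
  have hnode2 : ∀ j, (G2.shape ht').Node j ↔ (G.shape ht).Node j ∨ j = t := by
    rw [hG2, Store.refit_shape]; exact T3
  refine ⟨?_, ?_, Store.Exact.refit (Store.Exact.refit T2), ?_⟩
  · refine TreeInv.refit (T1.refit ((T3 i).2 (Or.inl hin)) (by omega) ?_ has hml)
      ((hnode2 t).2 (Or.inr rfl)) (by omega) ?_ hsb hmr
    · rw [hzl]; exact length_le _ _ _
    · rw [hzr]; exact length_le _ _ _
  · intro j hj hj0
    rw [hshape] at hj ⊢
    rw [T3] at hj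
    by_cases hjt : j = t
    · rw [hjt, T8]
      have : (G1.shape ht').lo t = s := T5
      rw [this]
      exact ht2
    · have hj' := hj.resolve_right hjt
      have e : (G1.shape ht').lo j = G.lo j := T4 j hjt
      rw [e]
      by_cases hji : j = i
      · rw [hji, T7]; exact hi'
      · rw [T6 j hj' hji]
        have hj0' : ht j = 0 := by
          rw [← hj0]; exact (Function.update_of_ne hjt _ _).symm
        refine Leaves.other h.tree h.leaves h.mem hin h.leaf h.lo_le h.lt_hi (h.lo_lt_one hv) hj'
          hj0' hji ?_ ?_ ?_ ?_ fun c hc => ?_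
        · rw [hG', Store.refit_fld (by simp), hG2, Store.refit_fld (by simp), fat,
            Function.update_of_ne hjt]
        · rw [hG', Store.refit_trained_of_ne hjt, hG2, Store.refit_trained_of_ne hji, ftr,
            Function.update_of_ne hjt, Function.update_of_ne hji]
        · rw [hG', Store.refit_fld (by simp), hG2, Store.refit_fld (by simp), fba,
            Function.update_of_ne hjt]
        · rw [hG', Store.refit_model_of_ne hjt, hG2, Store.refit_model_of_ne hji, hmodel]
        · rw [hG', Store.refit_data, hG2, Store.refit_data, hdata]
          exact hd' c hc
  · have ti : G'.fld .trained i = zl.length := by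
      have h1 := hi'.state a le_rfl has
      rw [hstate a le_rfl (has.trans hsb), if_pos has] at h1
      simpa using h1.symm
    have tt : G'.fld .trained t = zr.length := by
      have h1 := ht2.state s le_rfl hsb
      rw [hstate s has.le hsb, if_neg (lt_irrefl _)] at h1
      simpa using h1.symm
    -- Both halves are completely trained and have at most half of the capacity, so their stale
    -- points and their excess are zero. The excess of the old leaf, taken twice, together with the
    -- allowance of the insertion pays for their training sets, which have at most `M` points in
    -- total.
    have hsum : ∀ F : ℕ → ℕ → ℕ, ∑ a ∈ G'.leafPoints ht', weight M R F (D ++ [v]) a +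
        F (inside a b D).length m = ∑ a ∈ G.leafPoints ht, weight M R F D a +
          F zl.length zl.length + F zr.length zr.length := by
      intro F
      have h1 := h.sum F
      rw [← ha, ← hb, ← hm, hi'.weight_eq has F, ← hzl, ti] at h1
      rw [hP, Finset.sum_insert T10, ht2.weight_eq hsb F, ← hzr, tt]
      omega
    have h1 := hsum fun c _ => c - (M + 1) / 2
    have h2 := hsum fun c m => c - m
    refine ⟨?_, le_rfl, fun _ => ?_, ?_, fun ρ hρ hρM => ?_, ?_, ?_⟩
    · rw [hP, Finset.card_insert_of_notMem T10]
    · have := length_le D a b; omega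
    · simp only [LearnedCE.excess]; omega
    · have hl : (((if 0 < zl.length then [zl.map (rescale a s)] else []) ++
          if 0 < zr.length then [zr.map (rescale s b)] else []).map List.length).sum =
          zl.length + zr.length := by
        split_ifs <;> simp_all
      rw [hl]
      simp only [LearnedCE.excess, stale]
      set E' := ∑ a ∈ G'.leafPoints ht', weight M R (fun c _ => c - (M + 1) / 2) (D ++ [v]) a
      set E := ∑ a ∈ G.leafPoints ht, weight M R (fun c _ => c - (M + 1) / 2) D a
      set T' := ∑ a ∈ G'.leafPoints ht', weight M R (fun c m => c - m) (D ++ [v]) a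
      set T := ∑ a ∈ G.leafPoints ht, weight M R (fun c m => c - m) D a
      have hT : T' ≤ T := by omega
      calc zl.length + zr.length + ρ * T' + 2 * E' ≤ zl.length + zr.length + ρ * T + 2 * E' := by
            gcongr
        _ ≤ _ := by omega
    · split_ifs <;> simp
    · intro y hy
      rw [List.mem_append] at hy
      rcases hy with hy | hy
      · split_ifs at hy with h3
        · rw [List.mem_singleton] at hy
          subst hy
          refine ⟨?_, by rw [List.length_map]; omega, ?_⟩
          · rw [ne_eq, List.map_eq_nil_iff]
            exact List.length_pos_iff.1 h3
          · intro y hy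
            obtain ⟨w, hw, rfl⟩ := List.mem_map.1 hy
            exact rescale_mem_Icc has (hml w hw).1 (hml w hw).2
        · simp at hy
      · split_ifs at hy with h3
        · rw [List.mem_singleton] at hy
          subst hy
          refine ⟨?_, by rw [List.length_map]; omega, ?_⟩
          · rw [ne_eq, List.map_eq_nil_iff]
            exact List.length_pos_iff.1 h3
          · intro y hy
            obtain ⟨w, hw, rfl⟩ := List.mem_map.1 hy
            exact rescale_mem_Icc hsb (hmr w hw).1 (hmr w hw).2
        · simp at hy

end Arrival

end LearnedCE

namespace LearnedCE

/-! ### Insertion of a point into a leaf: the program -/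

variable {A : Learner}

/-- The key registers that hold the points of a full leaf. -/
def leafKeys (M : ℕ) : List ℕ := (List.range (M + 1)).map fun i => 10 + i

/-- The operations that insert a leaf to the right of the leaf in register 4. -/
def linkOps : List Op :=
  [.get 19 .glob 0, .sub 20 16 11, .sub 21 17 22, .get 12 .right 4, .get 13 .nk 2, .add 13 13 1,
    .add 14 19 1, .add 15 21 18, .get 23 .atom 4, .add 24 23 20, .put .right 19 12,
    .put .right 4 19, .putKey 19 7, .put .nk 2 13, .put .base 19 22, .put .glob 9 22,
    .put .atom 19 18, .put .cnt 4 24, .put .cnt 19 15, .put .trained 4 0, .put .trained 19 0,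
    .put .glob 0 14]

/-- Split the leaf in register 4 at the median of its `M + 1` points. -/
def splitLeafProg (M R : ℕ) : Prog :=
  .seq (block (.add 14 11 0 :: loadOps (M + 1) 10)) (.seq
    (medianProg (M + 1).size (M / 2) (leafKeys M)) (.seq
    (block [.add 16 11 0, .get 22 .glob 9, .const 15 (M + 1), .add 22 22 15, .add 17 22 0,
      .const 18 0]) (.seq (partProg (leafKeys M)) (.seq (block linkOps) (.seq
    (refitProg R 4 11 20 5 7) (refitProg R 19 22 21 7 6))))))

/-- Store a new inner point of the leaf in register 4. -/
def interiorOps (M : ℕ) : List Op :=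
  [.get 5 .right 4, .getKey 6 5, .get 6 .cnt 4, .get 10 .atom 4, .sub 6 6 10, .get 11 .base 4,
    .add 12 11 6, .sub 12 12 1, .saveData 12 0, .const 13 M]

/-- Insert the new point into the leaf below the node in register 2. -/
def leafProg (M R : ℕ) : Prog :=
  .seq (findProg 0) (.seq (block [.get 6 .cnt 4, .add 6 6 1, .put .cnt 4 6, .getKey 5 4])
    (.ifKeyLt 5 0
      (.seq (block (interiorOps M)) (branch 13 6 (splitLeafProg M R) (refitProg R 4 11 6 5 6)))
      (block [.get 6 .atom 4, .add 6 6 1, .put .atom 4 6])))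

/-- A bound for the number of operations of a leaf split, apart from training. -/
def splitCost (M : ℕ) : ℕ := (M + 1) * ((M + 1).size + 40) + 500

theorem exec_arrive {M R : ℕ} {D : List ℝ} {v : ℝ} {ht : ℕ → ℕ} {c : Cfg A.Model}
    (hD : ∀ y ∈ D ++ [v], y ∈ Icc (0 : ℝ) 1) (hp : Path M R D v 1 ht c) :
    ∃ (t₁ t₂ : ℕ) (c₁ c' : Cfg A.Model), Exec A (findProg 0) c.toState t₁ c₁.toState ∧
      Exec A (block [.get 6 .cnt 4, .add 6 6 1, .put .cnt 4 6, .getKey 5 4]) c₁.toState t₂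
        c'.toState ∧ t₁ + t₂ ≤ 193 ∧ c'.Ready v ∧
      Arrival M R D v c'.G ht (c'.reg 2) (c'.reg 4) ∧ c'.kreg 5 = c'.G.lo (c'.reg 4) ∧
      c'.G.leafPoints ht = c.G.leafPoints ht := by
  have hS := hp.tree.valid
  have hv : v < 3 := by have := (hD v (by simp)).2; linarith
  obtain ⟨t1, c1, e1, b1, f1, r4, -⟩ := exec_find (kv := 0) (by norm_num) hS hp.node hp.ready.r0
    (by have := hp.ht_eq; omega)
  rw [hp.ready.k0] at r4
  obtain ⟨m1, m2, m3⟩ := hS.child_spec hp.node (by have := hp.ht_eq; simp only [Store.shape]; omega)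
    hp.lo_le hp.lt_hi hv
  rw [← r4] at m1 m2 m3
  obtain ⟨n1, n2, n3, n4⟩ := Shape.mem_kids.1 m1
  have hti : ht (c1.reg 4) = 0 := by
    have : ht (c1.reg 4) + 1 = ht (c.reg 2) := n2
    have := hp.ht_eq
    omega
  have q1 := f1.ready hp.ready (by norm_num)
  obtain ⟨t2, e2, b2⟩ := exec_block (A := A) [.get 6 .cnt 4, .add 6 6 1, .put .cnt 4 6,
    .getKey 5 4] c1
  set c2 := effs [.get 6 .cnt 4, .add 6 6 1, .put .cnt 4 6, .getKey 5 4] c1 with hc2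
  simp only [List.length_cons, List.length_nil] at b2
  have g2 : c2.G = c.G.bump (c1.reg 4) := by
    simp [hc2, Op.eff, Cfg.setReg_reg, q1.r1, f1.G, Store.bump]
  have s4 : c2.reg 4 = c1.reg 4 := by simp [hc2, Op.eff, Cfg.setReg_reg]
  have s2 : c2.reg 2 = c.reg 2 := by simp [hc2, Op.eff, Cfg.setReg_reg, f1.reg 2 (by norm_num)]
  obtain ⟨T1, T2⟩ := hp.tree.bump n1
  refine ⟨t1, t2, c1, c2, e1, e2, by omega, ?_, ?_, ?_, ?_⟩
  · constructor <;> simp [hc2, Op.eff, Cfg.setReg_reg, Cfg.setKreg_kreg, q1.r0, q1.r1, q1.r8,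
      q1.r9, q1.k0, q1.k2, q1.k3]
  · rw [g2, s4, s2]
    refine ⟨T1.mono (by simp), T2 R D hp.leaves, (hp.counts.bump hS n1 hti m2 m3).exact, ?_, ?_,
      hti, m2, ?_, ?_, hD⟩
    · rw [Store.bump_shape]; exact hp.node
    · rw [Store.bump_shape]; exact m1
    · rw [Store.bump_shape]; exact m3
    · rw [Store.bump, Store.set_fld_of_ne _ _ _ (by simp)]; exact hp.nk_le
  · rw [s4, g2]
    simp [hc2, Op.eff, Cfg.setReg_reg, Cfg.setKreg_kreg, q1.r1, f1.G, Store.bump]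
  · rw [g2, Store.bump_leafPoints]

/-- All `M + 1` points are brought into key registers before any cell is overwritten. The depth `(M
+ 1).size` of the binary searches makes the sorting cost `O(M log M)`. -/
theorem exec_splitLeaf {M R : ℕ} {D : List ℝ} {v : ℝ} {ht : ℕ → ℕ} {G : Store A.Model}
    {d : ℕ → ℝ} {c : Cfg A.Model} (hc : c.Ready v)
    (h : Arrival M R D v G ht (c.reg 2) (c.reg 4)) (hv : G.lo (c.reg 4) < v)
    (hG : c.G = { G with data := d }) {z : List ℝ}
    (hz : z = inside (G.lo (c.reg 4)) ((G.shape ht).hi (c.reg 4)) (D ++ [v]))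
    (hM : M < z.length) (hd : Holds d (G.fld .base (c.reg 4)) z)
    (hd' : ∀ a, a < G.fld .base (c.reg 4) ∨ G.fld .base (c.reg 4) + (M + 1) ≤ a →
      d a = G.data a)
    (h11 : c.reg 11 = G.fld .base (c.reg 4)) (h5 : c.kreg 5 = G.lo (c.reg 4))
    (h6 : c.kreg 6 = (G.shape ht).hi (c.reg 4)) :
    ∃ (t : ℕ) (c' : Cfg A.Model) (ht' : ℕ → ℕ) (zs : List (List ℝ)),
      Exec A (splitLeafProg M R) c.toState t c'.toState ∧
      t ≤ splitCost M + (zs.map A.trainCost).sum ∧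
      TreeInv M (D ++ [v]).length c'.G ht' ∧ Leaves M R c'.G ht' (D ++ [v]) ∧
      c'.G.Exact ht' (D ++ [v]) ∧
      Ledger M R D v (G.leafPoints ht) (c'.G.leafPoints ht') 1 zs := by
  set i := c.reg 4 with hi
  set x := c.reg 2 with hx
  set a := G.lo i with ha
  set b := (G.shape ht).hi i with hb
  have hzc : z.length = M + 1 := by
    have h1 : z.length = (inside a b D).length + 1 := by
      rw [hz, h.inside_concat hv, List.length_append, List.length_singleton]
    have h2 : (inside a b D).length ≤ M := h.good.card_le
    omega
  -- load
  obtain ⟨t1, e1, b1⟩ := exec_block (A := A) (.add 14 11 0 :: loadOps (M + 1) 10) c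
  rw [List.length_cons, length_loadOps] at b1
  rw [effs_cons] at e1
  set c0 := Op.eff (.add 14 11 0) c with hc0
  obtain ⟨p1, p2, p3, p4⟩ := effs_loadOps (M + 1) 10 c0 (by
    simp [hc0, Op.eff, Cfg.setReg_reg, hc.r1])
  set c1 := effs (loadOps (M + 1) 10) c0 with hc1
  have g1 : c1.G = { G with data := d } := p1.trans hG
  have r1 : ∀ r, r ≠ 14 → c1.reg r = c.reg r := by
    intro r hr
    rw [p2 r hr, hc0]; simp [Op.eff, Cfg.setReg_reg, hr]
  have k1 : ∀ k, k < 10 → c1.kreg k = c.kreg k := fun k hk => p3 k hk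
  have m1 : (leafKeys M).map c1.kreg = z := by
    rw [leafKeys, List.map_map]
    have h1 := hd.map_range id
    rw [List.map_id, hzc] at h1
    rw [← h1]
    refine List.map_congr_left fun j hj => ?_
    rw [List.mem_range] at hj
    change c1.kreg (10 + j) = d _
    rw [p4 j hj]
    have : c0.G = { G with data := d } := hG
    rw [this]
    simp [hc0, Op.eff, Cfg.setReg_reg, h11, hc.r0]
  have hlk : (leafKeys M).length = M + 1 := by simp [leafKeys]
  -- median
  set s := kth (M / 2) z with hs
  obtain ⟨t2, b2, e2⟩ := exec_median (A := A) (M + 1).size (M / 2) (leafKeys M) c1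
    (by rw [hlk]; exact (Nat.lt_size_self _).le) (by rw [hlk]; omega)
  rw [m1, ← hs] at e2
  rw [hlk] at b2
  set c2 := c1.setKreg 7 s with hc2
  have r2 : ∀ r, r ≠ 14 → c2.reg r = c.reg r := r1
  have k2 : ∀ k, k ≠ 7 → c2.kreg k = c1.kreg k := by
    intro k hk; simp [hc2, Cfg.setKreg_kreg, hk]
  have k27 : c2.kreg 7 = s := by simp [hc2, Cfg.setKreg_kreg]
  -- prepare
  set ops : List Op := [.add 16 11 0, .get 22 .glob 9, .const 15 (M + 1), .add 22 22 15,
    .add 17 22 0, .const 18 0] with hops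
  obtain ⟨t3, e3, b3⟩ := exec_block (A := A) ops c2
  have b3' : t3 ≤ 49 := b3
  set c3 := effs ops c2 with hc3
  have g3 : c3.G = { G with data := d } := g1
  have k3 : c3.kreg = c2.kreg := rfl
  have r3 : ∀ r, r < 14 → c3.reg r = c.reg r := by
    intro r hr
    rw [← r2 r (by omega)]
    simp only [hc3, hops, effs_cons, effs_nil, Op.eff, Cfg.setReg_reg]
    rw [if_neg (by omega), if_neg (by omega), if_neg (by omega), if_neg (by omega),
      if_neg (by omega), if_neg (by omega)]
  have u0 : c2.reg 0 = 0 := by rw [r2 0 (by norm_num), hc.r0]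
  have u9 : c2.reg 9 = 3 := by rw [r2 9 (by norm_num), hc.r9]
  have u11 : c2.reg 11 = G.fld .base i := by rw [r2 11 (by norm_num), h11]
  have g2 : c2.G = { G with data := d } := g1
  have s16 : c3.reg 16 = G.fld .base i := by
    simp [hc3, hops, Op.eff, Cfg.setReg_reg, u0, u11]
  have s22 : c3.reg 22 = G.fld .glob 3 + (M + 1) := by
    simp [hc3, hops, Op.eff, Cfg.setReg_reg, u9, g2]
  have s17 : c3.reg 17 = G.fld .glob 3 + (M + 1) := by
    simp [hc3, hops, Op.eff, Cfg.setReg_reg, u0, u9, g2]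
  have s18 : c3.reg 18 = 0 := by
    simp [hc3, hops, Op.eff, Cfg.setReg_reg]
  have m3 : (leafKeys M).map c3.kreg = z := by
    rw [← m1]
    refine List.map_congr_left fun j hj => ?_
    obtain ⟨j', -, rfl⟩ := List.mem_map.1 hj
    rw [k3, k2 _ (by omega)]
  -- partition
  obtain ⟨t4, c4, e4, b4, g4, k4, r4, q16, q17, q18, hl4, hr4, d4⟩ := exec_part (A := A) (s := s)
    (p := G.fld .base i) (q := G.fld .glob 3 + (M + 1)) (leafKeys M) (c := c3) (zl := [])
    (zr := []) (by rw [s16]; rfl) (by rw [s17]; rfl) (by rw [r3 1 (by norm_num), hc.r1])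
    (by rw [k3, k27]) (fun j hj => absurd hj (Nat.not_lt_zero _))
    (fun j hj => absurd hj (Nat.not_lt_zero _)) (by
      rw [hlk]; have := h.tree.base_le i; simp only [List.length_nil]; omega)
  rw [m3, List.nil_append] at q16 q17 hl4 hr4
  rw [m3, s18, zero_add] at q18
  rw [hlk] at b4 d4
  rw [List.length_nil, zero_add] at d4
  set zl := z.filter fun y => y < s with hzl
  set zr := z.filter fun y => s < y with hzr
  set d' := c4.G.data with hdd
  have g4' : c4.G = { G with data := d' } := by rw [g4, g3]
  have w : ∀ r, r < 14 → c4.reg r = c.reg r := fun r hr => by rw [r4 r (by omega), r3 r hr]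
  have w22 : c4.reg 22 = G.fld .glob 3 + (M + 1) := by rw [r4 22 (by norm_num), s22]
  -- link
  obtain ⟨t5, e5, b5⟩ := exec_block (A := A) linkOps c4
  have b5' : t5 ≤ 177 := b5
  set c5 := effs linkOps c4 with hc5
  have v0 : c4.reg 0 = 0 := by rw [w 0 (by norm_num), hc.r0]
  have v1 : c4.reg 1 = 1 := by rw [w 1 (by norm_num), hc.r1]
  have v9 : c4.reg 9 = 3 := by rw [w 9 (by norm_num), hc.r9]
  have v2 : c4.reg 2 = x := by rw [w 2 (by norm_num)]
  have v4 : c4.reg 4 = i := by rw [w 4 (by norm_num)]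
  have v11 : c4.reg 11 = G.fld .base i := by rw [w 11 (by norm_num), h11]
  have v7 : c4.kreg 7 = s := by rw [k4, k3, k27]
  have g5 : c5.G = Store.linkLeaf { G with data := d' } x i s (G.fld .glob 3 + (M + 1))
      (z.countP fun y => y = s) (G.fld .atom i + zl.length)
      ((z.countP fun y => y = s) + zr.length) := by
    simp [hc5, linkOps, Op.eff, Cfg.setReg_reg, Store.linkLeaf, g4', v0, v1, v2, v4, v7, v9, v11,
      w22, q16, q17, q18, add_comm]
  have s20 : c5.reg 20 = zl.length := by
    simp [hc5, linkOps, Op.eff, Cfg.setReg_reg, v11, q16]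
  have s21 : c5.reg 21 = zr.length := by
    simp [hc5, linkOps, Op.eff, Cfg.setReg_reg, w22, q17]
  have s19 : c5.reg 19 = G.fld .glob 0 := by
    simp [hc5, linkOps, Op.eff, Cfg.setReg_reg, v0, g4']
  have s4 : c5.reg 4 = i := by simp [hc5, linkOps, Op.eff, Cfg.setReg_reg, v4]
  have s11 : c5.reg 11 = G.fld .base i := by simp [hc5, linkOps, Op.eff, Cfg.setReg_reg, v11]
  have s22' : c5.reg 22 = G.fld .glob 3 + (M + 1) := by
    simp [hc5, linkOps, Op.eff, Cfg.setReg_reg, w22]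
  have k5 : c5.kreg = c4.kreg := rfl
  have kk : ∀ k, k < 7 → c5.kreg k = c.kreg k := by
    intro k hk
    rw [k5, k4, k3, k2 k (by omega), k1 k (by omega)]
  have d5 : c5.G.data = d' := by rw [g5]; rfl
  -- train
  obtain ⟨t6, c6, e6, b6, g6, k6, r6⟩ := exec_refit (A := A) (R := R) (ri := 4) (rb := 11)
    (rc := 20) (ka := 5) (kb := 7) (by norm_num) (by norm_num) (by norm_num) (c := c5)
    (z := zl) (a := a) (b := s) s20 (by rw [d5, s11]; exact hl4) (by rw [kk 5 (by norm_num), h5])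
    (by rw [k5, v7])
  rw [s4] at b6 g6
  obtain ⟨t7, c7, e7, b7, g7, k7, r7⟩ := exec_refit (A := A) (R := R) (ri := 19) (rb := 22)
    (rc := 21) (ka := 7) (kb := 6) (by norm_num) (by norm_num) (by norm_num) (c := c6)
    (z := zr) (a := s) (b := b) (by rw [r6 21 (by norm_num), s21])
    (by rw [g6, Store.refit_data, d5, r6 22 (by norm_num), s22']; exact hr4) (by rw [k6, k5, v7])
    (by rw [k6, kk 6 (by norm_num), h6])
  rw [r6 19 (by norm_num), s19] at b7 g7
  have hit : G.fld .glob 0 ≠ i := h.node_leaf.2.ne'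
  have f5 : c5.G.fld .trained i = 0 := by
    rw [g5]; simp [Store.linkLeaf, Store.set_fld, Function.update_apply]
  have f6 : c6.G.fld .trained (G.fld .glob 0) = 0 := by
    rw [g6, Store.refit_trained_of_ne hit, g5]; simp [Store.linkLeaf, Store.set_fld]
  rw [f5] at b6
  rw [f6] at b7
  have T := h.insert_split hv hz hM hs (d := d') hl4 hr4 (fun y hy => by
    rw [d4 y hy, g3]; exact hd' y (by omega))
  rw [g6, g5] at g7
  refine ⟨_, c7, Function.update ht (G.fld .glob 0) 0,
    (if 0 < zl.length then [zl.map (rescale a s)] else []) ++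
      (if 0 < zr.length then [zr.map (rescale s b)] else []),
    e1.seq (e2.seq (e3.seq (e4.seq (e5.seq (e6.seq e7))))), ?_, by rw [g7]; exact T⟩
  have hsum : (((if 0 < zl.length then [zl.map (rescale a s)] else []) ++
      if 0 < zr.length then [zr.map (rescale s b)] else []).map A.trainCost).sum =
      (if 0 + min 0 R < zl.length then A.trainCost (zl.map (rescale a s)) else 0) +
      if 0 + min 0 R < zr.length then A.trainCost (zr.map (rescale s b)) else 0 := by
    simp only [Nat.zero_min, add_zero]
    split_ifs <;> simp
  rw [hsum, splitCost]
  have e : (M + 1) * ((M + 1).size + 40) = (M + 1).size * (M + 1) + 40 * (M + 1) := by ring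
  rw [e]
  omega

/-- The comparison with the left end point and that of the new size with `M` distinguish the three
cases `insert_atom`, `insert_refit` and `insert_split`. -/
theorem exec_leaf {M R : ℕ} {D : List ℝ} {v : ℝ} {ht : ℕ → ℕ} {c : Cfg A.Model}
    (hD : ∀ y ∈ D ++ [v], y ∈ Icc (0 : ℝ) 1) (hp : Path M R D v 1 ht c) :
    ∃ (t : ℕ) (c' : Cfg A.Model) (ht' : ℕ → ℕ) (sp : ℕ) (zs : List (List ℝ)),
      Exec A (leafProg M R) c.toState t c'.toState ∧
      t ≤ 400 + sp * splitCost M + (zs.map A.trainCost).sum ∧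
      TreeInv M (D ++ [v]).length c'.G ht' ∧ Leaves M R c'.G ht' (D ++ [v]) ∧
      c'.G.Exact ht' (D ++ [v]) ∧
      Ledger M R D v (c.G.leafPoints ht) (c'.G.leafPoints ht') sp zs := by
  obtain ⟨t1, t2, c1, c2, e1, e2, b2, q2, h, k5, hP⟩ := exec_arrive hD hp
  rw [← hP]
  set i := c2.reg 4 with hi
  set a := c2.G.lo i with ha
  set b := (c2.G.shape ht).hi i with hb
  have hcnt : c2.G.fld .cnt i = (D ++ [v]).countP (fun y => y = a) +
      (inside a b (D ++ [v])).length :=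
    (h.exact i h.node_leaf).trans (Store.count_eq h.lo_lt_hi)
  by_cases hv : a < v
  · have hatom : c2.G.fld .atom i = (D ++ [v]).countP fun y => y = a := by
      rw [h.leafInv.atom, List.countP_append, List.countP_singleton, if_neg]
      · rfl
      · simpa using hv.ne'
    set z := inside a b (D ++ [v]) with hz
    have hzc : z.length = (inside a b D).length + 1 := by
      rw [hz, h.inside_concat hv, List.length_append, List.length_singleton]
    have hcM : (inside a b D).length ≤ M := h.good.card_le
    -- A leaf with an inner point begins before `1`, so it ends at `1` at the latest. It therefore
    -- has a right neighbour, from which its right end is read.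
    have hright : c2.G.fld .right i ≠ 0 := by
      intro h0
      have h3 : b = 3 := Shape.hi_of_right_eq_zero h0
      have := h.good.le_one (h.lo_lt_one hv)
      simp only at this
      rw [← hb, h3] at this
      norm_num at this
    obtain ⟨t3, e3, b3⟩ := exec_block (A := A) (interiorOps M) c2
    have b3' : t3 ≤ 81 := b3
    set c3 := effs (interiorOps M) c2 with hc3
    set d := Function.update c2.G.data (c2.G.fld .base i + (inside a b D).length) v with hd
    have s6 : c3.reg 6 = z.length := by
      simp [hc3, interiorOps, Op.eff, Cfg.setReg_reg, ← hi, hcnt, hatom]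
    have g3 : c3.G = { c2.G with data := d } := by
      have e : c2.G.fld .base i + z.length - 1 =
          c2.G.fld .base i + (inside a b D).length := by omega
      simp [hc3, interiorOps, Op.eff, Cfg.setReg_reg, Cfg.setKreg_kreg, ← hi, hcnt, hatom, q2.r1,
        q2.k0, Store.setData, hd, e]
    have q3 : c3.Ready v := by
      constructor <;> simp [hc3, interiorOps, Op.eff, Cfg.setReg_reg, Cfg.setKreg_kreg, q2.r0,
        q2.r1, q2.r8, q2.r9, q2.k0, q2.k2, q2.k3]
    have s4 : c3.reg 4 = i := by simp [hc3, interiorOps, Op.eff, Cfg.setReg_reg, hi]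
    have s2 : c3.reg 2 = c2.reg 2 := by simp [hc3, interiorOps, Op.eff, Cfg.setReg_reg]
    have s11 : c3.reg 11 = c2.G.fld .base i := by
      simp [hc3, interiorOps, Op.eff, Cfg.setReg_reg, hi]
    have s13 : c3.reg 13 = M := by simp [hc3, interiorOps, Op.eff, Cfg.setReg_reg]
    have k5' : c3.kreg 5 = a := by
      simp [hc3, interiorOps, Op.eff, Cfg.setReg_reg, Cfg.setKreg_kreg, k5]
    have k6' : c3.kreg 6 = b := by
      rw [hb, Shape.hi_of_right_ne_zero hright]
      simp [hc3, interiorOps, Op.eff, Cfg.setReg_reg, Cfg.setKreg_kreg, ← hi, Store.shape]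
    have hhold : Holds d (c2.G.fld .base i) z := by
      rw [hz, h.inside_concat hv]
      exact Holds.concat h.leafInv.data v
    have hd' : ∀ y, y < c2.G.fld .base i ∨ c2.G.fld .base i + (M + 1) ≤ y →
        d y = c2.G.data y := by
      intro y hy
      rw [hd, Function.update_of_ne (by omega)]
    by_cases hM : M < z.length
    · obtain ⟨t4, c4, ht', zs, e4, b4, T⟩ := exec_splitLeaf (A := A) (R := R) (c := c3)
        (G := c2.G) (ht := ht) (d := d) (D := D) q3 (by rw [s4, s2]; exact h) (by rw [s4]; exact hv)
        g3 (z := z) (by rw [s4]) hM (by rw [s4]; exact hhold) (by rw [s4]; exact hd')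
        (by rw [s4, s11]) (by rw [s4, k5']) (by rw [s4, k6'])
      refine ⟨_, c4, ht', 1, zs, e1.seq (e2.seq (exec_key_true (by rw [k5, q2.k0]; exact hv)
        (e3.seq (exec_branch_true (by rw [s13, s6]; exact hM) e4)))), by omega, T⟩
    · obtain ⟨t4, c4, e4, b4, g4, -, -⟩ := exec_refit (A := A) (R := R) (ri := 4) (rb := 11)
        (rc := 6) (ka := 5) (kb := 6) (by norm_num) (by norm_num) (by norm_num) (c := c3)
        (z := z) (a := a) (b := b) s6 (by rw [g3, s11]; exact hhold) k5' k6'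
      rw [s4, g3] at b4 g4
      have T := h.insert_refit hv hz (not_lt.1 hM) hhold hd'
      rw [← g4] at T
      refine ⟨_, c4, ht, 0, _, e1.seq (e2.seq (exec_key_true (by rw [k5, q2.k0]; exact hv)
        (e3.seq (exec_branch_false (by rw [s13, s6]; exact hM) e4)))), ?_, T⟩
      have : ((if c2.G.fld .trained i + min (c2.G.fld .trained i) R < z.length then
          [z.map (rescale a b)] else []).map A.trainCost).sum =
          if c2.G.fld .trained i + min (c2.G.fld .trained i) R < z.length then
            A.trainCost (z.map (rescale a b)) else 0 := by
        split_ifs <;> simp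
      rw [this]
      change t4 ≤ 50 + (if c2.G.fld .trained i + min (c2.G.fld .trained i) R < z.length then
        A.trainCost (z.map (rescale a b)) else 0) at b4
      omega
  · obtain ⟨t3, e3, b3⟩ := exec_block (A := A) [.get 6 .atom 4, .add 6 6 1, .put .atom 4 6] c2
    simp only [List.length_cons, List.length_nil] at b3
    set c3 := effs [.get 6 .atom 4, .add 6 6 1, .put .atom 4 6] c2 with hc3
    have g3 : c3.G = c2.G.set .atom i (c2.G.fld .atom i + 1) := by
      simp [hc3, Op.eff, Cfg.setReg_reg, q2.r1, hi]
    have hva : v = a := le_antisymm (not_lt.1 hv) h.lo_le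
    have ha1 : c2.G.fld .atom i + 1 ≤ (D ++ [v]).length := by
      have h1 : _ = D.countP fun y => y = a := h.leafInv.atom
      have h2 : D.countP (fun y => y = a) ≤ D.length := List.countP_le_length
      rw [List.length_append, List.length_singleton]
      omega
    have T := h.insert_atom hv ha1
    rw [← g3] at T
    refine ⟨_, c3, ht, 0, [], e1.seq (e2.seq (exec_key_false (by rw [k5, q2.k0]; exact hv) e3)),
      by simp; omega, T⟩

end LearnedCE

namespace LearnedCE

/-! ### The estimator -/

variable {A : Learner}

/-- The program for insertions. -/
def insertProg (M R : ℕ) : Prog :=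
  .seq (block [.const 1 1, .const 8 2, .const 9 3, .get 6 .glob 0])
    (.seq (branch 0 6 skip initProg) (.seq rootProg (.seq (loop 1 3 levelProg) (leafProg M R))))

/-- The invariant after the insertion of the points of `D` with `T` operations, among them `S`
leaf splits and the trainings on the datasets `zs`. -/
structure Run (M R : ℕ) (D : List ℝ) (G : Store A.Model) (ht : ℕ → ℕ) (T S : ℕ)
    (zs : List (List ℝ)) : Prop where
  tree : TreeInv M D.length G ht
  leaves : Leaves M R G ht D
  exact : G.Exact ht D
  card : (G.leafPoints ht).card = 2 + S
  le : S ≤ D.length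
  cost : T ≤ D.length * (1000 + 501 * Nat.log 2 (D.length + 2)) + S * splitCost M +
    (zs.map A.trainCost).sum
  -- Bounds the logarithmic factor of the sorting cost by `log n`, although the capacity is
  -- independent of `n`.
  le_length : S ≠ 0 → M + 1 ≤ D.length
  excess : S * (M + 1 - (M + 1) / 2) + excess M R D (G.leafPoints ht) ≤ D.length
  train : ∀ ρ, 2 ≤ ρ → M ≤ ρ * (R + 1) → (zs.map List.length).sum +
    ρ * stale M R D (G.leafPoints ht) + 2 * LearnedCE.excess M R D (G.leafPoints ht) ≤
      (ρ + 2) * D.length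
  length_le : zs.length ≤ 2 * D.length
  good : ∀ z ∈ zs, z ≠ [] ∧ z.length ≤ M ∧ ∀ y ∈ z, y ∈ Icc (0 : ℝ) 1

theorem TreeInv.card_leafPoints {M n : ℕ} {G : Store A.Model} {ht : ℕ → ℕ}
    (h : TreeInv M n G ht) : (G.leafPoints ht).card = ((G.shape ht).level 0).card := by
  refine Finset.card_image_of_injOn fun i hi j hj hij => ?_
  obtain ⟨h1, h2⟩ := Shape.mem_level.1 (Finset.mem_coe.1 hi)
  obtain ⟨h3, h4⟩ := Shape.mem_level.1 (Finset.mem_coe.1 hj)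
  exact h.valid.inj i j h1 h3 (h2.trans h4.symm) hij

theorem TreeInv.height_le {M n : ℕ} {G : Store A.Model} {ht : ℕ → ℕ} (h : TreeInv M n G ht)
    {m : ℕ} (hm : (G.leafPoints ht).card ≤ m) : G.fld .glob 2 ≤ Nat.log 2 m + 1 := by
  have h1 : 2 ^ (G.fld .glob 2 - 1) ≤ ((G.shape ht).level 0).card := h.valid.two_pow_le
  rw [← h.card_leafPoints] at h1
  have := Nat.le_log_of_pow_le (by norm_num) (h1.trans hm)
  omega

theorem exec_init {c : Cfg A.Model} {v : ℝ} (hc : c.Ready v) (hG : c.G = Store.blank A.Model) :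
    ∃ (t : ℕ) (c' : Cfg A.Model), Exec A initProg c.toState t c'.toState ∧ t ≤ 81 ∧
      c'.Ready v ∧ c'.G = Store.initial A.Model := by
  obtain ⟨t, e, b⟩ := exec_block (A := A) [.put .right 1 8, .put .down 9 1, .put .nk 9 8,
    .put .glob 1 9, .put .glob 8 1, .putKey 1 2, .putKey 8 3, .putKey 9 2, .const 6 4,
    .put .glob 0 6] c
  refine ⟨t, _, e, b, ?_, ?_⟩
  · constructor <;> simp [Op.eff, Cfg.setReg_reg, hc.r0, hc.r1, hc.r8, hc.r9,
      hc.k0, hc.k2, hc.k3]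
  · simp [Op.eff, Cfg.setReg_reg, hc.r0, hc.r1, hc.r8, hc.r9, hc.k2, hc.k3, hG, Store.initial]

/-- The memory is still blank at this point, since the first insertion creates the initial tree;
that is why `Reached` treats the empty dataset separately. -/
theorem run_nil (A : Learner) (M R : ℕ) :
    ∃ ht, Run M R [] (Store.initial A.Model) ht 0 0 [] := by
  obtain ⟨h1, h2, h3, h4⟩ := initial_invariant A M R 0
  have hw : ∀ (F : ℕ → ℕ → ℕ) (a : ℝ), F 0 0 = 0 → weight M R F [] a = 0 := by
    intro F a hF
    rw [weight, leafState_nil]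
    split_ifs <;> simpa [inside] using hF
  refine ⟨_, h1, h2, ?_, ?_, le_rfl, by simp, fun h => absurd rfl h, ?_, ?_, by simp, by simp⟩
  · intro i hi
    have h5 : _ ≤ (Store.initial A.Model).fld .glob 2 := h1.valid.ht_le i hi
    have h6 := h3 i hi
    rwa [if_neg, add_zero] at h6
    rintro ⟨h7, -⟩
    exact Nat.not_succ_le_self _ (h7.trans h5)
  · rw [h4, Finset.card_pair (by norm_num)]
  · rw [excess, Finset.sum_eq_zero fun a _ => hw _ a (by simp)]; simp
  · intro ρ _ _
    rw [stale, excess, Finset.sum_eq_zero fun a _ => hw _ a (by simp),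
      Finset.sum_eq_zero fun a _ => hw _ a (by simp)]
    simp

/-- The additional `200` operations are reserved for the prelude of the insertion program, which
sets the constants and perhaps creates the initial tree. There are at most `D.length + 2` leaves,
which bounds the number of levels. -/
theorem exec_body {M R : ℕ} {D : List ℝ} {v : ℝ} (hD : ∀ y ∈ D ++ [v], y ∈ Icc (0 : ℝ) 1)
    {c : Cfg A.Model} (hc : c.Ready v) {ht : ℕ → ℕ} {T S : ℕ} {zs : List (List ℝ)}
    (h : Run M R D c.G ht T S zs) :
    ∃ (t : ℕ) (c' : Cfg A.Model) (ht' : ℕ → ℕ) (S' : ℕ) (zs' : List (List ℝ)),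
      Exec A (.seq rootProg (.seq (loop 1 3 levelProg) (leafProg M R))) c.toState t c'.toState ∧
      Run M R (D ++ [v]) c'.G ht' (T + (t + 200)) S' zs' := by
  have hv := hD v (by simp)
  have hv3 : v < 3 := by have := hv.2; linarith
  obtain ⟨t1, c1, ht1, k, e1, b1, p1, g1, l1⟩ := exec_root hv.1 hv3 hc h.tree h.leaves
    (h.exact.counts h.tree.valid v)
  obtain ⟨t2, c2, ht2, e2, b2, p2, g2, l2⟩ := exec_levels hv3 k p1
  obtain ⟨t3, c3, ht3, sp, ws, e3, b3, T1, T2, T3, T4⟩ := exec_leaf hD p2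
  rw [l2, l1] at T4
  set P := c.G.leafPoints ht with hP
  have hn : (D ++ [v]).length = D.length + 1 := by simp
  have hk : k ≤ Nat.log 2 (D.length + 2) := by
    have h1 := p1.tree.height_le (m := D.length + 2) (by
      rw [l1, h.card]; have := h.le; omega)
    omega
  have hsp := T4.sp_le
  have hS := h.le
  refine ⟨_, c3, ht3, S + sp, zs ++ ws, e1.seq (e2.seq e3), T1, T2, T3, ?_, ?_, ?_, ?_, ?_, ?_, ?_,
    ?_⟩
  · rw [T4.card, h.card]; omega
  · rw [hn]; omega
  · have h0 := h.cost
    have hlog : Nat.log 2 (D.length + 2) ≤ Nat.log 2 (D.length + 1 + 2) :=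
      Nat.log_mono_right (by omega)
    rw [hn, List.map_append, List.sum_append]
    set L := Nat.log 2 (D.length + 2)
    set L' := Nat.log 2 (D.length + 1 + 2)
    have h2 : D.length * (1000 + 501 * L) ≤ D.length * (1000 + 501 * L') :=
      Nat.mul_le_mul_left _ (by omega)
    have h3 : t1 + (t2 + t3) + 200 ≤ 1000 + 501 * L' + sp * splitCost M +
        (ws.map A.trainCost).sum := by omega
    calc T + (t1 + (t2 + t3) + 200) ≤ (D.length * (1000 + 501 * L') + S * splitCost M +
          (zs.map A.trainCost).sum) + (1000 + 501 * L' + sp * splitCost M +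
        (ws.map A.trainCost).sum) := by omega
      _ = _ := by ring
  · intro h0
    rw [hn]
    by_cases h1 : sp = 0
    · have := h.le_length (by omega); omega
    · have := T4.le_length h1; omega
  · have h1 := h.excess
    have h2 := T4.excess
    rw [← hP] at h1
    rw [hn, add_mul]
    omega
  · intro ρ h1 h2
    have h3 := h.train ρ h1 h2
    have h4 := T4.train ρ h1 h2
    rw [← hP] at h3
    rw [hn, List.map_append, List.sum_append, Nat.mul_succ]
    omega
  · have h1 := h.length_le
    have h2 := T4.length_le
    rw [hn, List.length_append]
    omega
  · intro z hz
    rcases List.mem_append.1 hz with hz | hz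
    · exact h.good z hz
    · exact T4.good z hz

/-- The invariant after the insertion of the points of `D` with `T` operations. -/
def Reached (M R : ℕ) (D : List ℝ) (G : Store A.Model) (T : ℕ) : Prop :=
  D = [] ∧ G = Store.blank A.Model ∧ T = 0 ∨ D ≠ [] ∧ ∃ ht S zs, Run M R D G ht T S zs

theorem exec_insert {M R : ℕ} {D : List ℝ} {v : ℝ} (hD : ∀ y ∈ D ++ [v], y ∈ Icc (0 : ℝ) 1)
    {G : Store A.Model} {T : ℕ} (h : Reached M R D G T) :
    ∃ (t : ℕ) (τ : State A.Model) (G' : Store A.Model),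
      Exec A (insertProg M R) (State.start G.toMemory v v) t τ ∧ τ.mem = G'.toMemory ∧
      Reached M R (D ++ [v]) G' (T + t) := by
  set c : Cfg A.Model := ⟨G, fun _ => 0, fun k => if k = 0 then v else if k = 1 then v else
    if k = 3 then 1 else 0, 0⟩ with hc
  have hstart : State.start G.toMemory v v = c.toState := by
    simp [State.start, Cfg.toState, hc]
  obtain ⟨t1, e1, b1⟩ := exec_block (A := A) [.const 1 1, .const 8 2, .const 9 3,
    .get 6 .glob 0] c
  set c1 := effs [.const 1 1, .const 8 2, .const 9 3, .get 6 .glob 0] c with hc1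
  simp only [List.length_cons, List.length_nil] at b1
  have q1 : c1.Ready v := by
    constructor <;> simp [hc1, Op.eff, Cfg.setReg_reg, hc]
  have g1 : c1.G = G := rfl
  have s6 : c1.reg 6 = G.fld .glob 0 := by simp [hc1, Op.eff, Cfg.setReg_reg, hc]
  obtain ⟨t2, c2, ht, S, zs, e2, b2, q2, hrun⟩ : ∃ (t : ℕ) (c2 : Cfg A.Model) (ht : ℕ → ℕ) (S : ℕ)
      (zs : List (List ℝ)), Exec A (branch 0 6 skip initProg) c1.toState t c2.toState ∧ t ≤ 82 ∧
      c2.Ready v ∧ Run M R D c2.G ht T S zs := by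
    rcases h with ⟨rfl, rfl, rfl⟩ | ⟨-, ht, S, zs, h⟩
    · obtain ⟨t2, c2, e2, b2, q2, g2⟩ := exec_init q1 g1
      obtain ⟨ht, h⟩ := run_nil A M R
      exact ⟨_, c2, ht, 0, [], exec_branch_false (by rw [q1.r0, s6]; simp [Store.blank]) e2,
        by omega, q2, by rw [g2]; exact h⟩
    · have := h.tree.four_le
      exact ⟨_, c1, ht, S, zs, exec_branch_true (by rw [q1.r0, s6]; omega) (exec_skip c1),
        by omega, q1, by rw [g1]; exact h⟩
  obtain ⟨t3, c3, ht', S', zs', e3, h3⟩ := exec_body hD q2 hrun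
  refine ⟨_, c3.toState, c3.G, by rw [hstart]; exact e1.seq (e2.seq e3), rfl,
    Or.inr ⟨by simp, ht', S', zs', ?_⟩⟩
  exact { h3 with cost := le_trans (by omega) h3.cost }

theorem exec_query {M R : ℕ} {D : List ℝ} (hD : ∀ y ∈ D, y ∈ Icc (0 : ℝ) 1)
    {G : Store A.Model} {T : ℕ} (h : Reached M R D G T) {τ : ℝ} (hτ : EvalBound A M τ) {q : ℝ × ℝ}
    (hq : IsQuery q) :
    ∃ (t : ℕ) (σ : State A.Model),
      Exec A queryProg (State.start G.toMemory.summary q.1 (q.1 + q.2)) t σ ∧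
      (t : ℝ) ≤ 360 * Nat.log 2 (D.length + 2) + 2 * τ + 800 ∧
      σ.out = rangeEstimate A M R D q.1 (q.1 + q.2) := by
  set c : Cfg A.Model := ⟨{ G with data := fun _ => 0 }, fun _ => 0,
    fun k => if k = 0 then q.1 else if k = 1 then q.1 + q.2 else if k = 3 then 1 else 0, 0⟩ with hc
  have hstart : State.start G.toMemory.summary q.1 (q.1 + q.2) = c.toState := by
    simp [State.start, Cfg.toState, hc, Memory.summary, Store.toMemory]
  obtain ⟨⟨a1, a2⟩, a3, a4⟩ := hq
  obtain ⟨t1, e1, b1⟩ := exec_block (A := A) [.const 1 1, .get 8 .glob 0] c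
  set c1 := effs [.const 1 1, .get 8 .glob 0] c with hc1
  simp only [List.length_cons, List.length_nil] at b1
  have r0 : c1.reg 0 = 0 := by simp [hc1, Op.eff, Cfg.setReg_reg, hc]
  have r1 : c1.reg 1 = 1 := by simp [hc1, Op.eff, Cfg.setReg_reg]
  have r8 : c1.reg 8 = G.fld .glob 0 := by simp [hc1, Op.eff, Cfg.setReg_reg, hc]
  have k0 : c1.kreg 0 = q.1 := rfl
  have k1 : c1.kreg 1 = q.1 + q.2 := rfl
  have b1' : (t1 : ℝ) ≤ 17 := by exact_mod_cast b1
  have hτ0 := hτ.1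
  rcases h with ⟨rfl, rfl, rfl⟩ | ⟨-, ht, S, zs, h⟩
  · refine ⟨_, c1.toState, by
      rw [hstart]
      exact e1.seq (exec_branch_false (by rw [r0, r8]; simp [Store.blank]) (exec_skip c1)), ?_, ?_⟩
    · have : (0 : ℝ) ≤ (Nat.log 2 (([] : List ℝ).length + 2) : ℝ) := Nat.cast_nonneg _
      push_cast
      linarith
    · have hl : ∀ w, leafEstimate A q.1 (q.1 + q.2) (leafState M R w [])
          (inside (leafState M R w []).1 (leafState M R w []).2.1 []) = 0 := by
        intro w
        rw [leafState_nil]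
        split_ifs <;> simp [leafEstimate, inside]
      rw [rangeEstimate]
      simp only [hl]
      simp [hc1, Op.eff, Cfg.toState, hc, Cfg.setReg]
  · have h4 := h.tree.four_le
    obtain ⟨t2, c2, e2, b2, o2⟩ := exec_queryMain (c := c1) (G := G) hτ h.tree h.leaves hD h.exact
      rfl rfl rfl r0 r1 rfl (by rw [k0]; exact a1) (by rw [k0, k1]; linarith) (by rw [k1]; linarith)
    refine ⟨_, c2.toState, by
      rw [hstart]
      exact e1.seq (exec_branch_true (by rw [r0, r8]; omega) e2), ?_, o2⟩
    have h5 : G.fld .glob 2 ≤ Nat.log 2 (D.length + 2) + 1 :=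
      h.tree.height_le (by rw [h.card]; have := h.le; omega)
    have h6 : (G.fld .glob 2 : ℝ) ≤ Nat.log 2 (D.length + 2) + 1 := by exact_mod_cast h5
    push_cast
    linarith

open Classical in
/-- The memory and the number of operations after the insertion of the points of a list, the last
one first. -/
noncomputable def insertAll (A : Learner) (M R : ℕ) : List ℝ → Memory A.Model × ℕ
  | [] => (Memory.blank A.Model, 0)
  | v :: L =>
    if h : ∃ p : ℕ × State A.Model,
        Exec A (insertProg M R) (State.start (insertAll A M R L).1 v v) p.1 p.2 then
      (h.choose.2.mem, (insertAll A M R L).2 + h.choose.1)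
    else insertAll A M R L

/-- `insertAll` chooses a halting run; by `Exec.det` there is only one, so the choice is the run at
hand. -/
theorem insertAll_concat (A : Learner) (M R : ℕ) (D : List ℝ) {v : ℝ} {t : ℕ} {τ : State A.Model}
    (h : Exec A (insertProg M R) (State.start (insertAll A M R D.reverse).1 v v) t τ) :
    insertAll A M R (D ++ [v]).reverse = (τ.mem, (insertAll A M R D.reverse).2 + t) := by
  have hex : ∃ p : ℕ × State A.Model,
      Exec A (insertProg M R) (State.start (insertAll A M R D.reverse).1 v v) p.1 p.2 := ⟨(t, τ), h⟩
  obtain ⟨h1, h2⟩ := hex.choose_spec.det h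
  rw [List.reverse_append, List.reverse_singleton, List.singleton_append, insertAll, dif_pos hex,
    h1, h2]

theorem reached_insertAll (A : Learner) (M R : ℕ) (D : List ℝ)
    (hD : ∀ y ∈ D, y ∈ Icc (0 : ℝ) 1) : ∃ G : Store A.Model,
      (insertAll A M R D.reverse).1 = G.toMemory ∧
      Reached M R D G (insertAll A M R D.reverse).2 := by
  induction D using List.reverseRecOn with
  | nil => exact ⟨Store.blank A.Model, rfl, Or.inl ⟨rfl, rfl, rfl⟩⟩
  | append_singleton D v ih =>
    obtain ⟨G, h1, h2⟩ := ih fun y hy => hD y (by simp [hy])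
    obtain ⟨t, τ, G', e, h3, h4⟩ := exec_insert hD h2
    rw [← h1] at e
    rw [insertAll_concat A M R D e]
    exact ⟨G', h3, h4⟩

open Classical in
/-- The answer to a query and the number of operations. -/
noncomputable def runQuery (A : Learner) (M R : ℕ) (D : List ℝ) (q : ℝ × ℝ) : ℕ × ℝ :=
  if h : ∃ p : ℕ × State A.Model,
      Exec A queryProg (State.start (insertAll A M R D.reverse).1.summary q.1 (q.1 + q.2))
        p.1 p.2 then
    (h.choose.1, h.choose.2.out)
  else 0

theorem runQuery_eq {M R : ℕ} {D : List ℝ} {q : ℝ × ℝ} {t : ℕ} {σ : State A.Model}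
    (h : Exec A queryProg (State.start (insertAll A M R D.reverse).1.summary q.1 (q.1 + q.2)) t σ) :
    runQuery A M R D q = (t, σ.out) := by
  have hex : ∃ p : ℕ × State A.Model,
      Exec A queryProg (State.start (insertAll A M R D.reverse).1.summary q.1 (q.1 + q.2))
        p.1 p.2 := ⟨(t, σ), h⟩
  obtain ⟨h1, h2⟩ := hex.choose_spec.det h
  rw [runQuery, dif_pos hex, h1, h2]

/-- The learned cardinality estimator with leaves of capacity `M`, the models of which are trained
again after at most `R` insertions. -/
noncomputable def estimator (A : Learner) (M R : ℕ) {τ : ℝ} (hτ : EvalBound A M τ) :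
    Estimator A where
  insertProg := insertProg M R
  queryProg := queryProg
  memory D := (insertAll A M R D.reverse).1
  insertCost D := (insertAll A M R D.reverse).2
  answer D q := (runQuery A M R D q).2
  queryCost D q := (runQuery A M R D q).1
  memory_nil := rfl
  insertCost_nil := rfl
  insert_run D v hD hv := by
    obtain ⟨G, h1, h2⟩ := reached_insertAll A M R D hD
    obtain ⟨t, τ, G', e, h3, h4⟩ := exec_insert (v := v) (fun y hy => by
      rcases List.mem_append.1 hy with hy | hy
      · exact hD y hy
      · rw [List.mem_singleton.1 hy]; exact hv) h2
    rw [← h1] at e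
    have h5 := insertAll_concat A M R D e
    exact ⟨t, τ, e, by rw [h5], by rw [h5]⟩
  query_run D q hD hq := by
    obtain ⟨G, h1, h2⟩ := reached_insertAll A M R D hD
    obtain ⟨t, σ, e, -, -⟩ := exec_query hD h2 hτ hq
    rw [← h1] at e
    have h5 := runQuery_eq e
    exact ⟨σ, by rw [h5]; exact e, by rw [h5]⟩

end LearnedCE

namespace LearnedCE

/-! ### Complexity -/

variable {A : Learner}

namespace Learner.Learns

variable {κ₁ κ₂ : ℝ} {Y : Set (Measure ℝ)} {T S B : ℕ → ℝ}

theorem evalCost_le (hA : A.Learns κ₁ κ₂ Y T S B) {z : List ℝ} (hz : z ≠ [])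
    (hI : ∀ y ∈ z, y ∈ Icc (0 : ℝ) 1) {q : ℝ × ℝ} (hq : IsQuery q) :
    (A.evalCost (A.train z) q : ℝ) ≤ T z.length := by
  have := hA.inference_time z.length (List.length_pos_iff.2 hz) z.get
    (fun i => hI _ (List.get_mem z i)) q hq
  rwa [List.ofFn_get] at this

theorem space_le (hA : A.Learns κ₁ κ₂ Y T S B) {z : List ℝ} (hz : z ≠ [])
    (hI : ∀ y ∈ z, y ∈ Icc (0 : ℝ) 1) : (A.space (A.train z) : ℝ) ≤ S z.length := by
  have := hA.model_space z.length (List.length_pos_iff.2 hz) z.get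
    (fun i => hI _ (List.get_mem z i))
  rwa [List.ofFn_get] at this

theorem trainCost_le (hA : A.Learns κ₁ κ₂ Y T S B) {z : List ℝ} (hz : z ≠ [])
    (hI : ∀ y ∈ z, y ∈ Icc (0 : ℝ) 1) : (A.trainCost z : ℝ) ≤ z.length * B z.length := by
  have := hA.training_time z.length (List.length_pos_iff.2 hz) z.get
    (fun i => hI _ (List.get_mem z i))
  rwa [List.ofFn_get] at this

theorem T_nonneg (hA : A.Learns κ₁ κ₂ Y T S B) {m : ℕ} (hm : 1 ≤ m) : 0 ≤ T m :=
  (Nat.cast_nonneg _).trans (hA.inference_time m hm (fun _ => 0) (fun _ => by simp) (0, 0)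
    (by simp [IsQuery]))

theorem S_nonneg (hA : A.Learns κ₁ κ₂ Y T S B) {m : ℕ} (hm : 1 ≤ m) : 0 ≤ S m :=
  (Nat.cast_nonneg _).trans (hA.model_space m hm (fun _ => 0) (fun _ => by simp))

theorem B_nonneg (hA : A.Learns κ₁ κ₂ Y T S B) {m : ℕ} (hm : 1 ≤ m) : 0 ≤ B m := by
  have h1 : (0 : ℝ) ≤ m * B m :=
    (Nat.cast_nonneg _).trans (hA.training_time m hm (fun _ => 0) (fun _ => by simp))
  have h2 : (0 : ℝ) < m := by exact_mod_cast hm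
  exact nonneg_of_mul_nonneg_right h1 h2

theorem evalBound (hA : A.Learns κ₁ κ₂ Y T S B) (hT : Monotone T) {M N : ℕ} (hN : 1 ≤ N)
    (hMN : M ≤ N) : EvalBound A M (T N) :=
  ⟨hA.T_nonneg hN, fun _ hl hlM hI _ hq => (hA.evalCost_le hl hI hq).trans (hT (hlM.trans hMN))⟩

end Learner.Learns

/-- The factor `2` is a bound for `1 / log 2`; it converts binary into natural logarithms. -/
theorem cast_le_two_mul_log {k m : ℕ} (h : 2 ^ k ≤ m) :
    (k : ℝ) ≤ 2 * Real.log m := by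
  have h1 : Real.log ((2 : ℝ) ^ k) ≤ Real.log m :=
    Real.log_le_log (by positivity) (by exact_mod_cast h)
  rw [Real.log_pow] at h1
  have h2 := Real.log_two_gt_d9
  have h3 : (0 : ℝ) ≤ k := Nat.cast_nonneg k
  nlinarith

theorem one_le_two_mul_log {n : ℕ} (hn : 2 ≤ n) : 1 ≤ 2 * Real.log n := by
  simpa using cast_le_two_mul_log (k := 1) (by simpa using hn)

theorem size_le_log {n : ℕ} (hn : 2 ≤ n) : (n.size : ℝ) ≤ 4 * Real.log n := by
  have h0 : 0 < n.size := Nat.size_pos.2 (by omega)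
  have h1 := cast_le_two_mul_log (k := n.size - 1) (m := n)
    (Nat.lt_size.1 (by omega))
  have h2 := one_le_two_mul_log hn
  rw [Nat.cast_sub h0] at h1
  push_cast at h1
  linarith

theorem log_add_two_le {n : ℕ} (hn : 2 ≤ n) :
    (Nat.log 2 (n + 2) : ℝ) ≤ 4 * Real.log n := by
  have h1 := cast_le_two_mul_log (k := Nat.log 2 (n + 2)) (m := n ^ 2)
    ((Nat.pow_log_le_self 2 (by omega)).trans (by nlinarith))
  push_cast at h1
  rw [Real.log_pow] at h1
  push_cast at h1
  linarith

namespace Run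

variable {M R : ℕ} {D : List ℝ} {G : Store A.Model} {ht : ℕ → ℕ} {t s : ℕ} {zs : List (List ℝ)}

/-- Each split consumes at least half of `M + 1` units of a potential that grows by at most one per
insertion. -/
theorem splits_mul_le (h : Run M R D G ht t s zs) : s * (M + 1) ≤ 2 * D.length := by
  have h1 := h.excess
  have h2 : M + 1 ≤ 2 * (M + 1 - (M + 1) / 2) := by omega
  calc s * (M + 1) ≤ s * (2 * (M + 1 - (M + 1) / 2)) := Nat.mul_le_mul_left _ h2
    _ = 2 * (s * (M + 1 - (M + 1) / 2)) := by ring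
    _ ≤ _ := by omega

/-- A split costs `O(M log M)` and is paid for by about `M / 2` insertions, so the amortized cost is
logarithmic. -/
theorem splitCost_le (h : Run M R D G ht t s zs) :
    s * splitCost M ≤ D.length * (2 * (D.length.size + 540)) := by
  by_cases h0 : s = 0
  · simp [h0]
  · have h1 := Nat.size_le_size (h.le_length h0)
    calc s * splitCost M ≤ s * ((M + 1) * (D.length.size + 540)) := by
          refine Nat.mul_le_mul_left _ ?_
          rw [splitCost]
          calc (M + 1) * ((M + 1).size + 40) + 500
              ≤ (M + 1) * (D.length.size + 40) + (M + 1) * 500 := by gcongr; omega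
            _ = _ := by ring
      _ = s * (M + 1) * (D.length.size + 540) := by ring
      _ ≤ 2 * D.length * (D.length.size + 540) := Nat.mul_le_mul_right _ h.splits_mul_le
      _ = _ := by ring

theorem time_le (h : Run M R D G ht t s zs) (hn : 2 ≤ D.length) {U : ℝ}
    (hU : ((zs.map A.trainCost).sum : ℝ) ≤ D.length * U) :
    (t : ℝ) / D.length ≤ U + 7000 * Real.log D.length := by
  have hn0 : (0 : ℝ) < D.length := by exact_mod_cast (by omega : 0 < D.length)
  rw [div_le_iff₀ hn0]
  have h1 := h.cost
  have h2 := h.splitCost_le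
  have h3 : t ≤ D.length * (1000 + 501 * Nat.log 2 (D.length + 2)) +
    D.length * (2 * (D.length.size + 540)) + (zs.map A.trainCost).sum := by omega
  have h4 : (t : ℝ) ≤ D.length * (1000 + 501 * Nat.log 2 (D.length + 2)) +
    D.length * (2 * (D.length.size + 540)) + (zs.map A.trainCost).sum := by exact_mod_cast h3
  have h5 := log_add_two_le hn
  have h6 := size_le_log hn
  have h7 := one_le_two_mul_log hn
  -- The constants `1000 + 1080` cost `4160 * log n`, and the two logarithmic terms cost `2004 * log
  -- n` and `8 * log n`.
  have h8 : (1000 + 501 * Nat.log 2 (D.length + 2) : ℝ) + 2 * (D.length.size + 540) ≤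
      7000 * Real.log D.length := by linarith
  nlinarith [mul_le_mul_of_nonneg_left h8 hn0.le]

variable {κ₁ κ₂ : ℝ} {Y : Set (Measure ℝ)} {T S B : ℕ → ℝ} {N : ℕ}

/-- An insertion trains at most two models, each on at most `N` points. Monotonicity is needed for
the total training time only. -/
theorem sum_trainCost_le (h : Run M R D G ht t s zs) (hA : A.Learns κ₁ κ₂ Y T S B)
    (hB : Monotone fun m : ℕ => (m : ℝ) * B m) (hN : 1 ≤ N) (hMN : M ≤ N) :
    ((zs.map A.trainCost).sum : ℝ) ≤ D.length * (2 * (N * B N)) := by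
  have h0 : 0 ≤ N * B N := mul_nonneg (Nat.cast_nonneg _) (hA.B_nonneg hN)
  have h1 : ∀ ws : List (List ℝ), (∀ z ∈ ws, z ∈ zs) →
      ((ws.map A.trainCost).sum : ℝ) ≤ ws.length * (N * B N) := by
    intro ws
    induction ws with
    | nil => simp
    | cons z ws ih =>
      intro hws
      have h2 := ih fun z hz => hws z (List.mem_cons_of_mem _ hz)
      obtain ⟨g1, g2, g3⟩ := h.good z (hws z List.mem_cons_self)
      have h3 := (hA.trainCost_le g1 g3).trans (hB (g2.trans hMN))
      simp only at h3
      simp only [List.map_cons, List.sum_cons, List.length_cons]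
      push_cast at h2 ⊢
      linarith
  refine (h1 zs fun _ => id).trans ?_
  have h2 : (zs.length : ℝ) ≤ 2 * D.length := by exact_mod_cast h.length_le
  calc (zs.length : ℝ) * (N * B N) ≤ 2 * D.length * (N * B N) := by gcongr
    _ = _ := by ring

/-- With `B` monotone, each training costs at most `B N` per point, and the potential argument
bounds the total number of training points. -/
theorem sum_trainCost_le_of_monotone (h : Run M R D G ht t s zs) (hA : A.Learns κ₁ κ₂ Y T S B)
    (hB : Monotone B) (hN : 1 ≤ N) (hMN : M ≤ N) {ρ : ℕ} (hρ : 2 ≤ ρ) (hρM : M ≤ ρ * (R + 1)) :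
    ((zs.map A.trainCost).sum : ℝ) ≤ D.length * ((ρ + 2) * B N) := by
  have h0 := hA.B_nonneg hN
  have h1 : ∀ ws : List (List ℝ), (∀ z ∈ ws, z ∈ zs) →
      ((ws.map A.trainCost).sum : ℝ) ≤ (ws.map List.length).sum * B N := by
    intro ws
    induction ws with
    | nil => simp
    | cons z ws ih =>
      intro hws
      have h2 := ih fun z hz => hws z (List.mem_cons_of_mem _ hz)
      obtain ⟨g1, g2, g3⟩ := h.good z (hws z List.mem_cons_self)
      have h3 : (A.trainCost z : ℝ) ≤ z.length * B N := (hA.trainCost_le g1 g3).trans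
        (mul_le_mul_of_nonneg_left (hB (g2.trans hMN)) (Nat.cast_nonneg _))
      simp only [List.map_cons, List.sum_cons]
      push_cast at h2 ⊢
      linarith
  refine (h1 zs fun _ => id).trans ?_
  have h2 : (zs.map List.length).sum ≤ (ρ + 2) * D.length := by
    have := h.train ρ hρ hρM
    omega
  have h3 : ((zs.map List.length).sum : ℝ) ≤ (ρ + 2) * D.length := by exact_mod_cast h2
  calc ((zs.map List.length).sum : ℝ) * B N ≤ (ρ + 2) * D.length * B N := by gcongr
    _ = _ := by ring

/-- For small `ε` the capacity is zero and the estimator is exact. This case is separate because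
`N`, being at least `1`, is then not bounded by a multiple of `ε ^ 2`. -/
theorem zs_eq_nil (h : Run M R D G ht t s zs) (hM : M = 0) : zs = [] := by
  subst hM
  rw [List.eq_nil_iff_forall_not_mem]
  intro z hz
  obtain ⟨g1, g2, -⟩ := h.good z hz
  exact g1 (List.length_eq_zero_iff.1 (Nat.le_zero.1 g2))

theorem next_le (h : Run M R D G ht t s zs) : G.fld .glob 0 ≤ 2 * s + 6 := by
  have h1 : G.fld .glob 0 ≤ 2 * ((G.shape ht).level 0).card + 2 := h.tree.valid.next_le
  rw [← h.tree.card_leafPoints, h.card] at h1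
  omega

/-- All stored numbers are linear in `n`, so they have `O(log n)` bits. For the addresses of data
this uses that the last base is `(M + 1) * s`, which `splits_mul_le` bounds by `2 * n`. -/
theorem fld_le (h : Run M R D G ht t s zs) (hn : 2 ≤ D.length) (f : Field) (i : ℕ) :
    G.fld f i ≤ 8 * D.length := by
  have h1 := h.next_le
  have h2 := h.le
  have h3 : G.fld .glob 3 ≤ 2 * D.length := by
    have h4 := h.tree.last
    rw [← h.tree.card_leafPoints, h.card] at h4
    have h5 := h.splits_mul_le
    rw [mul_comm] at h5
    have h7 : (M + 1) * (2 + s) = (M + 1) * 2 + (M + 1) * s := Nat.mul_add _ _ _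
    omega
  have hb := h.tree.base_le i
  by_cases f1 : f = .base
  · subst f1; omega
  by_cases f2 : f = .cnt
  · subst f2
    by_cases i0 : i = 0
    · rw [i0, h.tree.cnt_zero]; omega
    · by_cases hi : i < G.fld .glob 0
      · have e := h.exact i ⟨Nat.pos_of_ne_zero i0, hi⟩
        rw [e]
        exact List.countP_le_length.trans (by omega)
      · rw [(h.tree.blank i (not_lt.1 hi)).1]; omega
  by_cases f3 : f = .glob
  · subst f3
    have hr : G.fld .glob 1 < G.fld .glob 0 := h.tree.valid.root_node.2
    have hh := h.tree.height_le (m := D.length + 2) (by rw [h.card]; omega)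
    have hl := Nat.log_lt_self 2 (x := D.length + 2) (by omega)
    rcases Nat.lt_or_ge i 4 with hi | hi
    · interval_cases i <;> omega
    · rw [h.tree.glob_eq_zero i hi]; omega
  · have := h.tree.bound f i f3 f2 f1
    omega

end Run

theorem sum_range_le_of_eq_zero {f : ℕ → ℕ} {m n b : ℕ} (hmn : m ≤ n) (h0 : ∀ i, m ≤ i → f i = 0)
    (hb : ∀ i, f i ≤ b) : ∑ i ∈ Finset.range n, f i ≤ m * b := by
  rw [← Finset.sum_subset (Finset.range_subset_range.2 hmn)]
  · refine (Finset.sum_le_card_nsmul _ _ b fun i _ => hb i).trans ?_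
    rw [Finset.card_range, smul_eq_mul]
  · intro i _ hi
    exact h0 i (by simpa using hi)

/-- The number of records is linear in the number of leaves. A record has eight number cells, so the
addresses run up to `8 * X`, whereas only the first `X` key and model cells can be occupied. -/
theorem Run.spaceAtMost {M R : ℕ} {D : List ℝ} {G : Store A.Model} {ht : ℕ → ℕ} {t s : ℕ}
    {zs : List (List ℝ)} {κ₁ κ₂ : ℝ} {Y : Set (Measure ℝ)} {T S B : ℕ → ℝ} {N : ℕ}
    (h : Run M R D G ht t s zs) (hn : 2 ≤ D.length) (hA : A.Learns κ₁ κ₂ Y T S B)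
    (hS : Monotone S) (hN : 1 ≤ N) (hMN : M ≤ N) :
    SpaceAtMost A D.length.size G.toMemory
      ((2 * s + 6) * (144 * (S N + Real.log D.length))) := by
  set X := G.fld .glob 0 with hX
  refine ⟨8 * X, fun i hi => ?_, ?_⟩
  · refine ⟨(h.tree.blank (i / 8) (by omega)).1 _, ?_, ?_⟩
    · exact (h.tree.blank i (by omega)).2.1
    · exact (h.tree.blank i (by omega)).2.2
  have hnum : ∀ i, (G.toMemory.num i).size ≤ D.length.size + 3 := by
    intro i
    refine Nat.size_le.2 ((h.fld_le hn _ _).trans_lt ?_)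
    have := Nat.lt_size_self D.length
    rw [pow_add]
    omega
  have hkey : ∑ i ∈ Finset.range (8 * X), (G.toMemory.key i).elim 0 (fun _ => D.length.size) ≤
      X * D.length.size := by
    refine sum_range_le_of_eq_zero (by omega) (fun i hi => ?_) fun i => ?_
    · have : G.toMemory.key i = none := (h.tree.blank i hi).2.1
      rw [this]; rfl
    · cases G.toMemory.key i <;> simp
  have hmodel : ∑ i ∈ Finset.range (8 * X), (G.toMemory.model i).elim 0 A.space ≤
      X * ⌊S N⌋₊ := by
    refine sum_range_le_of_eq_zero (by omega) (fun i hi => ?_) fun i => ?_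
    · have : G.toMemory.model i = none := (h.tree.blank i hi).2.2
      rw [this]; rfl
    · rcases hm : G.toMemory.model i with _ | f
      · simp
      · obtain ⟨l, h1, h2, h3, rfl⟩ := h.tree.models i f hm
        exact Nat.le_floor ((hA.space_le h1 h3).trans (hS (h2.trans hMN)))
  have hsum : ∑ i ∈ Finset.range (8 * X), ((1 + (G.toMemory.num i).size) +
      (1 + (G.toMemory.key i).elim 0 fun _ => D.length.size) +
        (1 + (G.toMemory.model i).elim 0 A.space)) ≤
      8 * X * (D.length.size + 6) + X * D.length.size + X * ⌊S N⌋₊ := by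
    have h1 : ∑ i ∈ Finset.range (8 * X), (3 + (G.toMemory.num i).size) ≤
        8 * X * (D.length.size + 6) := by
      refine (Finset.sum_le_card_nsmul _ _ (D.length.size + 6) fun i _ => ?_).trans ?_
      · have := hnum i; omega
      · rw [Finset.card_range, smul_eq_mul]
    calc _ = ∑ i ∈ Finset.range (8 * X), (3 + (G.toMemory.num i).size) +
          ∑ i ∈ Finset.range (8 * X), ((G.toMemory.key i).elim 0 fun _ => D.length.size) +
          ∑ i ∈ Finset.range (8 * X), (G.toMemory.model i).elim 0 A.space := by
          rw [← Finset.sum_add_distrib, ← Finset.sum_add_distrib]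
          exact Finset.sum_congr rfl fun i _ => by ring
      _ ≤ _ := by omega
  have h0 := hA.S_nonneg hN
  have hfl := Nat.floor_le h0
  have h6 := size_le_log hn
  have h7 := one_le_two_mul_log hn
  have hXs : (X : ℝ) ≤ 2 * s + 6 := by exact_mod_cast h.next_le
  have hX0 : (0 : ℝ) ≤ X := Nat.cast_nonneg X
  calc _ ≤ ((8 * X * (D.length.size + 6) + X * D.length.size + X * ⌊S N⌋₊ : ℕ) : ℝ) := by
        exact_mod_cast hsum
    -- Up to the floor, the bracket is at most `S N + 132 * log n`: `36 * log n` from the sizes and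
    -- `96 * log n` from the constant.
    _ = X * (9 * D.length.size + 48 + ⌊S N⌋₊) := by push_cast; ring
    _ ≤ X * (144 * (S N + Real.log D.length)) := by
        refine mul_le_mul_of_nonneg_left ?_ hX0
        linarith
    _ ≤ _ := by
        refine mul_le_mul_of_nonneg_right hXs ?_
        linarith

end LearnedCE

/-! ### The cost, the answers and the invariant of the estimator. -/

namespace LearnedCE

variable {A : Learner} {M R : ℕ} {τ : ℝ}

theorem estimator_query (hτ : EvalBound A M τ) {D : List ℝ} (hD : ∀ y ∈ D, y ∈ Icc (0 : ℝ) 1)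
    {q : ℝ × ℝ} (hq : IsQuery q) :
    ((estimator A M R hτ).queryCost D q : ℝ) ≤ 360 * Nat.log 2 (D.length + 2) + 2 * τ + 800 ∧
      (estimator A M R hτ).answer D q = rangeEstimate A M R D q.1 (q.1 + q.2) := by
  obtain ⟨G, h1, h2⟩ := reached_insertAll A M R D hD
  obtain ⟨t, σ, e, h3, h4⟩ := exec_query hD h2 hτ hq
  rw [← h1] at e
  have h5 := runQuery_eq e
  change ((runQuery A M R D q).1 : ℝ) ≤ _ ∧ (runQuery A M R D q).2 = _
  rw [h5]
  exact ⟨h3, h4⟩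

theorem estimator_run (hτ : EvalBound A M τ) {D : List ℝ}
    (hD : ∀ y ∈ D, y ∈ Icc (0 : ℝ) 1) (h0 : D ≠ []) :
    ∃ (G : Store A.Model) (ht : ℕ → ℕ) (s : ℕ) (zs : List (List ℝ)),
      (estimator A M R hτ).memory D = G.toMemory ∧
      Run M R D G ht ((estimator A M R hτ).insertCost D) s zs := by
  obtain ⟨G, h1, h2⟩ := reached_insertAll A M R D hD
  rcases h2 with ⟨h, -⟩ | ⟨-, ht, s, zs, h⟩
  · exact absurd h h0
  · exact ⟨G, ht, s, zs, h1, h⟩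

/-- The behaviour of the programs is known only for data in the unit interval, so the answer equals
`rangeEstimate` almost surely, not everywhere. -/
theorem ae_mem_Icc_of_pi {n : ℕ} {χ : Fin n → Measure ℝ}
    (h : ∀ i, IsProbabilityMeasure (χ i) ∧ χ i (Icc 0 1)ᶜ = 0) :
    ∀ᵐ D ∂(Measure.pi χ), ∀ y ∈ List.ofFn D, y ∈ Icc (0 : ℝ) 1 := by
  have hp : ∀ i, IsProbabilityMeasure (χ i) := fun i => (h i).1
  have h1 : ∀ i, ∀ᵐ D ∂(Measure.pi χ), D i ∈ Icc (0 : ℝ) 1 := fun i =>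
    (Measure.quasiMeasurePreserving_eval (μ := χ) i).ae
      (p := fun y => y ∈ Icc (0 : ℝ) 1) (ae_iff.2 (h i).2)
  filter_upwards [ae_all_iff.2 h1] with D hD y hy
  obtain ⟨i, rfl⟩ := List.mem_ofFn.1 hy
  exact hD i

theorem SpaceAtMost.mono {w : ℕ} {G : Memory A.Model} {b c : ℝ} (h : SpaceAtMost A w G b)
    (hbc : b ≤ c) : SpaceAtMost A w G c := by
  obtain ⟨k, h1, h2⟩ := h
  exact ⟨k, h1, h2.trans hbc⟩

/-! ### The choice of capacity and patience. -/

/-- The capacity of the leaves for the accuracy `ε`. -/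
noncomputable def capacity (K ε : ℝ) : ℕ := ⌊ε ^ 2 / K⌋₊

/-- The number of insertions after which a model is trained again. -/
noncomputable def patience (K ε δ : ℝ) : ℕ :=
  -- Without distribution shift any patience is accurate; the capacity is large enough for `M / (R +
  -- 1)` to vanish, whereas the formula for `δ > 0` would give `0` through division by zero.
  if δ = 0 then capacity K ε else ⌊ε / (4 * δ)⌋₊

section Parameters

variable {K ε δ : ℝ}

theorem sqrt_capacity_le {c : ℝ} (hc : 0 < c) (hε : 0 < ε) :
    √(capacity (16 * c ^ 2) ε : ℝ) * c ≤ ε / 4 := by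
  have h1 : (capacity (16 * c ^ 2) ε : ℝ) ≤ (ε / (4 * c)) ^ 2 := by
    refine (Nat.floor_le (by positivity)).trans_eq ?_
    rw [div_pow, mul_pow]; norm_num
  have h2 : √(capacity (16 * c ^ 2) ε : ℝ) ≤ ε / (4 * c) := Real.sqrt_le_iff.2 ⟨by positivity, h1⟩
  calc _ ≤ ε / (4 * c) * c := by gcongr
    _ = ε / 4 := by field_simp

theorem patience_mul_le (hε : 0 < ε) (hδ : 0 ≤ δ) : patience K ε δ * δ ≤ ε / 4 := by
  rcases hδ.eq_or_lt with rfl | h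
  · simp; positivity
  · rw [patience, if_neg h.ne']
    calc (⌊ε / (4 * δ)⌋₊ : ℝ) * δ ≤ ε / (4 * δ) * δ := by
          gcongr; exact Nat.floor_le (by positivity)
      _ = ε / 4 := by field_simp

theorem capacity_le_ceil (hK : 1 ≤ K) : capacity K ε ≤ ⌈ε ^ 2⌉₊ := by
  refine (Nat.floor_le_floor ?_).trans (Nat.floor_le_ceil _)
  exact div_le_self (sq_nonneg ε) hK

theorem ceil_le_of_capacity_ne_zero (hK : 1 ≤ K) (h : capacity K ε ≠ 0) :
    (⌈ε ^ 2⌉₊ : ℝ) ≤ 2 * ε ^ 2 := by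
  have h1 : 1 ≤ ε ^ 2 / K := Nat.floor_pos.1 (Nat.pos_of_ne_zero h)
  have h2 : 1 ≤ ε ^ 2 := h1.trans (div_le_self (sq_nonneg ε) hK)
  have h3 := Nat.ceil_lt_add_one (sq_nonneg ε)
  linarith

/-- Retraining on up to `ε ^ 2 / 4` points happens after about `ε / (4 * δ)` insertions; the
quotient is the factor `δ * ε` in the insertion time. -/
theorem div_patience_le (hK : 4 ≤ K) (hε : 0 < ε) (hδ : 0 ≤ δ) :
    ((capacity K ε / (patience K ε δ + 1) : ℕ) : ℝ) ≤ δ * ε := by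
  rcases hδ.eq_or_lt with rfl | h
  · rw [patience, if_pos rfl, Nat.div_eq_of_lt (Nat.lt_succ_self _)]; simp
  · have h1 : ε / (4 * δ) ≤ (patience K ε δ + 1 : ℕ) := by
      rw [patience, if_neg h.ne']
      push_cast
      exact (Nat.lt_floor_add_one _).le
    have h2 : (capacity K ε : ℝ) ≤ ε ^ 2 / 4 :=
      (Nat.floor_le (by positivity)).trans (by gcongr)
    refine Nat.cast_div_le.trans ?_
    calc (capacity K ε : ℝ) / (patience K ε δ + 1 : ℕ) ≤ (ε ^ 2 / 4) / (ε / (4 * δ)) := by gcongr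
      _ = δ * ε := by field_simp

/-- The summand `1` next to the capacity absorbs the rounding, since `ε ^ 2 / K` is less than the
capacity plus one; so the bound also holds when the capacity is zero. -/
theorem mul_div_sq_le {s n : ℕ} (hK : 0 < K) (hε : 0 < ε) (h : s * (capacity K ε + 1) ≤ 2 * n) :
    (2 * s + 6 : ℝ) ≤ (4 * K + 6) * max 1 (n / ε ^ 2) := by
  have h1 : (s : ℝ) * (capacity K ε + 1) ≤ 2 * n := by exact_mod_cast h
  have h2 : ε ^ 2 / K ≤ capacity K ε + 1 := (Nat.lt_floor_add_one _).le
  have h3 : (s : ℝ) * (ε ^ 2 / K) ≤ 2 * n := (mul_le_mul_of_nonneg_left h2 s.cast_nonneg).trans h1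
  have h4 : (s : ℝ) ≤ 2 * K * (n / ε ^ 2) := by
    rw [mul_div_assoc', le_div_iff₀ (by positivity)]
    rw [mul_div_assoc', div_le_iff₀ hK] at h3
    linarith
  have h5 := le_max_left 1 ((n : ℝ) / ε ^ 2)
  have h6 := mul_le_mul_of_nonneg_left (le_max_right 1 ((n : ℝ) / ε ^ 2)) hK.le
  linarith

end Parameters

end LearnedCE

/-! ### Assembly of accuracy and complexity. -/

theorem mainTheorem5 (κ₁ κ₂ : ℝ) (hκ₁ : 0 < κ₁) (hκ₂ : 0 < κ₂) :
    ∃ C : ℝ, 0 < C ∧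
      ∀ (X : Set (Measure ℝ)) (T S B : ℕ → ℝ) (A : LearnedCE.Learner),
        (∀ μ ∈ X, IsProbabilityMeasure μ ∧ μ (Set.Icc 0 1)ᶜ = 0) →
        A.Learns κ₁ κ₂ (LearnedCE.condClosure X) T S B →
        Monotone T → Monotone S → Monotone (fun m : ℕ => (m : ℝ) * B m) →
        ∀ ε δ : ℝ, 0 < ε → 0 ≤ δ →
          ∃ E : LearnedCE.Estimator A,
            -- accuracy
            (∀ (n : ℕ) (χ : Fin n → Measure ℝ), (∀ i, χ i ∈ X) →
              LearnedCE.tvSet (LearnedCE.condClosure (Set.range χ)) ≤ δ →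
              ∀ q : ℝ × ℝ, LearnedCE.IsQuery q →
                Integrable (fun D : Fin n → ℝ =>
                  |E.answer (List.ofFn D) q - LearnedCE.cardinality D q|) (Measure.pi χ) ∧
                ∫ D : Fin n → ℝ, |E.answer (List.ofFn D) q - LearnedCE.cardinality D q|
                  ∂(Measure.pi χ) ≤ ε) ∧
            -- complexity
            (∀ (n : ℕ) (D : Fin n → ℝ), 2 ≤ n → (∀ i, D i ∈ Set.Icc (0 : ℝ) 1) →
              -- amortized insertion time
              (E.insertCost (List.ofFn D) : ℝ) / n
                ≤ C * (max (δ * ε) (ε ^ 2) * B ⌈ε ^ 2⌉₊ + Real.log n) ∧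
              (Monotone B → (E.insertCost (List.ofFn D) : ℝ) / n
                ≤ C * (max (δ * ε) 1 * B ⌈ε ^ 2⌉₊ + Real.log n)) ∧
              -- query time
              (∀ q : ℝ × ℝ, LearnedCE.IsQuery q →
                (E.queryCost (List.ofFn D) q : ℝ) ≤ C * (Real.log n + T ⌈ε ^ 2⌉₊)) ∧
              -- space
              LearnedCE.SpaceAtMost A n.size (E.memory (List.ofFn D))
                (C * (max 1 (n / ε ^ 2) * (S ⌈ε ^ 2⌉₊ + Real.log n)))) := by

  have hc : 0 < 2 * LearnedCE.errorFactor κ₁ κ₂ + 1 := by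
    have := LearnedCE.one_le_errorFactor κ₂ hκ₁
    linarith
  set c := 2 * LearnedCE.errorFactor κ₁ κ₂ + 1 with hcdef
  have hc1 : 1 ≤ c := by
    have := LearnedCE.one_le_errorFactor κ₂ hκ₁
    linarith
  -- Chosen so that `√M * c ≤ ε / 4`. The patience contributes another `ε / 4`, and together they
  -- make up the `ε / 2` that is allowed for one leaf.
  set K := 16 * c ^ 2 with hKdef
  have hK : 4 ≤ K := by nlinarith
  -- The first summand serves the insertion time, the second one the space. Both depend on `κ₁` and
  -- `κ₂` only, through `errorFactor`.
  refine ⟨7000 + 144 * (4 * K + 6), by linarith, ?_⟩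
  intro X T S B A hX hA hT hS hB ε δ hε hδ
  set N := ⌈ε ^ 2⌉₊ with hNdef
  have hN : 1 ≤ N := Nat.ceil_pos.2 (by positivity)
  set M := LearnedCE.capacity K ε with hM
  set R := LearnedCE.patience K ε δ with hR
  have hMN : M ≤ N := LearnedCE.capacity_le_ceil (by linarith)
  have hτ := hA.evalBound hT hN hMN
  refine ⟨LearnedCE.estimator A M R hτ, ?_, ?_⟩
  · intro n χ hχ htv q hq
    have he : √(M : ℝ) * (2 * LearnedCE.errorFactor κ₁ κ₂ + 1) + R * δ ≤ ε / 2 := by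
      have h1 := LearnedCE.sqrt_capacity_le hc hε
      have h2 := LearnedCE.patience_mul_le (K := K) hε hδ
      rw [← hcdef]
      linarith
    obtain ⟨h1, h2⟩ := LearnedCE.rangeEstimate_accuracy hκ₁ hκ₂ hX hA hδ hε he hχ htv hq
    have h3 : (fun D : Fin n → ℝ => |LearnedCE.rangeEstimate A M R (List.ofFn D) q.1 (q.1 + q.2) -
        LearnedCE.cardinality D q|) =ᵐ[Measure.pi χ] fun D =>
        |(LearnedCE.estimator A M R hτ).answer (List.ofFn D) q - LearnedCE.cardinality D q| := by
      filter_upwards [LearnedCE.ae_mem_Icc_of_pi fun i => hX _ (hχ i)] with D hD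
      rw [(LearnedCE.estimator_query hτ hD hq).2]
    exact ⟨h1.congr h3, (integral_congr_ae h3).symm.trans_le h2⟩
  · intro n D hn hD
    have hl : (List.ofFn D).length = n := List.length_ofFn
    have hI : ∀ y ∈ List.ofFn D, y ∈ Set.Icc (0 : ℝ) 1 := by
      intro y hy
      obtain ⟨i, rfl⟩ := List.mem_ofFn.1 hy
      exact hD i
    obtain ⟨G, ht, s, zs, hmem, hrun⟩ := LearnedCE.estimator_run (R := R) hτ hI
      (List.length_pos_iff.1 (by omega))
    have hl2 : 2 ≤ (List.ofFn D).length := by omega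
    have hB0 := hA.B_nonneg hN
    have hT0 := hA.T_nonneg hN
    have hS0 := hA.S_nonneg hN
    have hlog : 0 ≤ Real.log n := Real.log_natCast_nonneg n
    have hins : ∀ (U V : ℝ), U ≤ 7000 * V → 0 ≤ V →
        ((zs.map A.trainCost).sum : ℝ) ≤ (List.ofFn D).length * U →
        ((LearnedCE.estimator A M R hτ).insertCost (List.ofFn D) : ℝ) / n ≤
          (7000 + 144 * (4 * K + 6)) * (V + Real.log n) := by
      intro U V hUV hV hU
      have h1 := hrun.time_le hl2 hU
      rw [hl] at h1
      have h2 : 0 ≤ K * (V + Real.log n) := by positivity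
      linarith
    refine ⟨?_, ?_, ?_, ?_⟩
    · have hm := mul_le_mul_of_nonneg_right (le_max_right (δ * ε) (ε ^ 2)) hB0
      have hV : 0 ≤ ε ^ 2 * B N := by positivity
      -- If the capacity is positive, then `ε ^ 2 ≥ 1` and `N ≤ 2 * ε ^ 2`; otherwise nothing is
      -- ever trained.
      by_cases hM0 : M = 0
      · refine hins 0 _ (by linarith) (hV.trans hm) ?_
        simp [hrun.zs_eq_nil hM0]
      · refine hins _ _ ?_ (hV.trans hm) (hrun.sum_trainCost_le hA hB hN hMN)
        have h1 := mul_le_mul_of_nonneg_right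
          (LearnedCE.ceil_le_of_capacity_ne_zero (by linarith) hM0) hB0
        linarith
    · intro hBm
      have h1 := LearnedCE.div_patience_le hK hε hδ
      -- The smallest convenient `ρ` with `2 ≤ ρ` and `M ≤ ρ * (R + 1)`. Since `M / (R + 1) ≤ δ *
      -- ε`, the sum is at most `4` or at most `δ * ε + 3`.
      have h2 : (max 2 (M / (R + 1) + 1) : ℕ) + (2 : ℝ) ≤ 4 * max (δ * ε) 1 := by
        have h3 := le_max_left (δ * ε) 1
        have h4 := le_max_right (δ * ε) 1
        push_cast
        rcases max_cases (2 : ℝ) (((M / (R + 1) : ℕ) : ℝ) + 1) with ⟨h, -⟩ | ⟨h, -⟩ <;> rw [h] <;>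
          linarith
      have hV : 0 ≤ max (δ * ε) 1 * B N := by positivity
      refine hins _ _ ?_ hV (hrun.sum_trainCost_le_of_monotone hA hBm hN hMN
        (ρ := max 2 (M / (R + 1) + 1)) (le_max_left _ _) ?_)
      · have := mul_le_mul_of_nonneg_right h2 hB0
        linarith
      · calc M ≤ (M / (R + 1) + 1) * (R + 1) :=
            (Nat.lt_mul_of_div_lt (Nat.lt_succ_self _) R.succ_pos).le
          _ ≤ _ := Nat.mul_le_mul_right _ (le_max_right _ _)
    · intro q hq
      have h1 := (LearnedCE.estimator_query (R := R) hτ hI hq).1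
      have h2 := LearnedCE.log_add_two_le hn
      have h3 := LearnedCE.one_le_two_mul_log hn
      rw [hl] at h1
      have h4 : 0 ≤ K * (Real.log n + T N) := by positivity
      linarith
    · rw [hmem]
      have h1 := hrun.spaceAtMost hl2 hA hS hN hMN
      have h2 := hrun.splits_mul_le
      rw [hl] at h1 h2
      refine h1.mono ?_
      have h3 := LearnedCE.mul_div_sq_le (by linarith) hε h2
      have h4 : 0 ≤ max 1 (n / ε ^ 2) * (S N + Real.log n) := by positivity
      calc _ ≤ (4 * K + 6) * max 1 (n / ε ^ 2) * (144 * (S N + Real.log n)) := by gcongr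
        _ = 144 * (4 * K + 6) * (max 1 (n / ε ^ 2) * (S N + Real.log n)) := by ring
        _ ≤ _ := by gcongr; linarith
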